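/- Let $\Omega\subset\mathbb{R}^2$ be a bounded open set with $\operatorname{int}\overline\Omega=\Omega$, let $T>0$, $\mathrm{Re}>0$, $0<\gamma<\frac14$, $c>0$, $A>0$. Let $f\in C([0,T];L^2(\Omega)^2)$ be of bounded variation in time with values in $L^2(\Omega)^2$ (for instance $f_t\in L^1(0,T;L^2(\Omega)^2)$), let $u_0\in L^2(\Omega)^2$, and assume that the Navier–Stokes equations $$u_t-\tfrac1{\mathrm{Re}}\Delta u+(u\cdot\nabla)u+\nabla p=f,\qquad \operatorname{div}u=0,\qquad u|_{\partial\Omega}=0,\qquad u|_{t=0}=u_0$$ have a solution $(u,p)$ on $[0,T]$ with $u\in C([0,T];H^2(\Omega)^2)$, $u(t)\in H^1_0(\Omega)^2$, $p(t)\in L^2(\Omega)$ and $\nabla p\in C([0,T];L^2(\Omega)^2)$. *Mesh.* Let $\mathcal T_h$ be a finite conforming mesh of $\overline\Omega$ by triangles with all angles $<\pi/2$. For $K\in\mathcal T_h$ let $x_K$ be its circumcenter and, for an edge $\sigma$ of $K$, let $|\sigma|$, $x_\sigma$, $n_{K,\sigma}$ be its length, midpoint and unit normal outward from $K$; $|K|$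 is the area. An edge is interior if it belongs to two triangles $K,L$ (then $L$ denotes the triangle on the other side, $d_\sigma=|x_K-x_L|$), and exterior otherwise ($d_\sigma=|x_K-x_\sigma|$); $\tau_\sigma=|\sigma|/d_\sigma$. Let $h$ be the maximal circumradius and assume $d(x_K,\sigma)\ge c|\sigma|$ and $|\sigma|\ge c\,h$ for all $K$ and all edges $\sigma$ of $K$. *Spaces and operators.* $\mathbf P_0$ is the space of vector fields constant on each triangle; $P_1^{nc}$ is the space of functions that are affine on each triangle and continuous at the midpoints of the interior edges; $L^2_0$ is the space of $L^2$ functions with zero mean. $\mathbf P_0\cap\mathbf{RT}_0$ consists of those $v\in\mathbf P_0$ with $v_K\cdot n_{K,\sigma}=v_L\cdot n_{K,\sigma}$ on interior edges and $v_K\cdot n_{K,\sigma}=0$ on exterior edges. $\Pi$ is the $L^2$ projection onto $\mathbf P_0$ (cell averages). $\nabla_hq|_K=\nabla(q|_K)$ for $q\in P^{nc}_1$. For $v\in\mathbf P_0$, $\operatorname{div}_hv$ is affine on each triangle with $$(\operatorname{div}_hv)(x_\sigma)=\frac{3|\sigma|}{|K|+|L|}(v_L-v_K)\cdot n_{K,\sigma}\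 (\sigma\text{ interior}),\qquad (\operatorname{div}_hv)(x_\sigma)=-\frac{3|\sigma|}{|K|}v_K\cdot n_{K,\sigma}\ (\sigma\text{ exterior}),$$ $\Delta_h=\operatorname{div}_h\nabla_h$, and, with $a^+=\max(a,0)$, $a^-=\min(a,0)$, $$\widetilde\Delta_hv|_K=\frac1{|K|}\sum_{\sigma\subset\partial K\ \mathrm{int.}}\tau_\sigma(v_L-v_K)-\frac1{|K|}\sum_{\sigma\subset\partial K\ \mathrm{ext.}}\tau_\sigma v_K,$$ $$\tilde b_h(w,v)|_K=\frac1{|K|}\sum_{\sigma\subset\partial K\ \mathrm{int.}}|\sigma|\big((w_K\cdot n_{K,\sigma})^+v_K+(w_K\cdot n_{K,\sigma})^-v_L\big).$$ *Scheme.* Let $N\ge1$, $k=T/N$, $t_n=nk$. Given $u_h^0,u_h^1\in\mathbf P_0\cap\mathbf{RT}_0$, $p_h^1\in P_1^{nc}\cap L^2_0$ and $\tilde u_h^1=u_h^1$, let $\tilde u_h^{n+1},u_h^{n+1}\in\mathbf P_0$ and $p_h^{n+1}\in P_1^{nc}\cap L^2_0$ satisfy, for $1\le n\le N-1$, $$\frac{3\tilde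 u_h^{n+1}-4u_h^n+u_h^{n-1}}{2k}-\frac1{\mathrm{Re}}\widetilde\Delta_h\tilde u_h^{n+1}+\tilde b_h(2u_h^n-u_h^{n-1},\tilde u_h^{n+1})+\nabla_hp_h^n=\Pi f(t_{n+1}),$$ $$\Delta_h(p_h^{n+1}-p_h^n)=\frac3{2k}\operatorname{div}_h\tilde u_h^{n+1},\qquad u_h^{n+1}=\tilde u_h^{n+1}-\frac{2k}3\nabla_h(p_h^{n+1}-p_h^n).$$ Assume that the initial values satisfy $$|u_h^0-u_0|_{L^2}+\frac1h\|u_h^1-u(t_1)\|_{L^\infty}+|p_h^1-p(t_1)|_{L^2}\le A\,h,\qquad |u_h^1-u_h^0|_{L^2}\le A\,k.$$ Put $\varepsilon=\max(h,k)$, $\tilde u_\varepsilon(t)=\tilde u_h^{n+1}$ for $t\in[t_n,t_{n+1})$, $0\le n\le N-1$, $\tilde u_\varepsilon(t)=0$ for $t\notin[0,T)$, and $\widehat{\tilde u}_\varepsilon(\tau)=\int_{\mathbb R}e^{-2i\pi\tau t}\,\tilde u_\varepsilon(t)\,dt$. Then there is a constant $C>0$, depending only on $\Omega,T,\mathrm{Re},f,u_0,(u,p),c,A,\gamma$,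 and not on the mesh, the time step, the initial values or $\varepsilon$, such that for all such discretizations $$\int_{\mathbb R}|\tau|^{2\gamma}\,\big|\widehat{\tilde u}_\varepsilon(\tau)\big|_{L^2(\Omega)}^2\,d\tau\le C .$$ -/

import Mathlib

open MeasureTheory Set Filter
open scoped Topology ContDiff FourierTransform ENNReal

noncomputable section

namespace FVScheme

/-- The Euclidean plane. -/
abbrev Plane := EuclideanSpace ℝ (Fin 2)

/-- Lebesgue measure on `Ω`. -/
abbrev vol (Ω : Set Plane) : Measure Plane := volume.restrict Ω

/-- `L²(Ω; F)`. -/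
abbrev L2 (Ω : Set Plane) (F : Type) [NormedAddCommGroup F] := Lp F 2 (vol Ω)

/-- Classical partial derivative of `φ` in the `i`-th coordinate direction. -/
def pd {F : Type} [NormedAddCommGroup F] [NormedSpace ℝ F]
    (i : Fin 2) (φ : Plane → F) (x : Plane) : F :=
  fderiv ℝ φ x (EuclideanSpace.single i 1)

/-- Smooth functions with compact support in `Ω`. -/
def IsTest {F : Type} [NormedAddCommGroup F] [NormedSpace ℝ F]
    (Ω : Set Plane) (φ : Plane → F) : Prop :=
  ContDiff ℝ ∞ φ ∧ HasCompactSupport φ ∧ tsupport φ ⊆ Ω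

/-- `g` is the weak partial derivative `∂ᵢ w` in `Ω`. -/
def IsWeakPD {F : Type} [NormedAddCommGroup F] [NormedSpace ℝ F]
    (Ω : Set Plane) (i : Fin 2) (w g : Plane → F) : Prop :=
  ∀ φ : Plane → ℝ, IsTest Ω φ →
    ∫ x in Ω, pd i φ x • w x = -∫ x in Ω, φ x • g x

/-- `w`, whose weak partial derivatives are `Dw`, belongs to `H¹₀(Ω)`, the `H¹` closure of the
smooth compactly supported vector fields. -/
def IsH10 (Ω : Set Plane) (w : L2 Ω Plane) (Dw : Fin 2 → L2 Ω Plane) : Prop :=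
  ∃ φ : ℕ → Plane → Plane, (∀ n, IsTest Ω (φ n)) ∧
    Tendsto (fun n => eLpNorm (fun x => φ n x - w x) 2 (vol Ω)) atTop (𝓝 0) ∧
    ∀ i, Tendsto (fun n => eLpNorm (fun x => pd i (φ n) x - Dw i x) 2 (vol Ω)) atTop (𝓝 0)

/-- `(v, q)` solves the incompressible Navier-Stokes equations in `Ω` on `[0,T]` with
homogeneous Dirichlet condition and `v(0) = u₀`, and has the regularity
`v ∈ C([0,T]; H²)`, `∇q ∈ C([0,T]; L²)`. Here `Dv t i = ∂ᵢ v(t)`, `D2v t i j = ∂ⱼ∂ᵢ v(t)` and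
`gq t = ∇q(t)`. The momentum equation holds weakly in space, pointwise in time. -/
def IsRegularNSSolution (Ω : Set Plane) (T Re : ℝ) (f : ℝ → L2 Ω Plane) (u₀ : L2 Ω Plane)
    (v : ℝ → L2 Ω Plane) (q : ℝ → L2 Ω ℝ) : Prop :=
  ∃ (Dv : ℝ → Fin 2 → L2 Ω Plane) (D2v : ℝ → Fin 2 → Fin 2 → L2 Ω Plane)
    (gq : ℝ → L2 Ω Plane),
    ContinuousOn v (Icc 0 T) ∧
    (∀ i, ContinuousOn (fun t => Dv t i) (Icc 0 T)) ∧
    (∀ i j, ContinuousOn (fun t => D2v t i j) (Icc 0 T)) ∧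
    ContinuousOn gq (Icc 0 T) ∧
    v 0 = u₀ ∧
    ∀ t ∈ Icc 0 T,
      (∀ i, IsWeakPD Ω i (v t) (Dv t i)) ∧
      (∀ i j, IsWeakPD Ω j (Dv t i) (D2v t i j)) ∧
      (∀ i, IsWeakPD Ω i (q t) (fun x => gq t x i)) ∧
      IsH10 Ω (v t) (Dv t) ∧
      (∀ᵐ x ∂vol Ω, ∑ i, Dv t i x i = 0) ∧
      ∀ φ : Plane → ℝ, IsTest Ω φ →
        HasDerivWithinAt (fun s => ∫ x in Ω, φ x • v s x)
          (∫ x in Ω, φ x • (Re⁻¹ • ∑ i, D2v t i i x - ∑ i, v t x i • Dv t i x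
            - gq t x + f t x)) (Icc 0 T) t

/-- A conforming mesh of `closure Ω` by finitely many acute triangles. -/
structure TriMesh (Ω : Set Plane) where
  /-- number of triangles -/
  num : ℕ
  tri : Fin num → Affine.Triangle ℝ Plane
  cover : ⋃ K, convexHull ℝ (range (tri K).points) = closure Ω
  distinct : ∀ K L, K ≠ L → range (tri K).points ≠ range (tri L).points
  conforming : ∀ K L, K ≠ L →
    convexHull ℝ (range (tri K).points) ∩ convexHull ℝ (range (tri L).points) =
      convexHull ℝ (range (tri K).points ∩ range (tri L).points)
  acute : ∀ K, (tri K).AcuteAngled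

namespace TriMesh

variable {Ω : Set Plane} (m : TriMesh Ω)

/-- The closed triangle `K`. -/
def cell (K : Fin m.num) : Set Plane := convexHull ℝ (range (m.tri K).points)

/-- The area `|K|`. -/
def area (K : Fin m.num) : ℝ := volume.real (m.cell K)

/-- The circumcenter `x_K`. -/
def ctr (K : Fin m.num) : Plane := (m.tri K).circumcenter

/-- The maximal circumradius `h`. -/
def h : ℝ := ⨆ K, (m.tri K).circumradius

/-- The edge of `K` opposite to its `i`-th vertex. -/
def edge (K : Fin m.num) (i : Fin 3) : Set Plane :=
  convexHull ℝ ((m.tri K).points '' {i}ᶜ)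

/-- The length `|σ|`. -/
def len (K : Fin m.num) (i : Fin 3) : ℝ := Metric.diam (m.edge K i)

/-- The midpoint `x_σ`. -/
def mid (K : Fin m.num) (i : Fin 3) : Plane :=
  (2 : ℝ)⁻¹ • ∑ j ∈ Finset.univ.erase i, (m.tri K).points j

/-- The unit normal `n_{K,σ}` pointing out of `K`: the direction from the `i`-th vertex to the foot
of the altitude through it. -/
def nrm (K : Fin m.num) (i : Fin 3) : Plane :=
  ‖(m.tri K).altitudeFoot i - (m.tri K).points i‖⁻¹ •
    ((m.tri K).altitudeFoot i - (m.tri K).points i)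

open Classical in
/-- The other triangle that has the edge, if there is one (it is then unique); `none` if the
edge lies on the boundary. -/
def nbr (K : Fin m.num) (i : Fin 3) : Option (Fin m.num) :=
  if H : ∃ L, L ≠ K ∧ ∃ j, m.edge L j = m.edge K i then some H.choose else none

/-- The transmissivity `τ_σ = |σ| / d_σ`. -/
def trans (K : Fin m.num) (i : Fin 3) : ℝ :=
  match m.nbr K i with
  | some L => m.len K i / dist (m.ctr K) (m.ctr L)
  | none => m.len K i / dist (m.ctr K) (m.mid K i)

/-- Uniform regularity of the mesh, with constant `c`. -/
def IsRegular (c : ℝ) : Prop :=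
  ∀ K i, c * m.len K i ≤ Metric.infDist (m.ctr K) (m.edge K i) ∧ c * m.h ≤ m.len K i

/-- Vector fields that are constant on each triangle, given by their values on the triangles. -/
abbrev P0 := Fin m.num → Plane

/-- Scalar functions that are affine on each triangle, given by the affine functions. -/
abbrev P1d := Fin m.num → (Plane →ᵃ[ℝ] ℝ)

/-- The function on the plane that is `g K` on each triangle `K` (up to the edges, a null set),
and `0` off the mesh. -/
def glue {F : Type} [AddCommMonoid F] (g : Fin m.num → Plane → F) (x : Plane) : F :=
  ∑ K, (m.cell K).indicator (g K) x

/-- Membership in the nonconforming space: continuity at the midpoints of interior edges. -/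
def IsP1nc (q : m.P1d) : Prop :=
  ∀ K i L, m.nbr K i = some L → q K (m.mid K i) = q L (m.mid K i)

/-- Zero mean over `Ω`. -/
def HasZeroMean (q : m.P1d) : Prop := ∑ K, ∫ x in m.cell K, q K x = 0

/-- Membership of a piecewise constant field in the Raviart-Thomas space: continuous normal
component across interior edges, zero normal component on the boundary. -/
def IsRT0 (v : m.P0) : Prop :=
  ∀ K i, match m.nbr K i with
    | some L => inner ℝ (v K) (m.nrm K i) = inner ℝ (v L) (m.nrm K i)
    | none => inner ℝ (v K) (m.nrm K i) = 0

/-- The `L²` projection onto piecewise constant fields (mean values). -/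
def proj (w : L2 Ω Plane) : m.P0 := fun K => (m.area K)⁻¹ • ∫ x in m.cell K, w x

/-- The discrete gradient `∇_h`. -/
def grad (q : m.P1d) : m.P0 := fun K =>
  WithLp.toLp 2 fun i => (q K).linear (EuclideanSpace.single i 1)

/-- The vertices of a triangle as an affine basis of the plane. -/
def basis (K : Fin m.num) : AffineBasis (Fin 3) ℝ Plane :=
  ⟨(m.tri K).points, (m.tri K).independent, by
    rw [(m.tri K).independent.affineSpan_eq_top_iff_card_eq_finrank_add_one]
    simp⟩

/-- The affine function on `K` with value `1` at the midpoint of the edge `i` and `0` at the other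
two midpoints. -/
def midFun (K : Fin m.num) (i : Fin 3) : Plane →ᵃ[ℝ] ℝ :=
  AffineMap.const ℝ Plane 1 - (2 : ℝ) • (m.basis K).coord i

/-- The value of `div_h v` at the midpoint of an edge. -/
def divMid (v : m.P0) (K : Fin m.num) (i : Fin 3) : ℝ :=
  match m.nbr K i with
  | some L => 3 * m.len K i / (m.area K + m.area L) * inner ℝ (v L - v K) (m.nrm K i)
  | none => -(3 * m.len K i / m.area K * inner ℝ (v K) (m.nrm K i))

/-- The discrete divergence `div_h`: piecewise affine, with values `divMid` at the midpoints. -/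
def div (v : m.P0) : m.P1d := fun K => ∑ i, m.divMid v K i • m.midFun K i

/-- The discrete Laplacian of nonconforming functions, `Δ_h = div_h ∇_h`. -/
def lapP (q : m.P1d) : m.P1d := m.div (m.grad q)

/-- The finite volume Laplacian of piecewise constant fields. -/
def lap (v : m.P0) : m.P0 := fun K =>
  (m.area K)⁻¹ • ∑ i, match m.nbr K i with
    | some L => m.trans K i • (v L - v K)
    | none => -(m.trans K i • v K)

/-- The upwind convection term (sum over interior edges). -/
def conv (u v : m.P0) : m.P0 := fun K =>
  (m.area K)⁻¹ • ∑ i, match m.nbr K i with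
    | some L => m.len K i • (max (inner ℝ (u K) (m.nrm K i)) 0 • v K
        + min (inner ℝ (u K) (m.nrm K i)) 0 • v L)
    | none => 0

/-- The incremental BDF2 projection scheme with time step `k` and `N` steps: `ut` is the predicted
velocity, `u` the projected velocity, `p` the pressure. -/
structure IsSchemeSolution (Re k : ℝ) (N : ℕ) (f : ℝ → L2 Ω Plane)
    (u ut : ℕ → m.P0) (p : ℕ → m.P1d) : Prop where
  rt_zero : m.IsRT0 (u 0)
  rt_one : m.IsRT0 (u 1)
  p_one : m.IsP1nc (p 1) ∧ m.HasZeroMean (p 1)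
  ut_one : ut 1 = u 1
  prediction : ∀ n, 1 ≤ n → n < N →
    (2 * k)⁻¹ • ((3 : ℝ) • ut (n + 1) - (4 : ℝ) • u n + u (n - 1))
      - Re⁻¹ • m.lap (ut (n + 1))
      + m.conv ((2 : ℝ) • u n - u (n - 1)) (ut (n + 1))
      + m.grad (p n) = m.proj (f ((n + 1 : ℕ) * k))
  pressure_mem : ∀ n, 1 ≤ n → n < N → m.IsP1nc (p (n + 1)) ∧ m.HasZeroMean (p (n + 1))
  pressure : ∀ n, 1 ≤ n → n < N →
    m.lapP (p (n + 1) - p n) = (3 / (2 * k)) • m.div (ut (n + 1))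
  correction : ∀ n, 1 ≤ n → n < N →
    u (n + 1) = ut (n + 1) - (2 * k / 3) • m.grad (p (n + 1) - p n)

/-- Accuracy of the initial values of the scheme, with constant `A`; `v`, `q` is the exact
solution. -/
def InitialAccuracy (A k : ℝ) (v : ℝ → L2 Ω Plane) (q : ℝ → L2 Ω ℝ)
    (u0 u1 : m.P0) (p1 : m.P1d) : Prop :=
  eLpNorm (fun x => m.glue (fun K _ => u0 K) x - v 0 x) 2 (vol Ω)
    + (ENNReal.ofReal m.h)⁻¹ * eLpNorm (fun x => m.glue (fun K _ => u1 K) x - v k x) ∞ (vol Ω)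
    + eLpNorm (fun x => m.glue (fun K y => p1 K y) x - q k x) 2 (vol Ω)
      ≤ ENNReal.ofReal (A * m.h) ∧
  eLpNorm (m.glue (fun K _ => u1 K - u0 K)) 2 (vol Ω) ≤ ENNReal.ofReal (A * k)

/-- The predicted velocity as a function of time: `ut (n+1)` on `[n k, (n+1) k)` for `n < N`,
and `0` outside `[0, N k)`. -/
def utEps (k : ℝ) (N : ℕ) (ut : ℕ → m.P0) (t : ℝ) : m.P0 :=
  ∑ n ∈ Finset.range N, (Ico (n * k) ((n + 1) * k)).indicator (fun _ => ut (n + 1)) t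

/-- The time Fourier transform of the predicted velocity, a complex piecewise constant field. -/
def utHat (k : ℝ) (N : ℕ) (ut : ℕ → m.P0) (τ : ℝ) :
    Fin m.num → EuclideanSpace ℂ (Fin 2) := fun K =>
  𝓕 (fun t : ℝ =>
    (WithLp.toLp 2 fun j => ((m.utEps k N ut t K j : ℝ) : ℂ) : EuclideanSpace ℂ (Fin 2))) τ

end TriMesh

end FVScheme

end

/-! A step function of time with values in L², bounded and with N = T/k increments of size at most D
k, has total variation bounded independently of k. Its Fourier transform is then O(1/(1+|τ|)), and
|τ|^{2γ} times the square of this is integrable once γ < 1/2. Everything reduces to a Lipschitz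
bound in time for the predicted velocity, uniform in the discretization: `norm_increment_le`.

That bound is an energy estimate for differences of consecutive time steps. The two-step formula
with incremental projection satisfies an exact energy identity (`bdf_projection_identity`), which
rests only on the orthogonality of discrete pressure gradients to discretely divergence-free fields;
it serves both the solution and its increments. For the solution, upwinding is dissipative and the
diffusion coercive, so the time integral of |ũ|²_{1,h}, the sum of squared jumps `jumpSq`, is
bounded (`sum_jumpSq_le`). For the increments, a change of transport field δw leaves a term that
must be bounded by C ‖δw‖ |v|_{1,h} |z|_{1,h} (`abs_inner_conv_sub_le`). The diffusion absorbs
|z|_{1,h}, and the Gronwall exponent becomes a multiple of the sum of k |ũ^n|²_{1,h}, already under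
control.

The trilinear bound asks only for the L² norm of δw, although H¹ does not embed in L^∞ in the plane;
this is compensated compactness. Extended by zero, δw is divergence free on the whole plane, because
normal fluxes cancel across edges. The piecewise constant v and z are replaced by mollifications at
scale h, whose gradients and errors are controlled by jumps. For a divergence-free D, the form ∫
(D·∇a) b is estimated on the Fourier side (`enorm_integral_convection_le`): the constraint allows
the derivative to fall on the smaller of the two frequencies, and Cauchy–Schwarz over |ζ| ≤ |η|
costs the area π|η|² of a disc, exactly the weight of one gradient (`lintegral_region_le`).

To start the Gronwall argument, the first increment must be O(k), so the discrete Laplacian and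
convection of u¹ and the discrete gradient of p¹ must be bounded in L². The pressure is tested
against bumps inside triangles. The velocity u¹ is within A h² in L^∞ of an H¹₀ field, and such a
field has no jump across an edge, so the jumps of u¹ are O(h²) (`norm_jump_le_of_isH10`); this is
the order that the discrete Laplacian needs. The force enters through its supremum and its total
variation. -/

noncomputable section

/-! ### Integration over triangles and the divergence theorem -/

namespace FVScheme

/-- The reference triangle in `ℝ × ℝ`. -/
def refTri : Set (ℝ × ℝ) := {p | 0 ≤ p.1 ∧ 0 ≤ p.2 ∧ p.1 + p.2 ≤ 1}

lemma isClosed_refTri : IsClosed refTri := by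
  have h1 : IsClosed {p : ℝ × ℝ | 0 ≤ p.1} := isClosed_le continuous_const continuous_fst
  have h2 : IsClosed {p : ℝ × ℝ | 0 ≤ p.2} := isClosed_le continuous_const continuous_snd
  have h3 : IsClosed {p : ℝ × ℝ | p.1 + p.2 ≤ 1} := isClosed_le (by fun_prop) continuous_const
  exact h1.inter (h2.inter h3)

lemma refTri_subset : refTri ⊆ Icc 0 1 ×ˢ Icc 0 1 := by
  rintro ⟨s, t⟩ ⟨h1, h2, h3⟩
  simp only [mem_prod, mem_Icc] at *
  refine ⟨⟨h1, ?_⟩, h2, ?_⟩ <;> linarith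

lemma isCompact_refTri : IsCompact refTri :=
  (isCompact_Icc.prod isCompact_Icc).of_isClosed_subset isClosed_refTri refTri_subset

lemma preimage_swap_refTri : Prod.swap ⁻¹' refTri = refTri := by
  ext ⟨s, t⟩
  simp only [refTri, mem_preimage, Prod.swap_prod_mk, mem_ofPred_eq]
  constructor <;> rintro ⟨h1, h2, h3⟩ <;> refine ⟨h2, h1, ?_⟩ <;> linarith

lemma setIntegral_refTri {F : ℝ × ℝ → ℝ} (hF : Continuous F) :
    ∫ p in refTri, F p = ∫ t in (0 : ℝ)..1, ∫ s in (0 : ℝ)..(1 - t), F (s, t) := by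
  have hm : MeasurableSet refTri := isClosed_refTri.measurableSet
  have hint : Integrable (refTri.indicator F) (volume.prod volume) := by
    rw [← Measure.volume_eq_prod, integrable_indicator_iff hm]
    exact hF.continuousOn.integrableOn_compact isCompact_refTri
  rw [← integral_indicator hm, Measure.volume_eq_prod, integral_prod_symm _ hint,
    intervalIntegral.integral_of_le zero_le_one, ← integral_Icc_eq_integral_Ioc,
    ← integral_indicator measurableSet_Icc]
  congr 1
  ext t
  by_cases ht : t ∈ Icc (0 : ℝ) 1
  · rw [indicator_of_mem ht, intervalIntegral.integral_of_le (by linarith [ht.2]),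
      ← integral_Icc_eq_integral_Ioc, ← integral_indicator measurableSet_Icc]
    congr 1
    ext s
    by_cases hs : s ∈ Icc (0 : ℝ) (1 - t)
    · rw [indicator_of_mem hs, indicator_of_mem]
      exact ⟨hs.1, ht.1, by simp only; linarith [hs.2]⟩
    · rw [indicator_of_notMem hs, indicator_of_notMem]
      rintro ⟨h1, h2, h3⟩
      exact hs ⟨h1, by simp only at h3; linarith⟩
  · rw [indicator_of_notMem ht]
    rw [integral_eq_zero_of_ae]
    refine ae_of_all _ fun s => ?_
    refine indicator_of_notMem (f := F) ?_
    rintro ⟨h1, h2, h3⟩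
    simp only at h1 h2 h3
    exact ht ⟨h2, by linarith⟩

lemma setIntegral_refTri_swap (F : ℝ × ℝ → ℝ) :
    ∫ p in refTri, F p.swap = ∫ p in refTri, F p := by
  have h := (Measure.measurePreserving_swap (μ := (volume : Measure ℝ))
    (ν := (volume : Measure ℝ))).setIntegral_preimage_emb
    (MeasurableEquiv.prodComm (α := ℝ) (β := ℝ)).measurableEmbedding F refTri
  rw [preimage_swap_refTri] at h
  exact h

/-- Fubini and the fundamental theorem of calculus along horizontal lines. The two boundary terms
live on the hypotenuse and on the vertical leg, both parametrized by the height, so no edge lengths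
appear. -/
lemma setIntegral_refTri_fderiv_fst {g : ℝ × ℝ → ℝ} (hg : ContDiff ℝ 1 g) :
    ∫ p in refTri, fderiv ℝ g p (1, 0) =
      (∫ t in (0 : ℝ)..1, g (1 - t, t)) - ∫ t in (0 : ℝ)..1, g (0, t) := by
  have hc : Continuous (fun p => fderiv ℝ g p (1, 0)) :=
    (hg.continuous_fderiv one_ne_zero).clm_apply continuous_const
  rw [setIntegral_refTri hc]
  have : ∀ t : ℝ, ∫ s in (0 : ℝ)..(1 - t), fderiv ℝ g (s, t) (1, 0) = g (1 - t, t) - g (0, t) := by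
    intro t
    rw [intervalIntegral.integral_eq_sub_of_hasDerivAt (f := fun s => g (s, t))]
    · intro s _
      have h1 : HasFDerivAt g (fderiv ℝ g (s, t)) (s, t) :=
        (hg.differentiable one_ne_zero _).hasFDerivAt
      have h2 : HasDerivAt (fun s : ℝ => (s, t)) (1, 0) s :=
        (hasDerivAt_id s).prodMk (hasDerivAt_const s t)
      exact h1.comp_hasDerivAt s h2
    · exact (hc.comp (by fun_prop : Continuous fun s : ℝ => (s, t))).intervalIntegrable _ _
  simp_rw [this]
  rw [intervalIntegral.integral_sub]
  · exact (hg.continuous.comp (by fun_prop : Continuous fun t : ℝ => (1 - t, t))).intervalIntegrable _ _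
  · exact (hg.continuous.comp (by fun_prop : Continuous fun t : ℝ => ((0 : ℝ), t))).intervalIntegrable _ _

lemma setIntegral_refTri_fderiv_snd {g : ℝ × ℝ → ℝ} (hg : ContDiff ℝ 1 g) :
    ∫ p in refTri, fderiv ℝ g p (0, 1) =
      (∫ t in (0 : ℝ)..1, g (1 - t, t)) - ∫ t in (0 : ℝ)..1, g (t, 0) := by
  have hg' : ContDiff ℝ 1 (fun p : ℝ × ℝ => g p.swap) :=
    hg.comp (contDiff_snd.prodMk contDiff_fst)
  have h := setIntegral_refTri_fderiv_fst hg'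
  simp only [Prod.swap_prod_mk] at h
  rw [← setIntegral_refTri_swap]
  have e : ∀ p : ℝ × ℝ, fderiv ℝ (fun p : ℝ × ℝ => g p.swap) p (1, 0) =
      fderiv ℝ g p.swap (0, 1) := by
    intro p
    have h1 : HasFDerivAt g (fderiv ℝ g p.swap) p.swap :=
      (hg.differentiable one_ne_zero _).hasFDerivAt
    have h2 : HasFDerivAt (fun p : ℝ × ℝ => p.swap)
      ((ContinuousLinearMap.snd ℝ ℝ ℝ).prod (ContinuousLinearMap.fst ℝ ℝ ℝ)) p :=
      hasFDerivAt_snd.prodMk hasFDerivAt_fst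
    have h3 : fderiv ℝ (fun p : ℝ × ℝ => g p.swap) p = _ := (h1.comp p h2).fderiv
    rw [h3]
    simp
  simp_rw [e] at h
  rw [h]
  congr 1
  have := intervalIntegral.integral_comp_sub_left (fun t => g (1 - t, t)) (a := 0) (b := 1) 1
  simp only [sub_sub_cancel, sub_self, sub_zero] at this
  exact this

lemma setIntegral_refTri_one : ∫ _ in refTri, (1 : ℝ) = 1 / 2 := by
  rw [setIntegral_refTri continuous_const]
  simp only [intervalIntegral.integral_const, sub_zero, smul_eq_mul, mul_one]
  rw [intervalIntegral.integral_sub (by simp) (by simp)]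
  simp
  norm_num

/-- The affine parametrization of the triangle with vertices `a`, `b`, `c`. -/
def triMap (a b c : Plane) (p : ℝ × ℝ) : Plane := a + p.1 • (b - a) + p.2 • (c - a)

lemma contDiff_triMap (a b c : Plane) : ContDiff ℝ 1 (triMap a b c) := by
  unfold triMap; fun_prop

lemma hasFDerivAt_triMap (a b c : Plane) (p : ℝ × ℝ) :
    HasFDerivAt (triMap a b c) ((ContinuousLinearMap.fst ℝ ℝ ℝ).smulRight (b - a) +
      (ContinuousLinearMap.snd ℝ ℝ ℝ).smulRight (c - a)) p := by
  unfold triMap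
  exact (((hasFDerivAt_fst (p := p)).smul_const (b - a)).const_add a).add
    ((hasFDerivAt_snd (p := p)).smul_const (c - a))

/-- The plane as a product. -/
def planeEquiv : Plane ≃ᵐ ℝ × ℝ :=
  (MeasurableEquiv.toLp 2 (Fin 2 → ℝ)).symm.trans MeasurableEquiv.finTwoArrow

lemma measurePreserving_planeEquiv : MeasurePreserving planeEquiv volume volume :=
  (volume_preserving_finTwoArrow ℝ).comp
    (EuclideanSpace.volume_preserving_symm_measurableEquiv_toLp (Fin 2))

@[simp] lemma planeEquiv_apply (x : Plane) : planeEquiv x = (x 0, x 1) := rfl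

/-- Twice the signed area of the triangle with vertices `a`, `b`, `c`. -/
def jac (a b c : Plane) : ℝ := (b - a) 0 * (c - a) 1 - (b - a) 1 * (c - a) 0

/-- Affine change of variables. The barycentric coordinates of the image of (y₀, y₁) are (1 - y₀ -
y₁, y₀, y₁), from which both the image of the reference triangle and injectivity are read off. -/
lemma setIntegral_triangle (b : AffineBasis (Fin 3) ℝ Plane) (F : Plane → ℝ) :
    ∫ x in convexHull ℝ (range b), F x =
      |jac (b 0) (b 1) (b 2)| * ∫ p in refTri, F (triMap (b 0) (b 1) (b 2) p) := by
  set M : Plane →L[ℝ] Plane :=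
    (EuclideanSpace.proj (0 : Fin 2) : Plane →L[ℝ] ℝ).smulRight (b 1 - b 0) +
    (EuclideanSpace.proj (1 : Fin 2) : Plane →L[ℝ] ℝ).smulRight (b 2 - b 0) with hM
  have hT : ∀ y : Plane, triMap (b 0) (b 1) (b 2) (planeEquiv y) = b 0 + M y := by
    intro y
    simp [triMap, hM, add_assoc]
  have hdet : M.det = jac (b 0) (b 1) (b 2) := by
    have : M.det = LinearMap.det (M : Plane →ₗ[ℝ] Plane) := rfl
    rw [this, ← LinearMap.det_toMatrix (EuclideanSpace.basisFun (Fin 2) ℝ).toBasis,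
      Matrix.det_fin_two]
    simp [LinearMap.toMatrix_apply, hM, jac]
    ring
  have hcoord : ∀ y : Plane, ∀ i, (b.coord i) (b 0 + M y) =
      ![1 - y 0 - y 1, y 0, y 1] i := by
    intro y i
    have e : b 0 + M y = Finset.univ.affineCombination ℝ b ![1 - y 0 - y 1, y 0, y 1] := by
      rw [Finset.affineCombination_eq_linear_combination]
      · simp only [Fin.sum_univ_three, hM]
        simp
        module
      · simp [Fin.sum_univ_three]; ring
    rw [e, b.coord_apply_combination_of_mem (Finset.mem_univ i)]
    simp [Fin.sum_univ_three]; ring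
  have himg : convexHull ℝ (range b) = (fun y => b 0 + M y) '' (planeEquiv ⁻¹' refTri) := by
    rw [b.convexHull_eq_nonneg_coord]
    apply Subset.antisymm
    · intro x hx
      have hsum := b.sum_coord_apply_eq_one x
      refine ⟨!₂[b.coord 1 x, b.coord 2 x], ?_, ?_⟩
      · rw [Fin.sum_univ_three] at hsum
        refine ⟨?_, ?_, ?_⟩
        · simpa using hx 1
        · simpa using hx 2
        · have := hx 0
          simp only [planeEquiv_apply]
          simp
          linarith
      · apply b.ext_elem
        intro i
        rw [hcoord]
        rw [Fin.sum_univ_three] at hsum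
        fin_cases i
        · simp; linarith
        · simp
        · simp
    · rintro _ ⟨y, ⟨h1, h2, h3⟩, rfl⟩ i
      rw [hcoord]
      simp only [planeEquiv_apply] at h1 h2 h3
      fin_cases i
      · simp; linarith
      · simpa using h1
      · simpa using h2
  have hinj : InjOn (fun y => b 0 + M y) (planeEquiv ⁻¹' refTri) := by
    intro y _ z _ h
    have h1 := hcoord y
    rw [show b 0 + M y = b 0 + M z from h] at h1
    have h2 := fun i => (h1 i).symm.trans (hcoord z i)
    ext i
    fin_cases i
    · simpa using h2 1
    · simpa using h2 2
  have hmeas : MeasurableSet (planeEquiv ⁻¹' refTri) :=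
    planeEquiv.measurable isClosed_refTri.measurableSet
  rw [himg, integral_image_eq_integral_abs_det_fderiv_smul volume hmeas
    (fun x _ => ((M.hasFDerivAt (x := x)).const_add (b 0)).hasFDerivWithinAt) hinj, hdet]
  simp only [smul_eq_mul]
  rw [integral_const_mul]
  congr 1
  rw [← measurePreserving_planeEquiv.setIntegral_preimage_emb planeEquiv.measurableEmbedding]
  simp_rw [hT]

lemma volume_real_triangle (b : AffineBasis (Fin 3) ℝ Plane) :
    volume.real (convexHull ℝ (range b)) = |jac (b 0) (b 1) (b 2)| / 2 := by
  have h := setIntegral_triangle b (fun _ => 1)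
  rw [setIntegral_refTri_one] at h
  simp only [integral_const, smul_eq_mul, mul_one, measureReal_restrict_apply_univ] at h
  rw [h]; ring

/-- The mean value of a function over the side of a triangle opposite to the `i`-th vertex. -/
def edgeMean (φ : Plane → ℝ) (p : Fin 3 → Plane) (i : Fin 3) : ℝ :=
  ∫ t in (0 : ℝ)..1, φ ((1 - t) • p (i + 1) + t • p (i + 2))

lemma intervalIntegral_segment_symm (φ : Plane → ℝ) (a b : Plane) :
    ∫ t in (0 : ℝ)..1, φ ((1 - t) • a + t • b) = ∫ t in (0 : ℝ)..1, φ ((1 - t) • b + t • a) := by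
  have := intervalIntegral.integral_comp_sub_left
    (fun t => φ ((1 - t) • b + t • a)) (a := 0) (b := 1) 1
  simp only [sub_sub_cancel, sub_self, sub_zero] at this
  rw [← this]
  congr 1; ext t; congr 1; abel

/-- The divergence theorem on a triangle. -/
theorem setIntegral_triangle_fderiv (b : AffineBasis (Fin 3) ℝ Plane) {φ : Plane → ℝ}
    (hφ : ContDiff ℝ 1 φ) (e : Plane) :
    ∫ x in convexHull ℝ (range b), fderiv ℝ φ x e =
      -(2 * volume.real (convexHull ℝ (range b))) *
        ∑ i, (b.coord i).linear e * edgeMean φ b i := by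
  rw [setIntegral_triangle, volume_real_triangle]
  set T := triMap (b 0) (b 1) (b 2) with hT
  have hg : ContDiff ℝ 1 (fun p => φ (T p)) := hφ.comp (contDiff_triMap _ _ _)
  -- The direction is expanded along the two sides issuing from vertex 0, the images of the two
  -- coordinate directions of the reference triangle.
  have he : e = (b.coord 1).linear e • (b 1 - b 0) + (b.coord 2).linear e • (b 2 - b 0) := by
    have hx : ∀ i, (b.coord i).linear e = b.coord i (e + b 0) - b.coord i (b 0) := by
      intro i
      have := (b.coord i).map_vadd (b 0) e
      simp only [vadd_eq_add] at this
      rw [this]; ring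
    have h1 := b.linear_combination_coord_eq_self (e + b 0)
    have h2 := b.sum_coord_apply_eq_one (e + b 0)
    rw [Fin.sum_univ_three] at h1 h2
    rw [hx, hx]
    simp only [AffineBasis.coord_apply]
    have h3 : b.coord 0 (e + b 0) = 1 - b.coord 1 (e + b 0) - b.coord 2 (e + b 0) := by linarith
    rw [h3] at h1
    simp only [Fin.isValue, Fin.reduceEq, if_false, sub_zero]
    calc e = (e + b 0) - b 0 := by abel
      _ = _ := by
        nth_rewrite 1 [← h1]
        module
  -- The barycentric coordinates sum to 1, so their linear parts sum to 0; this collects the two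
  -- hypotenuse terms into the single term of edge 0.
  have h0 : (b.coord 0).linear e = -(b.coord 1).linear e - (b.coord 2).linear e := by
    have hx : ∀ i, (b.coord i).linear e = b.coord i (e + b 0) - b.coord i (b 0) := by
      intro i
      have := (b.coord i).map_vadd (b 0) e
      simp only [vadd_eq_add] at this
      rw [this]; ring
    have h2 := b.sum_coord_apply_eq_one (e + b 0)
    have h3 := b.sum_coord_apply_eq_one (b 0)
    rw [Fin.sum_univ_three] at h2 h3
    simp only [hx]; linarith
  set α := (b.coord 1).linear e
  set β := (b.coord 2).linear e
  have hd : ∀ p, fderiv ℝ φ (T p) e = α * fderiv ℝ (fun p => φ (T p)) p (1, 0) +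
      β * fderiv ℝ (fun p => φ (T p)) p (0, 1) := by
    intro p
    have h1 : HasFDerivAt φ (fderiv ℝ φ (T p)) (T p) :=
      (hφ.differentiable one_ne_zero _).hasFDerivAt
    have h2 := h1.comp p (hasFDerivAt_triMap (b 0) (b 1) (b 2) p)
    have h3 : fderiv ℝ (fun p => φ (T p)) p = _ := h2.fderiv
    rw [h3]
    conv_lhs => rw [he]
    simp
  have hc : ∀ v, IntegrableOn (fun p => fderiv ℝ (fun p => φ (T p)) p v) refTri := fun v =>
    ((hg.continuous_fderiv one_ne_zero).clm_apply
      continuous_const).continuousOn.integrableOn_compact isCompact_refTri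
  simp_rw [hd]
  rw [integral_add ((hc _).const_mul _) ((hc _).const_mul _), integral_const_mul,
    integral_const_mul, setIntegral_refTri_fderiv_fst hg, setIntegral_refTri_fderiv_snd hg,
    Fin.sum_univ_three, h0]
  have e0 : ∫ t in (0 : ℝ)..1, φ (T (1 - t, t)) = edgeMean φ b 0 := by
    unfold edgeMean
    congr 1; ext t; congr 1
    simp only [hT, triMap]
    have a1 : (0 + 1 : Fin 3) = 1 := rfl
    have a2 : (0 + 2 : Fin 3) = 2 := rfl
    rw [a1, a2]; module
  have e1 : ∫ t in (0 : ℝ)..1, φ (T (0, t)) = edgeMean φ b 1 := by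
    unfold edgeMean
    have a1 : (1 + 1 : Fin 3) = 2 := rfl
    have a2 : (1 + 2 : Fin 3) = 0 := rfl
    rw [a1, a2, intervalIntegral_segment_symm]
    congr 1; ext t; congr 1
    simp only [hT, triMap]
    module
  have e2 : ∫ t in (0 : ℝ)..1, φ (T (t, 0)) = edgeMean φ b 2 := by
    unfold edgeMean
    have a1 : (2 + 1 : Fin 3) = 0 := rfl
    have a2 : (2 + 2 : Fin 3) = 1 := rfl
    rw [a1, a2]
    congr 1; ext t; congr 1
    simp only [hT, triMap]
    module
  rw [e0, e1, e2]
  ring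

/-! ### Segments and barycentric coordinates -/

lemma plane_inner (x y : Plane) : inner ℝ x y = x 0 * y 0 + x 1 * y 1 := by
  simp [PiLp.inner_apply, Fin.sum_univ_two]; ring

/-- The endpoints of one segment have parameters s, t in [0,1] on the other, and equality of lengths
forces |s - t| = 1, hence {s, t} = {0, 1}. -/
lemma segment_eq_segment {a b a' b' : Plane} (h : segment ℝ a b = segment ℝ a' b')
    (hne : a' ≠ b') : (a = a' ∧ b = b') ∨ (a = b' ∧ b = a') := by
  have hd : dist a b = dist a' b' := by
    rw [← Metric.diam_pair (x := a), ← Metric.diam_pair (x := a'), ← convexHull_diam {a, b},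
      ← convexHull_diam {a', b'}, convexHull_pair, convexHull_pair, h]
  have ha : a ∈ segment ℝ a' b' := h ▸ left_mem_segment ℝ a b
  have hb : b ∈ segment ℝ a' b' := h ▸ right_mem_segment ℝ a b
  rw [segment_eq_image] at ha hb
  obtain ⟨s, ⟨hs0, hs1⟩, rfl⟩ := ha
  obtain ⟨t, ⟨ht0, ht1⟩, rfl⟩ := hb
  have e : dist ((1 - s) • a' + s • b') ((1 - t) • a' + t • b') = |s - t| * dist a' b' := by
    rw [dist_eq_norm, dist_eq_norm, show (1 - s) • a' + s • b' - ((1 - t) • a' + t • b') =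
      (t - s) • (a' - b') by module, norm_smul, Real.norm_eq_abs, abs_sub_comm]
  simp only at hd
  rw [e] at hd
  have hp : 0 < dist a' b' := dist_pos.2 hne
  have h1 : |s - t| = 1 := by
    field_simp at hd; exact hd
  rcases abs_eq (zero_le_one) |>.1 h1 with h1 | h1
  · right
    have : s = 1 := by linarith
    have : t = 0 := by linarith
    subst_vars; simp
  · left
    have : s = 0 := by linarith
    have : t = 1 := by linarith
    subst_vars; simp

lemma coord_linear_sub (b : AffineBasis (Fin 3) ℝ Plane) (i : Fin 3) (x y : Plane) :
    (b.coord i).linear (x - y) = b.coord i x - b.coord i y := by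
  have := (b.coord i).linearMap_vsub x y
  simpa using this

lemma coord_zero_of_mem_affineSpan (b : AffineBasis (Fin 3) ℝ Plane) (i : Fin 3) {x : Plane}
    (hx : x ∈ affineSpan ℝ (b '' {i}ᶜ)) : b.coord i x = 0 := by
  have h : affineSpan ℝ (b '' {i}ᶜ) ≤ (affineSpan ℝ {(0 : ℝ)}).comap (b.coord i) := by
    rw [affineSpan_le]
    rintro _ ⟨j, hj, rfl⟩
    have : b.coord i (b j) = 0 := b.coord_apply_ne (fun h => hj (by simp [h]))
    simp [this]
  have := h hx
  simpa using this

lemma abs_jac_rotate (b : Fin 3 → Plane) (i : Fin 3) :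
    |jac (b 0) (b 1) (b 2)| = |jac (b i) (b (i + 1)) (b (i + 2))| := by
  fin_cases i
  · rfl
  · change _ = |jac (b 1) (b 2) (b 0)|
    congr 1; simp [jac]; ring
  · change _ = |jac (b 2) (b 0) (b 1)|
    congr 1; simp [jac]; ring

lemma compl_singleton_fin_three (i : Fin 3) : ({i}ᶜ : Set (Fin 3)) = {i + 1, i + 2} := by
  ext j
  fin_cases i <;> fin_cases j <;> simp

lemma fin_three_cases : ∀ i j : Fin 3, (j = i ∧ j ≠ i + 1 ∧ j ≠ i + 2) ∨
    (j ≠ i ∧ j = i + 1 ∧ j ≠ i + 2) ∨ (j ≠ i ∧ j ≠ i + 1 ∧ j = i + 2) := by decide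

/-! ### Geometry of a single mesh triangle -/

namespace TriMesh

variable {Ω : Set Plane} (m : TriMesh Ω)

/-- The vertices of a triangle of the mesh. -/
def pt (K : Fin m.num) : Fin 3 → Plane := (m.tri K).points

lemma basis_apply (K : Fin m.num) (i : Fin 3) : m.basis K i = m.pt K i := rfl

lemma coe_basis (K : Fin m.num) : ⇑(m.basis K) = m.pt K := rfl

lemma pt_injective (K : Fin m.num) : Function.Injective (m.pt K) := (m.tri K).independent.injective

lemma cell_eq_convexHull (K : Fin m.num) : m.cell K = convexHull ℝ (range (m.basis K)) := rfl

lemma mem_cell {K : Fin m.num} {x : Plane} : x ∈ m.cell K ↔ ∀ i, 0 ≤ (m.basis K).coord i x := by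
  rw [cell_eq_convexHull, AffineBasis.convexHull_eq_nonneg_coord]; rfl

lemma mem_interior_cell {K : Fin m.num} {x : Plane} :
    x ∈ interior (m.cell K) ↔ ∀ i, 0 < (m.basis K).coord i x := by
  rw [cell_eq_convexHull, AffineBasis.interior_convexHull]; rfl

lemma edge_eq_segment (K : Fin m.num) (i : Fin 3) :
    m.edge K i = segment ℝ (m.pt K (i + 1)) (m.pt K (i + 2)) := by
  rw [edge, compl_singleton_fin_three, image_pair, convexHull_pair]; rfl

lemma len_eq_dist (K : Fin m.num) (i : Fin 3) :
    m.len K i = dist (m.pt K (i + 1)) (m.pt K (i + 2)) := by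
  rw [len, edge, compl_singleton_fin_three, image_pair, convexHull_diam, Metric.diam_pair]; rfl

lemma len_pos (K : Fin m.num) (i : Fin 3) : 0 < m.len K i := by
  rw [len_eq_dist, dist_pos]
  intro h
  have := m.pt_injective K h
  revert this; fin_cases i <;> decide

lemma coord_pt (K : Fin m.num) (i j : Fin 3) :
    (m.basis K).coord i (m.pt K j) = if i = j then 1 else 0 := by
  rw [← basis_apply, AffineBasis.coord_apply]

lemma mid_eq (K : Fin m.num) (i : Fin 3) :
    m.mid K i = (2 : ℝ)⁻¹ • m.pt K (i + 1) + (2 : ℝ)⁻¹ • m.pt K (i + 2) := by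
  unfold mid pt
  rw [← smul_add]
  congr 1
  have : (Finset.univ.erase i : Finset (Fin 3)) = {i + 1, i + 2} := by fin_cases i <;> decide
  rw [this, Finset.sum_pair]
  fin_cases i <;> decide

lemma coord_segment (K : Fin m.num) (j : Fin 3) (x y : Plane) (t : ℝ) :
    (m.basis K).coord j ((1 - t) • x + t • y) =
      (1 - t) * (m.basis K).coord j x + t * (m.basis K).coord j y := by
  have h1 := coord_linear_sub (m.basis K) j ((1 - t) • x + t • y) x
  have h2 := coord_linear_sub (m.basis K) j y x
  rw [show (1 - t) • x + t • y - x = t • (y - x) by module, map_smul, h2, smul_eq_mul] at h1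
  linarith

lemma coord_mid (K : Fin m.num) (i j : Fin 3) :
    (m.basis K).coord j (m.mid K i) = if j = i then 0 else 1 / 2 := by
  have := m.coord_segment K j (m.pt K (i + 1)) (m.pt K (i + 2)) (1 / 2)
  rw [mid_eq, show (2 : ℝ)⁻¹ • m.pt K (i + 1) + (2 : ℝ)⁻¹ • m.pt K (i + 2) =
    (1 - 1 / 2 : ℝ) • m.pt K (i + 1) + (1 / 2 : ℝ) • m.pt K (i + 2) by norm_num, this, coord_pt,
    coord_pt]
  rcases fin_three_cases i j with ⟨h0, h1, h2⟩ | ⟨h0, h1, h2⟩ | ⟨h0, h1, h2⟩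
  · rw [if_pos h0, if_neg h1, if_neg h2]; norm_num
  · rw [if_neg h0, if_pos h1, if_neg h2]; norm_num
  · rw [if_neg h0, if_neg h1, if_pos h2]; norm_num

lemma mem_edge {K : Fin m.num} {i : Fin 3} {x : Plane} :
    x ∈ m.edge K i ↔ x ∈ m.cell K ∧ (m.basis K).coord i x = 0 := by
  constructor
  · intro hx
    refine ⟨convexHull_mono (image_subset_range _ _) hx, ?_⟩
    exact coord_zero_of_mem_affineSpan _ _ (convexHull_subset_affineSpan _ hx)
  · rintro ⟨hx, h0⟩
    rw [mem_cell] at hx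
    have h1 := (m.basis K).linear_combination_coord_eq_self x
    have h2 := (m.basis K).sum_coord_apply_eq_one x
    rw [edge_eq_segment]
    refine ⟨(m.basis K).coord (i + 1) x, (m.basis K).coord (i + 2) x, hx _, hx _, ?_, ?_⟩
    · rw [Fin.sum_univ_three] at h2
      fin_cases i <;> simp at h0 ⊢ <;> linarith
    · rw [Fin.sum_univ_three] at h1
      conv_rhs => rw [← h1]
      simp only [basis_apply]
      fin_cases i
      · change _ • m.pt K 1 + _ • m.pt K 2 = _
        simp only [Fin.zero_eta] at h0
        rw [h0, zero_smul, zero_add]; rfl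
      · change _ • m.pt K 2 + _ • m.pt K 0 = _
        simp only [Fin.mk_one] at h0
        rw [h0, zero_smul, add_zero, add_comm]; rfl
      · change _ • m.pt K 0 + _ • m.pt K 1 = _
        change (m.basis K).coord 2 x = 0 at h0
        rw [h0, zero_smul, add_zero]; rfl

lemma mid_mem_edge (K : Fin m.num) (i : Fin 3) : m.mid K i ∈ m.edge K i := by
  rw [mem_edge, mem_cell, coord_mid]
  refine ⟨fun j => ?_, by simp⟩
  rw [coord_mid]; split_ifs <;> norm_num

lemma edge_subset_cell (K : Fin m.num) (i : Fin 3) : m.edge K i ⊆ m.cell K := fun _ hx =>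
  (m.mem_edge.1 hx).1

lemma isCompact_edge (K : Fin m.num) (i : Fin 3) : IsCompact (m.edge K i) :=
  ((finite_range _).subset (image_subset_range _ _)).isCompact_convexHull ℝ

lemma isCompact_cell (K : Fin m.num) : IsCompact (m.cell K) :=
  (finite_range _).isCompact_convexHull ℝ

lemma measurableSet_cell (K : Fin m.num) : MeasurableSet (m.cell K) :=
  (m.isCompact_cell K).isClosed.measurableSet

lemma convex_cell (K : Fin m.num) : Convex ℝ (m.cell K) := convex_convexHull _ _

/-- The altitude vector, from a vertex to its foot. -/
def alt (K : Fin m.num) (i : Fin 3) : Plane := (m.tri K).altitudeFoot i - (m.tri K).points i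

lemma nrm_eq (K : Fin m.num) (i : Fin 3) : m.nrm K i = ‖m.alt K i‖⁻¹ • m.alt K i := rfl

lemma alt_ne_zero (K : Fin m.num) (i : Fin 3) : m.alt K i ≠ 0 :=
  sub_ne_zero.2 ((m.tri K).ne_altitudeFoot i).symm

lemma norm_nrm (K : Fin m.num) (i : Fin 3) : ‖m.nrm K i‖ = 1 := by
  rw [nrm_eq, norm_smul, norm_inv, norm_norm,
    inv_mul_cancel₀ (norm_ne_zero_iff.2 (m.alt_ne_zero K i))]

lemma inner_alt_of_ne (K : Fin m.num) {i j : Fin 3} (h : i ≠ j) :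
    inner ℝ (m.pt K j - (m.tri K).altitudeFoot i) (m.alt K i) = 0 := by
  have := (m.tri K).inner_vsub_altitudeFoot_vsub_altitudeFoot_eq_zero h
  simp only [vsub_eq_sub] at this
  have e : m.alt K i = -((m.tri K).points i - (m.tri K).altitudeFoot i) := by simp [alt]
  rw [e, inner_neg_right]; simpa [pt] using this

lemma inner_alt_edge (K : Fin m.num) (i : Fin 3) :
    inner ℝ (m.pt K (i + 1) - m.pt K (i + 2)) (m.alt K i) = 0 := by
  have h1 := m.inner_alt_of_ne K (i := i) (j := i + 1) (by fin_cases i <;> decide)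
  have h2 := m.inner_alt_of_ne K (i := i) (j := i + 2) (by fin_cases i <;> decide)
  rw [show m.pt K (i + 1) - m.pt K (i + 2) = (m.pt K (i + 1) - (m.tri K).altitudeFoot i) -
    (m.pt K (i + 2) - (m.tri K).altitudeFoot i) by abel, inner_sub_left, h1, h2, sub_zero]

lemma coord_linear_alt (K : Fin m.num) (i : Fin 3) :
    ((m.basis K).coord i).linear (m.alt K i) = -1 := by
  have h1 : (m.basis K).coord i ((m.tri K).altitudeFoot i) = 0 :=
    coord_zero_of_mem_affineSpan _ _ ((m.tri K).altitudeFoot_mem_affineSpan_image_compl i)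
  have h2 := coord_linear_sub (m.basis K) i ((m.tri K).altitudeFoot i) (m.pt K i)
  rw [h1, coord_pt] at h2
  simpa [alt, pt] using h2

lemma area_eq (K : Fin m.num) (i : Fin 3) :
    2 * m.area K = |jac (m.pt K i) (m.pt K (i + 1)) (m.pt K (i + 2))| := by
  have := volume_real_triangle (m.basis K)
  rw [abs_jac_rotate (m.basis K) i] at this
  rw [area, cell_eq_convexHull, this, coe_basis]; ring

/-- In the plane a vector orthogonal to w is a multiple s of w turned by a right angle. Substituting
this turns the orthogonal expansion into a rational identity in s and the coordinates of w. -/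
lemma plane_decomp {x w : Plane} (hx : x ≠ 0) (hw : w ≠ 0) (h : inner ℝ x w = 0) (e : Plane) :
    e = (inner ℝ w e / ‖w‖ ^ 2) • w + (inner ℝ x e / ‖x‖ ^ 2) • x := by
  have hw2 : ‖w‖ ^ 2 = w 0 ^ 2 + w 1 ^ 2 := by
    rw [← real_inner_self_eq_norm_sq, plane_inner]; ring
  have hx2 : ‖x‖ ^ 2 = x 0 ^ 2 + x 1 ^ 2 := by
    rw [← real_inner_self_eq_norm_sq, plane_inner]; ring
  have hwp : 0 < ‖w‖ ^ 2 := by positivity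
  have hxp : 0 < ‖x‖ ^ 2 := by positivity
  rw [plane_inner] at h
  rw [hw2] at hwp
  rw [hx2] at hxp
  rw [plane_inner, plane_inner, hw2, hx2]
  set s := (w 0 * x 1 - w 1 * x 0) / (w 0 ^ 2 + w 1 ^ 2) with hs
  have h0 : x 0 = -s * w 1 := by
    rw [hs]; field_simp; linear_combination w 0 * h
  have h1 : x 1 = s * w 0 := by
    rw [hs]; field_simp; linear_combination w 1 * h
  have hsp : s ≠ 0 := by
    rintro h; rw [h0, h1, h] at hxp; simp at hxp
  have e1 : (x 0 ^ 2 + x 1 ^ 2) = s ^ 2 * (w 0 ^ 2 + w 1 ^ 2) := by rw [h0, h1]; ring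
  rw [e1]
  ext i
  fin_cases i
  · simp [h0, h1]; field_simp; ring
  · simp [h0, h1]; field_simp; ring

lemma abs_det_of_orthogonal {x w : Plane} (h : inner ℝ x w = 0) :
    |w 0 * x 1 - w 1 * x 0| = ‖w‖ * ‖x‖ := by
  have hw2 : ‖w‖ ^ 2 = w 0 ^ 2 + w 1 ^ 2 := by
    rw [← real_inner_self_eq_norm_sq, plane_inner]; ring
  have hx2 : ‖x‖ ^ 2 = x 0 ^ 2 + x 1 ^ 2 := by
    rw [← real_inner_self_eq_norm_sq, plane_inner]; ring
  rw [plane_inner] at h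
  rw [← abs_of_nonneg (by positivity : 0 ≤ ‖w‖ * ‖x‖), ← sq_eq_sq_iff_abs_eq_abs, mul_pow, hw2, hx2]
  linear_combination (-(x 0 * w 0 + x 1 * w 1)) * h

/-- The flux vector of an edge in terms of the barycentric coordinate. -/
lemma len_mul_inner_nrm (K : Fin m.num) (i : Fin 3) (e : Plane) :
    m.len K i * inner ℝ (m.nrm K i) e =
      -(2 * m.area K) * ((m.basis K).coord i).linear e := by
  set x := m.pt K (i + 1) - m.pt K (i + 2) with hxdef
  set w := m.alt K i with hwdef
  have hxw : inner ℝ x w = 0 := m.inner_alt_edge K i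
  have hw : w ≠ 0 := m.alt_ne_zero K i
  have hlen : m.len K i = ‖x‖ := by rw [len_eq_dist, dist_eq_norm]
  have hx : x ≠ 0 := norm_ne_zero_iff.1 (hlen ▸ (m.len_pos K i).ne')
  have hlx : ((m.basis K).coord i).linear x = 0 := by
    rw [hxdef, coord_linear_sub, coord_pt, coord_pt]
    fin_cases i <;> simp
  -- Base times height: relative to vertex i the two other vertices are the altitude plus multiples
  -- of the edge vector, and only the altitude-edge determinant survives.
  have harea : 2 * m.area K = ‖w‖ * ‖x‖ := by
    rw [area_eq m K i, ← abs_det_of_orthogonal hxw]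
    set y := m.pt K (i + 1) - (m.tri K).altitudeFoot i with hy
    have hyw : inner ℝ y w = 0 := m.inner_alt_of_ne K (by fin_cases i <;> decide)
    have hyx : y = (inner ℝ x y / ‖x‖ ^ 2) • x := by
      have := plane_decomp hx hw hxw y
      rwa [real_inner_comm, hyw, zero_div, zero_smul, zero_add] at this
    set s := inner ℝ x y / ‖x‖ ^ 2
    have e1 : m.pt K (i + 1) - m.pt K i = w + s • x := by
      rw [← hyx, hy, hwdef, alt, pt]; abel
    have e2 : m.pt K (i + 2) - m.pt K i = w + s • x - x := by
      rw [← e1, hxdef]; abel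
    rw [jac, e1, e2]
    rw [← abs_neg]
    congr 1
    simp
    ring
  -- Split along the altitude and the edge: the i-th barycentric coordinate is constant along the
  -- edge and drops by 1 along the altitude.
  have hd := plane_decomp hx hw hxw e
  have hlin : ((m.basis K).coord i).linear e = -(inner ℝ w e / ‖w‖ ^ 2) := by
    conv_lhs => rw [hd]
    rw [map_add, map_smul, map_smul, hlx, coord_linear_alt]
    simp
  have hwn : ‖w‖ ≠ 0 := norm_ne_zero_iff.2 hw
  rw [hlin, harea, hlen, nrm_eq, ← hwdef, real_inner_smul_left]
  field_simp

/-- Evaluate the flux identity on the altitude vector: the left side is positive and the right side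
is 2|K|. -/
lemma area_pos (K : Fin m.num) : 0 < m.area K := by
  have h := m.len_mul_inner_nrm K 0 (m.alt K 0)
  rw [coord_linear_alt, nrm_eq, real_inner_smul_left, real_inner_self_eq_norm_sq] at h
  have h1 := m.len_pos K 0
  have h2 : 0 < ‖m.alt K 0‖ := norm_pos_iff.2 (m.alt_ne_zero K 0)
  have h3 : 0 < m.len K 0 * (‖m.alt K 0‖⁻¹ * ‖m.alt K 0‖ ^ 2) := by positivity
  linarith

/-- The divergence theorem on a triangle of the mesh. -/
lemma setIntegral_cell_fderiv (K : Fin m.num) {φ : Plane → ℝ} (hφ : ContDiff ℝ 1 φ) (e : Plane) :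
    ∫ x in m.cell K, fderiv ℝ φ x e =
      ∑ i, m.len K i * inner ℝ (m.nrm K i) e * edgeMean φ (m.pt K) i := by
  rw [cell_eq_convexHull, setIntegral_triangle_fderiv _ hφ, ← cell_eq_convexHull, Finset.mul_sum]
  refine Finset.sum_congr rfl fun i _ => ?_
  rw [len_mul_inner_nrm, area, coe_basis]; ring

lemma edgeMean_const (p : Fin 3 → Plane) (i : Fin 3) (a : ℝ) : edgeMean (fun _ => a) p i = a := by
  simp [edgeMean]

/-- The divergence theorem for the constant function 1: a constant field has no net flux out of a
triangle. -/
lemma sum_len_nrm (K : Fin m.num) (e : Plane) :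
    ∑ i, m.len K i * inner ℝ (m.nrm K i) e = 0 := by
  have h := m.setIntegral_cell_fderiv K (φ := fun _ => 1) contDiff_const e
  simp only [edgeMean_const, mul_one] at h
  rw [← h]; simp

end TriMesh

/-! ### Circumcentres of acute triangles and the two sides of an edge -/

namespace TriMesh

variable {Ω : Set Plane} (m : TriMesh Ω)

lemma inner_pos_of_acute (K : Fin m.num) (i : Fin 3) :
    0 < inner ℝ (m.pt K i - m.pt K (i + 1)) (m.pt K i - m.pt K (i + 2)) := by
  have h := m.acute K (i + 1) i (i + 2) (by fin_cases i <;> decide) (by fin_cases i <;> decide)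
    (by fin_cases i <;> decide)
  rw [EuclideanGeometry.angle] at h
  simp only [vsub_eq_sub] at h
  have hcos := Real.cos_pos_of_mem_Ioo ⟨by
    linarith [Real.pi_pos, InnerProductGeometry.angle_nonneg
      ((m.tri K).points (i + 1) - (m.tri K).points i)
      ((m.tri K).points (i + 2) - (m.tri K).points i)], h⟩
  have h1 := InnerProductGeometry.cos_angle_mul_norm_mul_norm
    ((m.tri K).points (i + 1) - (m.tri K).points i) ((m.tri K).points (i + 2) - (m.tri K).points i)
  have n1 : (m.tri K).points (i + 1) - (m.tri K).points i ≠ 0 := sub_ne_zero.2 fun h =>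
    absurd ((m.tri K).independent.injective h) (by fin_cases i <;> decide)
  have n2 : (m.tri K).points (i + 2) - (m.tri K).points i ≠ 0 := sub_ne_zero.2 fun h =>
    absurd ((m.tri K).independent.injective h) (by fin_cases i <;> decide)
  have : 0 < inner ℝ ((m.tri K).points (i + 1) - (m.tri K).points i)
      ((m.tri K).points (i + 2) - (m.tri K).points i) := by
    rw [← h1]; positivity
  rw [← neg_sub, ← neg_sub (m.pt K (i + 2)), inner_neg_neg]
  exact this

lemma dist_pt_ctr (K : Fin m.num) (i : Fin 3) :
    dist (m.pt K i) (m.ctr K) = (m.tri K).circumradius :=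
  (m.tri K).dist_circumcenter_eq_circumradius i

/-- Equidistance from the vertices gives o·u = |u|²/2 and o·w = |w|²/2 for the position o of the
circumcentre relative to vertex i+1. Solving this 2 by 2 system for the coordinate of vertex i
produces a numerator that is positive because the angle at i is acute. -/
lemma coord_ctr_pos (K : Fin m.num) (i : Fin 3) : 0 < (m.basis K).coord i (m.ctr K) := by
  set u := m.pt K i - m.pt K (i + 1) with hu
  set w := m.pt K (i + 2) - m.pt K (i + 1) with hw
  set o := m.ctr K - m.pt K (i + 1) with ho
  set α := (m.basis K).coord i (m.ctr K) with hα
  set β := (m.basis K).coord (i + 2) (m.ctr K) with hβ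
  have hsum := (m.basis K).sum_coord_apply_eq_one (m.ctr K)
  have hlin := (m.basis K).linear_combination_coord_eq_self (m.ctr K)
  have hdec : o = α • u + β • w := by
    have h1 : (m.basis K).coord (i + 1) (m.ctr K) = 1 - α - β := by
      rw [hα, hβ]; rw [Fin.sum_univ_three] at hsum
      fin_cases i
      · simp at hsum ⊢; linarith
      · simp at hsum ⊢
        linarith
      · simp at hsum ⊢
        linarith
    have h2 : m.ctr K = α • m.pt K i + (1 - α - β) • m.pt K (i + 1) + β • m.pt K (i + 2) := by
      rw [← h1]
      conv_lhs => rw [← hlin, Fin.sum_univ_three]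
      simp only [basis_apply, hα, hβ]
      fin_cases i
      · rfl
      · rw [add_assoc, add_comm]; rfl
      · rw [add_comm, ← add_assoc]; rfl
    rw [ho, h2, hu, hw]; module
  have hd1 : inner ℝ o u = ‖u‖ ^ 2 / 2 := by
    have h1 : ‖o - u‖ = ‖o‖ := by
      have e1 : o - u = -(m.pt K i - m.ctr K) := by rw [ho, hu]; abel
      have e2 : o = -(m.pt K (i + 1) - m.ctr K) := by rw [ho]; abel
      rw [e1, e2, norm_neg, norm_neg, ← dist_eq_norm, ← dist_eq_norm, dist_pt_ctr, dist_pt_ctr]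
    have h2 := norm_sub_sq_real o u
    rw [h1] at h2; linarith
  have hd2 : inner ℝ o w = ‖w‖ ^ 2 / 2 := by
    have h1 : ‖o - w‖ = ‖o‖ := by
      have e1 : o - w = -(m.pt K (i + 2) - m.ctr K) := by rw [ho, hw]; abel
      have e2 : o = -(m.pt K (i + 1) - m.ctr K) := by rw [ho]; abel
      rw [e1, e2, norm_neg, norm_neg, ← dist_eq_norm, ← dist_eq_norm, dist_pt_ctr, dist_pt_ctr]
    have h2 := norm_sub_sq_real o w
    rw [h1] at h2; linarith
  have hac : 0 < ‖u‖ ^ 2 - inner ℝ u w := by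
    have := m.inner_pos_of_acute K i
    rw [← hu, show m.pt K i - m.pt K (i + 2) = u - w by rw [hu, hw]; abel, inner_sub_right,
      real_inner_self_eq_norm_sq] at this
    exact this
  rw [hdec, inner_add_left, real_inner_smul_left, real_inner_smul_left,
    real_inner_self_eq_norm_sq] at hd1
  rw [hdec, inner_add_left, real_inner_smul_left, real_inner_smul_left,
    real_inner_self_eq_norm_sq] at hd2
  rw [real_inner_comm] at hd1
  have hwpos : 0 < ‖w‖ ^ 2 := by
    have : w ≠ 0 := sub_ne_zero.2 fun h => absurd (m.pt_injective K h) (by fin_cases i <;> decide)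
    positivity
  set g := inner ℝ u w
  -- Cramer's rule, with the Gram determinant kept as a factor on the left.
  have key : α * (‖u‖ ^ 2 * ‖w‖ ^ 2 - g ^ 2) = ‖w‖ ^ 2 / 2 * (‖u‖ ^ 2 - g) := by
    linear_combination ‖w‖ ^ 2 * hd1 - g * hd2
  have hcs : 0 ≤ ‖u‖ ^ 2 * ‖w‖ ^ 2 - g ^ 2 := by
    have := abs_real_inner_le_norm u w
    have h2 := pow_le_pow_left₀ (abs_nonneg _) this 2
    rw [sq_abs, mul_pow] at h2
    linarith
  -- Strict positivity of the Gram determinant is not needed: a positive product with a nonnegative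
  -- factor has a positive other factor.
  have hpos : 0 < α * (‖u‖ ^ 2 * ‖w‖ ^ 2 - g ^ 2) := by rw [key]; positivity
  exact pos_of_mul_pos_left hpos hcs

lemma ctr_mem_interior (K : Fin m.num) : m.ctr K ∈ interior (m.cell K) :=
  m.mem_interior_cell.2 (m.coord_ctr_pos K)

lemma circumradius_le_h (K : Fin m.num) : (m.tri K).circumradius ≤ m.h :=
  le_ciSup (f := fun K => (m.tri K).circumradius) (finite_range _).bddAbove K

lemma circumradius_pos (K : Fin m.num) : 0 < (m.tri K).circumradius := by
  rw [← m.dist_pt_ctr K 0]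
  refine lt_of_le_of_ne dist_nonneg fun h => ?_
  have h0 := m.coord_ctr_pos K 1
  rw [← dist_eq_zero.1 h.symm, coord_pt] at h0
  simp at h0

lemma h_pos (K : Fin m.num) : 0 < m.h := (m.circumradius_pos K).trans_le (m.circumradius_le_h K)

lemma cell_subset_closedBall (K : Fin m.num) : m.cell K ⊆ Metric.closedBall (m.ctr K) m.h := by
  refine convexHull_min ?_ (convex_closedBall _ _)
  rintro _ ⟨i, rfl⟩
  exact (m.dist_pt_ctr K i).le.trans (m.circumradius_le_h K)

lemma len_le (K : Fin m.num) (i : Fin 3) : m.len K i ≤ 2 * m.h := by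
  rw [len_eq_dist]
  have h1 := m.dist_pt_ctr K (i + 1)
  have h2 := m.dist_pt_ctr K (i + 2)
  have h3 := dist_triangle_right (m.pt K (i + 1)) (m.pt K (i + 2)) (m.ctr K)
  have := m.circumradius_le_h K
  linarith

/-- By connectedness, the ball can leave the interior of the triangle only through an edge, and
every edge is at distance at least r from the circumcentre. -/
lemma ball_subset_interior_cell (K : Fin m.num) {r : ℝ}
    (hr : ∀ i, r ≤ Metric.infDist (m.ctr K) (m.edge K i)) :
    Metric.ball (m.ctr K) r ⊆ interior (m.cell K) := by
  rcases le_or_gt r 0 with h0 | h0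
  · rw [Metric.ball_eq_empty.2 h0]; exact empty_subset _
  have hpre : IsPreconnected (Metric.ball (m.ctr K) r) := (convex_ball _ _).isPreconnected
  refine hpre.subset_of_closure_inter_subset isOpen_interior
    ⟨m.ctr K, Metric.mem_ball_self h0, m.ctr_mem_interior K⟩ ?_
  rintro x ⟨hx, hxb⟩
  have hxc : x ∈ m.cell K := by
    have := closure_mono (interior_subset (s := m.cell K)) hx
    rwa [(m.isCompact_cell K).isClosed.closure_eq] at this
  rw [mem_interior_cell]
  intro i
  refine lt_of_le_of_ne (m.mem_cell.1 hxc i) fun h => ?_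
  have hxe : x ∈ m.edge K i := m.mem_edge.2 ⟨hxc, h.symm⟩
  have := Metric.infDist_le_dist_of_mem (x := m.ctr K) hxe
  rw [Metric.mem_ball, dist_comm] at hxb
  linarith [hr i]

lemma volume_edge (K : Fin m.num) (i : Fin 3) : volume (m.edge K i) = 0 := by
  refine measure_mono_null ?_ (Convex.addHaar_frontier volume (m.convex_cell K))
  intro x hx
  rw [(m.isCompact_cell K).isClosed.frontier_eq]
  refine ⟨m.edge_subset_cell K i hx, fun h => ?_⟩
  have := m.mem_interior_cell.1 h i
  rw [(m.mem_edge.1 hx).2] at this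
  exact lt_irrefl _ this

/-- Distinct triangles have distinct vertex sets of equal size, so some vertex of K is not one of L.
By conformity the intersection then lies in the edge of K opposite to that vertex, a null set. -/
lemma volume_cell_inter {K L : Fin m.num} (h : K ≠ L) : volume (m.cell K ∩ m.cell L) = 0 := by
  have hsub : ∃ i, m.pt K i ∉ range (m.pt L) := by
    by_contra hcon
    push Not at hcon
    have h1 : range (m.pt K) ⊆ range (m.pt L) := by rintro _ ⟨i, rfl⟩; exact hcon i
    refine m.distinct K L h (Set.eq_of_subset_of_ncard_le h1 ?_ (finite_range _))
    have e : ∀ M, (range (m.tri M).points).ncard = Nat.card (Fin 3) := fun M =>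
      Set.ncard_range_of_injective (m.pt_injective M)
    rw [e, e]
  obtain ⟨i, hi⟩ := hsub
  refine measure_mono_null ?_ (m.volume_edge K i)
  rw [cell, cell, m.conforming K L h]
  refine convexHull_mono ?_
  rintro _ ⟨⟨j, rfl⟩, hj⟩
  exact ⟨j, fun hji => hi (by rw [← show j = i from hji]; exact hj), rfl⟩

lemma aedisjoint_cell : Pairwise (Function.onFun (AEDisjoint volume) m.cell) :=
  fun _ _ h => m.volume_cell_inter h

lemma interior_cell_disjoint {K L : Fin m.num} {x : Plane} (hK : x ∈ interior (m.cell K))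
    (hL : x ∈ interior (m.cell L)) : K = L := by
  by_contra h
  have h1 : IsOpen (interior (m.cell K) ∩ interior (m.cell L)) := isOpen_interior.inter isOpen_interior
  have h2 := h1.measure_pos volume ⟨x, hK, hL⟩
  have h3 : volume (interior (m.cell K) ∩ interior (m.cell L)) = 0 :=
    measure_mono_null (inter_subset_inter interior_subset interior_subset) (m.volume_cell_inter h)
  exact h2.ne' h3

/-- Two triangle-edge pairs that are the two sides of an interior edge. -/
def IsOpp (e e' : Fin m.num × Fin 3) : Prop := e'.1 ≠ e.1 ∧ m.edge e'.1 e'.2 = m.edge e.1 e.2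

variable {m}

lemma IsOpp.symm {e e' : Fin m.num × Fin 3} (h : m.IsOpp e e') : m.IsOpp e' e :=
  ⟨h.1.symm, h.2.symm⟩

lemma IsOpp.pt {e e' : Fin m.num × Fin 3} (h : m.IsOpp e e') :
    (m.pt e.1 (e.2 + 1) = m.pt e'.1 (e'.2 + 1) ∧ m.pt e.1 (e.2 + 2) = m.pt e'.1 (e'.2 + 2)) ∨
    (m.pt e.1 (e.2 + 1) = m.pt e'.1 (e'.2 + 2) ∧ m.pt e.1 (e.2 + 2) = m.pt e'.1 (e'.2 + 1)) := by
  have := h.2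
  rw [edge_eq_segment, edge_eq_segment] at this
  exact segment_eq_segment this.symm
    (fun h => absurd (m.pt_injective _ h) (by
      generalize e'.2 = i; fin_cases i <;> decide))

lemma IsOpp.len {e e' : Fin m.num × Fin 3} (h : m.IsOpp e e') :
    m.len e'.1 e'.2 = m.len e.1 e.2 := by
  rw [TriMesh.len, TriMesh.len, h.2]

lemma IsOpp.mid {e e' : Fin m.num × Fin 3} (h : m.IsOpp e e') :
    m.mid e'.1 e'.2 = m.mid e.1 e.2 := by
  rw [mid_eq, mid_eq]
  rcases h.pt with ⟨h1, h2⟩ | ⟨h1, h2⟩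
  · rw [h1, h2]
  · rw [h1, h2, add_comm]

lemma IsOpp.edgeMean {e e' : Fin m.num × Fin 3} (h : m.IsOpp e e') (φ : Plane → ℝ) :
    edgeMean φ (m.pt e'.1) e'.2 = edgeMean φ (m.pt e.1) e.2 := by
  unfold FVScheme.edgeMean
  rcases h.pt with ⟨h1, h2⟩ | ⟨h1, h2⟩
  · rw [h1, h2]
  · rw [h1, h2, intervalIntegral_segment_symm]

lemma inner_nrm_edge (K : Fin m.num) (i : Fin 3) :
    inner ℝ (m.pt K (i + 1) - m.pt K (i + 2)) (m.nrm K i) = 0 := by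
  rw [nrm_eq, real_inner_smul_right, inner_alt_edge, mul_zero]

/-- Moving from the midpoint against the normal, the i-th barycentric coordinate grows from 0, while
the other two start at 1/2 and stay positive for a short time. -/
lemma eventually_mem_interior (K : Fin m.num) (i : Fin 3) :
    ∀ᶠ t in 𝓝[>] (0 : ℝ), m.mid K i - t • m.nrm K i ∈ interior (m.cell K) := by
  have hc : ∀ j t, (m.basis K).coord j (m.mid K i - t • m.nrm K i) =
      (m.basis K).coord j (m.mid K i) - t * ((m.basis K).coord j).linear (m.nrm K i) := by
    intro j t
    have := coord_linear_sub (m.basis K) j (m.mid K i - t • m.nrm K i) (m.mid K i)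
    rw [show m.mid K i - t • m.nrm K i - m.mid K i = -(t • m.nrm K i) by abel, map_neg,
      map_smul, smul_eq_mul] at this
    linarith
  simp only [mem_interior_cell]
  rw [Filter.eventually_all]
  intro j
  by_cases hj : j = i
  · subst hj
    filter_upwards [self_mem_nhdsWithin] with t ht
    rw [hc, coord_mid, if_pos rfl]
    have h := m.len_mul_inner_nrm K j (m.nrm K j)
    rw [real_inner_self_eq_norm_sq, norm_nrm] at h
    have h1 := m.len_pos K j
    have h2 := m.area_pos K
    have h3 : ((m.basis K).coord j).linear (m.nrm K j) < 0 := by nlinarith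
    have ht' : 0 < t := ht
    nlinarith
  · have hcont : ContinuousAt (fun t => (m.basis K).coord j (m.mid K i) -
        t * ((m.basis K).coord j).linear (m.nrm K i)) 0 := by fun_prop
    have h0 : 0 < (m.basis K).coord j (m.mid K i) -
        0 * ((m.basis K).coord j).linear (m.nrm K i) := by
      rw [coord_mid, if_neg hj]; norm_num
    have := hcont.eventually (lt_mem_nhds h0)
    filter_upwards [mem_nhdsWithin_of_mem_nhds this] with t ht
    rw [hc]; exact ht

lemma eq_or_eq_neg_of_orthogonal {x n n' : Plane} (hx : x ≠ 0) (h : inner ℝ x n = 0)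
    (h' : inner ℝ x n' = 0) (hn : ‖n‖ = 1) (hn' : ‖n'‖ = 1) : n' = n ∨ n' = -n := by
  have hn0 : n ≠ 0 := norm_ne_zero_iff.1 (by rw [hn]; norm_num)
  have := plane_decomp hx hn0 h n'
  rw [h', zero_div, zero_smul, add_zero, hn] at this
  have h2 : |inner ℝ n n'| = 1 := by
    have := congrArg norm this
    rw [hn', norm_smul, hn] at this
    simpa using this.symm
  rcases abs_eq (zero_le_one) |>.1 h2 with h2 | h2
  · left; rw [this, h2]; simp
  · right; rw [this, h2]; simp

/-- Both normals are unit vectors orthogonal to the common edge, hence equal or opposite. If they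
were equal, a short inward step from the midpoint would land in both interiors. -/
lemma IsOpp.nrm {e e' : Fin m.num × Fin 3} (h : m.IsOpp e e') :
    m.nrm e'.1 e'.2 = -m.nrm e.1 e.2 := by
  have hx : m.pt e.1 (e.2 + 1) - m.pt e.1 (e.2 + 2) ≠ 0 := sub_ne_zero.2 fun h => absurd
    (m.pt_injective _ h) (by generalize e.2 = i; fin_cases i <;> decide)
  have h1 := inner_nrm_edge (m := m) e.1 e.2
  have h2 : inner ℝ (m.pt e.1 (e.2 + 1) - m.pt e.1 (e.2 + 2)) (m.nrm e'.1 e'.2) = 0 := by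
    have := inner_nrm_edge (m := m) e'.1 e'.2
    rcases h.pt with ⟨h1, h2⟩ | ⟨h1, h2⟩
    · rw [h1, h2, this]
    · rw [h1, h2, ← neg_sub, inner_neg_left, this, neg_zero]
  rcases eq_or_eq_neg_of_orthogonal hx h1 h2 (m.norm_nrm _ _) (m.norm_nrm _ _) with h3 | h3
  · exfalso
    have e1 := eventually_mem_interior (m := m) e.1 e.2
    have e2 := eventually_mem_interior (m := m) e'.1 e'.2
    rw [h3, h.mid] at e2
    obtain ⟨t, ht1, ht2⟩ := (e1.and e2).exists
    exact h.1 (m.interior_cell_disjoint ht2 ht1)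
  · exact h3

lemma edge_injective (K : Fin m.num) {i j : Fin 3} (h : m.edge K i = m.edge K j) : i = j := by
  by_contra hij
  have h1 := m.mid_mem_edge K i
  rw [h, mem_edge, coord_mid, if_neg (Ne.symm hij)] at h1
  norm_num at h1

/-- Three triangles sharing an edge would have pairwise opposite normals, which is impossible for
three unit vectors. -/
lemma IsOpp.unique {e e' e'' : Fin m.num × Fin 3} (h : m.IsOpp e e') (h' : m.IsOpp e e'') :
    e' = e'' := by
  by_cases h1 : e''.1 = e'.1
  · have h2 := h.2.trans h'.2.symm
    obtain ⟨a, b⟩ := e'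
    obtain ⟨a', b'⟩ := e''
    simp only at h1 h2
    subst h1
    rw [edge_injective _ h2]
  · have h2 : m.IsOpp e' e'' := ⟨h1, h'.2.trans h.2.symm⟩
    have h3 := h2.nrm
    rw [h.nrm, h'.nrm, neg_neg] at h3
    have h4 := m.norm_nrm e.1 e.2
    have h5 : (2 : ℝ) • m.nrm e.1 e.2 = 0 := by
      rw [two_smul]; nth_rewrite 1 [← h3]; simp
    rw [(smul_eq_zero.1 h5).resolve_left two_ne_zero] at h4; simp at h4

/-- If an endpoint of the edge were not a vertex of the other triangle, conformity would confine the
intersection to the edge of K opposite to that endpoint, which misses the midpoint. So both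
endpoints are shared, and with them the whole edge. -/
lemma eq_or_isOpp_of_mid_mem {e e' : Fin m.num × Fin 3} (h : m.mid e.1 e.2 ∈ m.edge e'.1 e'.2) :
    e' = e ∨ m.IsOpp e e' := by
  obtain ⟨K, i⟩ := e
  obtain ⟨M, l⟩ := e'
  simp only at h
  by_cases hKM : M = K
  · subst hKM
    left
    rw [mem_edge, coord_mid] at h
    by_cases hl : l = i
    · rw [hl]
    · rw [if_neg hl] at h; norm_num at h
  · right
    have h1 : m.mid K i ∈ convexHull ℝ (range (m.tri K).points ∩ range (m.tri M).points) := by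
      rw [← m.conforming K M (Ne.symm hKM)]
      exact ⟨m.edge_subset_cell K i (m.mid_mem_edge K i), m.edge_subset_cell M l h⟩
    have hv : ∀ j, j ≠ i → m.pt K j ∈ range (m.pt M) := by
      intro j hj
      by_contra hcon
      have h2 : convexHull ℝ (range (m.tri K).points ∩ range (m.tri M).points) ⊆ m.edge K j := by
        refine convexHull_mono ?_
        rintro _ ⟨⟨j', rfl⟩, hj'⟩
        exact ⟨j', fun hji => hcon (by rw [← show j' = j from hji]; exact hj'), rfl⟩
      have h3 := h2 h1
      rw [mem_edge, coord_mid, if_neg hj] at h3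
      norm_num at h3
    obtain ⟨a, ha⟩ := hv (i + 1) (by fin_cases i <;> decide)
    obtain ⟨b, hb⟩ := hv (i + 2) (by fin_cases i <;> decide)
    have hab : a ≠ b := by
      rintro rfl
      have := m.pt_injective K (ha.symm.trans hb)
      revert this; fin_cases i <;> decide
    obtain ⟨j, hj⟩ : ∃ j : Fin 3, (a = j + 1 ∧ b = j + 2) ∨ (a = j + 2 ∧ b = j + 1) := by
      clear ha hb; revert hab; revert a b; decide
    have hedge : m.edge M j = m.edge K i := by
      rw [edge_eq_segment, edge_eq_segment, ← ha, ← hb]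
      rcases hj with ⟨rfl, rfl⟩ | ⟨rfl, rfl⟩
      · rfl
      · rw [segment_symm]
    have hopp : m.IsOpp (K, i) (M, j) := ⟨hKM, hedge⟩
    have hlj : l = j := by
      rw [← hopp.mid, mem_edge, coord_mid] at h
      by_contra hl
      rw [if_neg hl] at h; norm_num at h
    rw [hlj]; exact hopp

variable (m)

open Classical in
/-- The other side of an interior edge; a boundary edge is its own other side. -/
def opp (e : Fin m.num × Fin 3) : Fin m.num × Fin 3 :=
  if h : ∃ e', m.IsOpp e e' then h.choose else e

variable {m}

lemma isOpp_opp {e : Fin m.num × Fin 3} (h : m.opp e ≠ e) : m.IsOpp e (m.opp e) := by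
  unfold opp at *
  split_ifs at * with h1
  · exact h1.choose_spec
  · exact absurd rfl h

lemma opp_eq_of_isOpp {e e' : Fin m.num × Fin 3} (h : m.IsOpp e e') : m.opp e = e' := by
  unfold opp
  rw [dif_pos ⟨e', h⟩]
  exact IsOpp.unique (Exists.choose_spec (⟨e', h⟩ : ∃ e', m.IsOpp e e')) h

lemma opp_opp (e : Fin m.num × Fin 3) : m.opp (m.opp e) = e := by
  by_cases h : m.opp e = e
  · rw [h, h]
  · exact opp_eq_of_isOpp (isOpp_opp h).symm

lemma opp_ne_opp {e : Fin m.num × Fin 3} (h : m.opp e ≠ e) : m.opp (m.opp e) ≠ m.opp e := by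
  rw [opp_opp]; exact h.symm

lemma not_isOpp_of_opp_eq {e : Fin m.num × Fin 3} (h : m.opp e = e) (e' : Fin m.num × Fin 3) :
    ¬ m.IsOpp e e' := fun h' => h'.1 (by rw [← opp_eq_of_isOpp h', h])

lemma nbr_eq_some {e : Fin m.num × Fin 3} (h : m.opp e ≠ e) :
    m.nbr e.1 e.2 = some (m.opp e).1 := by
  have h1 := isOpp_opp h
  have H : ∃ L, L ≠ e.1 ∧ ∃ j, m.edge L j = m.edge e.1 e.2 := ⟨_, h1.1, _, h1.2⟩
  rw [nbr, dif_pos H]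
  obtain ⟨h2, j, h3⟩ := H.choose_spec
  have h4 : m.IsOpp e (H.choose, j) := ⟨h2, h3⟩
  rw [opp_eq_of_isOpp h4]

lemma nbr_eq_none {e : Fin m.num × Fin 3} (h : m.opp e = e) : m.nbr e.1 e.2 = none := by
  rw [nbr, dif_neg]
  rintro ⟨L, hL, j, hj⟩
  exact not_isOpp_of_opp_eq h (L, j) ⟨hL, hj⟩

/-- Changing sides is an involution of the triangle-edge pairs. This is the source of every discrete
integration by parts below: interior edges occur twice in such sums, boundary edges once. -/
lemma sum_opp {M : Type*} [AddCommMonoid M] (F : Fin m.num × Fin 3 → M) :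
    ∑ e, F (m.opp e) = ∑ e, F e :=
  Equiv.sum_comp ⟨m.opp, m.opp, opp_opp, opp_opp⟩ F

end TriMesh

/-! ### Jumps, edge sums and the discrete operators -/

namespace TriMesh

variable {Ω : Set Plane} (m : TriMesh Ω)

section Jumps

variable {F : Type} [NormedAddCommGroup F]

open Classical in
/-- The value of a piecewise constant function on the other side of an edge, `0` off the mesh. -/
def nb (v : Fin m.num → F) (e : Fin m.num × Fin 3) : F :=
  if m.opp e = e then 0 else v (m.opp e).1

/-- The jump of a piecewise constant function across an edge. -/
def jump (v : Fin m.num → F) (e : Fin m.num × Fin 3) : F := m.nb v e - v e.1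

/-- The sum of the squares of the jumps. -/
def jumpSq (v : Fin m.num → F) : ℝ := ∑ e, ‖m.jump v e‖ ^ 2

lemma jumpSq_nonneg (v : Fin m.num → F) : 0 ≤ m.jumpSq v := Finset.sum_nonneg fun _ _ => by positivity

lemma norm_jump_le (v : Fin m.num → F) (e : Fin m.num × Fin 3) :
    ‖m.jump v e‖ ≤ √(m.jumpSq v) := by
  apply Real.le_sqrt_of_sq_le
  exact Finset.single_le_sum (f := fun e => ‖m.jump v e‖ ^ 2) (fun _ _ => by positivity)
    (Finset.mem_univ e)

variable {m}

lemma nb_of_eq {v : Fin m.num → F} {e : Fin m.num × Fin 3} (h : m.opp e = e) : m.nb v e = 0 :=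
  if_pos h

lemma nb_of_ne {v : Fin m.num → F} {e : Fin m.num × Fin 3} (h : m.opp e ≠ e) :
    m.nb v e = v (m.opp e).1 := if_neg h

lemma jump_opp {v : Fin m.num → F} {e : Fin m.num × Fin 3} (h : m.opp e ≠ e) :
    m.jump v (m.opp e) = -m.jump v e := by
  rw [jump, jump, nb_of_ne h, nb_of_ne (opp_ne_opp h), opp_opp]; abel

lemma nb_sub (v w : Fin m.num → F) (e : Fin m.num × Fin 3) :
    m.nb (v - w) e = m.nb v e - m.nb w e := by
  unfold nb; split_ifs <;> simp

lemma jump_sub (v w : Fin m.num → F) (e : Fin m.num × Fin 3) :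
    m.jump (v - w) e = m.jump v e - m.jump w e := by
  rw [jump, nb_sub, jump, jump]; simp; abel

lemma jump_smul [NormedSpace ℝ F] (a : ℝ) (v : Fin m.num → F) (e : Fin m.num × Fin 3) :
    m.jump (a • v) e = a • m.jump v e := by
  rw [jump, jump, nb, nb, smul_sub]; split_ifs <;> simp

lemma nb_coord (v : m.P0) (e : Fin m.num × Fin 3) (j : Fin 2) :
    m.nb (fun K => v K j) e = m.nb v e j := by
  unfold nb; split_ifs <;> simp

lemma jump_coord (v : m.P0) (e : Fin m.num × Fin 3) (j : Fin 2) :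
    m.jump (fun K => v K j) e = m.jump v e j := by
  rw [jump, nb_coord, jump]; simp

lemma jumpSq_coord_le (v : m.P0) (j : Fin 2) : m.jumpSq (fun K => v K j) ≤ m.jumpSq v := by
  refine Finset.sum_le_sum fun e _ => ?_
  rw [jump_coord]
  exact pow_le_pow_left₀ (norm_nonneg _) (PiLp.norm_apply_le _ _) 2

/-- The sum equals its own negative under the involution; on boundary edges, which are fixed, the
hypothesis itself says that f vanishes. -/
lemma sum_eq_zero_of_opp_eq_neg {f : Fin m.num × Fin 3 → ℝ} (h : ∀ e, f (m.opp e) = -f e) :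
    ∑ e, f e = 0 := by
  have h1 := sum_opp f
  simp only [h, Finset.sum_neg_distrib] at h1
  linarith

end Jumps

/-- The length of an edge. -/
def ln (e : Fin m.num × Fin 3) : ℝ := m.len e.1 e.2

/-- The unit normal of an edge. -/
def nv (e : Fin m.num × Fin 3) : Plane := m.nrm e.1 e.2

/-- The transmissivity of an edge. -/
def tr (e : Fin m.num × Fin 3) : ℝ := m.trans e.1 e.2

variable {m}

lemma ln_pos (e : Fin m.num × Fin 3) : 0 < m.ln e := m.len_pos _ _

lemma ln_opp (e : Fin m.num × Fin 3) : m.ln (m.opp e) = m.ln e := by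
  by_cases h : m.opp e = e
  · rw [h]
  · exact (isOpp_opp h).len

lemma nv_opp {e : Fin m.num × Fin 3} (h : m.opp e ≠ e) : m.nv (m.opp e) = -m.nv e :=
  (isOpp_opp h).nrm

lemma norm_nv (e : Fin m.num × Fin 3) : ‖m.nv e‖ = 1 := m.norm_nrm _ _

lemma tr_of_ne {e : Fin m.num × Fin 3} (h : m.opp e ≠ e) :
    m.tr e = m.ln e / dist (m.ctr e.1) (m.ctr (m.opp e).1) := by
  rw [tr, trans, nbr_eq_some h]; rfl

lemma tr_of_eq {e : Fin m.num × Fin 3} (h : m.opp e = e) :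
    m.tr e = m.ln e / dist (m.ctr e.1) (m.mid e.1 e.2) := by
  rw [tr, trans, nbr_eq_none h]; rfl

lemma tr_opp (e : Fin m.num × Fin 3) : m.tr (m.opp e) = m.tr e := by
  by_cases h : m.opp e = e
  · rw [h]
  · rw [tr_of_ne h, tr_of_ne (opp_ne_opp h), opp_opp, ln_opp, dist_comm]

lemma tr_nonneg (e : Fin m.num × Fin 3) : 0 ≤ m.tr e := by
  by_cases h : m.opp e = e
  · rw [tr_of_eq h]; exact div_nonneg (ln_pos e).le dist_nonneg
  · rw [tr_of_ne h]; exact div_nonneg (ln_pos e).le dist_nonneg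

lemma sum_prod_edges {M : Type*} [AddCommMonoid M] (F : Fin m.num × Fin 3 → M) :
    ∑ e, F e = ∑ K, ∑ i, F (K, i) := Fintype.sum_prod_type F

variable (m)

/-- Piecewise constant fields as a Hilbert space with the `L²` norm. -/
def emb : m.P0 →ₗ[ℝ] PiLp 2 (fun _ : Fin m.num => Plane) where
  toFun v := WithLp.toLp 2 fun K => √(m.area K) • v K
  map_add' v w := by ext K j; simp
  map_smul' a v := by ext K j; simp; ring

lemma inner_emb (v w : m.P0) :
    inner ℝ (m.emb v) (m.emb w) = ∑ K, m.area K * inner ℝ (v K) (w K) := by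
  rw [PiLp.inner_apply]
  refine Finset.sum_congr rfl fun K _ => ?_
  simp only [emb, LinearMap.coe_mk, AddHom.coe_mk]
  rw [real_inner_smul_left, real_inner_smul_right, ← mul_assoc,
    Real.mul_self_sqrt (m.area_pos K).le]

lemma norm_emb_sq (v : m.P0) : ‖m.emb v‖ ^ 2 = ∑ K, m.area K * ‖v K‖ ^ 2 := by
  rw [← real_inner_self_eq_norm_sq, inner_emb]
  simp only [real_inner_self_eq_norm_sq]

variable {m}

/-- With the exterior value 0 built into the jump, interior edges and Dirichlet boundary edges obey
one formula. -/
lemma area_smul_lap (v : m.P0) (K : Fin m.num) :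
    m.area K • m.lap v K = ∑ i, m.tr (K, i) • m.jump v (K, i) := by
  rw [lap, smul_inv_smul₀ (m.area_pos K).ne']
  refine Finset.sum_congr rfl fun i _ => ?_
  by_cases h : m.opp (K, i) = (K, i)
  · have := nbr_eq_none h
    simp only at this
    rw [this, jump, nb_of_eq h]
    simp [tr]
  · have := nbr_eq_some h
    simp only at this
    rw [this, jump, nb_of_ne h]; rfl

lemma inner_lap (v w : m.P0) :
    inner ℝ (m.emb (m.lap v)) (m.emb w) = ∑ e, m.tr e * inner ℝ (m.jump v e) (w e.1) := by
  rw [inner_emb, sum_prod_edges]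
  refine Finset.sum_congr rfl fun K _ => ?_
  rw [← real_inner_smul_left, area_smul_lap, sum_inner]
  simp only [real_inner_smul_left]

/-- Discrete integration by parts. Pairing the two sides gives equality on interior edges; boundary
edges, counted only once, leave a nonnegative surplus. -/
lemma half_sum_le_neg_inner_lap (v : m.P0) :
    1 / 2 * ∑ e, m.tr e * ‖m.jump v e‖ ^ 2 ≤ -inner ℝ (m.emb (m.lap v)) (m.emb v) := by
  rw [inner_lap]
  have h1 := sum_opp fun e => m.tr e * inner ℝ (m.jump v e) (v e.1)
  have h2 : ∑ e, m.tr e * ‖m.jump v e‖ ^ 2 ≤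
      -(∑ e, m.tr e * inner ℝ (m.jump v e) (v e.1)
        + ∑ e, m.tr (m.opp e) * inner ℝ (m.jump v (m.opp e)) (v (m.opp e).1)) := by
    rw [← Finset.sum_add_distrib, ← Finset.sum_neg_distrib]
    refine Finset.sum_le_sum fun e _ => ?_
    rw [tr_opp]
    have ht := tr_nonneg e
    by_cases h : m.opp e = e
    · rw [h, jump, nb_of_eq h]
      simp only [zero_sub, norm_neg, inner_neg_left, real_inner_self_eq_norm_sq]
      nlinarith [mul_nonneg ht (sq_nonneg ‖v e.1‖)]
    · rw [jump_opp h]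
      apply le_of_eq
      rw [inner_neg_left, ← real_inner_self_eq_norm_sq]
      have : inner ℝ (m.jump v e) (m.jump v e) =
          inner ℝ (m.jump v e) (v (m.opp e).1) - inner ℝ (m.jump v e) (v e.1) := by
        rw [← inner_sub_right]; congr 1; rw [jump, nb_of_ne h]
      rw [this]; ring
  linarith

lemma isRT0_iff (v : m.P0) : m.IsRT0 v ↔ ∀ e, inner ℝ (m.jump v e) (m.nv e) = 0 := by
  constructor
  · intro hv e
    have h1 := hv e.1 e.2
    by_cases h : m.opp e = e
    · rw [nbr_eq_none h] at h1
      simp only at h1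
      rw [jump, nb_of_eq h, zero_sub, inner_neg_left, nv, h1, neg_zero]
    · rw [nbr_eq_some h] at h1
      simp only at h1
      rw [jump, nb_of_ne h, inner_sub_left, nv, h1, sub_self]
  · intro hv K i
    have h1 := hv (K, i)
    by_cases h : m.opp (K, i) = (K, i)
    · have h2 := nbr_eq_none h
      simp only at h2
      rw [h2]
      rw [jump, nb_of_eq h, zero_sub, inner_neg_left, neg_eq_zero] at h1
      exact h1
    · have h2 := nbr_eq_some h
      simp only at h2
      rw [h2]
      rw [jump, nb_of_ne h, inner_sub_left] at h1
      simp only [nv] at h1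
      simp only
      linarith

lemma IsRT0.sub {v w : m.P0} (hv : m.IsRT0 v) (hw : m.IsRT0 w) : m.IsRT0 (v - w) := by
  rw [isRT0_iff] at *
  intro e
  rw [jump_sub, inner_sub_left, hv, hw, sub_zero]

lemma IsRT0.smul {v : m.P0} (hv : m.IsRT0 v) (a : ℝ) : m.IsRT0 (a • v) := by
  rw [isRT0_iff] at *
  intro e
  rw [jump_smul, real_inner_smul_left, hv, mul_zero]

variable (m) in
/-- The normal component of a field on an edge. -/
def nc (w : m.P0) (e : Fin m.num × Fin 3) : ℝ := inner ℝ (w e.1) (m.nv e)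

lemma abs_nc_le (w : m.P0) (e : Fin m.num × Fin 3) : |m.nc w e| ≤ ‖w e.1‖ := by
  have := abs_real_inner_le_norm (w e.1) (m.nv e)
  rwa [norm_nv, mul_one] at this

lemma nc_sub (v w : m.P0) (e : Fin m.num × Fin 3) : m.nc (v - w) e = m.nc v e - m.nc w e := by
  simp [nc, inner_sub_left]

lemma IsRT0.nc_of_eq {w : m.P0} (hw : m.IsRT0 w) {e : Fin m.num × Fin 3} (h : m.opp e = e) :
    m.nc w e = 0 := by
  have := (isRT0_iff w).1 hw e
  rw [jump, nb_of_eq h, zero_sub, inner_neg_left, neg_eq_zero] at this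
  exact this

lemma IsRT0.nc_opp {w : m.P0} (hw : m.IsRT0 w) (e : Fin m.num × Fin 3) :
    m.nc w (m.opp e) = -m.nc w e := by
  by_cases h : m.opp e = e
  · rw [h, hw.nc_of_eq h, neg_zero]
  · have := (isRT0_iff w).1 hw e
    rw [jump, nb_of_ne h, inner_sub_left] at this
    rw [nc, nv_opp h, inner_neg_right, nc]; linarith

lemma sum_ln_nc (w : m.P0) (K : Fin m.num) : ∑ i, m.ln (K, i) * m.nc w (K, i) = 0 := by
  have := m.sum_len_nrm K (w K)
  simpa [ln, nc, nv, real_inner_comm] using this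

/-- The net flux of the constant w_K out of K is zero, so the sum of |σ| (w_K·n) v_K may be
subtracted. What remains is the incoming part (w·n)⁻ times the jump, and (w·n)⁻ = (w·n - |w·n|)/2
separates a centred term from numerical diffusion. -/
lemma area_smul_conv {w : m.P0} (hw : m.IsRT0 w) (v : m.P0) (K : Fin m.num) :
    m.area K • m.conv w v K =
      ∑ i, (m.ln (K, i) / 2 * (m.nc w (K, i) - |m.nc w (K, i)|)) • m.jump v (K, i) := by
  have h0 : ∑ i, (m.ln (K, i) * m.nc w (K, i)) • v K = 0 := by
    rw [← Finset.sum_smul, sum_ln_nc, zero_smul]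
  rw [conv, smul_inv_smul₀ (m.area_pos K).ne']
  trans ∑ i, ((m.ln (K, i) * m.nc w (K, i)) • v K +
    (m.ln (K, i) / 2 * (m.nc w (K, i) - |m.nc w (K, i)|)) • m.jump v (K, i))
  · refine Finset.sum_congr rfl fun i _ => ?_
    by_cases h : m.opp (K, i) = (K, i)
    · have h2 := nbr_eq_none h
      simp only at h2
      rw [h2, hw.nc_of_eq h]
      simp
    · have h2 := nbr_eq_some h
      simp only at h2
      rw [h2, jump, nb_of_ne h]
      change m.ln (K, i) • (max (m.nc w (K, i)) 0 • v K +
        min (m.nc w (K, i)) 0 • v (m.opp (K, i)).1) = _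
      have e1 : max (m.nc w (K, i)) 0 = (m.nc w (K, i) + |m.nc w (K, i)|) / 2 := by
        rcases abs_cases (m.nc w (K, i)) with ⟨h1, h2⟩ | ⟨h1, h2⟩
        · rw [h1, max_eq_left h2]; ring
        · rw [h1, max_eq_right h2.le]; ring
      have e2 : min (m.nc w (K, i)) 0 = (m.nc w (K, i) - |m.nc w (K, i)|) / 2 := by
        rcases abs_cases (m.nc w (K, i)) with ⟨h1, h2⟩ | ⟨h1, h2⟩
        · rw [h1, min_eq_right h2]; ring
        · rw [h1, min_eq_left h2.le]; ring
      rw [e1, e2]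
      module
  · rw [Finset.sum_add_distrib, h0, zero_add]

lemma inner_conv {w : m.P0} (hw : m.IsRT0 w) (v z : m.P0) :
    inner ℝ (m.emb (m.conv w v)) (m.emb z) =
      ∑ e, m.ln e / 2 * (m.nc w e - |m.nc w e|) * inner ℝ (m.jump v e) (z e.1) := by
  rw [inner_emb, sum_prod_edges]
  refine Finset.sum_congr rfl fun K _ => ?_
  rw [← real_inner_smul_left, area_smul_conv hw, sum_inner]
  simp only [real_inner_smul_left]

/-- Weights equal on the two sides of an edge and zero on the boundary: averaging the contributions
of the two sides replaces the value of z by half its jump. -/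
lemma sum_abs_nc_inner {a : Fin m.num × Fin 3 → ℝ} (ha : ∀ e, a (m.opp e) = a e)
    (ha0 : ∀ e, m.opp e = e → a e = 0) (v z : m.P0) :
    ∑ e, a e * inner ℝ (m.jump v e) (z e.1) =
      -(1 / 2 * ∑ e, a e * inner ℝ (m.jump v e) (m.jump z e)) := by
  have h1 := sum_opp fun e => a e * inner ℝ (m.jump v e) (z e.1)
  have h2 : ∑ e, a e * inner ℝ (m.jump v e) (m.jump z e) =
      -(∑ e, a e * inner ℝ (m.jump v e) (z e.1)
        + ∑ e, a (m.opp e) * inner ℝ (m.jump v (m.opp e)) (z (m.opp e).1)) := by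
    rw [← Finset.sum_add_distrib, ← Finset.sum_neg_distrib]
    refine Finset.sum_congr rfl fun e _ => ?_
    rw [ha]
    by_cases h : m.opp e = e
    · rw [ha0 e h]; simp
    · rw [jump_opp h, inner_neg_left]
      have : inner ℝ (m.jump v e) (m.jump z e) =
          inner ℝ (m.jump v e) (z (m.opp e).1) - inner ℝ (m.jump v e) (z e.1) := by
        rw [← inner_sub_right]; congr 1; rw [jump, nb_of_ne h]
      rw [this]; ring
  linarith

lemma sum_ln_nc_mul (w : m.P0) (f : Fin m.num → ℝ) :
    ∑ e, m.ln e * m.nc w e * f e.1 = 0 := by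
  rw [sum_prod_edges]
  refine Finset.sum_eq_zero fun K _ => ?_
  simp only
  rw [← Finset.sum_mul, sum_ln_nc, zero_mul]

/-- The convection term is dissipative for discretely divergence-free transport fields. -/
lemma inner_conv_self_nonneg {w : m.P0} (hw : m.IsRT0 w) (v : m.P0) :
    0 ≤ inner ℝ (m.emb (m.conv w v)) (m.emb v) := by
  rw [inner_conv hw]
  -- The centred flux is split into a neighbour part and a self part, followed by the upwind
  -- diffusion.
  have e1 : ∑ e, m.ln e / 2 * (m.nc w e - |m.nc w e|) * inner ℝ (m.jump v e) (v e.1) =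
      1 / 2 * (∑ e, m.ln e * m.nc w e * inner ℝ (m.nb v e) (v e.1)) -
      1 / 2 * (∑ e, m.ln e * m.nc w e * inner ℝ (v e.1) (v e.1)) -
      1 / 2 * ∑ e, (m.ln e * |m.nc w e|) * inner ℝ (m.jump v e) (v e.1) := by
    rw [Finset.mul_sum, Finset.mul_sum, Finset.mul_sum, ← Finset.sum_sub_distrib,
      ← Finset.sum_sub_distrib]
    refine Finset.sum_congr rfl fun e _ => ?_
    rw [jump, inner_sub_left]; ring
  -- Normal fluxes change sign with the side while the product of the two neighbouring values does
  -- not. The self part vanishes because the flux out of each triangle is zero, so only the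
  -- numerical diffusion is left.
  have e2 : ∑ e, m.ln e * m.nc w e * inner ℝ (m.nb v e) (v e.1) = 0 := by
    apply sum_eq_zero_of_opp_eq_neg
    intro e
    by_cases h : m.opp e = e
    · rw [h, nb_of_eq h]; simp
    · rw [ln_opp, hw.nc_opp, nb_of_ne h, nb_of_ne (opp_ne_opp h), opp_opp, real_inner_comm]; ring
  have e3 := sum_ln_nc_mul w fun K => inner ℝ (v K) (v K)
  have e4 := sum_abs_nc_inner (a := fun e => m.ln e * |m.nc w e|)
    (fun e => by rw [ln_opp, hw.nc_opp, abs_neg]) (fun e h => by rw [hw.nc_of_eq h]; simp) v v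
  rw [e1, e2, e3, e4]
  have : 0 ≤ ∑ e, m.ln e * |m.nc w e| * inner ℝ (m.jump v e) (m.jump v e) :=
    Finset.sum_nonneg fun e _ =>
      mul_nonneg (mul_nonneg (ln_pos e).le (abs_nonneg _)) real_inner_self_nonneg
  linarith

/-- The difference of two convection terms, split into a centered and an upwind part. -/
lemma inner_conv_sub {w w' : m.P0} (hw : m.IsRT0 w) (hw' : m.IsRT0 w') (v z : m.P0) :
    inner ℝ (m.emb (m.conv w v - m.conv w' v)) (m.emb z) =
      1 / 2 * ∑ e, m.ln e * m.nc (w - w') e * inner ℝ (m.jump v e) (z e.1) +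
      1 / 4 * ∑ e, m.ln e * (|m.nc w e| - |m.nc w' e|) * inner ℝ (m.jump v e) (m.jump z e) := by
  have e4 := sum_abs_nc_inner (a := fun e => m.ln e * (|m.nc w e| - |m.nc w' e|))
    (fun e => by rw [ln_opp, hw.nc_opp, abs_neg, hw'.nc_opp, abs_neg])
    (fun e h => by rw [hw.nc_of_eq h, hw'.nc_of_eq h]; simp) v z
  rw [map_sub, inner_sub_left, inner_conv hw, inner_conv hw', ← Finset.sum_sub_distrib]
  trans 1 / 2 * ∑ e, m.ln e * m.nc (w - w') e * inner ℝ (m.jump v e) (z e.1) -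
    1 / 2 * ∑ e, m.ln e * (|m.nc w e| - |m.nc w' e|) * inner ℝ (m.jump v e) (z e.1)
  · rw [Finset.mul_sum, Finset.mul_sum, ← Finset.sum_sub_distrib]
    refine Finset.sum_congr rfl fun e _ => ?_
    rw [nc_sub]; ring
  · rw [e4]; ring

lemma fderiv_affine (q : Plane →ᵃ[ℝ] ℝ) (x e : Plane) : fderiv ℝ q x e = q.linear e := by
  have h : (q : Plane → ℝ) = fun x => q.linear.toContinuousLinearMap x + q 0 := by
    ext y
    have := q.linearMap_vsub y 0
    simp at this ⊢
    linarith
  rw [h, fderiv_add_const, ContinuousLinearMap.fderiv]; rfl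

lemma contDiff_affine (q : Plane →ᵃ[ℝ] ℝ) : ContDiff ℝ 1 q := by
  have h : (q : Plane → ℝ) = fun x => q.linear.toContinuousLinearMap x + q 0 := by
    ext y
    have := q.linearMap_vsub y 0
    simp at this ⊢
    linarith
  rw [h]; exact (ContinuousLinearMap.contDiff _).add contDiff_const

lemma edgeMean_affine (q : Plane →ᵃ[ℝ] ℝ) (K : Fin m.num) (i : Fin 3) :
    edgeMean q (m.pt K) i = q (m.mid K i) := by
  have h : ∀ (x y : Plane) (t : ℝ), q ((1 - t) • x + t • y) = q x + t * (q y - q x) := by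
    intro x y t
    have h1 := q.linearMap_vsub ((1 - t) • x + t • y) x
    have h2 := q.linearMap_vsub y x
    simp only [vsub_eq_sub] at h1 h2
    rw [show (1 - t) • x + t • y - x = t • (y - x) by module, map_smul, h2, smul_eq_mul] at h1
    linarith
  have h3 := h (m.pt K (i + 1)) (m.pt K (i + 2)) (1 / 2)
  rw [mid_eq, show (2 : ℝ)⁻¹ • m.pt K (i + 1) + (2 : ℝ)⁻¹ • m.pt K (i + 2) =
    (1 - 1 / 2 : ℝ) • m.pt K (i + 1) + (1 / 2 : ℝ) • m.pt K (i + 2) by norm_num, h3, edgeMean]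
  simp_rw [h]
  rw [intervalIntegral.integral_add (by simp)
    (Continuous.intervalIntegrable (by fun_prop) _ _)]
  simp

lemma inner_grad_apply (q : m.P1d) (K : Fin m.num) (x : Plane) :
    inner ℝ (m.grad q K) x = (q K).linear x := by
  have hx : x = x 0 • EuclideanSpace.single 0 1 + x 1 • EuclideanSpace.single 1 1 := by
    ext i; fin_cases i <;> simp
  conv_rhs => rw [hx, map_add, map_smul, map_smul]
  rw [plane_inner, grad]
  simp
  ring

/-- The divergence theorem for an affine function, whose mean over an edge is its midpoint value:
the nonconforming degrees of freedom are exactly what is needed. -/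
lemma area_mul_inner_grad (q : m.P1d) (K : Fin m.num) (x : Plane) :
    m.area K * inner ℝ (m.grad q K) x =
      ∑ i, m.len K i * inner ℝ (m.nrm K i) x * q K (m.mid K i) := by
  have h := m.setIntegral_cell_fderiv K (contDiff_affine (q K)) x
  simp only [fderiv_affine, edgeMean_affine] at h
  rw [← h, inner_grad_apply]
  simp [area]

/-- Discrete gradients of nonconforming functions are orthogonal to the Raviart-Thomas space. -/
lemma inner_grad_of_isRT0 {q : m.P1d} (hq : m.IsP1nc q) {v : m.P0} (hv : m.IsRT0 v) :
    inner ℝ (m.emb v) (m.emb (m.grad q)) = 0 := by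
  rw [real_inner_comm, inner_emb]
  simp only [area_mul_inner_grad]
  rw [← sum_prod_edges (m := m) fun e => m.len e.1 e.2 * inner ℝ (m.nrm e.1 e.2) (v e.1) *
    q e.1 (m.mid e.1 e.2)]
  have e1 : ∀ e : Fin m.num × Fin 3, m.len e.1 e.2 * inner ℝ (m.nrm e.1 e.2) (v e.1) *
      q e.1 (m.mid e.1 e.2) = m.ln e * m.nc v e * q e.1 (m.mid e.1 e.2) := fun e => by
    rw [nc, real_inner_comm]; rfl
  simp only [e1]
  -- Normal components of the field are opposite on the two sides, midpoint values of q agree, and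
  -- the flux is zero on the boundary.
  apply sum_eq_zero_of_opp_eq_neg
  intro e
  by_cases h : m.opp e = e
  · rw [h, hv.nc_of_eq h]; simp
  · rw [ln_opp, hv.nc_opp, (isOpp_opp h).mid, hq e.1 e.2 _ (nbr_eq_some h)]; ring

lemma grad_sub (p q : m.P1d) : m.grad (p - q) = m.grad p - m.grad q := by
  ext K i; simp [grad]

lemma midFun_mid (K : Fin m.num) (i j : Fin 3) :
    m.midFun K i (m.mid K j) = if i = j then 1 else 0 := by
  simp only [midFun, AffineMap.coe_sub, AffineMap.coe_smul, Pi.sub_apply, Pi.smul_apply,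
    AffineMap.const_apply, coord_mid, smul_eq_mul]
  split_ifs <;> norm_num

lemma div_mid (v : m.P0) (K : Fin m.num) (j : Fin 3) :
    m.div v K (m.mid K j) = m.divMid v K j := by
  have : ∀ s : Finset (Fin 3), (∑ i ∈ s, m.divMid v K i • m.midFun K i) (m.mid K j) =
      ∑ i ∈ s, m.divMid v K i * m.midFun K i (m.mid K j) := by
    intro s
    induction s using Finset.induction_on with
    | empty => simp
    | insert a s ha ih => rw [Finset.sum_insert ha, Finset.sum_insert ha, ← ih]; simp
  rw [div, this]
  simp [midFun_mid]

/-- At a midpoint the discrete divergence is the normal jump times a positive factor that does not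
depend on the field. Equations between discrete divergences are therefore equations between normal
jumps, and the kernel is the Raviart–Thomas space. -/
lemma exists_divMid (e : Fin m.num × Fin 3) :
    ∃ κ : ℝ, 0 < κ ∧ ∀ v, m.divMid v e.1 e.2 = κ * inner ℝ (m.jump v e) (m.nv e) := by
  have h1 := m.len_pos e.1 e.2
  have h2 := m.area_pos e.1
  by_cases h : m.opp e = e
  · refine ⟨3 * m.len e.1 e.2 / m.area e.1, by positivity, fun v => ?_⟩
    rw [divMid, nbr_eq_none h, jump, nb_of_eq h, zero_sub, inner_neg_left]
    simp only [nv]; ring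
  · have h3 := m.area_pos (m.opp e).1
    refine ⟨3 * m.len e.1 e.2 / (m.area e.1 + m.area (m.opp e).1), by positivity, fun v => ?_⟩
    rw [divMid, nbr_eq_some h, jump, nb_of_ne h]; rfl

/-- The corrected velocity is discretely divergence free. -/
lemma isRT0_of_correction {k : ℝ} (hk : 0 < k) {ut : m.P0} {q : m.P1d}
    (h : m.lapP q = (3 / (2 * k)) • m.div ut) :
    m.IsRT0 (ut - (2 * k / 3) • m.grad q) := by
  rw [isRT0_iff]
  intro e
  obtain ⟨κ, hκ, hd⟩ := exists_divMid e
  -- The pressure equation is read at the midpoint of each edge and the common positive factor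
  -- cancelled.
  have h1 := congrArg (fun g => g e.1 (m.mid e.1 e.2)) h
  simp only [lapP, Pi.smul_apply, AffineMap.coe_smul, div_mid, hd, smul_eq_mul] at h1
  rw [jump_sub, jump_smul, inner_sub_left, real_inner_smul_left]
  have h2 : inner ℝ (m.jump (m.grad q) e) (m.nv e) =
      3 / (2 * k) * inner ℝ (m.jump ut e) (m.nv e) := by
    have := mul_left_cancel₀ hκ.ne' (h1.trans (mul_left_comm _ _ _))
    exact this
  rw [h2]; field_simp; ring

end TriMesh

/-! ### The compensated-compactness estimate in Fourier variables -/

section Fourier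

open SchwartzMap LineDeriv

lemma integral_mul_fourier_eq {f g : Plane → ℂ} (hf : Integrable f) (hg : Integrable g) :
    ∫ x, 𝓕 f x * g x = ∫ x, f x * 𝓕 g x := by
  have := VectorFourier.integral_fourierIntegral_smul_eq_flip (L := innerₗ Plane)
    Real.continuous_fourierChar continuous_inner hf hg
  rw [flip_innerₗ] at this
  exact this

/-- The Fourier transform is an `L²` contraction on `L¹ ∩ L²`. -/
lemma lintegral_fourier_sq_le {f : Plane → ℂ} (hf : Integrable f) (hf2 : MemLp f 2) :
    ∫⁻ ξ, ‖𝓕 f ξ‖ₑ ^ 2 ≤ ∫⁻ x, ‖f x‖ₑ ^ 2 := by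
  set F : Lp ℂ 2 (volume : Measure Plane) := 𝓕 (hf2.toLp f) with hF
  have hcont : Continuous (𝓕 f) := VectorFourier.fourierIntegral_continuous
    Real.continuous_fourierChar (by exact continuous_inner) hf
  -- The L² Fourier transform, defined by extension, agrees with the Fourier integral: both are
  -- tested against smooth compactly supported functions, where duality moves the transform onto the
  -- test function.
  have hae : ∀ᵐ x, F x = 𝓕 f x := by
    refine ae_eq_of_integral_contDiff_smul_eq
      ((Lp.memLp F).locallyIntegrable (by norm_num)) hcont.locallyIntegrable ?_
    intro g hg hgs
    have hgc : HasCompactSupport (fun x => (g x : ℂ)) := hgs.comp_left (g := fun r : ℝ => (r : ℂ)) rfl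
    have hgd : ContDiff ℝ ∞ (fun x => (g x : ℂ)) := Complex.ofRealCLM.contDiff.comp hg
    set G : 𝓢(Plane, ℂ) := hgc.toSchwartzMap hgd with hG
    have hGx : ∀ x, G x = (g x : ℂ) := fun x => rfl
    have h1 := congrArg (fun T => T G) (Lp.fourier_toTemperedDistribution_eq (hf2.toLp f))
    simp only [TemperedDistribution.fourier_apply, Lp.toTemperedDistribution_apply, smul_eq_mul,
      hGx, ← hF] at h1
    simp only [Complex.real_smul]
    rw [← h1]
    have h2 : ∫ x, 𝓕 f x * G x = ∫ x, f x * 𝓕 (G : Plane → ℂ) x :=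
      integral_mul_fourier_eq hf G.integrable
    simp only [hGx] at h2
    simp_rw [mul_comm ((g _ : ℂ))]
    rw [h2]
    refine integral_congr_ae ?_
    filter_upwards [hf2.coeFn_toLp] with x hx
    rw [hx, mul_comm, SchwartzMap.fourier_coe]
  have h1 : ∫⁻ ξ, ‖𝓕 f ξ‖ₑ ^ 2 = ∫⁻ ξ, ‖F ξ‖ₑ ^ 2 :=
    lintegral_congr_ae (hae.mono fun x hx => by simp only [hx])
  have h2 : ∫⁻ ξ, ‖f ξ‖ₑ ^ 2 = ∫⁻ ξ, ‖hf2.toLp f ξ‖ₑ ^ 2 :=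
    lintegral_congr_ae (hf2.coeFn_toLp.mono fun x hx => by simp only [hx])
  have h3 : ∀ u : Lp ℂ 2 (volume : Measure Plane), ∫⁻ ξ, ‖u ξ‖ₑ ^ 2 = ‖u‖ₑ ^ 2 := by
    intro u
    rw [Lp.enorm_def, eLpNorm_eq_lintegral_rpow_enorm_toReal (by norm_num) (by norm_num)]
    simp only [ENNReal.toReal_ofNat, ENNReal.rpow_ofNat]
    rw [← ENNReal.rpow_natCast, ← ENNReal.rpow_mul]
    norm_num
  rw [h1, h2, h3, h3]
  have : ‖F‖ₑ = ‖hf2.toLp f‖ₑ := by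
    rw [← ofReal_norm, ← ofReal_norm, hF, Lp.norm_fourier_eq]
  rw [this]

/-- Cauchy–Schwarz on pairs of frequencies, with the region attached to the factor F. Integrating
out ζ over the disc |ζ| ≤ |η| yields π|η|², so in two dimensions the price is exactly one power of
|η| on F; the other factor is handled by translation invariance. -/
lemma lintegral_region_le {F G H : Plane → ℝ≥0∞} (hF : Measurable F) (hG : Measurable G)
    (hH : Measurable H) :
    ∫⁻ p : Plane × Plane, {p : Plane × Plane | ‖p.2‖ ≤ ‖p.1‖}.indicator
        (fun p => F p.1 * (G p.2 * H (p.1 + p.2))) p ≤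
      (ENNReal.ofReal Real.pi * ∫⁻ η, (‖η‖ₑ * F η) ^ 2) ^ (1 / 2 : ℝ) *
        ((∫⁻ ζ, G ζ ^ 2) * ∫⁻ ξ, H ξ ^ 2) ^ (1 / 2 : ℝ) := by
  set R : Set (Plane × Plane) := {p | ‖p.2‖ ≤ ‖p.1‖} with hR
  have hRm : MeasurableSet R := measurableSet_le (by fun_prop) (by fun_prop)
  have h1 := ENNReal.lintegral_mul_le_Lp_mul_Lq (volume : Measure (Plane × Plane))
    Real.HolderConjugate.two_two
    (f := R.indicator fun p => F p.1) (g := fun p => G p.2 * H (p.1 + p.2))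
    ((Measurable.indicator (by fun_prop) hRm).aemeasurable) (by fun_prop)
  refine (le_of_eq ?_).trans (h1.trans (mul_le_mul' ?_ ?_))
  · refine lintegral_congr fun p => ?_
    simp only [Pi.mul_apply, indicator_apply]
    split_ifs <;> simp
  · refine ENNReal.rpow_le_rpow ?_ (by norm_num)
    rw [Measure.volume_eq_prod, lintegral_prod _
      (((Measurable.indicator (by fun_prop) hRm).pow_const _).aemeasurable),
      ← lintegral_const_mul _ (by fun_prop)]
    refine lintegral_mono fun η => ?_
    have e : ∀ ζ, R.indicator (fun p : Plane × Plane => F p.1) (η, ζ) ^ (2 : ℝ) =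
        (Metric.closedBall (0 : Plane) ‖η‖).indicator (fun _ => F η ^ 2) ζ := by
      intro ζ
      by_cases h : ‖ζ‖ ≤ ‖η‖
      · rw [indicator_of_mem (show (η, ζ) ∈ R from h), indicator_of_mem (by simpa using h)]
        simp
      · rw [indicator_of_notMem (show (η, ζ) ∉ R from h), indicator_of_notMem (by simpa using h)]
        simp
    simp only [e]
    rw [lintegral_indicator_const Metric.isClosed_closedBall.measurableSet,
      EuclideanSpace.volume_closedBall_fin_two, ofReal_norm]
    apply le_of_eq; ring
  · refine ENNReal.rpow_le_rpow ?_ (by norm_num)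
    rw [Measure.volume_eq_prod, lintegral_prod_symm _ (by fun_prop)]
    simp only [ENNReal.rpow_ofNat, mul_pow]
    rw [← lintegral_mul_const _ (by fun_prop)]
    refine lintegral_mono fun ζ => ?_
    rw [lintegral_const_mul _ (by fun_prop),
      lintegral_add_right_eq_self (fun η => H η ^ 2) ζ]

lemma lintegral_region_le' {F G H : Plane → ℝ≥0∞} (hF : Measurable F) (hG : Measurable G)
    (hH : Measurable H) :
    ∫⁻ p : Plane × Plane, {p : Plane × Plane | ‖p.1‖ ≤ ‖p.2‖}.indicator
        (fun p => F p.1 * (G p.2 * H (p.1 + p.2))) p ≤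
      (ENNReal.ofReal Real.pi * ∫⁻ η, (‖η‖ₑ * G η) ^ 2) ^ (1 / 2 : ℝ) *
        ((∫⁻ ζ, F ζ ^ 2) * ∫⁻ ξ, H ξ ^ 2) ^ (1 / 2 : ℝ) := by
  refine le_trans (le_of_eq ?_) (lintegral_region_le hG hF hH)
  rw [Measure.volume_eq_prod, ← lintegral_prod_swap]
  refine lintegral_congr fun p => ?_
  simp only [indicator_apply, Prod.fst_swap, Prod.snd_swap, mem_ofPred_eq]
  congr 1
  rw [add_comm p.2 p.1]; ring

lemma enorm_sum_mul_le (η : Plane) (E : Fin 2 → ℂ) :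
    ‖∑ i, (η i : ℂ) * E i‖ₑ ≤ ‖η‖ₑ * (‖E 0‖ₑ + ‖E 1‖ₑ) := by
  have h : ∀ i, ‖(η i : ℂ)‖ₑ ≤ ‖η‖ₑ := by
    intro i
    rw [← ofReal_norm, ← ofReal_norm, Complex.norm_real]
    exact ENNReal.ofReal_le_ofReal (PiLp.norm_apply_le η i)
  rw [Fin.sum_univ_two, mul_add]
  refine (enorm_add_le _ _).trans (add_le_add ?_ ?_) <;> rw [enorm_mul] <;>
    exact mul_le_mul_left (h _) _

/-- The multiplication formula applied to D times the character of frequency -ζ: modulation of D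
translates its transform. -/
lemma fourier_mul_fourier {D α : Plane → ℂ} (hD : Integrable D) (hα : Integrable α) (ζ : Plane) :
    𝓕 (fun x => D x * 𝓕 α x) ζ = ∫ η, 𝓕 D (η + ζ) * α η := by
  have hD' : Integrable (fun x => Real.fourierChar (-inner ℝ x ζ) • D x) :=
    (Real.fourierIntegral_convergent_iff ζ).2 hD
  have h := integral_mul_fourier_eq hD' hα
  have e : ∀ η, 𝓕 (fun x => Real.fourierChar (-inner ℝ x ζ) • D x) η = 𝓕 D (η + ζ) := by
    intro η
    rw [Real.fourier_eq, Real.fourier_eq]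
    refine integral_congr_ae (ae_of_all _ fun x => ?_)
    simp only [inner_add_right]
    rw [smul_smul, neg_add, AddChar.map_add_eq_mul]
  simp only [e] at h
  rw [h, Real.fourier_eq]
  simp only [smul_mul_assoc]

lemma fourierInv_lineDeriv_apply (a : 𝓢(Plane, ℂ)) (i : Fin 2) (η : Plane) :
    𝓕⁻ (∂_{EuclideanSpace.single i (1 : ℝ)} a) η = -(2 * Real.pi * Complex.I) * (η i * 𝓕⁻ a η) := by
  rw [SchwartzMap.fourierInv_lineDerivOp_eq]
  have : (inner ℝ · (EuclideanSpace.single i (1 : ℝ)) : Plane → ℝ).HasTemperateGrowth := by fun_prop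
  rw [smul_apply, SchwartzMap.smulLeftCLM_apply_apply this]
  simp [EuclideanSpace.inner_single_right]

/-- Plancherel for each partial derivative; the factor (2π)² ≥ 1 produced by differentiation is
discarded. -/
lemma lintegral_mul_fourierInv_sq (a : 𝓢(Plane, ℂ)) :
    ∫⁻ η, (‖η‖ₑ * ‖𝓕⁻ a η‖ₑ) ^ 2 ≤
      ∑ i, ∫⁻ x, ‖fderiv ℝ a x (EuclideanSpace.single i 1)‖ₑ ^ 2 := by
  have h1 : ∀ i, ∫⁻ x, ‖fderiv ℝ a x (EuclideanSpace.single i 1)‖ₑ ^ 2 =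
      ∫⁻ η, ‖𝓕⁻ (∂_{EuclideanSpace.single i (1 : ℝ)} a) η‖ₑ ^ 2 := by
    intro i
    set d : 𝓢(Plane, ℂ) := ∂_{EuclideanSpace.single i (1 : ℝ)} a
    have h2 : ∀ f : 𝓢(Plane, ℂ), ∫⁻ x, ‖f x‖ₑ ^ 2 = ENNReal.ofReal (∫ x, ‖f x‖ ^ 2) := by
      intro f
      rw [ofReal_integral_eq_lintegral_ofReal]
      · refine lintegral_congr fun x => ?_
        rw [← ofReal_norm, ENNReal.ofReal_pow (norm_nonneg _)]
      · exact (f.memLp 2).integrable_norm_pow two_ne_zero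
      · exact ae_of_all _ fun x => by positivity
    have h3 := SchwartzMap.integral_norm_sq_fourier (𝓕⁻ d)
    rw [FourierTransform.fourier_fourierInv_eq] at h3
    rw [h2 (𝓕⁻ d), ← h3, ← h2]
    rfl
  simp only [h1]
  rw [← lintegral_finsetSum _ (fun i _ => by fun_prop)]
  refine lintegral_mono fun η => ?_
  simp only [fourierInv_lineDeriv_apply]
  have e : ∀ i : Fin 2, ‖-(2 * Real.pi * Complex.I) * (η i * 𝓕⁻ a η)‖ₑ ^ 2 =
      ENNReal.ofReal ((2 * Real.pi) ^ 2 * (η i ^ 2 * ‖𝓕⁻ a η‖ ^ 2)) := by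
    intro i
    rw [← ofReal_norm, ← ENNReal.ofReal_pow (norm_nonneg _)]
    congr 1
    simp [mul_pow]
  simp only [e]
  rw [Fin.sum_univ_two, ← ENNReal.ofReal_add (by positivity) (by positivity), ← ofReal_norm,
    ← ofReal_norm, ← ENNReal.ofReal_mul (norm_nonneg _), ← ENNReal.ofReal_pow (by positivity)]
  apply ENNReal.ofReal_le_ofReal
  have hη : ‖η‖ ^ 2 = η 0 ^ 2 + η 1 ^ 2 := by
    rw [EuclideanSpace.real_norm_sq_eq, Fin.sum_univ_two]
  have hpi : 1 ≤ (2 * Real.pi) ^ 2 := by nlinarith [Real.pi_gt_three]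
  have : 0 ≤ (η 0 ^ 2 + η 1 ^ 2) * ‖𝓕⁻ a η‖ ^ 2 := by positivity
  rw [mul_pow, hη]
  nlinarith

/-- Compensated compactness: the trilinear convection form is bounded in two dimensions by the
`L²` norm of a divergence-free field and the `L²` norms of two gradients. -/
theorem enorm_integral_convection_le {D : Fin 2 → Plane → ℂ} (hD : ∀ i, Integrable (D i))
    (hD2 : ∀ i, MemLp (D i) 2) (hdiv : ∀ ξ : Plane, ∑ i, (ξ i : ℂ) * 𝓕 (D i) ξ = 0)
    (a b : 𝓢(Plane, ℂ)) :
    ‖∫ x, (∑ i, D i x * fderiv ℝ a x (EuclideanSpace.single i 1)) * b x‖ₑ ≤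
      ENNReal.ofReal (2 * Real.pi) * (2 *
      ((ENNReal.ofReal Real.pi *
          ∑ i, ∫⁻ x, ‖fderiv ℝ a x (EuclideanSpace.single i 1)‖ₑ ^ 2) ^ (1 / 2 : ℝ) *
        ((∑ i, ∫⁻ x, ‖fderiv ℝ b x (EuclideanSpace.single i 1)‖ₑ ^ 2) *
          (2 * ∑ i, ∫⁻ x, ‖D i x‖ₑ ^ 2)) ^ (1 / 2 : ℝ))) := by
  set α : 𝓢(Plane, ℂ) := 𝓕⁻ a with hα
  set β : 𝓢(Plane, ℂ) := 𝓕⁻ b with hβ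
  set αi : Fin 2 → 𝓢(Plane, ℂ) := fun i => 𝓕⁻ (∂_{EuclideanSpace.single i (1 : ℝ)} a) with hαi
  have hαix : ∀ i η, αi i η = -(2 * Real.pi * Complex.I) * (η i * α η) :=
    fun i η => fourierInv_lineDeriv_apply a i η
  have hda : ∀ i x, fderiv ℝ a x (EuclideanSpace.single i 1) = 𝓕 (αi i : Plane → ℂ) x := by
    intro i x
    rw [← SchwartzMap.fourier_coe, hαi]
    simp only [FourierTransform.fourier_fourierInv_eq]
    rfl
  have hb : ∀ x, b x = 𝓕 (β : Plane → ℂ) x := by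
    intro x
    rw [← SchwartzMap.fourier_coe, hβ, FourierTransform.fourier_fourierInv_eq]
  have hprod : ∀ i, Integrable (fun x => D i x * 𝓕 (αi i : Plane → ℂ) x) := by
    intro i
    refine (hD i).mul_bdd (c := ∫ v, ‖αi i v‖) ?_ (ae_of_all _ fun x => ?_)
    · rw [← SchwartzMap.fourier_coe]; exact (SchwartzMap.continuous _).aestronglyMeasurable
    · exact VectorFourier.norm_fourierIntegral_le_integral_norm _ _ _ _ _
  set E : Fin 2 → Plane → ℂ := fun i => 𝓕 (D i) with hE
  have hEc : ∀ i, Continuous (E i) := fun i => VectorFourier.fourierIntegral_continuous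
    Real.continuous_fourierChar (by exact continuous_inner) (hD i)
  have hEb : ∀ i ξ, ‖E i ξ‖ ≤ ∫ v, ‖D i v‖ := fun i ξ =>
    VectorFourier.norm_fourierIntegral_le_integral_norm _ _ _ _ _
  have hEint : ∀ i ζ, Integrable (fun η => E i (η + ζ) * αi i η) := fun i ζ =>
    (αi i).integrable.bdd_mul
      ((hEc i).comp (continuous_id.add continuous_const)).aestronglyMeasurable
      (ae_of_all _ fun η => hEb i _)
  have hT : ∫ x, (∑ i, D i x * fderiv ℝ a x (EuclideanSpace.single i 1)) * b x =
      ∫ ζ, (∑ i, ∫ η, E i (η + ζ) * αi i η) * β ζ := by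
    simp only [hda, hb]
    have h1 : Integrable (fun x => ∑ i, D i x * 𝓕 (αi i : Plane → ℂ) x) :=
      integrable_finsetSum _ fun i _ => hprod i
    rw [← integral_mul_fourier_eq h1 β.integrable]
    refine integral_congr_ae (ae_of_all _ fun ζ => ?_)
    simp only
    congr 1
    rw [Real.fourier_eq]
    simp only [Finset.smul_sum]
    rw [integral_finsetSum _ fun i _ => (Real.fourierIntegral_convergent_iff ζ).2 (hprod i)]
    refine Finset.sum_congr rfl fun i _ => ?_
    rw [← fourier_mul_fourier (hD i) (αi i).integrable, Real.fourier_eq]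
  set H : Plane → ℝ≥0∞ := fun ξ => ‖E 0 ξ‖ₑ + ‖E 1 ξ‖ₑ with hH
  have hHm : Measurable H := by
    have h0 := (hEc 0).measurable
    have h1 := (hEc 1).measurable
    fun_prop
  -- Pointwise, the factor η·E(η+ζ) is bounded by the smaller of |η| and |ζ| times the size of E.
  -- This places the weight on the low frequency, as the region estimates require.
  have hpt : ∀ ζ η : Plane, ‖α η‖ₑ * ‖β ζ‖ₑ * ‖∑ i, (η i : ℂ) * E i (η + ζ)‖ₑ ≤
      {p : Plane × Plane | ‖p.2‖ ≤ ‖p.1‖}.indicator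
        (fun p => ‖α p.1‖ₑ * ((‖p.2‖ₑ * ‖β p.2‖ₑ) * H (p.1 + p.2))) (η, ζ) +
      {p : Plane × Plane | ‖p.1‖ ≤ ‖p.2‖}.indicator
        (fun p => (‖p.1‖ₑ * ‖α p.1‖ₑ) * (‖β p.2‖ₑ * H (p.1 + p.2))) (η, ζ) := by
    intro ζ η
    rcases le_total ‖ζ‖ ‖η‖ with h | h
    · refine le_trans ?_ le_self_add
      rw [indicator_of_mem (show (η, ζ) ∈ {p : Plane × Plane | ‖p.2‖ ≤ ‖p.1‖} from h)]
      -- Zero divergence means (η+ζ)·E(η+ζ) = 0, so η may be traded for -ζ.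
      have e : ∑ i, (η i : ℂ) * E i (η + ζ) = -∑ i, (ζ i : ℂ) * E i (η + ζ) := by
        have := hdiv (η + ζ)
        rw [eq_neg_iff_add_eq_zero, ← this, ← Finset.sum_add_distrib]
        refine Finset.sum_congr rfl fun i _ => ?_
        simp [hE]; ring
      rw [e, enorm_neg]
      calc _ ≤ ‖α η‖ₑ * ‖β ζ‖ₑ * (‖ζ‖ₑ * H (η + ζ)) := by
            gcongr; exact enorm_sum_mul_le ζ fun i => E i (η + ζ)
        _ = _ := by ring
    · refine le_trans ?_ le_add_self
      rw [indicator_of_mem (show (η, ζ) ∈ {p : Plane × Plane | ‖p.1‖ ≤ ‖p.2‖} from h)]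
      calc _ ≤ ‖α η‖ₑ * ‖β ζ‖ₑ * (‖η‖ₑ * H (η + ζ)) := by
            gcongr; exact enorm_sum_mul_le η fun i => E i (η + ζ)
        _ = _ := by ring
  have hinner : ∀ ζ, ‖(∑ i, ∫ η, E i (η + ζ) * αi i η) * β ζ‖ₑ ≤
      ENNReal.ofReal (2 * Real.pi) *
        ∫⁻ η, ‖α η‖ₑ * ‖β ζ‖ₑ * ‖∑ i, (η i : ℂ) * E i (η + ζ)‖ₑ := by
    intro ζ
    rw [← integral_finsetSum _ fun i _ => hEint i ζ, enorm_mul]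
    have e : ∀ η, ∑ i, E i (η + ζ) * αi i η =
        -(2 * Real.pi * Complex.I) * (α η * ∑ i, (η i : ℂ) * E i (η + ζ)) := by
      intro η
      simp only [hαix, Finset.mul_sum]
      exact Finset.sum_congr rfl fun i _ => by ring
    have e2 : ‖(-(2 * Real.pi * Complex.I) : ℂ)‖ₑ = ENNReal.ofReal (2 * Real.pi) := by
      rw [← ofReal_norm]; congr 1; simp [Real.pi_pos.le]
    calc _ ≤ (∫⁻ η, ‖∑ i, E i (η + ζ) * αi i η‖ₑ) * ‖β ζ‖ₑ := by
          gcongr; exact enorm_integral_le_lintegral_enorm _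
      _ = (ENNReal.ofReal (2 * Real.pi) *
            ∫⁻ η, ‖α η‖ₑ * ‖∑ i, (η i : ℂ) * E i (η + ζ)‖ₑ) * ‖β ζ‖ₑ := by
          rw [← lintegral_const_mul' _ _ ENNReal.ofReal_ne_top]
          congr 1
          refine lintegral_congr fun η => ?_
          rw [e, enorm_mul, e2, enorm_mul]
      _ = _ := by
          rw [mul_assoc, ← lintegral_mul_const' _ _ (by simp)]
          congr 1
          exact lintegral_congr fun η => by ring
  rw [hT]
  have hR1 : MeasurableSet {p : Plane × Plane | ‖p.2‖ ≤ ‖p.1‖} :=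
    measurableSet_le (by fun_prop) (by fun_prop)
  have hR2 : MeasurableSet {p : Plane × Plane | ‖p.1‖ ≤ ‖p.2‖} :=
    measurableSet_le (by fun_prop) (by fun_prop)
  have hαm : Measurable α := α.continuous.measurable
  have hβm : Measurable β := β.continuous.measurable
  have hm1 : Measurable ({p : Plane × Plane | ‖p.2‖ ≤ ‖p.1‖}.indicator
      (fun p : Plane × Plane => ‖α p.1‖ₑ * ((‖p.2‖ₑ * ‖β p.2‖ₑ) * H (p.1 + p.2)))) :=
    Measurable.indicator (by fun_prop) hR1
  have hm2 : Measurable ({p : Plane × Plane | ‖p.1‖ ≤ ‖p.2‖}.indicator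
      (fun p : Plane × Plane => (‖p.1‖ₑ * ‖α p.1‖ₑ) * (‖β p.2‖ₑ * H (p.1 + p.2)))) :=
    Measurable.indicator (by fun_prop) hR2
  have hHsq : ∫⁻ ξ, H ξ ^ 2 ≤ 2 * ∑ i, ∫⁻ x, ‖D i x‖ₑ ^ 2 := by
    calc ∫⁻ ξ, H ξ ^ 2 ≤ ∫⁻ ξ, 2 * (‖E 0 ξ‖ₑ ^ 2 + ‖E 1 ξ‖ₑ ^ 2) := by
          refine lintegral_mono fun ξ => ?_
          have := ENNReal.rpow_add_le_mul_rpow_add_rpow ‖E 0 ξ‖ₑ ‖E 1 ξ‖ₑ (p := 2) (by norm_num)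
          rw [show (2 : ℝ) - 1 = 1 by norm_num, ENNReal.rpow_one] at this
          simpa using this
      _ ≤ _ := by
          rw [lintegral_const_mul' _ _ (by norm_num), lintegral_add_left
            ((hEc 0).measurable.enorm.pow_const _), Fin.sum_univ_two]
          exact mul_le_mul_right (add_le_add (lintegral_fourier_sq_le (hD 0) (hD2 0))
            (lintegral_fourier_sq_le (hD 1) (hD2 1))) 2
  calc _ ≤ ∫⁻ ζ, ‖(∑ i, ∫ η, E i (η + ζ) * αi i η) * β ζ‖ₑ := enorm_integral_le_lintegral_enorm _
    _ ≤ ∫⁻ ζ, ENNReal.ofReal (2 * Real.pi) *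
        ∫⁻ η, ‖α η‖ₑ * ‖β ζ‖ₑ * ‖∑ i, (η i : ℂ) * E i (η + ζ)‖ₑ := lintegral_mono hinner
    _ = ENNReal.ofReal (2 * Real.pi) *
        ∫⁻ ζ, ∫⁻ η, ‖α η‖ₑ * ‖β ζ‖ₑ * ‖∑ i, (η i : ℂ) * E i (η + ζ)‖ₑ :=
      lintegral_const_mul' _ _ ENNReal.ofReal_ne_top
    _ ≤ ENNReal.ofReal (2 * Real.pi) * (
        (∫⁻ p : Plane × Plane, {p : Plane × Plane | ‖p.2‖ ≤ ‖p.1‖}.indicator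
          (fun p => ‖α p.1‖ₑ * ((‖p.2‖ₑ * ‖β p.2‖ₑ) * H (p.1 + p.2))) p) +
        ∫⁻ p : Plane × Plane, {p : Plane × Plane | ‖p.1‖ ≤ ‖p.2‖}.indicator
          (fun p => (‖p.1‖ₑ * ‖α p.1‖ₑ) * (‖β p.2‖ₑ * H (p.1 + p.2))) p) := by
      gcongr
      rw [← lintegral_add_left hm1]
      have h3 := lintegral_prod_symm (μ := (volume : Measure Plane))
        (ν := (volume : Measure Plane)) _ (hm1.add hm2).aemeasurable
      simp only [Pi.add_apply] at h3
      rw [Measure.volume_eq_prod, h3]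
      exact lintegral_mono fun ζ => lintegral_mono fun η => hpt ζ η
    _ ≤ _ := by
      gcongr ENNReal.ofReal (2 * Real.pi) * ?_
      rw [two_mul]
      refine add_le_add ?_ ?_
      · refine (lintegral_region_le (F := fun η => ‖α η‖ₑ) (G := fun ζ => ‖ζ‖ₑ * ‖β ζ‖ₑ)
          (by fun_prop) (by fun_prop) hHm).trans ?_
        gcongr
        · exact lintegral_mul_fourierInv_sq a
        · exact lintegral_mul_fourierInv_sq b
      · refine (lintegral_region_le' (F := fun η => ‖η‖ₑ * ‖α η‖ₑ) (G := fun ζ => ‖β ζ‖ₑ)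
          (by fun_prop) (by fun_prop) hHm).trans ?_
        -- The second region has the roles of a and b exchanged; regrouping the factors brings it to
        -- the bound of the first.
        have hr : ∀ x y z w : ℝ≥0∞, (x * y) ^ (1 / 2 : ℝ) * (z * w) ^ (1 / 2 : ℝ) =
            (x * z) ^ (1 / 2 : ℝ) * (y * w) ^ (1 / 2 : ℝ) := by
          intro x y z w
          simp only [ENNReal.mul_rpow_of_nonneg _ _ (by norm_num : (0 : ℝ) ≤ 1 / 2)]
          ring
        rw [hr]
        gcongr
        · exact lintegral_mul_fourierInv_sq a
        · exact lintegral_mul_fourierInv_sq b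

end Fourier

/-! ### Regular meshes and mollification of piecewise constant functions -/

namespace TriMesh

variable {Ω : Set Plane} {m : TriMesh Ω} {c : ℝ}

section Regular

lemma IsRegular.sq_mul_h_le (hm : m.IsRegular c) (hc : 0 < c) (K : Fin m.num) (i : Fin 3) :
    c ^ 2 * m.h ≤ Metric.infDist (m.ctr K) (m.edge K i) := by
  have h1 := (hm K i).1
  have h2 := (hm K i).2
  nlinarith

lemma IsRegular.ball_subset (hm : m.IsRegular c) (hc : 0 < c) (K : Fin m.num) :
    Metric.ball (m.ctr K) (c ^ 2 * m.h) ⊆ interior (m.cell K) :=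
  m.ball_subset_interior_cell K (hm.sq_mul_h_le hc K)

lemma dist_ctr_le_h {K : Fin m.num} {x : Plane} (hx : x ∈ m.cell K) : dist x (m.ctr K) ≤ m.h :=
  m.cell_subset_closedBall K hx

/-- The distance c² h that separates circumcentre and edge cannot exceed h, since each triangle lies
within h of its circumcentre. -/
lemma IsRegular.sq_le_one (hm : m.IsRegular c) (hc : 0 < c) (K : Fin m.num) : c ^ 2 ≤ 1 := by
  have h1 := hm.sq_mul_h_le hc K 0
  have h2 := Metric.infDist_le_dist_of_mem (x := m.ctr K) (m.mid_mem_edge K 0)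
  have h3 := dist_ctr_le_h (m.edge_subset_cell K 0 (m.mid_mem_edge K 0))
  rw [dist_comm] at h3
  have := m.h_pos K
  by_contra h
  nlinarith

lemma volume_real_ball (x : Plane) {r : ℝ} (hr : 0 ≤ r) :
    volume.real (Metric.ball x r) = Real.pi * r ^ 2 := by
  rw [measureReal_def, EuclideanSpace.volume_ball_fin_two, ENNReal.toReal_mul, ENNReal.toReal_pow,
    ENNReal.toReal_ofReal hr, ENNReal.toReal_ofReal Real.pi_pos.le, mul_comm]

lemma volume_real_closedBall (x : Plane) {r : ℝ} (hr : 0 ≤ r) :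
    volume.real (Metric.closedBall x r) = Real.pi * r ^ 2 := by
  rw [measureReal_def, EuclideanSpace.volume_closedBall_fin_two, ENNReal.toReal_mul,
    ENNReal.toReal_pow, ENNReal.toReal_ofReal hr, ENNReal.toReal_ofReal Real.pi_pos.le, mul_comm]

lemma volume_cell_ne_top (K : Fin m.num) : volume (m.cell K) ≠ ⊤ :=
  (m.isCompact_cell K).measure_lt_top.ne

lemma IsRegular.le_area (hm : m.IsRegular c) (hc : 0 < c) (K : Fin m.num) :
    Real.pi * (c ^ 2 * m.h) ^ 2 ≤ m.area K := by
  have := m.h_pos K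
  rw [← volume_real_ball (m.ctr K) (by positivity)]
  exact measureReal_mono ((hm.ball_subset hc K).trans interior_subset) (volume_cell_ne_top K)

-- Packing: the disjoint discs of radius c² h about the circumcentres concerned all fit into the
-- disc of radius 3h about x, so comparing areas gives the number 9/c⁴.
open Classical in
lemma IsRegular.card_near_le (hm : m.IsRegular c) (hc : 0 < c) (x : Plane) :
    ((Finset.univ.filter fun K => x ∈ Metric.closedBall (m.ctr K) (2 * m.h)).card : ℝ) ≤
      9 / c ^ 4 := by
  rcases (Finset.univ.filter fun K => x ∈ Metric.closedBall (m.ctr K) (2 * m.h)).eq_empty_or_nonempty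
    with h0 | ⟨K₀, hK₀⟩
  · rw [h0]; simp; positivity
  have hh := m.h_pos K₀
  set s := Finset.univ.filter fun K => x ∈ Metric.closedBall (m.ctr K) (2 * m.h)
  have hr : 0 < c ^ 2 * m.h := by positivity
  have hsub : (⋃ K ∈ s, Metric.ball (m.ctr K) (c ^ 2 * m.h)) ⊆ Metric.closedBall x (3 * m.h) := by
    intro y hy
    simp only [mem_iUnion] at hy
    obtain ⟨K, hK, hy⟩ := hy
    have h1 : dist x (m.ctr K) ≤ 2 * m.h := (Finset.mem_filter.1 hK).2
    have h2 := dist_ctr_le_h (interior_subset (hm.ball_subset hc K hy))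
    rw [Metric.mem_closedBall]
    linarith [dist_triangle_right y x (m.ctr K)]
  have hdisj : (s : Set (Fin m.num)).PairwiseDisjoint
      fun K => Metric.ball (m.ctr K) (c ^ 2 * m.h) := by
    intro K _ L _ hKL
    refine Set.disjoint_left.2 fun y hK hL => hKL ?_
    exact m.interior_cell_disjoint (hm.ball_subset hc K hK) (hm.ball_subset hc L hL)
  have h1 := measure_mono (μ := volume) hsub
  rw [measure_biUnion_finset hdisj fun _ _ => Metric.isOpen_ball.measurableSet] at h1
  simp only [EuclideanSpace.volume_ball_fin_two, EuclideanSpace.volume_closedBall_fin_two,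
    Finset.sum_const, nsmul_eq_mul] at h1
  have h2 := ENNReal.toReal_mono (by finiteness) h1
  simp only [ENNReal.toReal_mul, ENNReal.toReal_natCast, ENNReal.toReal_pow,
    ENNReal.toReal_ofReal hr.le, ENNReal.toReal_ofReal Real.pi_pos.le,
    ENNReal.toReal_ofReal (by positivity : (0 : ℝ) ≤ 3 * m.h)] at h2
  rw [← mul_assoc] at h2
  have h3 := le_of_mul_le_mul_right h2 Real.pi_pos
  rw [le_div_iff₀ (by positivity)]
  have h4 : (s.card * c ^ 4 : ℝ) * m.h ^ 2 ≤ 9 * m.h ^ 2 := by nlinarith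
  exact le_of_mul_le_mul_right h4 (by positivity)

end Regular

section Mollify

variable (m) in
/-- The extension by zero of a piecewise constant scalar function. -/
def ext0 (v : Fin m.num → ℝ) : Plane → ℝ := m.glue fun K _ => v K

lemma ext0_apply (v : Fin m.num → ℝ) (x : Plane) :
    m.ext0 v x = ∑ K, (m.cell K).indicator (fun _ => v K) x := rfl

lemma integrable_indicator_cell (K : Fin m.num) (a : ℝ) :
    Integrable ((m.cell K).indicator fun _ : Plane => a) :=
  (integrable_indicator_iff (m.measurableSet_cell K)).2
    (integrableOn_const (volume_cell_ne_top K))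

lemma integrable_ext0 (v : Fin m.num → ℝ) : Integrable (m.ext0 v) := by
  have : m.ext0 v = fun x => ∑ K, (m.cell K).indicator (fun _ => v K) x := rfl
  rw [this]
  exact integrable_finsetSum _ fun K _ => integrable_indicator_cell K _

lemma hasCompactSupport_ext0 (v : Fin m.num → ℝ) : HasCompactSupport (m.ext0 v) := by
  refine HasCompactSupport.intro (isCompact_iUnion fun K => m.isCompact_cell K) fun x hx => ?_
  rw [ext0_apply]
  refine Finset.sum_eq_zero fun K _ => indicator_of_notMem (fun h => hx ?_) _
  exact mem_iUnion.2 ⟨K, h⟩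

lemma integral_ext0_mul (v : Fin m.num → ℝ) {φ : Plane → ℝ} (hφ : Continuous φ) :
    ∫ x, m.ext0 v x * φ x = ∑ K, v K * ∫ x in m.cell K, φ x := by
  simp only [ext0_apply, Finset.sum_mul]
  have e : ∀ K x, (m.cell K).indicator (fun _ => v K) x * φ x =
      (m.cell K).indicator (fun x => v K * φ x) x := by
    intro K x; by_cases h : x ∈ m.cell K <;> simp [h]
  simp only [e]
  rw [integral_finsetSum]
  · refine Finset.sum_congr rfl fun K _ => ?_
    rw [integral_indicator (m.measurableSet_cell K), integral_const_mul]
  · intro K _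
    rw [integrable_indicator_iff (m.measurableSet_cell K)]
    exact (hφ.const_mul _).continuousOn.integrableOn_compact (m.isCompact_cell K)

variable (m) in
/-- Mollification of the extension by zero of a piecewise constant scalar function. -/
def moll (η : ContDiffBump (0 : Plane)) (v : Fin m.num → ℝ) : Plane → ℝ :=
  convolution (m.ext0 v) (η.normed volume) (ContinuousLinearMap.lsmul ℝ ℝ) volume

variable (η : ContDiffBump (0 : Plane))

lemma contDiff_moll (v : Fin m.num → ℝ) : ContDiff ℝ ∞ (m.moll η v) :=
  η.hasCompactSupport_normed.contDiff_convolution_right _ (integrable_ext0 v).locallyIntegrable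
    η.contDiff_normed

lemma hasCompactSupport_moll (v : Fin m.num → ℝ) : HasCompactSupport (m.moll η v) :=
  HasCompactSupport.convolution _ (hasCompactSupport_ext0 v) η.hasCompactSupport_normed

lemma moll_apply (v : Fin m.num → ℝ) (x : Plane) :
    m.moll η v x = ∑ K, v K * ∫ y in m.cell K, η.normed volume (x - y) := by
  rw [moll, convolution_def]
  simp only [ContinuousLinearMap.lsmul_apply, smul_eq_mul]
  exact integral_ext0_mul v (η.continuous_normed.comp (continuous_const.sub continuous_id))

/-- The derivative falls on the kernel, and the divergence theorem on each triangle turns its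
integral into edge means. -/
lemma fderiv_moll (v : Fin m.num → ℝ) (x e : Plane) :
    fderiv ℝ (m.moll η v) x e =
      -∑ a : Fin m.num × Fin 3, v a.1 * (m.ln a * inner ℝ (m.nv a) e *
        edgeMean (fun y => η.normed volume (x - y)) (m.pt a.1) a.2) := by
  have hη : ContDiff ℝ 1 (η.normed volume) := η.contDiff_normed
  have h1 := η.hasCompactSupport_normed.hasFDerivAt_convolution_right
    (ContinuousLinearMap.lsmul ℝ ℝ) (integrable_ext0 v).locallyIntegrable hη x
  have h2 : fderiv ℝ (m.moll η v) x = _ := h1.fderiv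
  rw [h2, convolution_precompR_apply _ (integrable_ext0 v).locallyIntegrable
    (η.hasCompactSupport_normed.fderiv ℝ) (hη.continuous_fderiv one_ne_zero), convolution_def]
  simp only [ContinuousLinearMap.lsmul_apply, smul_eq_mul]
  rw [integral_ext0_mul v (φ := fun y => fderiv ℝ (η.normed volume) (x - y) e)
    (((hη.continuous_fderiv one_ne_zero).comp (continuous_const.sub continuous_id)).clm_apply
      continuous_const), sum_prod_edges, ← Finset.sum_neg_distrib]
  refine Finset.sum_congr rfl fun K _ => ?_
  have hφ : ContDiff ℝ 1 (fun y => η.normed volume (x - y)) :=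
    hη.comp (contDiff_const.sub contDiff_id)
  have h3 := m.setIntegral_cell_fderiv K hφ e
  have h4 : ∀ y, fderiv ℝ (fun y => η.normed volume (x - y)) y e =
      -fderiv ℝ (η.normed volume) (x - y) e := by
    intro y
    have h5 : HasFDerivAt (fun y => η.normed volume (x - y))
        ((fderiv ℝ (η.normed volume) (x - y)).comp (-ContinuousLinearMap.id ℝ Plane)) y :=
      ((hη.differentiable one_ne_zero _).hasFDerivAt).comp y ((hasFDerivAt_id y).const_sub x)
    rw [h5.fderiv]; simp
  simp only [h4, integral_neg] at h3
  simp only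
  rw [← Finset.mul_sum, ← mul_neg]
  congr 1
  rw [← neg_neg (∫ x_1 in m.cell K, _), h3]
  rfl

/-- Summation by parts: weights of opposite sign on the two sides see only the jump. On the boundary
the jump is the value itself up to sign, so no symmetry of the weight is required there. -/
lemma abs_sum_mul_le_sum_jump (v : Fin m.num → ℝ) {g : Fin m.num × Fin 3 → ℝ}
    (hg : ∀ a, m.opp a ≠ a → g (m.opp a) = -g a) :
    |∑ a : Fin m.num × Fin 3, v a.1 * g a| ≤ ∑ a, |m.jump v a| * |g a| := by
  have h1 := sum_opp fun a => v a.1 * g a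
  have h2 : 2 * |∑ a : Fin m.num × Fin 3, v a.1 * g a| =
      |∑ a, (v a.1 * g a + v (m.opp a).1 * g (m.opp a))| := by
    rw [Finset.sum_add_distrib, h1, ← two_mul, abs_mul, abs_two]
  have h3 : ∀ a, |v a.1 * g a + v (m.opp a).1 * g (m.opp a)| ≤ 2 * (|m.jump v a| * |g a|) := by
    intro a
    by_cases h : m.opp a = a
    · rw [h, jump, nb_of_eq h, zero_sub, abs_neg, ← two_mul, abs_mul, abs_two, abs_mul]
    · rw [hg a h, jump, nb_of_ne h, show v a.1 * g a + v (m.opp a).1 * -g a =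
        -((v (m.opp a).1 - v a.1) * g a) by ring, abs_neg, abs_mul]
      have : 0 ≤ |v (m.opp a).1 - v a.1| * |g a| := by positivity
      linarith
  have h4 : 2 * |∑ a : Fin m.num × Fin 3, v a.1 * g a| ≤ 2 * ∑ a, |m.jump v a| * |g a| := by
    rw [h2, Finset.mul_sum]
    exact (Finset.abs_sum_le_sum_abs _ _).trans (Finset.sum_le_sum fun a _ => h3 a)
  linarith

lemma edgeMean_mem_of_forall {φ : Plane → ℝ} (hφ : Continuous φ) {K : Fin m.num} {i : Fin 3}
    {z b : ℝ} (h : ∀ x ∈ m.edge K i, |φ x - z| ≤ b) :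
    |edgeMean φ (m.pt K) i - z| ≤ b := by
  have h1 : edgeMean φ (m.pt K) i - z =
      ∫ t in (0 : ℝ)..1, (φ ((1 - t) • m.pt K (i + 1) + t • m.pt K (i + 2)) - z) := by
    rw [intervalIntegral.integral_sub (Continuous.intervalIntegrable (by fun_prop) _ _) (by simp)]
    simp [edgeMean]
  rw [h1]
  have := intervalIntegral.norm_integral_le_of_norm_le_const (a := 0) (b := 1)
    (f := fun t => φ ((1 - t) • m.pt K (i + 1) + t • m.pt K (i + 2)) - z) (C := b) ?_
  · simpa using this
  · intro t ht
    rw [uIoc_of_le zero_le_one] at ht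
    apply h
    rw [edge_eq_segment, segment_eq_image]
    exact ⟨t, ⟨ht.1.le, ht.2⟩, rfl⟩

end Mollify

end TriMesh

/-! ### Bounds for the mollification in terms of jumps -/

namespace TriMesh

variable {Ω : Set Plane} {m : TriMesh Ω} {c : ℝ}

section MollBounds

/-- The constant in the gradient bounds for the mollification. -/
def gradC (c : ℝ) : ℝ := (8 / (Real.pi * c ^ 4)) ^ 2 * (27 / c ^ 4)

lemma gradC_nonneg (c : ℝ) : 0 ≤ gradC c := by
  have := Real.pi_pos; unfold gradC; positivity

variable {η : ContDiffBump (0 : Plane)}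

lemma normed_le (hc : 0 < c) (hh : 0 < m.h) (hin : η.rIn = c ^ 2 * m.h / 2) (x : Plane) :
    η.normed volume x ≤ 4 / (Real.pi * (c ^ 4 * m.h ^ 2)) := by
  refine (η.normed_le_div_measure_closedBall_rIn volume x).trans (le_of_eq ?_)
  have := Real.pi_pos
  rw [volume_real_closedBall _ η.rIn_pos.le, hin]
  field_simp
  ring

/-- The kernel reaches at most c² h ≤ h and an edge lies within h of its circumcentre, so only
points within 2h of the circumcentre are affected. -/
lemma abs_edgeMean_normed_le (hm : m.IsRegular c) (hc : 0 < c) (hin : η.rIn = c ^ 2 * m.h / 2)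
    (hout : η.rOut = c ^ 2 * m.h) (x : Plane) (a : Fin m.num × Fin 3) :
    |edgeMean (fun y => η.normed volume (x - y)) (m.pt a.1) a.2| ≤
      (Metric.closedBall (m.ctr a.1) (2 * m.h)).indicator
        (fun _ => 4 / (Real.pi * (c ^ 4 * m.h ^ 2))) x := by
  have hcont : Continuous (fun y => η.normed volume (x - y)) :=
    η.continuous_normed.comp (continuous_const.sub continuous_id)
  rw [← sub_zero (edgeMean _ _ _)]
  refine edgeMean_mem_of_forall hcont fun y hy => ?_
  rw [sub_zero, abs_of_nonneg (η.nonneg_normed _)]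
  by_cases hx : x ∈ Metric.closedBall (m.ctr a.1) (2 * m.h)
  · rw [indicator_of_mem hx]
    exact normed_le hc (m.h_pos a.1) hin _
  · rw [indicator_of_notMem hx]
    apply le_of_eq
    rw [← Function.notMem_support, η.support_normed_eq, mem_ball_zero_iff, hout, not_lt]
    rw [Metric.mem_closedBall, not_le] at hx
    have h1 := dist_ctr_le_h (m.edge_subset_cell _ _ hy)
    have h2 := dist_triangle x y (m.ctr a.1)
    have h3 := hm.sq_le_one hc a.1
    have h4 := m.h_pos a.1
    rw [← dist_eq_norm]
    nlinarith

-- Only edges of the boundedly many triangles near x contribute. Each has length at most 2h and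
-- meets a kernel of size O(h⁻²), so the derivative is O(1/h) times a bounded number of jumps;
-- Cauchy–Schwarz gives the square.
open Classical in
lemma sq_fderiv_moll_le (hm : m.IsRegular c) (hc : 0 < c) (hin : η.rIn = c ^ 2 * m.h / 2)
    (hout : η.rOut = c ^ 2 * m.h) (v : Fin m.num → ℝ) (x e : Plane) :
    (fderiv ℝ (m.moll η v) x e) ^ 2 ≤ gradC c / m.h ^ 2 * ‖e‖ ^ 2 *
      ∑ a, (Metric.closedBall (m.ctr a.1) (2 * m.h)).indicator (fun _ => m.jump v a ^ 2) x := by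
  have hpi := Real.pi_pos
  set E := fun a : Fin m.num × Fin 3 =>
    edgeMean (fun y => η.normed volume (x - y)) (m.pt a.1) a.2 with hE
  set s := Finset.univ.filter fun K => x ∈ Metric.closedBall (m.ctr K) (2 * m.h) with hs
  -- Edge length 2h times the kernel bound 4/(π c⁴ h²). Together with the count of three edges on
  -- each of 9/c⁴ triangles, it determines `gradC`.
  set B : ℝ := 8 * ‖e‖ / (Real.pi * c ^ 4 * m.h) with hB
  have hg : ∀ a, m.opp a ≠ a → m.ln (m.opp a) * inner ℝ (m.nv (m.opp a)) e * E (m.opp a) =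
      -(m.ln a * inner ℝ (m.nv a) e * E a) := by
    intro a ha
    have : E (m.opp a) = E a := (isOpp_opp ha).edgeMean _
    rw [ln_opp, nv_opp ha, this, inner_neg_left]; ring
  have h1 : |fderiv ℝ (m.moll η v) x e| ≤
      ∑ a, |m.jump v a| * |m.ln a * inner ℝ (m.nv a) e * E a| := by
    rw [fderiv_moll, abs_neg]
    exact abs_sum_mul_le_sum_jump v hg
  have h2 : ∀ a, |m.jump v a| * |m.ln a * inner ℝ (m.nv a) e * E a| ≤
      if a ∈ s ×ˢ (Finset.univ : Finset (Fin 3)) then |m.jump v a| * B else 0 := by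
    intro a
    have hh := m.h_pos a.1
    have h3 := abs_edgeMean_normed_le hm hc hin hout x a
    have h4 : |inner ℝ (m.nv a) e| ≤ ‖e‖ := by
      simpa [norm_nv] using abs_real_inner_le_norm (m.nv a) e
    have h5 : m.ln a ≤ 2 * m.h := m.len_le _ _
    have h6 : 0 < m.ln a := m.ln_pos a
    by_cases ha : x ∈ Metric.closedBall (m.ctr a.1) (2 * m.h)
    · rw [if_pos (by simp [hs]; exact ha)]
      rw [indicator_of_mem ha] at h3
      refine mul_le_mul_of_nonneg_left ?_ (abs_nonneg _)
      rw [abs_mul, abs_mul, abs_of_pos h6]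
      calc m.ln a * |inner ℝ (m.nv a) e| * |E a| ≤
          2 * m.h * ‖e‖ * (4 / (Real.pi * (c ^ 4 * m.h ^ 2))) := by gcongr
        _ = B := by rw [hB]; field_simp; ring
    · rw [if_neg (by simp [hs]; simpa using ha)]
      rw [indicator_of_notMem ha] at h3
      rw [abs_mul, abs_mul, le_antisymm h3 (abs_nonneg _)]; simp
  have h3 : |fderiv ℝ (m.moll η v) x e| ≤
      ∑ a ∈ s ×ˢ (Finset.univ : Finset (Fin 3)), |m.jump v a| * B := by
    refine h1.trans ((Finset.sum_le_sum fun a _ => h2 a).trans (le_of_eq ?_))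
    rw [← Finset.sum_filter, Finset.filter_mem_eq_inter, Finset.univ_inter]
  have h4 := Finset.sum_mul_sq_le_sq_mul_sq (s ×ˢ (Finset.univ : Finset (Fin 3)))
    (fun a => |m.jump v a|) (fun _ => B)
  have hsum : ∑ a, (Metric.closedBall (m.ctr a.1) (2 * m.h)).indicator (fun _ => m.jump v a ^ 2) x
      = ∑ a ∈ s ×ˢ (Finset.univ : Finset (Fin 3)), m.jump v a ^ 2 := by
    rw [← Finset.univ_inter (s ×ˢ (Finset.univ : Finset (Fin 3))), ← Finset.filter_mem_eq_inter,
      Finset.sum_filter]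
    refine Finset.sum_congr rfl fun a _ => ?_
    simp [hs, indicator_apply]
  rw [hsum]
  simp only [sq_abs, Finset.sum_const, nsmul_eq_mul, Finset.card_product, Finset.card_univ,
    Fintype.card_fin, Nat.cast_mul] at h4
  rcases Nat.eq_zero_or_pos m.num with h0 | h0
  · have : IsEmpty (Fin m.num × Fin 3) := by rw [h0]; infer_instance
    have : fderiv ℝ (m.moll η v) x e = 0 := by
      rw [fderiv_moll]; simp
    have hG := gradC_nonneg c
    rw [this, zero_pow two_ne_zero]
    exact mul_nonneg (by positivity) (Finset.sum_nonneg fun _ _ => sq_nonneg _)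
  have hh := m.h_pos ⟨0, h0⟩
  have hcard := hm.card_near_le hc x
  calc (fderiv ℝ (m.moll η v) x e) ^ 2 = |fderiv ℝ (m.moll η v) x e| ^ 2 := (sq_abs _).symm
    _ ≤ (∑ a ∈ s ×ˢ (Finset.univ : Finset (Fin 3)), |m.jump v a| * B) ^ 2 :=
        pow_le_pow_left₀ (abs_nonneg _) h3 2
    _ ≤ _ := h4
    _ ≤ (∑ a ∈ s ×ˢ (Finset.univ : Finset (Fin 3)), m.jump v a ^ 2) *
        (9 / c ^ 4 * (3 : ℕ) * B ^ 2) := by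
        refine mul_le_mul_of_nonneg_left ?_ (Finset.sum_nonneg fun _ _ => sq_nonneg _)
        gcongr
    _ = _ := by rw [hB, gradC]; push_cast; field_simp; ring

lemma norm_fderiv_moll_le (hm : m.IsRegular c) (hc : 0 < c) (hh : 0 < m.h)
    (hin : η.rIn = c ^ 2 * m.h / 2)
    (hout : η.rOut = c ^ 2 * m.h) (v : Fin m.num → ℝ) (x : Plane) :
    ‖fderiv ℝ (m.moll η v) x‖ ≤ √(gradC c) / m.h * √(m.jumpSq v) := by
  have hG := gradC_nonneg c
  refine ContinuousLinearMap.opNorm_le_bound _ (by positivity) fun e => ?_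
  rw [Real.norm_eq_abs]
  apply abs_le_of_sq_le_sq _ (by positivity)
  have h1 := sq_fderiv_moll_le hm hc hin hout v x e
  refine h1.trans ?_
  rw [mul_pow, mul_pow, div_pow, Real.sq_sqrt hG, Real.sq_sqrt (m.jumpSq_nonneg v)]
  have h2 : ∑ a, (Metric.closedBall (m.ctr a.1) (2 * m.h)).indicator
      (fun _ => m.jump v a ^ 2) x ≤ m.jumpSq v := by
    refine Finset.sum_le_sum fun a _ => ?_
    refine (indicator_le_self' (fun _ _ => sq_nonneg _) x).trans ?_
    simp
  calc _ ≤ gradC c / m.h ^ 2 * ‖e‖ ^ 2 * m.jumpSq v := by gcongr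
    _ = _ := by ring

/-- Integrating the pointwise bound, each jump acts on a disc of area 4π h², which cancels h⁻². In
the plane the squared gradient thus scales like the unweighted sum of squared jumps. -/
lemma lintegral_fderiv_moll_sq_le (hm : m.IsRegular c) (hc : 0 < c) (hh : 0 < m.h)
    (hin : η.rIn = c ^ 2 * m.h / 2)
    (hout : η.rOut = c ^ 2 * m.h) (v : Fin m.num → ℝ) (e : Plane) :
    ∫⁻ x, ‖fderiv ℝ (m.moll η v) x e‖ₑ ^ 2 ≤
      ENNReal.ofReal (4 * Real.pi * gradC c * ‖e‖ ^ 2 * m.jumpSq v) := by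
  have hG := gradC_nonneg c
  have hpi := Real.pi_pos
  have h1 : ∀ x, ‖fderiv ℝ (m.moll η v) x e‖ₑ ^ 2 ≤ ENNReal.ofReal (gradC c / m.h ^ 2 * ‖e‖ ^ 2) *
      ∑ a, (Metric.closedBall (m.ctr a.1) (2 * m.h)).indicator
        (fun _ => ENNReal.ofReal (m.jump v a ^ 2)) x := by
    intro x
    have h2 := ENNReal.ofReal_le_ofReal (sq_fderiv_moll_le hm hc hin hout v x e)
    rw [ENNReal.ofReal_mul (by positivity), ENNReal.ofReal_sum_of_nonneg
      (fun a _ => indicator_nonneg (fun _ _ => sq_nonneg _) _)] at h2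
    rw [Real.enorm_eq_ofReal_abs, ← ENNReal.ofReal_pow (abs_nonneg _), sq_abs]
    refine h2.trans (le_of_eq ?_)
    congr 1
    refine Finset.sum_congr rfl fun a _ => ?_
    by_cases h : x ∈ Metric.closedBall (m.ctr a.1) (2 * m.h) <;> simp [h]
  refine (lintegral_mono h1).trans ?_
  rw [lintegral_const_mul _ (Finset.measurable_sum _ fun a _ =>
    measurable_const.indicator Metric.isClosed_closedBall.measurableSet), lintegral_finsetSum _
    fun a _ => measurable_const.indicator Metric.isClosed_closedBall.measurableSet]
  simp only [lintegral_indicator_const Metric.isClosed_closedBall.measurableSet,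
    EuclideanSpace.volume_closedBall_fin_two]
  rw [← Finset.sum_mul, ← ENNReal.ofReal_sum_of_nonneg (fun _ _ => sq_nonneg _),
    ← ENNReal.ofReal_pow (by positivity), ← ENNReal.ofReal_mul (by positivity),
    ← ENNReal.ofReal_mul (Finset.sum_nonneg fun _ _ => sq_nonneg _),
    ← ENNReal.ofReal_mul (by positivity)]
  apply ENNReal.ofReal_le_ofReal
  apply le_of_eq
  have : m.jumpSq v = ∑ a, m.jump v a ^ 2 := by simp [jumpSq]
  rw [this]
  field_simp
  ring

/-- The kernel centred at a circumcentre is supported inside its triangle and has mass 1, so the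
mollification is exact there. -/
lemma moll_ctr (hm : m.IsRegular c) (hc : 0 < c) (hout : η.rOut = c ^ 2 * m.h)
    (v : Fin m.num → ℝ) (K : Fin m.num) : m.moll η v (m.ctr K) = v K := by
  have h0 : (fun y => η.normed volume (m.ctr K - y)) =
      (m.cell K).indicator fun y => η.normed volume (m.ctr K - y) := by
    symm
    rw [indicator_eq_self]
    intro y hy
    have hy' : m.ctr K - y ∈ Function.support (η.normed volume) := hy
    rw [η.support_normed_eq, mem_ball_zero_iff, hout, ← dist_eq_norm, dist_comm] at hy'
    exact interior_subset (hm.ball_subset hc K hy')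
  have h1 : ∀ L, ∫ y in m.cell L, η.normed volume (m.ctr K - y) = if L = K then 1 else 0 := by
    intro L
    rw [h0, setIntegral_indicator (m.measurableSet_cell K)]
    split_ifs with h
    · subst h
      rw [inter_self, ← integral_indicator (m.measurableSet_cell L), ← h0,
        integral_sub_left_eq_self (fun y => η.normed volume y) volume, η.integral_normed]
    · exact setIntegral_measure_zero _ (m.volume_cell_inter h)
  rw [moll_apply]
  simp [h1]

/-- The mollification equals v_K at the circumcentre, and its gradient, of order 1/h, acts over a
distance at most h. -/
lemma abs_moll_sub_le (hm : m.IsRegular c) (hc : 0 < c)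
    (hin : η.rIn = c ^ 2 * m.h / 2)
    (hout : η.rOut = c ^ 2 * m.h) (v : Fin m.num → ℝ) {K : Fin m.num} {x : Plane}
    (hx : x ∈ m.cell K) :
    |m.moll η v x - v K| ≤ √(gradC c) * √(m.jumpSq v) := by
  have hh := m.h_pos K
  rw [← moll_ctr hm hc hout v K, ← Real.norm_eq_abs]
  have hd : Differentiable ℝ (m.moll η v) := (contDiff_moll η v).differentiable (by simp)
  have h1 := convex_univ.norm_image_sub_le_of_norm_fderiv_le (𝕜 := ℝ) (f := m.moll η v)
    (fun x _ => hd x) (fun x _ => norm_fderiv_moll_le hm hc hh hin hout v x)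
    (mem_univ (m.ctr K)) (mem_univ x)
  refine h1.trans ?_
  have h2 : ‖x - m.ctr K‖ ≤ m.h := by rw [← dist_eq_norm]; exact dist_ctr_le_h hx
  calc _ ≤ √(gradC c) / m.h * √(m.jumpSq v) * m.h := by gcongr
    _ = _ := by field_simp

lemma IsRegular.exists_bump (hc : 0 < c) (hh : 0 < m.h) :
    ∃ η : ContDiffBump (0 : Plane), η.rIn = c ^ 2 * m.h / 2 ∧ η.rOut = c ^ 2 * m.h :=
  ⟨⟨c ^ 2 * m.h / 2, c ^ 2 * m.h, by positivity, by
    have : 0 < c ^ 2 * m.h := by positivity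
    linarith⟩, rfl, rfl⟩

end MollBounds

end TriMesh

/-! ### Glued functions and the divergence of the extension by zero -/

namespace TriMesh

variable {Ω : Set Plane} {m : TriMesh Ω} {c : ℝ}

section Glue

variable (m) in
lemma ae_cell_unique : ∀ᵐ x : Plane, ∀ K L, x ∈ m.cell K → x ∈ m.cell L → K = L := by
  rw [ae_all_iff]; intro K
  rw [ae_all_iff]; intro L
  by_cases h : K = L
  · exact Eventually.of_forall fun _ _ _ => h
  · have := measure_eq_zero_iff_ae_notMem.1 (m.volume_cell_inter h)
    filter_upwards [this] with x hx hK hL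
    exact absurd ⟨hK, hL⟩ hx

lemma ae_apply_glue {F M : Type} [AddCommMonoid F] [AddCommMonoid M] (G : F → M) (hG : G 0 = 0)
    (g : Fin m.num → Plane → F) :
    ∀ᵐ x : Plane, G (m.glue g x) = ∑ K, (m.cell K).indicator (fun x => G (g K x)) x := by
  filter_upwards [m.ae_cell_unique] with x hx
  by_cases h : ∃ K, x ∈ m.cell K
  · obtain ⟨K, hK⟩ := h
    have h1 : ∀ L, L ≠ K → x ∉ m.cell L := fun L hL hxL => hL (hx L K hxL hK)
    rw [glue, Finset.sum_eq_single K, Finset.sum_eq_single K, indicator_of_mem hK,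
      indicator_of_mem hK]
    all_goals simp +contextual [h1]
  · push Not at h
    simp [glue, h, hG]

lemma lintegral_glue_enorm_sq {F : Type} [NormedAddCommGroup F] (g : Fin m.num → Plane → F)
    (hg : ∀ K, Measurable fun x => ‖g K x‖ₑ) :
    ∫⁻ x, ‖m.glue g x‖ₑ ^ 2 = ∑ K, ∫⁻ x in m.cell K, ‖g K x‖ₑ ^ 2 := by
  rw [lintegral_congr_ae (ae_apply_glue (fun y : F => ‖y‖ₑ ^ 2) (by simp) g),
    lintegral_finsetSum _ fun K _ => ((hg K).pow_const 2).indicator (m.measurableSet_cell K)]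
  exact Finset.sum_congr rfl fun K _ => lintegral_indicator (m.measurableSet_cell K) _

lemma sum_setIntegral_le {φ : Plane → ℝ} (hφ : Integrable φ) (h0 : ∀ x, 0 ≤ φ x) :
    ∑ K, ∫ x in m.cell K, φ x ≤ ∫ x, φ x := by
  simp_rw [← integral_indicator (m.measurableSet_cell _)]
  rw [← integral_finsetSum _ fun K _ => hφ.indicator (m.measurableSet_cell K)]
  refine integral_mono_ae (integrable_finsetSum _ fun K _ =>
    hφ.indicator (m.measurableSet_cell K)) hφ ?_
  filter_upwards [m.ae_cell_unique] with x hx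
  by_cases h : ∃ K, x ∈ m.cell K
  · obtain ⟨K, hK⟩ := h
    have h1 : ∀ L, L ≠ K → x ∉ m.cell L := fun L hL hxL => hL (hx L K hxL hK)
    rw [Finset.sum_eq_single K]
    · exact indicator_le_self' (fun _ _ => h0 _) x
    · simp +contextual [h1]
    · simp
  · push Not at h
    simp [h, h0]

lemma ofReal_area (K : Fin m.num) : ENNReal.ofReal (m.area K) = volume (m.cell K) :=
  ENNReal.ofReal_toReal (volume_cell_ne_top K)

end Glue

section DivFree

lemma sum_ln_nc_edgeMean {D : m.P0} (hD : m.IsRT0 D) (φ : Plane → ℝ) :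
    ∑ a, m.ln a * m.nc D a * edgeMean φ (m.pt a.1) a.2 = 0 := by
  apply sum_eq_zero_of_opp_eq_neg
  intro a
  by_cases h : m.opp a = a
  · rw [h, hD.nc_of_eq h]; simp
  · rw [ln_opp, hD.nc_opp, (isOpp_opp h).edgeMean]; ring

lemma setIntegral_cell_fderiv_apply (D : m.P0) (K : Fin m.num) {φ : Plane → ℝ}
    (hφ : ContDiff ℝ 1 φ) :
    ∫ x in m.cell K, fderiv ℝ φ x (D K) =
      ∑ i, m.ln (K, i) * m.nc D (K, i) * edgeMean φ (m.pt K) i := by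
  rw [m.setIntegral_cell_fderiv K hφ]
  refine Finset.sum_congr rfl fun i _ => ?_
  rw [real_inner_comm]; rfl

/-- The extension by zero of a piecewise constant Raviart–Thomas field is weakly divergence free on
the whole plane: fluxes cancel across interior edges and vanish on boundary edges, and the test
function is arbitrary near the boundary. -/
lemma sum_setIntegral_fderiv_eq_zero {D : m.P0} (hD : m.IsRT0 D) {φ : Plane → ℝ}
    (hφ : ContDiff ℝ 1 φ) : ∑ K, ∫ x in m.cell K, fderiv ℝ φ x (D K) = 0 := by
  simp_rw [setIntegral_cell_fderiv_apply D _ hφ]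
  rw [← sum_prod_edges fun a => m.ln a * m.nc D a * edgeMean φ (m.pt a.1) a.2]
  exact sum_ln_nc_edgeMean hD φ

lemma fourier_ext0 (v : Fin m.num → ℝ) (ξ : Plane) :
    𝓕 (fun x => (m.ext0 v x : ℂ)) ξ =
      ((∑ K, v K * ∫ x in m.cell K, Real.cos (2 * Real.pi * inner ℝ x ξ) : ℝ) : ℂ) -
      ((∑ K, v K * ∫ x in m.cell K, Real.sin (2 * Real.pi * inner ℝ x ξ) : ℝ) : ℂ)
        * Complex.I := by
  have hc : Continuous fun x : Plane => Real.cos (2 * Real.pi * inner ℝ x ξ) := by fun_prop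
  have hs : Continuous fun x : Plane => Real.sin (2 * Real.pi * inner ℝ x ξ) := by fun_prop
  have hi : ∀ {φ : Plane → ℝ}, Continuous φ → (∀ x, |φ x| ≤ 1) →
      Integrable fun x => ((m.ext0 v x * φ x : ℝ) : ℂ) := by
    intro φ hφ h1
    exact ((integrable_ext0 v).mul_bdd (c := 1) hφ.aestronglyMeasurable
      (Eventually.of_forall h1)).ofReal
  rw [← integral_ext0_mul v hc, ← integral_ext0_mul v hs, ← integral_complex_ofReal,
    ← integral_complex_ofReal, ← integral_mul_const, ← integral_sub
    (hi hc fun x => Real.abs_cos_le_one _) ((hi hs fun x => Real.abs_sin_le_one _).mul_const _),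
    Real.fourier_eq']
  congr 1
  funext x
  rw [smul_eq_mul, Complex.exp_mul_I, show (((-2 * Real.pi * inner ℝ x ξ : ℝ)) : ℂ) =
    -((2 * Real.pi * inner ℝ x ξ : ℝ) : ℂ) by push_cast; ring, Complex.cos_neg, Complex.sin_neg,
    ← Complex.ofReal_cos, ← Complex.ofReal_sin]
  push_cast
  ring

lemma fderiv_comp_inner {g g' : ℝ → ℝ} (hg : ∀ t, HasDerivAt g (g' t) t) (ξ x e : Plane) :
    fderiv ℝ (fun x => g (2 * Real.pi * inner ℝ x ξ)) x e =
      g' (2 * Real.pi * inner ℝ x ξ) * (2 * Real.pi * inner ℝ e ξ) := by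
  have h1 : HasFDerivAt (fun x : Plane => 2 * Real.pi * inner ℝ x ξ)
      ((2 * Real.pi) • (innerSL ℝ ξ)) x := by
    have := ((innerSL ℝ ξ).hasFDerivAt (x := x)).const_mul (2 * Real.pi)
    simpa [real_inner_comm] using this
  have h2 := (hg (2 * Real.pi * inner ℝ x ξ)).comp_hasFDerivAt x h1
  have h3 : fderiv ℝ (fun x => g (2 * Real.pi * inner ℝ x ξ)) x = _ := h2.fderiv
  rw [h3]
  simp [real_inner_comm]

/-- Weak freedom from divergence, tested with the sine and minus the cosine of 2π x·ξ; their
gradients give the real and imaginary parts of the Fourier identity. -/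
lemma fourier_divergence_eq_zero {D : m.P0} (hD : m.IsRT0 D) (ξ : Plane) :
    ∑ i, (ξ i : ℂ) * 𝓕 (fun x => (m.ext0 (fun K => D K i) x : ℂ)) ξ = 0 := by
  have hpi := Real.pi_pos
  have key : ∀ {g g' : ℝ → ℝ}, ContDiff ℝ 1 g → (∀ t, HasDerivAt g (g' t) t) →
      ∑ i, ξ i * ∑ K, D K i * ∫ x in m.cell K, g' (2 * Real.pi * inner ℝ x ξ) = 0 := by
    intro g g' hg hg'
    have h1 := sum_setIntegral_fderiv_eq_zero hD
      (φ := fun x => g (2 * Real.pi * inner ℝ x ξ)) (hg.comp (contDiff_const.mul (contDiff_id.inner ℝ contDiff_const)))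
    simp only [fderiv_comp_inner hg', integral_mul_const] at h1
    have h2 : (2 * Real.pi) * ∑ i, ξ i * ∑ K, D K i *
        ∫ x in m.cell K, g' (2 * Real.pi * inner ℝ x ξ) = 0 := by
      rw [← h1, Finset.mul_sum]
      simp only [Finset.mul_sum]
      rw [Finset.sum_comm]
      refine Finset.sum_congr rfl fun K _ => ?_
      rw [plane_inner, Fin.sum_univ_two]
      ring
    rcases mul_eq_zero.1 h2 with h | h
    · exact absurd h (by positivity)
    · exact h
  have hcos := key Real.contDiff_sin Real.hasDerivAt_sin
  have hsin := key (g := fun t => -Real.cos t) (g' := Real.sin) Real.contDiff_cos.neg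
    (fun t => by simpa using HasDerivAt.fun_neg (Real.hasDerivAt_cos t))
  simp only [fourier_ext0, mul_sub, Finset.sum_sub_distrib]
  rw [sub_eq_zero]
  trans (((∑ i, ξ i * ∑ K, D K i *
        ∫ x in m.cell K, Real.cos (2 * Real.pi * inner ℝ x ξ) : ℝ)) : ℂ)
  · push_cast; rfl
  trans (((∑ i, ξ i * ∑ K, D K i *
        ∫ x in m.cell K, Real.sin (2 * Real.pi * inner ℝ x ξ) : ℝ)) : ℂ) * Complex.I
  · rw [hcos, hsin]; simp
  · push_cast; rw [Finset.sum_mul]; simp only [mul_assoc]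

end DivFree

/-! ### The smoothed trilinear form -/

section Wente

variable {η : ContDiffBump (0 : Plane)}

lemma sum_lintegral_ext0_sq (D : m.P0) :
    ∑ i : Fin 2, ∫⁻ x, ‖(m.ext0 (fun K => D K i) x : ℂ)‖ₑ ^ 2 =
      ENNReal.ofReal (‖m.emb D‖ ^ 2) := by
  have h1 : ∀ i : Fin 2, ∫⁻ x, ‖(m.ext0 (fun K => D K i) x : ℂ)‖ₑ ^ 2 =
      ENNReal.ofReal (∑ K, m.area K * D K i ^ 2) := by
    intro i
    have h2 : ∀ x, ‖(m.ext0 (fun K => D K i) x : ℂ)‖ₑ = ‖m.glue (fun K _ => D K i) x‖ₑ := by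
      intro x; rw [← ofReal_norm, ← ofReal_norm, Complex.norm_real]; rfl
    simp only [h2]
    rw [lintegral_glue_enorm_sq (fun K _ => D K i) fun K => measurable_const, ENNReal.ofReal_sum_of_nonneg
      fun K _ => mul_nonneg (m.area_pos K).le (sq_nonneg _)]
    refine Finset.sum_congr rfl fun K _ => ?_
    rw [setLIntegral_const, ENNReal.ofReal_mul (m.area_pos K).le, ofReal_area, mul_comm,
      Real.enorm_eq_ofReal_abs, ← ENNReal.ofReal_pow (abs_nonneg _), sq_abs]
  rw [Finset.sum_congr rfl fun i _ => h1 i, ← ENNReal.ofReal_sum_of_nonneg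
    fun i _ => Finset.sum_nonneg fun K _ => mul_nonneg (m.area_pos K).le (sq_nonneg _),
    norm_emb_sq, Finset.sum_comm]
  congr 1
  refine Finset.sum_congr rfl fun K _ => ?_
  rw [EuclideanSpace.real_norm_sq_eq, Finset.mul_sum]

/-- The complexified mollification as a Schwartz function. -/
def mollS (η : ContDiffBump (0 : Plane)) (v : Fin m.num → ℝ) : SchwartzMap Plane ℂ :=
  HasCompactSupport.toSchwartzMap (f := fun x => (m.moll η v x : ℂ))
    ((hasCompactSupport_moll η v).comp_left (g := Complex.ofReal) Complex.ofReal_zero)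
    (Complex.ofRealCLM.contDiff.comp (contDiff_moll η v))

lemma mollS_apply (v : Fin m.num → ℝ) (x : Plane) : mollS η v x = (m.moll η v x : ℂ) := rfl

lemma fderiv_mollS (v : Fin m.num → ℝ) (x e : Plane) :
    fderiv ℝ (mollS η v) x e = (fderiv ℝ (m.moll η v) x e : ℂ) := by
  have h1 : HasFDerivAt (m.moll η v) (fderiv ℝ (m.moll η v) x) x :=
    ((contDiff_moll η v).differentiable (by simp) x).hasFDerivAt
  have h2 : HasFDerivAt (mollS η v) (Complex.ofRealCLM.comp (fderiv ℝ (m.moll η v) x)) x :=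
    (Complex.ofRealCLM.hasFDerivAt).comp x h1
  rw [h2.fderiv]; rfl

/-- The constant in the estimate of the smoothed trilinear form. -/
def wenteC (c : ℝ) : ℝ := 4 * Real.pi * (√Real.pi * √(8 * Real.pi * gradC c)) *
  √(16 * Real.pi * gradC c)

lemma wenteC_eq (c : ℝ) {a b n : ℝ} (ha : 0 ≤ a) (hb : 0 ≤ b) (hn : 0 ≤ n) :
    ENNReal.ofReal (2 * Real.pi) * (2 *
      ((ENNReal.ofReal Real.pi * ENNReal.ofReal (8 * Real.pi * gradC c * b)) ^
        (1 / 2 : ℝ) * (ENNReal.ofReal (8 * Real.pi * gradC c * a) *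
          (2 * ENNReal.ofReal (n ^ 2))) ^ (1 / 2 : ℝ))) =
      ENNReal.ofReal (wenteC c * (n * √a * √b)) := by
  have hpi := Real.pi_pos
  have hG := gradC_nonneg c
  rw [show (2 : ℝ≥0∞) = ENNReal.ofReal 2 by simp]
  rw [← ENNReal.ofReal_mul hpi.le, ← ENNReal.ofReal_mul (by positivity : (0 : ℝ) ≤ 2),
    ← ENNReal.ofReal_mul (by positivity), ENNReal.ofReal_rpow_of_nonneg (by positivity)
    (by positivity), ENNReal.ofReal_rpow_of_nonneg (by positivity) (by positivity),
    ← ENNReal.ofReal_mul (by positivity), ← ENNReal.ofReal_mul (by positivity),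
    ← ENNReal.ofReal_mul (by positivity), ← Real.sqrt_eq_rpow, ← Real.sqrt_eq_rpow]
  congr 1
  rw [show 8 * Real.pi * gradC c * a * (2 * n ^ 2) = 16 * Real.pi * gradC c * (a * n ^ 2) by ring,
    Real.sqrt_mul hpi.le, Real.sqrt_mul (show 0 ≤ 8 * Real.pi * gradC c by positivity),
    Real.sqrt_mul (show 0 ≤ 16 * Real.pi * gradC c by positivity), Real.sqrt_mul ha,
    Real.sqrt_sq hn, wenteC]
  ring

lemma integral_moll_convection (η : ContDiffBump (0 : Plane)) (D : m.P0) (v w : Fin m.num → ℝ) :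
    ∫ x, (∑ i, (m.ext0 (fun K => D K i) x : ℂ) *
      fderiv ℝ (mollS η w) x (EuclideanSpace.single i 1)) * mollS η v x =
      ((∑ K, ∫ x in m.cell K, fderiv ℝ (m.moll η w) x (D K) * m.moll η v x : ℝ) : ℂ) := by
  have hcw : Continuous (fderiv ℝ (m.moll η w)) := (contDiff_moll η w).continuous_fderiv (by simp)
  have hcv : Continuous (m.moll η v) := (contDiff_moll η v).continuous
  have h1 : ∀ x, (∑ i, (m.ext0 (fun K => D K i) x : ℂ) *
      fderiv ℝ (mollS η w) x (EuclideanSpace.single i 1)) * mollS η v x = ((∑ i, m.ext0 (fun K => D K i) x *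
        (fderiv ℝ (m.moll η w) x (EuclideanSpace.single i 1) * m.moll η v x) : ℝ) : ℂ) := by
    intro x
    simp only [fderiv_mollS, mollS_apply, Finset.sum_mul]
    push_cast
    refine Finset.sum_congr rfl fun i _ => by ring
  simp only [h1]
  rw [integral_complex_ofReal]
  congr 1
  have hci : ∀ i : Fin 2, Continuous fun x =>
      fderiv ℝ (m.moll η w) x (EuclideanSpace.single i 1) * m.moll η v x :=
    fun i => (hcw.clm_apply continuous_const).mul hcv
  rw [integral_finsetSum]
  · simp only [integral_ext0_mul _ (hci _)]
    rw [Finset.sum_comm]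
    refine Finset.sum_congr rfl fun K _ => ?_
    simp only [← integral_const_mul]
    rw [← integral_finsetSum]
    · refine integral_congr_ae (Eventually.of_forall fun x => ?_)
      simp only
      rw [show fderiv ℝ (m.moll η w) x (D K) = fderiv ℝ (m.moll η w) x
        (D K 0 • EuclideanSpace.single 0 1 + D K 1 • EuclideanSpace.single 1 1) by
          congr 1; ext j; fin_cases j <;> simp]
      rw [map_add, map_smul, map_smul, Fin.sum_univ_two, smul_eq_mul, smul_eq_mul]
      ring
    · intro i _
      exact ((hci i).const_mul _).continuousOn.integrableOn_compact (m.isCompact_cell K)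
  · intro i _
    have hcs : HasCompactSupport fun x =>
        fderiv ℝ (m.moll η w) x (EuclideanSpace.single i 1) * m.moll η v x :=
      (hasCompactSupport_moll η v).mul_left
    obtain ⟨B, hB⟩ := (hci i).bounded_above_of_compact_support hcs
    exact (integrable_ext0 _).mul_bdd (c := B) (hci i).aestronglyMeasurable
      (Eventually.of_forall hB)

lemma sum_lintegral_fderiv_mollS_le (hm : m.IsRegular c) (hc : 0 < c) (hh : 0 < m.h)
    (hin : η.rIn = c ^ 2 * m.h / 2) (hout : η.rOut = c ^ 2 * m.h) (u : Fin m.num → ℝ) :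
    ∑ i : Fin 2, ∫⁻ x, ‖fderiv ℝ (mollS η u) x (EuclideanSpace.single i 1)‖ₑ ^ 2 ≤
      ENNReal.ofReal (8 * Real.pi * gradC c * m.jumpSq u) := by
  have hpi := Real.pi_pos
  have hG := gradC_nonneg c
  have h1 : ∀ i : Fin 2,
      ∫⁻ x, ‖fderiv ℝ (mollS η u) x (EuclideanSpace.single i 1)‖ₑ ^ 2 ≤
      ENNReal.ofReal (4 * Real.pi * gradC c * m.jumpSq u) := by
    intro i
    have h2 := lintegral_fderiv_moll_sq_le hm hc hh hin hout u (EuclideanSpace.single i 1)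
    simp only [PiLp.norm_single, norm_one, one_pow, mul_one] at h2
    refine le_trans (le_of_eq ?_) h2
    congr 1; funext x
    rw [fderiv_mollS, ← ofReal_norm, Complex.norm_real, ofReal_norm]
  refine (Finset.sum_le_sum fun i _ => h1 i).trans ?_
  have hJ := m.jumpSq_nonneg u
  rw [Fin.sum_univ_two, ← ENNReal.ofReal_add (by positivity) (by positivity)]
  exact ENNReal.ofReal_le_ofReal (by linarith)

/-- Compensated compactness with D the zero extension of a Raviart–Thomas field and a, b the
mollifications of w and v; gradients of mollifications are replaced by jumps. -/
lemma abs_sum_moll_convection_le (hm : m.IsRegular c) (hc : 0 < c) (hh : 0 < m.h)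
    (hin : η.rIn = c ^ 2 * m.h / 2) (hout : η.rOut = c ^ 2 * m.h) {D : m.P0} (hD : m.IsRT0 D)
    (v w : Fin m.num → ℝ) :
    |∑ K, ∫ x in m.cell K, fderiv ℝ (m.moll η w) x (D K) * m.moll η v x| ≤
      wenteC c * (‖m.emb D‖ * √(m.jumpSq v) * √(m.jumpSq w)) := by
  have hpi := Real.pi_pos
  have hG := gradC_nonneg c
  set Dc : Fin 2 → Plane → ℂ := fun i x => (m.ext0 (fun K => D K i) x : ℂ) with hDc
  have hDi : ∀ i, Integrable (Dc i) := fun i => (integrable_ext0 _).ofReal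
  have hs := sum_lintegral_ext0_sq D
  have hD2 : ∀ i, MemLp (Dc i) 2 := by
    intro i
    refine ⟨(hDi i).1, ?_⟩
    rw [eLpNorm_lt_top_iff_lintegral_rpow_enorm_lt_top two_ne_zero ENNReal.ofNat_ne_top]
    have h1 : ∫⁻ x, ‖Dc i x‖ₑ ^ 2 ≤ ENNReal.ofReal (‖m.emb D‖ ^ 2) := by
      rw [← hs]
      exact Finset.single_le_sum (f := fun i => ∫⁻ x, ‖Dc i x‖ₑ ^ 2) (fun _ _ => zero_le)
        (Finset.mem_univ i)
    simpa using h1.trans_lt ENNReal.ofReal_lt_top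
  have hW := enorm_integral_convection_le hDi hD2 (fourier_divergence_eq_zero hD)
    (mollS η w) (mollS η v)
  have hL : _ = _ := integral_moll_convection η D v w
  have hgrad := sum_lintegral_fderiv_mollS_le hm hc hh hin hout
  have hJv := m.jumpSq_nonneg v
  have hJw := m.jumpSq_nonneg w
  have hfin := wenteC_eq c hJv hJw (norm_nonneg (m.emb D))
  rw [hL] at hW
  have hW2 : ENNReal.ofReal
      |∑ K, ∫ x in m.cell K, fderiv ℝ (m.moll η w) x (D K) * m.moll η v x| ≤
      ENNReal.ofReal (wenteC c * (‖m.emb D‖ * √(m.jumpSq v) * √(m.jumpSq w))) := by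
    rw [← hfin]
    rw [← ofReal_norm, Complex.norm_real, Real.norm_eq_abs, hs] at hW
    refine hW.trans ?_
    gcongr
    · exact hgrad w
    · exact hgrad v
  exact (ENNReal.ofReal_le_ofReal_iff (by unfold wenteC; positivity)).1 hW2

end Wente

end TriMesh

/-! ### The trilinear estimate for the upwind convection -/

namespace TriMesh

variable {Ω : Set Plane} {m : TriMesh Ω} {c : ℝ}

section Trilinear

/-- The constant in the bound of edge sums by cell sums. -/
def edgeC (c : ℝ) : ℝ := 12 / (Real.pi * c ^ 4)

lemma edgeC_nonneg (c : ℝ) : 0 ≤ edgeC c := by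
  have := Real.pi_pos; unfold edgeC; positivity

/-- On a regular mesh the square of an edge length, at most 4h², is dominated by the area of the
triangle, at least π c⁴ h². -/
lemma sum_sq_ln_mul_nc_le (hm : m.IsRegular c) (hc : 0 < c) (D : m.P0) :
    ∑ a, (m.ln a * m.nc D a) ^ 2 ≤ edgeC c * ‖m.emb D‖ ^ 2 := by
  have hpi := Real.pi_pos
  rw [norm_emb_sq, Finset.mul_sum, sum_prod_edges]
  refine Finset.sum_le_sum fun K _ => ?_
  have hh := m.h_pos K
  have h1 : ∀ i, (m.ln (K, i) * m.nc D (K, i)) ^ 2 ≤ (2 * m.h) ^ 2 * ‖D K‖ ^ 2 := by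
    intro i
    rw [mul_pow, ← sq_abs (m.nc D (K, i))]
    have h2 : m.ln (K, i) ≤ 2 * m.h := m.len_le K i
    have h3 : 0 < m.ln (K, i) := m.ln_pos _
    have h4 : |m.nc D (K, i)| ≤ ‖D K‖ := abs_nc_le D (K, i)
    gcongr
  refine (Finset.sum_le_sum fun i _ => h1 i).trans ?_
  have h2 := hm.le_area hc K
  simp only [Finset.sum_const, Finset.card_univ, Fintype.card_fin, nsmul_eq_mul]
  have h3 : 12 * m.h ^ 2 ≤ edgeC c * m.area K := by
    calc 12 * m.h ^ 2 = edgeC c * (Real.pi * (c ^ 2 * m.h) ^ 2) := by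
          unfold edgeC; field_simp
      _ ≤ _ := by gcongr; exact edgeC_nonneg c
  push_cast
  nlinarith [sq_nonneg ‖D K‖]

lemma sum_ln_mul_abs_nc_mul_le (hm : m.IsRegular c) (hc : 0 < c) (D : m.P0)
    {F : Type} [NormedAddCommGroup F] (v : Fin m.num → F) :
    ∑ a, m.ln a * |m.nc D a| * ‖m.jump v a‖ ≤ √(edgeC c) * (‖m.emb D‖ * √(m.jumpSq v)) := by
  have h1 := Finset.sum_mul_sq_le_sq_mul_sq Finset.univ (fun a => m.ln a * |m.nc D a|)
    (fun a => ‖m.jump v a‖)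
  have h2 := sum_sq_ln_mul_nc_le hm hc D
  have hE := edgeC_nonneg c
  simp only [mul_pow, sq_abs] at h1 h2
  apply le_of_sq_le_sq _ (by positivity)
  refine h1.trans ?_
  rw [mul_pow, mul_pow, Real.sq_sqrt hE, Real.sq_sqrt (m.jumpSq_nonneg v), ← mul_assoc]
  exact mul_le_mul_of_nonneg_right h2 (m.jumpSq_nonneg v)

variable {η : ContDiffBump (0 : Plane)}

/-- Discrete Green formula, transferring the derivative from φ to the jumps of v. It links the
centred edge form to an integral form over triangles. -/
lemma sum_mul_setIntegral_fderiv_eq {D : m.P0} (hD : m.IsRT0 D) (v : Fin m.num → ℝ)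
    {φ : Plane → ℝ} (hφ : ContDiff ℝ 1 φ) :
    ∑ K, v K * ∫ x in m.cell K, fderiv ℝ φ x (D K) =
      -(1 / 2 * ∑ a, m.ln a * m.nc D a * m.jump v a * edgeMean φ (m.pt a.1) a.2) := by
  set g := fun a : Fin m.num × Fin 3 => m.ln a * m.nc D a * edgeMean φ (m.pt a.1) a.2 with hg
  have h1 : ∑ K, v K * ∫ x in m.cell K, fderiv ℝ φ x (D K) = ∑ a : Fin m.num × Fin 3,
      v a.1 * g a := by
    rw [sum_prod_edges]
    refine Finset.sum_congr rfl fun K _ => ?_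
    rw [setIntegral_cell_fderiv_apply D K hφ, Finset.mul_sum]
  have h2 := sum_opp fun a => v a.1 * g a
  have h3 : ∀ a, v a.1 * g a + v (m.opp a).1 * g (m.opp a) =
      -(m.ln a * m.nc D a * m.jump v a * edgeMean φ (m.pt a.1) a.2) := by
    intro a
    by_cases h : m.opp a = a
    · simp only [h, hg, hD.nc_of_eq h]; ring
    · simp only [hg]
      rw [ln_opp, hD.nc_opp, (isOpp_opp h).edgeMean, jump, nb_of_ne h]; ring
  have h4 : 2 * ∑ a : Fin m.num × Fin 3, v a.1 * g a =
      -∑ a, m.ln a * m.nc D a * m.jump v a * edgeMean φ (m.pt a.1) a.2 := by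
    rw [← Finset.sum_neg_distrib, ← Finset.sum_congr rfl fun a _ => h3 a, Finset.sum_add_distrib,
      h2, two_mul]
  rw [h1]; linarith

lemma abs_edgeMean_moll_sub_le (hm : m.IsRegular c) (hc : 0 < c) (hin : η.rIn = c ^ 2 * m.h / 2)
    (hout : η.rOut = c ^ 2 * m.h) (w : Fin m.num → ℝ) (a : Fin m.num × Fin 3) :
    |w a.1 - edgeMean (m.moll η w) (m.pt a.1) a.2| ≤ √(gradC c) * √(m.jumpSq w) := by
  rw [abs_sub_comm]
  exact edgeMean_mem_of_forall (contDiff_moll η w).continuous fun x hx =>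
    abs_moll_sub_le hm hc hin hout w (m.edge_subset_cell _ _ hx)

lemma integrable_fderiv_moll_sq (w : Fin m.num → ℝ) (e : Plane) :
    Integrable fun x => (fderiv ℝ (m.moll η w) x e) ^ 2 := by
  have hcw : Continuous fun x => fderiv ℝ (m.moll η w) x e :=
    ((contDiff_moll η w).continuous_fderiv (by simp)).clm_apply continuous_const
  have h1 : HasCompactSupport fun x => fderiv ℝ (m.moll η w) x e :=
    HasCompactSupport.intro' (hasCompactSupport_moll η w) (isClosed_tsupport _) fun x hx => by
      rw [fderiv_of_notMem_tsupport ℝ hx]; rfl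
  simp only [sq]
  exact (hcw.mul hcw).integrable_of_hasCompactSupport h1.mul_left

/-- Cauchy–Schwarz, obtained as nonnegativity of the variance of |f| on the triangle. -/
lemma sq_setIntegral_abs_le (K : Fin m.num) {f : Plane → ℝ} (hf : Continuous f) :
    (∫ x in m.cell K, |f x|) ^ 2 ≤ m.area K * ∫ x in m.cell K, f x ^ 2 := by
  have hI : IntegrableOn (fun x => |f x|) (m.cell K) :=
    hf.abs.continuousOn.integrableOn_compact (m.isCompact_cell K)
  have hI2 : IntegrableOn (fun x => f x ^ 2) (m.cell K) :=
    (hf.pow 2).continuousOn.integrableOn_compact (m.isCompact_cell K)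
  set b := ∫ x in m.cell K, |f x| with hb
  have ha := m.area_pos K
  have h0 : 0 ≤ ∫ x in m.cell K, (|f x| - b / m.area K) ^ 2 :=
    integral_nonneg fun x => sq_nonneg _
  have h1 : ∫ x in m.cell K, (|f x| - b / m.area K) ^ 2 =
      (∫ x in m.cell K, f x ^ 2) - b ^ 2 / m.area K := by
    have e : ∀ x, (|f x| - b / m.area K) ^ 2 =
        (f x ^ 2 - (2 * (b / m.area K)) * |f x|) + (b / m.area K) ^ 2 := by
      intro x; rw [sub_sq, sq_abs]; ring
    simp only [e]
    have hI3 : IntegrableOn (fun x => f x ^ 2 - (2 * (b / m.area K)) * |f x|) (m.cell K) :=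
      hI2.sub (hI.const_mul _)
    rw [integral_add hI3 (integrableOn_const (volume_cell_ne_top K)),
      integral_sub hI2 (hI.const_mul _), integral_const_mul, ← hb, setIntegral_const, smul_eq_mul]
    change _ + m.area K * _ = _
    field_simp
    ring
  rw [h1] at h0
  have h3 : b ^ 2 / m.area K ≤ ∫ x in m.cell K, f x ^ 2 := by linarith
  rw [div_le_iff₀ ha] at h3
  linarith

lemma integral_fderiv_moll_sq_le (hm : m.IsRegular c) (hc : 0 < c) (hh : 0 < m.h)
    (hin : η.rIn = c ^ 2 * m.h / 2) (hout : η.rOut = c ^ 2 * m.h) (w : Fin m.num → ℝ)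
    (i : Fin 2) :
    ∫ x, (fderiv ℝ (m.moll η w) x (EuclideanSpace.single i 1)) ^ 2 ≤
      4 * Real.pi * gradC c * m.jumpSq w := by
  have hpi := Real.pi_pos
  have hG := gradC_nonneg c
  have hJ := m.jumpSq_nonneg w
  have h2 := lintegral_fderiv_moll_sq_le hm hc hh hin hout w (EuclideanSpace.single i 1)
  simp only [PiLp.norm_single, norm_one, one_pow, mul_one] at h2
  rw [integral_eq_lintegral_of_nonneg_ae (Eventually.of_forall fun x => sq_nonneg _)
    (integrable_fderiv_moll_sq w _).1]
  apply ENNReal.toReal_le_of_le_ofReal (by positivity)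
  refine le_trans (le_of_eq ?_) h2
  congr 1; funext x
  rw [Real.enorm_eq_ofReal_abs, ← ENNReal.ofReal_pow (abs_nonneg _), sq_abs]

lemma sum_setIntegral_abs_fderiv_le (hm : m.IsRegular c) (hc : 0 < c) (hh : 0 < m.h)
    (hin : η.rIn = c ^ 2 * m.h / 2) (hout : η.rOut = c ^ 2 * m.h) (D : m.P0)
    (w : Fin m.num → ℝ) :
    ∑ K, ∫ x in m.cell K, |fderiv ℝ (m.moll η w) x (D K)| ≤
      ‖m.emb D‖ * √(8 * Real.pi * gradC c * m.jumpSq w) := by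
  have hpi := Real.pi_pos
  have hG := gradC_nonneg c
  have hJ := m.jumpSq_nonneg w
  set P : Plane → ℝ := fun x => ∑ i : Fin 2,
    (fderiv ℝ (m.moll η w) x (EuclideanSpace.single i 1)) ^ 2 with hP
  have hPi : Integrable P := integrable_finsetSum _ fun i _ => integrable_fderiv_moll_sq w _
  have hP0 : ∀ x, 0 ≤ P x := fun x => Finset.sum_nonneg fun i _ => sq_nonneg _
  have hcw : Continuous (fderiv ℝ (m.moll η w)) := (contDiff_moll η w).continuous_fderiv (by simp)
  have hpt : ∀ K x, (fderiv ℝ (m.moll η w) x (D K)) ^ 2 ≤ ‖D K‖ ^ 2 * P x := by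
    intro K x
    rw [show fderiv ℝ (m.moll η w) x (D K) = fderiv ℝ (m.moll η w) x
      (D K 0 • EuclideanSpace.single 0 1 + D K 1 • EuclideanSpace.single 1 1) by
        congr 1; ext j; fin_cases j <;> simp]
    rw [map_add, map_smul, map_smul, smul_eq_mul, smul_eq_mul, EuclideanSpace.real_norm_sq_eq, hP]
    simp only [Fin.sum_univ_two]
    nlinarith [sq_nonneg (D K 0 * fderiv ℝ (m.moll η w) x (EuclideanSpace.single 1 1) -
      D K 1 * fderiv ℝ (m.moll η w) x (EuclideanSpace.single 0 1))]
  have hK : ∀ K, ∫ x in m.cell K, |fderiv ℝ (m.moll η w) x (D K)| ≤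
      (√(m.area K) * ‖D K‖) * √(∫ x in m.cell K, P x) := by
    intro K
    have hcont : Continuous fun x => fderiv ℝ (m.moll η w) x (D K) := hcw.clm_apply continuous_const
    have hI2 : IntegrableOn (fun x => (fderiv ℝ (m.moll η w) x (D K)) ^ 2) (m.cell K) :=
      (hcont.pow 2).continuousOn.integrableOn_compact (m.isCompact_cell K)
    set b := ∫ x in m.cell K, |fderiv ℝ (m.moll η w) x (D K)| with hb
    have ha := m.area_pos K
    have hcs := sq_setIntegral_abs_le K hcont
    rw [← hb] at hcs
    have h4 : ∫ x in m.cell K, (fderiv ℝ (m.moll η w) x (D K)) ^ 2 ≤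
        ‖D K‖ ^ 2 * ∫ x in m.cell K, P x := by
      rw [← integral_const_mul]
      exact integral_mono hI2 (hPi.integrableOn.const_mul _) (hpt K)
    have h5 : 0 ≤ ∫ x in m.cell K, P x := integral_nonneg hP0
    apply le_of_sq_le_sq _ (by positivity)
    rw [mul_pow, mul_pow, Real.sq_sqrt ha.le, Real.sq_sqrt h5]
    nlinarith
  refine (Finset.sum_le_sum fun K _ => hK K).trans ?_
  have h6 := Finset.sum_mul_sq_le_sq_mul_sq Finset.univ (fun K => √(m.area K) * ‖D K‖)
    (fun K => √(∫ x in m.cell K, P x))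
  have h7 : ∑ K, (√(m.area K) * ‖D K‖) ^ 2 = ‖m.emb D‖ ^ 2 := by
    rw [norm_emb_sq]
    refine Finset.sum_congr rfl fun K _ => ?_
    rw [mul_pow, Real.sq_sqrt (m.area_pos K).le]
  have h8 : ∑ K, √(∫ x in m.cell K, P x) ^ 2 ≤ 8 * Real.pi * gradC c * m.jumpSq w := by
    calc ∑ K, √(∫ x in m.cell K, P x) ^ 2 = ∑ K, ∫ x in m.cell K, P x :=
          Finset.sum_congr rfl fun K _ => Real.sq_sqrt (integral_nonneg hP0)
      _ ≤ ∫ x, P x := sum_setIntegral_le hPi hP0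
      _ = ∑ i : Fin 2, ∫ x, (fderiv ℝ (m.moll η w) x (EuclideanSpace.single i 1)) ^ 2 :=
          integral_finsetSum _ fun i _ => integrable_fderiv_moll_sq w _
      _ ≤ ∑ i : Fin 2, 4 * Real.pi * gradC c * m.jumpSq w :=
          Finset.sum_le_sum fun i _ => integral_fderiv_moll_sq_le hm hc hh hin hout w i
      _ = _ := by rw [Fin.sum_univ_two]; ring
  apply le_of_sq_le_sq _ (by positivity)
  rw [mul_pow, Real.sq_sqrt (by positivity)]
  refine h6.trans ?_
  rw [h7]
  exact mul_le_mul_of_nonneg_left h8 (sq_nonneg _)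

/-- The constant in the estimate of the centered trilinear form. -/
def centC (c : ℝ) : ℝ := √(edgeC c) * √(gradC c) + √(gradC c) * √(8 * Real.pi * gradC c) + wenteC c

/-- The edge form B is compared with minus the form S having the mollified w, then S with the form
S' having both arguments mollified. The two errors are controlled because mollification changes a
value by at most a multiple of the square root of the sum of squared jumps; S' itself is the
compensated-compactness term. -/
lemma abs_centered_le (hm : m.IsRegular c) (hc : 0 < c) (hh : 0 < m.h) {D : m.P0}
    (hD : m.IsRT0 D) (v w : Fin m.num → ℝ) :
    |1 / 2 * ∑ a, m.ln a * m.nc D a * (m.jump v a * w a.1)| ≤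
      centC c * (‖m.emb D‖ * √(m.jumpSq v) * √(m.jumpSq w)) := by
  obtain ⟨η, hin, hout⟩ := IsRegular.exists_bump (m := m) hc hh
  have hpi := Real.pi_pos
  have hG := gradC_nonneg c
  have hJ := m.jumpSq_nonneg w
  set X := ‖m.emb D‖ * √(m.jumpSq v) * √(m.jumpSq w) with hX
  set B := 1 / 2 * ∑ a, m.ln a * m.nc D a * (m.jump v a * w a.1) with hB
  set S := ∑ K, v K * ∫ x in m.cell K, fderiv ℝ (m.moll η w) x (D K) with hS
  set S' := ∑ K, ∫ x in m.cell K, fderiv ℝ (m.moll η w) x (D K) * m.moll η v x with hS'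
  have hcw : Continuous (fderiv ℝ (m.moll η w)) := (contDiff_moll η w).continuous_fderiv (by simp)
  have hcv : Continuous (m.moll η v) := (contDiff_moll η v).continuous
  -- Error from replacing w_K on an edge by the edge mean of its mollification.
  have h1 : |B + S| ≤ √(edgeC c) * √(gradC c) * X := by
    rw [hS, sum_mul_setIntegral_fderiv_eq hD v ((contDiff_moll η w).of_le (by simp)), hB, ← sub_eq_add_neg,
      ← mul_sub, ← Finset.sum_sub_distrib, abs_mul]
    have h2 : |∑ a, (m.ln a * m.nc D a * (m.jump v a * w a.1) -
        m.ln a * m.nc D a * m.jump v a * edgeMean (m.moll η w) (m.pt a.1) a.2)| ≤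
        ∑ a, m.ln a * |m.nc D a| * ‖m.jump v a‖ * (√(gradC c) * √(m.jumpSq w)) := by
      refine (Finset.abs_sum_le_sum_abs _ _).trans (Finset.sum_le_sum fun a _ => ?_)
      rw [show m.ln a * m.nc D a * (m.jump v a * w a.1) -
        m.ln a * m.nc D a * m.jump v a * edgeMean (m.moll η w) (m.pt a.1) a.2 =
        m.ln a * m.nc D a * m.jump v a * (w a.1 - edgeMean (m.moll η w) (m.pt a.1) a.2) by ring,
        abs_mul, abs_mul, abs_mul, abs_of_pos (ln_pos a), Real.norm_eq_abs]
      exact mul_le_mul_of_nonneg_left (abs_edgeMean_moll_sub_le hm hc hin hout w a)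
        (mul_nonneg (mul_nonneg (ln_pos a).le (abs_nonneg _)) (abs_nonneg _))
    rw [← Finset.sum_mul] at h2
    have h3 := sum_ln_mul_abs_nc_mul_le hm hc D v
    have h4 := h2.trans (mul_le_mul_of_nonneg_right h3 (by positivity))
    rw [abs_of_pos (by norm_num : (0 : ℝ) < 1 / 2)]
    have h5 : 0 ≤ √(edgeC c) * √(gradC c) * X := by positivity
    have h6 : √(edgeC c) * (‖m.emb D‖ * √(m.jumpSq v)) * (√(gradC c) * √(m.jumpSq w)) =
      √(edgeC c) * √(gradC c) * X := by rw [hX]; ring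
    rw [h6] at h4
    linarith
  -- Error from replacing v_K by its mollification inside each triangle.
  have h2 : |S - S'| ≤ √(gradC c) * √(8 * Real.pi * gradC c) * X := by
    have hK : ∀ K, |(v K * ∫ x in m.cell K, fderiv ℝ (m.moll η w) x (D K)) -
        ∫ x in m.cell K, fderiv ℝ (m.moll η w) x (D K) * m.moll η v x| ≤
        (√(gradC c) * √(m.jumpSq v)) * ∫ x in m.cell K, |fderiv ℝ (m.moll η w) x (D K)| := by
      intro K
      have hcont : Continuous fun x => fderiv ℝ (m.moll η w) x (D K) :=
        hcw.clm_apply continuous_const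
      rw [← integral_const_mul, ← integral_sub, ← integral_const_mul]
      · refine (abs_integral_le_integral_abs).trans ?_
        refine setIntegral_mono_on ?_ ?_ (m.measurableSet_cell K) fun x hx => ?_
        · exact (((hcont.const_mul _).sub
            (hcont.mul hcv)).abs).continuousOn.integrableOn_compact (m.isCompact_cell K)
        · exact (hcont.abs.const_mul _).continuousOn.integrableOn_compact (m.isCompact_cell K)
        · rw [show v K * fderiv ℝ (m.moll η w) x (D K) - fderiv ℝ (m.moll η w) x (D K) *
            m.moll η v x = (v K - m.moll η v x) * fderiv ℝ (m.moll η w) x (D K) by ring, abs_mul,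
            abs_sub_comm]
          exact mul_le_mul_of_nonneg_right (abs_moll_sub_le hm hc hin hout v hx) (abs_nonneg _)
      · exact (hcont.const_mul _).continuousOn.integrableOn_compact (m.isCompact_cell K)
      · exact (hcont.mul hcv).continuousOn.integrableOn_compact (m.isCompact_cell K)
    rw [hS, hS', ← Finset.sum_sub_distrib]
    refine (Finset.abs_sum_le_sum_abs _ _).trans ((Finset.sum_le_sum fun K _ => hK K).trans ?_)
    rw [← Finset.mul_sum]
    have h4 := sum_setIntegral_abs_fderiv_le hm hc hh hin hout D w
    refine (mul_le_mul_of_nonneg_left h4 (by positivity)).trans (le_of_eq ?_)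
    rw [Real.sqrt_mul (by positivity), hX]; ring
  have h3 : |S'| ≤ wenteC c * X := abs_sum_moll_convection_le hm hc hh hin hout hD v w
  have h4 : |B| ≤ |B + S| + |S - S'| + |S'| := by
    have : B = (B + S) - (S - S') - S' := by ring
    calc |B| = |(B + S) - (S - S') - S'| := by rw [← this]
      _ ≤ |(B + S) - (S - S')| + |S'| := abs_sub _ _
      _ ≤ _ := by gcongr; exact abs_sub _ _
  rw [centC]
  linarith

/-- The upwind part is Lipschitz in the transport field by the reverse triangle inequality. It
contains two jumps, one of which is simply bounded by its maximum, hence by the square root of the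
sum of squares. -/
lemma abs_upwind_le (hm : m.IsRegular c) (hc : 0 < c) (w w' v z : m.P0) :
    |1 / 4 * ∑ e, m.ln e * (|m.nc w e| - |m.nc w' e|) * inner ℝ (m.jump v e) (m.jump z e)| ≤
      √(edgeC c) * (‖m.emb (w - w')‖ * √(m.jumpSq v) * √(m.jumpSq z)) := by
  have h3 : |∑ e, m.ln e * (|m.nc w e| - |m.nc w' e|) * inner ℝ (m.jump v e) (m.jump z e)| ≤
      ∑ e, m.ln e * |m.nc (w - w') e| * ‖m.jump v e‖ * √(m.jumpSq z) := by
    refine (Finset.abs_sum_le_sum_abs _ _).trans (Finset.sum_le_sum fun a _ => ?_)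
    rw [abs_mul, abs_mul, abs_of_pos (ln_pos a), nc_sub, mul_assoc (m.ln a * _)]
    refine mul_le_mul ?_ ?_ (abs_nonneg _) (mul_nonneg (ln_pos a).le (abs_nonneg _))
    · exact mul_le_mul_of_nonneg_left (abs_abs_sub_abs_le_abs_sub _ _) (ln_pos a).le
    · refine (abs_real_inner_le_norm _ _).trans ?_
      exact mul_le_mul_of_nonneg_left (norm_jump_le _ _ _) (norm_nonneg _)
  rw [← Finset.sum_mul] at h3
  have h4 := h3.trans (mul_le_mul_of_nonneg_right (sum_ln_mul_abs_nc_mul_le hm hc (w - w') v)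
    (Real.sqrt_nonneg (m.jumpSq z)))
  rw [abs_mul, abs_of_pos (by norm_num : (0 : ℝ) < 1 / 4)]
  have h7 := (abs_nonneg _).trans h4
  rw [show √(edgeC c) * (‖m.emb (w - w')‖ * √(m.jumpSq v)) * √(m.jumpSq z) =
    √(edgeC c) * (‖m.emb (w - w')‖ * √(m.jumpSq v) * √(m.jumpSq z)) by ring] at h4 h7
  linarith

/-- The constant in the estimate of the convection term. -/
def triC (c : ℝ) : ℝ := 2 * centC c + √(edgeC c)

lemma triC_nonneg (c : ℝ) : 0 ≤ triC c := by
  have := gradC_nonneg c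
  have := Real.pi_pos
  unfold triC centC wenteC; positivity

/-- The trilinear estimate for the upwind convection term. -/
theorem abs_inner_conv_sub_le (hm : m.IsRegular c) (hc : 0 < c) {w w' : m.P0}
    (hw : m.IsRT0 w) (hw' : m.IsRT0 w') (v z : m.P0) :
    |inner ℝ (m.emb (m.conv w v - m.conv w' v)) (m.emb z)| ≤
      triC c * (‖m.emb (w - w')‖ * √(m.jumpSq v) * √(m.jumpSq z)) := by
  rcases Nat.eq_zero_or_pos m.num with h0 | h0
  · have : IsEmpty (Fin m.num) := by rw [h0]; infer_instance
    have := triC_nonneg c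
    rw [inner_emb]
    simp only [Finset.univ_eq_empty, Finset.sum_empty, abs_zero]
    positivity
  have hh := m.h_pos ⟨0, h0⟩
  have hD : m.IsRT0 (w - w') := hw.sub hw'
  have hcent : 0 ≤ centC c := by
    have := gradC_nonneg c
    have := Real.pi_pos
    unfold centC wenteC; positivity
  set X := ‖m.emb (w - w')‖ * √(m.jumpSq v) * √(m.jumpSq z) with hX
  have h1 : ∀ j : Fin 2, |1 / 2 * ∑ a, m.ln a * m.nc (w - w') a *
      (m.jump v a j * z a.1 j)| ≤ centC c * X := by
    intro j
    have h2 := abs_centered_le hm hc hh hD (fun K => v K j) (fun K => z K j)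
    simp only [jump_coord] at h2
    refine h2.trans ?_
    have h3 := Real.sqrt_le_sqrt (jumpSq_coord_le v j)
    have h4 := Real.sqrt_le_sqrt (jumpSq_coord_le z j)
    exact mul_le_mul_of_nonneg_left (mul_le_mul (mul_le_mul_of_nonneg_left h3 (norm_nonneg _)) h4
      (Real.sqrt_nonneg _) (mul_nonneg (norm_nonneg _) (Real.sqrt_nonneg _))) hcent
  have h2 := abs_upwind_le hm hc w w' v z
  rw [inner_conv_sub hw hw']
  have h3 : 1 / 2 * ∑ e, m.ln e * m.nc (w - w') e * inner ℝ (m.jump v e) (z e.1) =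
      (1 / 2 * ∑ a, m.ln a * m.nc (w - w') a * (m.jump v a 0 * z a.1 0)) +
      1 / 2 * ∑ a, m.ln a * m.nc (w - w') a * (m.jump v a 1 * z a.1 1) := by
    rw [← mul_add, ← Finset.sum_add_distrib]
    congr 1
    refine Finset.sum_congr rfl fun a _ => ?_
    rw [plane_inner]; ring
  rw [h3]
  refine (abs_add_three _ _ _).trans ?_
  rw [triC]
  linarith [h1 0, h1 1]

end Trilinear

end TriMesh

/-! ### Energy identity of the two-step projection scheme and Gronwall lemmas -/

section AbstractEnergy

variable {H : Type*} [NormedAddCommGroup H] [InnerProductSpace ℝ H]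

/-- The energy identity of the incremental projection step with the two step backward difference
formula. -/
lemma bdf_projection_identity {k : ℝ} (hk : 0 < k) {x xt y z g g' s : H}
    (hs : (2 * k)⁻¹ • ((3 : ℝ) • xt - (4 : ℝ) • y + z) + g = s)
    (hx : x = xt - (2 * k / 3) • (g' - g))
    (hxg : inner ℝ x g = 0) (hxg' : inner ℝ x g' = 0) (hyg : inner ℝ y g = 0)
    (hyg' : inner ℝ y g' = 0) (hzg : inner ℝ z g = 0) (hzg' : inner ℝ z g' = 0) :
    ‖x‖ ^ 2 + ‖(2 : ℝ) • x - y‖ ^ 2 + 4 * k ^ 2 / 3 * ‖g'‖ ^ 2 + 3 * ‖xt - x‖ ^ 2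
      + ‖x - (2 : ℝ) • y + z‖ ^ 2 =
      ‖y‖ ^ 2 + ‖(2 : ℝ) • y - z‖ ^ 2 + 4 * k ^ 2 / 3 * ‖g‖ ^ 2 + 4 * k * inner ℝ s xt := by
  -- The predicted velocity is eliminated. The orthogonality of x, y, z to g and g' removes every
  -- mixed velocity-pressure product, and the rest is polynomial algebra in inner products.
  have hxt : xt = x + (2 * k / 3) • (g' - g) := by rw [hx]; abel
  subst hs
  rw [hxt]
  simp only [← real_inner_self_eq_norm_sq, add_sub_cancel_left]
  simp only [inner_add_left, inner_add_right, inner_sub_left, inner_sub_right,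
    real_inner_smul_left, real_inner_smul_right]
  rw [real_inner_comm x g, real_inner_comm x g', real_inner_comm y x, real_inner_comm z x,
    real_inner_comm z y, hxg, hxg', hyg, hyg', hzg, hzg', real_inner_comm g g']
  field_simp
  ring

/-- The source pairs with the predicted velocity whereas the energy contains the projected one.
Their distance is absorbed by the dissipated term 3‖xt - x‖², at the cost of 4/3 k² φ². -/
lemma bdf_energy_step {k φ Q r : ℝ} (hk : 0 < k) {x xt y z g g' s : H}
    (hs : (2 * k)⁻¹ • ((3 : ℝ) • xt - (4 : ℝ) • y + z) + g = s)
    (hx : x = xt - (2 * k / 3) • (g' - g))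
    (hxg : inner ℝ x g = 0) (hxg' : inner ℝ x g' = 0) (hyg : inner ℝ y g = 0)
    (hyg' : inner ℝ y g' = 0) (hzg : inner ℝ z g = 0) (hzg' : inner ℝ z g' = 0)
    (hφ : 0 ≤ φ) (hr : inner ℝ s xt ≤ φ * ‖xt‖ - Q + r) :
    ‖x‖ ^ 2 + ‖(2 : ℝ) • x - y‖ ^ 2 + 4 * k ^ 2 / 3 * ‖g'‖ ^ 2 + 4 * k * Q ≤
      ‖y‖ ^ 2 + ‖(2 : ℝ) • y - z‖ ^ 2 + 4 * k ^ 2 / 3 * ‖g‖ ^ 2 + 4 * k * φ * ‖x‖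
        + 4 / 3 * k ^ 2 * φ ^ 2 + 4 * k * r := by
  have h1 := bdf_projection_identity hk hs hx hxg hxg' hyg hyg' hzg hzg'
  have h2 : ‖xt‖ ≤ ‖x‖ + ‖xt - x‖ := by
    calc ‖xt‖ = ‖x + (xt - x)‖ := by rw [add_sub_cancel]
      _ ≤ _ := norm_add_le _ _
  have h3 := mul_le_mul_of_nonneg_left hr (by positivity : 0 ≤ 4 * k)
  have h4 : 4 * k * (φ * ‖xt‖) ≤ 4 * k * φ * ‖x‖ + 4 * k * φ * ‖xt - x‖ := by
    have := mul_le_mul_of_nonneg_left h2 (by positivity : 0 ≤ 4 * k * φ)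
    linarith
  have h5 : 4 * k * φ * ‖xt - x‖ ≤ 3 * ‖xt - x‖ ^ 2 + 4 / 3 * k ^ 2 * φ ^ 2 := by
    nlinarith [sq_nonneg (3 * ‖xt - x‖ - 2 * k * φ)]
  have h6 := sq_nonneg ‖x - (2 : ℝ) • y + z‖
  linarith

lemma discrete_gronwall {N s : ℕ} {Y g b : ℕ → ℝ} (hb : ∀ n, 0 ≤ b n)
    (hg : ∀ n, 0 ≤ g n) (h : ∀ n, s ≤ n → n < N → Y (n + 1) ≤ Real.exp (g n) * Y n + b n) :
    ∀ n, s ≤ n → n ≤ N → Y n ≤ Real.exp (∑ j ∈ Finset.Ico s n, g j) *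
      (Y s + ∑ j ∈ Finset.Ico s n, b j) := by
  intro n hn
  induction n, hn using Nat.le_induction with
  | base => intro _; simp
  | succ n hn ih =>
    intro hN
    have h1 := h n hn (by omega)
    have h2 := ih (by omega)
    rw [Finset.sum_Ico_succ_top hn, Finset.sum_Ico_succ_top hn]
    have h3 := mul_le_mul_of_nonneg_left h2 (Real.exp_pos (g n)).le
    have h4 : 1 ≤ Real.exp (∑ j ∈ Finset.Ico s n, g j + g n) :=
      Real.one_le_exp (add_nonneg (Finset.sum_nonneg fun _ _ => hg _) (hg n))
    have h5 := mul_le_mul_of_nonneg_right h4 (hb n)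
    rw [Real.exp_add] at h5 ⊢
    calc Y (n + 1) ≤ _ := h1
      _ ≤ Real.exp (g n) * (Real.exp (∑ j ∈ Finset.Ico s n, g j) *
        (Y s + ∑ j ∈ Finset.Ico s n, b j)) + Real.exp (∑ j ∈ Finset.Ico s n, g j) *
          Real.exp (g n) * b n := by linarith
      _ = _ := by ring

/-- The inequality 1/(1 - s) ≤ 1 + 2s on [0, 1/2], used to remove implicit terms before Gronwall. -/
lemma le_of_one_sub_mul_le {s Y Z : ℝ} (hs : 0 ≤ s) (hs2 : s ≤ 1 / 2) (hZ : 0 ≤ Z)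
    (h : (1 - s) * Y ≤ Z) : Y ≤ (1 + 2 * s) * Z := by
  have h2 : Y ≤ Z / (1 - s) := by rw [le_div_iff₀ (by linarith)]; linarith
  refine h2.trans ?_
  rw [div_le_iff₀ (by linarith)]
  have := mul_nonneg hZ (mul_nonneg hs (by linarith : 0 ≤ 1 - 2 * s))
  linarith

end AbstractEnergy

/-! ### Coercivity and structural properties of the scheme -/

namespace TriMesh

variable {Ω : Set Plane} {m : TriMesh Ω} {c : ℝ}

section Operators

lemma smul_area_injective {v w : m.P0} (h : ∀ K, m.area K • v K = m.area K • w K) : v = w :=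
  funext fun K => smul_right_injective _ (m.area_pos K).ne' (h K)

lemma lap_sub (v w : m.P0) : m.lap (v - w) = m.lap v - m.lap w := by
  apply smul_area_injective
  intro K
  rw [Pi.sub_apply, smul_sub, area_smul_lap, area_smul_lap, area_smul_lap,
    ← Finset.sum_sub_distrib]
  simp only [jump_sub, smul_sub]

lemma conv_sub {w : m.P0} (hw : m.IsRT0 w) (v z : m.P0) :
    m.conv w (v - z) = m.conv w v - m.conv w z := by
  apply smul_area_injective
  intro K
  rw [Pi.sub_apply, smul_sub, area_smul_conv hw, area_smul_conv hw, area_smul_conv hw,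
    ← Finset.sum_sub_distrib]
  simp only [jump_sub, smul_sub]

lemma dist_ctr_mid_pos (e : Fin m.num × Fin 3) : 0 < dist (m.ctr e.1) (m.mid e.1 e.2) := by
  rw [dist_pos]
  intro h
  have h1 := m.coord_ctr_pos e.1 e.2
  rw [h, coord_mid] at h1
  simp at h1

lemma dist_ctr_opp_pos {e : Fin m.num × Fin 3} (h : m.opp e ≠ e) :
    0 < dist (m.ctr e.1) (m.ctr (m.opp e).1) := by
  rw [dist_pos]
  intro h1
  have h2 := m.ctr_mem_interior (m.opp e).1
  rw [← h1] at h2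
  exact (isOpp_opp h).1 (m.interior_cell_disjoint (m.ctr_mem_interior _) h2).symm

lemma dist_ctr_mid_le (e : Fin m.num × Fin 3) : dist (m.ctr e.1) (m.mid e.1 e.2) ≤ m.h := by
  rw [dist_comm]
  exact dist_ctr_le_h (m.edge_subset_cell _ _ (m.mid_mem_edge _ _))

/-- Edges have length at least c h, and d_σ is at most 2h, by passing through the midpoint between
two circumcentres. -/
lemma IsRegular.le_tr (hm : m.IsRegular c) (hc : 0 < c) (e : Fin m.num × Fin 3) :
    c / 2 ≤ m.tr e := by
  have hh := m.h_pos e.1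
  have h1 : c * m.h ≤ m.ln e := (hm e.1 e.2).2
  by_cases h : m.opp e = e
  · rw [tr_of_eq h, le_div_iff₀ (dist_ctr_mid_pos e)]
    have := dist_ctr_mid_le e
    nlinarith
  · rw [tr_of_ne h, le_div_iff₀ (dist_ctr_opp_pos h)]
    have h2 := dist_ctr_mid_le e
    have h3 := dist_ctr_mid_le (m.opp e)
    rw [(isOpp_opp h).mid] at h3
    have h4 := dist_triangle_right (m.ctr e.1) (m.ctr (m.opp e).1) (m.mid e.1 e.2)
    nlinarith

lemma IsRegular.jumpSq_le_neg_inner_lap (hm : m.IsRegular c) (hc : 0 < c) (v : m.P0) :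
    c / 4 * m.jumpSq v ≤ -inner ℝ (m.emb (m.lap v)) (m.emb v) := by
  refine le_trans ?_ (half_sum_le_neg_inner_lap v)
  rw [jumpSq, Finset.mul_sum, Finset.mul_sum]
  refine Finset.sum_le_sum fun e _ => ?_
  have h1 := mul_le_mul_of_nonneg_right (hm.le_tr hc e) (sq_nonneg ‖m.jump v e‖)
  linarith

end Operators

section Scheme

variable {Re k : ℝ} {N : ℕ} {f : ℝ → L2 Ω Plane} {u ut : ℕ → m.P0} {p : ℕ → m.P1d}

lemma IsSchemeSolution.isRT0 (hS : m.IsSchemeSolution Re k N f u ut p) (hk : 0 < k) {n : ℕ}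
    (hn : n ≤ N) : m.IsRT0 (u n) := by
  match n with
  | 0 => exact hS.rt_zero
  | 1 => exact hS.rt_one
  | n + 2 =>
    rw [hS.correction (n + 1) (by omega) (by omega)]
    exact isRT0_of_correction hk (hS.pressure (n + 1) (by omega) (by omega))

lemma IsSchemeSolution.isP1nc (hS : m.IsSchemeSolution Re k N f u ut p) {n : ℕ}
    (h1 : 1 ≤ n) (hn : n ≤ N) : m.IsP1nc (p n) := by
  rcases Nat.lt_or_ge 1 n with h | h
  · obtain ⟨j, rfl⟩ : ∃ j, n = j + 1 := ⟨n - 1, by omega⟩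
    exact (hS.pressure_mem j (by omega) (by omega)).1
  · obtain rfl : n = 1 := by omega
    exact hS.p_one.1

lemma IsSchemeSolution.inner_grad (hS : m.IsSchemeSolution Re k N f u ut p) (hk : 0 < k) {i j : ℕ}
    (hi : i ≤ N) (h1 : 1 ≤ j) (hj : j ≤ N) :
    inner ℝ (m.emb (u i)) (m.emb (m.grad (p j))) = 0 :=
  inner_grad_of_isRT0 (hS.isP1nc h1 hj) (hS.isRT0 hk hi)

lemma IsSchemeSolution.isRT0_extrap (hS : m.IsSchemeSolution Re k N f u ut p) (hk : 0 < k) {n : ℕ}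
    (hn : n ≤ N) : m.IsRT0 ((2 : ℝ) • u n - u (n - 1)) :=
  ((hS.isRT0 hk hn).smul 2).sub (hS.isRT0 hk (by omega))

lemma IsSchemeSolution.emb_prediction (hS : m.IsSchemeSolution Re k N f u ut p) {n : ℕ}
    (h1 : 1 ≤ n) (hn : n < N) :
    (2 * k)⁻¹ • ((3 : ℝ) • m.emb (ut (n + 1)) - (4 : ℝ) • m.emb (u n) + m.emb (u (n - 1)))
      + m.emb (m.grad (p n)) = m.emb (m.proj (f ((n + 1 : ℕ) * k)))
        + Re⁻¹ • m.emb (m.lap (ut (n + 1)))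
        - m.emb (m.conv ((2 : ℝ) • u n - u (n - 1)) (ut (n + 1))) := by
  have h := congrArg m.emb (hS.prediction n h1 hn)
  simp only [map_add, map_sub, map_smul] at h
  rw [← h]
  abel

lemma IsSchemeSolution.emb_correction (hS : m.IsSchemeSolution Re k N f u ut p) {n : ℕ}
    (h1 : 1 ≤ n) (hn : n < N) :
    m.emb (u (n + 1)) = m.emb (ut (n + 1)) -
      (2 * k / 3) • (m.emb (m.grad (p (n + 1))) - m.emb (m.grad (p n))) := by
  have h := congrArg m.emb (hS.correction n h1 hn)
  simpa only [map_sub, map_smul, grad_sub] using h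

end Scheme

end TriMesh

/-! ### The energy estimate for the solution -/

namespace TriMesh

variable {Ω : Set Plane} {m : TriMesh Ω} {c : ℝ}

section Energy

variable {Re k T : ℝ} {N : ℕ} {f : ℝ → L2 Ω Plane} {u ut : ℕ → m.P0} {p : ℕ → m.P1d}

/-- The abstract energy step with `Q` the coercive part of the diffusion; the convection is dropped
because its transport field, the extrapolated velocity, is discretely divergence free. -/
lemma IsRegular.energy_step_velocity (hm : m.IsRegular c) (hc : 0 < c) (hRe : 0 < Re) (hk : 0 < k)
    (hS : m.IsSchemeSolution Re k N f u ut p) {n : ℕ} (h1 : 1 ≤ n) (hn : n < N) :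
    ‖m.emb (u (n + 1))‖ ^ 2 + ‖(2 : ℝ) • m.emb (u (n + 1)) - m.emb (u n)‖ ^ 2
        + 4 * k ^ 2 / 3 * ‖m.emb (m.grad (p (n + 1)))‖ ^ 2
        + 4 * k * (Re⁻¹ * (c / 4 * m.jumpSq (ut (n + 1)))) ≤
      ‖m.emb (u n)‖ ^ 2 + ‖(2 : ℝ) • m.emb (u n) - m.emb (u (n - 1))‖ ^ 2
        + 4 * k ^ 2 / 3 * ‖m.emb (m.grad (p n))‖ ^ 2
        + 4 * k * ‖m.emb (m.proj (f ((n + 1 : ℕ) * k)))‖ * ‖m.emb (u (n + 1))‖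
        + 4 / 3 * k ^ 2 * ‖m.emb (m.proj (f ((n + 1 : ℕ) * k)))‖ ^ 2 := by
  have h := bdf_energy_step (r := 0) (Q := Re⁻¹ * (c / 4 * m.jumpSq (ut (n + 1)))) hk
    (hS.emb_prediction h1 hn) (hS.emb_correction h1 hn)
    (hS.inner_grad hk (by omega) h1 (by omega)) (hS.inner_grad hk (by omega) (by omega) (by omega))
    (hS.inner_grad hk (by omega) h1 (by omega)) (hS.inner_grad hk (by omega) (by omega) (by omega))
    (hS.inner_grad hk (by omega) h1 (by omega)) (hS.inner_grad hk (by omega) (by omega) (by omega))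
    (norm_nonneg (m.emb (m.proj (f ((n + 1 : ℕ) * k))))) ?_
  · linarith
  · rw [inner_sub_left, inner_add_left, real_inner_smul_left]
    have h2 := inner_conv_self_nonneg (hS.isRT0_extrap hk hn.le) (ut (n + 1))
    have h3 := mul_le_mul_of_nonneg_left (hm.jumpSq_le_neg_inner_lap hc (ut (n + 1)))
      (inv_nonneg.2 hRe.le)
    have h4 := real_inner_le_norm (m.emb (m.proj (f ((n + 1 : ℕ) * k)))) (m.emb (ut (n + 1)))
    linarith

/-- The bound of the discrete energy. -/
def energyC (T F M : ℝ) : ℝ :=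
  Real.exp 1 * ((10 + 4 / 3 * T ^ 2) * M ^ 2 + 20 * T ^ 2 * F ^ 2)

lemma energyC_nonneg (T F M : ℝ) : 0 ≤ energyC T F M := by unfold energyC; positivity

/-- The implicit weight k/(2T) is at most 1/2, so Gronwall applies with rate k/T per step; the rates
sum to at most 1, whence the factor `Real.exp 1`. With Y bounded, the step inequality is summed
again and telescopes to bound the dissipation. -/
lemma sum_le_of_energy_step {N : ℕ} {k T F M : ℝ} {Y D : ℕ → ℝ} (hk : 0 < k) (hN : 1 ≤ N)
    (hNk : N * k = T) (hY0 : ∀ n, 0 ≤ Y n) (hD : ∀ n, 0 ≤ D n)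
    (hY1 : Y 1 ≤ (10 + 4 / 3 * T ^ 2) * M ^ 2)
    (hstep : ∀ n, 1 ≤ n → n < N →
      Y (n + 1) + D n ≤ Y n + k / (2 * T) * Y (n + 1) + 10 * k * T * F ^ 2) :
    ∑ n ∈ Finset.Ico 1 N, D n ≤ 2 * energyC T F M := by
  have hkT : k ≤ T := by
    rw [← hNk]
    have : (1 : ℝ) ≤ N := by exact_mod_cast hN
    nlinarith
  have hT : 0 < T := hk.trans_le hkT
  set b : ℝ := 10 * k * T * F ^ 2 with hb
  have hb0 : 0 ≤ b := by positivity
  set σ : ℝ := k / (2 * T) with hσ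
  have hσ0 : 0 ≤ σ := by positivity
  have hσ2 : σ ≤ 1 / 2 := by rw [hσ, div_le_iff₀ (by positivity)]; linarith
  have hgr := discrete_gronwall (N := N) (s := 1) (Y := Y) (g := fun _ => k / T)
    (b := fun _ => 2 * b) (fun _ => by positivity) (fun _ => by positivity) (by
      intro n h1 hn
      have h := hstep n h1 hn
      have hJ := hD n
      have h2 := le_of_one_sub_mul_le (Y := Y (n + 1)) hσ0 hσ2 (add_nonneg (hY0 n) hb0)
        (by linarith)
      have h3 : 1 + 2 * σ ≤ Real.exp (k / T) := by
        have := Real.add_one_le_exp (k / T)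
        have e : 2 * σ = k / T := by rw [hσ]; field_simp
        linarith
      have h4 := mul_le_mul_of_nonneg_right h3 (hY0 n)
      have h5 : (1 + 2 * σ) * b ≤ 2 * b := mul_le_mul_of_nonneg_right (by linarith) hb0
      linarith)
  have hsumle : ∀ {a : ℝ} {n : ℕ}, 0 ≤ a → n ≤ N → ∑ _j ∈ Finset.Ico 1 n, a ≤ N * a := by
    intro a n ha hn
    rw [Finset.sum_const, Nat.card_Ico, nsmul_eq_mul]
    refine mul_le_mul_of_nonneg_right ?_ ha
    exact_mod_cast (by omega : n - 1 ≤ N)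
  have hNb : N * b = 10 * T ^ 2 * F ^ 2 := by rw [hb, ← hNk]; ring
  set E := energyC T F M with hE
  have hYmax : ∀ n, 1 ≤ n → n ≤ N → Y n ≤ E := by
    intro n h1 hn
    refine (hgr n h1 hn).trans ?_
    rw [hE, energyC]
    have e1 : ∑ _j ∈ Finset.Ico 1 n, k / T ≤ 1 := by
      refine (hsumle (by positivity) hn).trans (le_of_eq ?_)
      rw [← hNk]; rw [← hNk] at hT; field_simp
    have e2 : ∑ _j ∈ Finset.Ico 1 n, 2 * b ≤ 20 * T ^ 2 * F ^ 2 := by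
      refine (hsumle (by positivity) hn).trans (le_of_eq ?_)
      linarith
    refine mul_le_mul (Real.exp_le_exp.2 e1) (add_le_add hY1 e2) ?_ (Real.exp_pos _).le
    exact add_nonneg (hY0 1) (Finset.sum_nonneg fun _ _ => by positivity)
  have hE0 : 0 ≤ E := energyC_nonneg _ _ _
  have htel : ∑ n ∈ Finset.Ico 1 N, D n ≤
      ∑ n ∈ Finset.Ico 1 N, ((Y n - Y (n + 1)) + (σ * E + b)) := by
    refine Finset.sum_le_sum fun n hn => ?_
    rw [Finset.mem_Ico] at hn
    have h := hstep n hn.1 hn.2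
    have h2 := mul_le_mul_of_nonneg_left (hYmax (n + 1) (by omega) (by omega)) hσ0
    linarith
  rw [Finset.sum_add_distrib] at htel
  have hT2 : ∑ n ∈ Finset.Ico 1 N, (Y n - Y (n + 1)) = Y 1 - Y N := by
    have := Finset.sum_Ico_sub (fun n => -Y n) hN
    simp only [neg_sub_neg] at this
    rw [this]
  have hT3 : ∑ _n ∈ Finset.Ico 1 N, (σ * E + b) ≤ N * (σ * E + b) :=
    hsumle (by positivity) le_rfl
  have hNσ : N * σ = 1 / 2 := by rw [hσ, ← hNk]; rw [← hNk] at hT; field_simp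
  have hEb : 10 * T ^ 2 * F ^ 2 + (10 + 4 / 3 * T ^ 2) * M ^ 2 ≤ E := by
    rw [hE, energyC]
    have : (1 : ℝ) ≤ Real.exp 1 := Real.one_le_exp zero_le_one
    have h0 : 0 ≤ (10 + 4 / 3 * T ^ 2) * M ^ 2 + 20 * T ^ 2 * F ^ 2 := by positivity
    have h1 : 0 ≤ T ^ 2 * F ^ 2 := by positivity
    nlinarith
  have e : N * (σ * E + b) = N * σ * E + N * b := by ring
  rw [e, hNσ, hNb] at hT3
  linarith [hY0 N]

/-- This time-integrated bound of the squared jumps is later the Gronwall exponent of the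
increments. -/
lemma IsRegular.sum_jumpSq_le (hm : m.IsRegular c) (hc : 0 < c) (hRe : 0 < Re) (hk : 0 < k)
    (hN : 1 ≤ N) (hNk : N * k = T) (hS : m.IsSchemeSolution Re k N f u ut p) {F M : ℝ}
    (hF : ∀ n : ℕ, n ≤ N → ‖m.emb (m.proj (f (n * k)))‖ ≤ F)
    (hu0 : ‖m.emb (u 0)‖ ≤ M) (hu1 : ‖m.emb (u 1)‖ ≤ M) (hp1 : ‖m.emb (m.grad (p 1))‖ ≤ M) :
    ∑ n ∈ Finset.Ico 1 N, k * m.jumpSq (ut (n + 1)) ≤ 2 * Re / c * energyC T F M := by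
  have hF0 : 0 ≤ F := (norm_nonneg _).trans (hF 0 (by omega))
  have hkT : k ≤ T := by
    rw [← hNk]
    have : (1 : ℝ) ≤ N := by exact_mod_cast hN
    nlinarith
  have hT : 0 < T := hk.trans_le hkT
  set Y : ℕ → ℝ := fun n => ‖m.emb (u n)‖ ^ 2 + ‖(2 : ℝ) • m.emb (u n) - m.emb (u (n - 1))‖ ^ 2
        + 4 * k ^ 2 / 3 * ‖m.emb (m.grad (p n))‖ ^ 2 with hYdef
  have hY0 : ∀ n, 0 ≤ Y n := fun n => by positivity
  have hY1 : Y 1 ≤ (10 + 4 / 3 * T ^ 2) * M ^ 2 := by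
    have h1 : ‖(2 : ℝ) • m.emb (u 1) - m.emb (u 0)‖ ≤ 3 * M := by
      refine (norm_sub_le _ _).trans ?_
      rw [norm_smul, Real.norm_two]; linarith
    have e1 := pow_le_pow_left₀ (norm_nonneg _) hu1 2
    have e2 := pow_le_pow_left₀ (norm_nonneg _) h1 2
    have e3 := pow_le_pow_left₀ (norm_nonneg _) hp1 2
    have e4 := pow_le_pow_left₀ hk.le hkT 2
    have e5 : 4 * k ^ 2 / 3 * ‖m.emb (m.grad (p 1))‖ ^ 2 ≤ 4 * T ^ 2 / 3 * M ^ 2 := by gcongr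
    change ‖m.emb (u 1)‖ ^ 2 + ‖(2 : ℝ) • m.emb (u 1) - m.emb (u 0)‖ ^ 2
        + 4 * k ^ 2 / 3 * ‖m.emb (m.grad (p 1))‖ ^ 2 ≤ _
    linarith
  set b : ℝ := 10 * k * T * F ^ 2 with hb
  have hb0 : 0 ≤ b := by positivity
  set σ : ℝ := k / (2 * T) with hσ
  have hσ0 : 0 ≤ σ := by positivity
  have hσ2 : σ ≤ 1 / 2 := by rw [hσ, div_le_iff₀ (by positivity)]; linarith
  have hstep : ∀ n, 1 ≤ n → n < N →
      Y (n + 1) + k * (Re⁻¹ * c) * m.jumpSq (ut (n + 1)) ≤ Y n + σ * Y (n + 1) + b := by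
    intro n h1 hn
    have h := hm.energy_step_velocity hc hRe hk hS h1 hn
    have hFn := hF (n + 1) (by omega)
    set φ := ‖m.emb (m.proj (f ((n + 1 : ℕ) * k)))‖ with hφ
    have hφ0 : 0 ≤ φ := norm_nonneg _
    set x := ‖m.emb (u (n + 1))‖ with hx
    -- Young's inequality as the square of x - 4TF, weighted so that the term in x² has the
    -- coefficient k/(2T).
    have e1 : 4 * k * φ * x ≤ σ * x ^ 2 + 8 * k * T * F ^ 2 := by
      have h3 : 4 * k * φ * x ≤ 4 * k * F * x := by gcongr
      have h4 : 0 ≤ k / (2 * T) * (x - 4 * T * F) ^ 2 := by positivity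
      have h5 : k / (2 * T) * (x - 4 * T * F) ^ 2 =
          k / (2 * T) * x ^ 2 - 4 * k * F * x + 8 * k * T * F ^ 2 := by field_simp; ring
      rw [hσ]; linarith
    have e2 : 4 / 3 * k ^ 2 * φ ^ 2 ≤ 4 / 3 * (k * T) * F ^ 2 := by
      have : k ^ 2 ≤ k * T := by nlinarith
      gcongr
    have e3 : σ * x ^ 2 ≤ σ * Y (n + 1) := by
      refine mul_le_mul_of_nonneg_left ?_ hσ0
      simp only [hYdef]
      have : 0 ≤ ‖(2 : ℝ) • m.emb (u (n + 1)) - m.emb (u n)‖ ^ 2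
        + 4 * k ^ 2 / 3 * ‖m.emb (m.grad (p (n + 1)))‖ ^ 2 := by positivity
      change x ^ 2 ≤ x ^ 2 + ‖(2 : ℝ) • m.emb (u (n + 1)) - m.emb (u n)‖ ^ 2
        + 4 * k ^ 2 / 3 * ‖m.emb (m.grad (p (n + 1)))‖ ^ 2
      linarith
    have e4 : 0 ≤ k * T * F ^ 2 := by positivity
    change x ^ 2 + ‖(2 : ℝ) • m.emb (u (n + 1)) - m.emb (u n)‖ ^ 2
        + 4 * k ^ 2 / 3 * ‖m.emb (m.grad (p (n + 1)))‖ ^ 2 + _ ≤ Y n + _ + b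
    change _ ≤ Y n + _ + _ at h
    rw [hb]
    linarith
  have hfin := sum_le_of_energy_step hk hN hNk hY0
    (D := fun n => k * (Re⁻¹ * c) * m.jumpSq (ut (n + 1)))
    (fun n => mul_nonneg (by positivity) (m.jumpSq_nonneg _)) hY1 hstep
  set E := energyC T F M
  have hconv : ∑ n ∈ Finset.Ico 1 N, k * (Re⁻¹ * c) * m.jumpSq (ut (n + 1)) =
      (Re⁻¹ * c) * ∑ n ∈ Finset.Ico 1 N, k * m.jumpSq (ut (n + 1)) := by
    rw [Finset.mul_sum]
    exact Finset.sum_congr rfl fun n _ => by ring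
  rw [hconv] at hfin
  have h9 : (2 * Re / c) * ((Re⁻¹ * c) * ∑ n ∈ Finset.Ico 1 N, k * m.jumpSq (ut (n + 1))) ≤
      (2 * Re / c) * (2 * E) := mul_le_mul_of_nonneg_left hfin (by positivity)
  have h10 : (2 * Re / c) * ((Re⁻¹ * c) * ∑ n ∈ Finset.Ico 1 N, k * m.jumpSq (ut (n + 1))) =
      2 * ∑ n ∈ Finset.Ico 1 N, k * m.jumpSq (ut (n + 1)) := by
    field_simp
  linarith

end Energy

end TriMesh

/-! ### The energy estimate for the time increments -/

namespace TriMesh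

variable {Ω : Set Plane} {m : TriMesh Ω} {c : ℝ}

section DifferenceEnergy

variable {Re k T : ℝ} {N : ℕ} {f : ℝ → L2 Ω Plane} {u ut : ℕ → m.P0} {p : ℕ → m.P1d}

/-- The energy of the time increments. -/
def incEnergy (k : ℝ) (u : ℕ → m.P0) (p : ℕ → m.P1d) (n : ℕ) : ℝ :=
  ‖m.emb (u n) - m.emb (u (n - 1))‖ ^ 2 +
    ‖(2 : ℝ) • (m.emb (u n) - m.emb (u (n - 1))) - (m.emb (u (n - 1)) - m.emb (u (n - 2)))‖ ^ 2 +
    4 * k ^ 2 / 3 * ‖m.emb (m.grad (p n)) - m.emb (m.grad (p (n - 1)))‖ ^ 2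

lemma incEnergy_nonneg (k : ℝ) (u : ℕ → m.P0) (p : ℕ → m.P1d) (n : ℕ) :
    0 ≤ incEnergy k u p n := by unfold incEnergy; positivity

/-- Convection of v by W' is added and subtracted. Transporting v' - v by W' is dissipative, and
changing the transport field under v is what the trilinear estimate controls. -/
lemma IsRegular.inner_rhs_increment_le (hm : m.IsRegular c) (hc : 0 < c) (hRe : 0 < Re)
    {W W' : m.P0} (hW : m.IsRT0 W) (hW' : m.IsRT0 W') (F F' v v' : m.P0) :
    inner ℝ ((m.emb F' + Re⁻¹ • m.emb (m.lap v') - m.emb (m.conv W' v')) -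
      (m.emb F + Re⁻¹ • m.emb (m.lap v) - m.emb (m.conv W v))) (m.emb v' - m.emb v) ≤
      ‖m.emb F' - m.emb F‖ * ‖m.emb v' - m.emb v‖ - Re⁻¹ * (c / 4 * m.jumpSq (v' - v)) +
      triC c * (‖m.emb W' - m.emb W‖ * √(m.jumpSq v) * √(m.jumpSq (v' - v))) := by
  have e : (m.emb F' + Re⁻¹ • m.emb (m.lap v') - m.emb (m.conv W' v')) -
      (m.emb F + Re⁻¹ • m.emb (m.lap v) - m.emb (m.conv W v)) =
      (m.emb F' - m.emb F) + Re⁻¹ • m.emb (m.lap (v' - v)) - m.emb (m.conv W' (v' - v)) -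
        m.emb (m.conv W' v - m.conv W v) := by
    rw [lap_sub, conv_sub hW', map_sub, map_sub, map_sub, smul_sub]
    abel
  rw [e, ← map_sub m.emb v' v, inner_sub_left, inner_sub_left, inner_add_left,
    real_inner_smul_left]
  have h1 := real_inner_le_norm (m.emb F' - m.emb F) (m.emb (v' - v))
  have h2 := inner_conv_self_nonneg hW' (v' - v)
  have h3 := mul_le_mul_of_nonneg_left (hm.jumpSq_le_neg_inner_lap hc (v' - v))
    (inv_nonneg.2 hRe.le)
  have h4 := neg_le_of_abs_le (abs_inner_conv_sub_le hm hc hW' hW v (v' - v))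
  rw [map_sub m.emb W' W] at h4
  linarith

/-- The growth rate of the increments. -/
def growthC (c Re : ℝ) : ℝ := 4 * triC c ^ 2 * Re / c

/-- Consecutive steps are subtracted. The differences satisfy equations of the same form with the
same orthogonality relations, so the abstract energy step applies again. -/
lemma IsRegular.energy_step_increment (hm : m.IsRegular c) (hc : 0 < c) (hRe : 0 < Re) (hk : 0 < k)
    (hS : m.IsSchemeSolution Re k N f u ut p) {n : ℕ} (h1 : 2 ≤ n) (hn : n < N) :
    incEnergy k u p (n + 1) ≤ (1 + growthC c Re * (k * m.jumpSq (ut n))) * incEnergy k u p n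
      + 4 * k * ‖m.emb (m.proj (f ((n + 1 : ℕ) * k))) - m.emb (m.proj (f (n * k)))‖ *
          ‖m.emb (u (n + 1)) - m.emb (u n)‖
      + 4 / 3 * k ^ 2 *
          ‖m.emb (m.proj (f ((n + 1 : ℕ) * k))) - m.emb (m.proj (f (n * k)))‖ ^ 2 := by
  obtain ⟨j, rfl⟩ : ∃ j, n = j + 2 := ⟨n - 2, by omega⟩
  have hp2 := hS.emb_prediction (n := j + 2) (by omega) hn
  have hp1 := hS.emb_prediction (n := j + 1) (by omega) (by omega)
  have hc2 := hS.emb_correction (n := j + 2) (by omega) hn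
  have hc1 := hS.emb_correction (n := j + 1) (by omega) (by omega)
  have hW2 := hS.isRT0_extrap hk (n := j + 2) (by omega)
  have hW1 := hS.isRT0_extrap hk (n := j + 1) (by omega)
  have hr := hm.inner_rhs_increment_le hc hRe hW1 hW2 (m.proj (f ((j + 2 : ℕ) * k)))
    (m.proj (f ((j + 3 : ℕ) * k))) (ut (j + 2)) (ut (j + 3))
  have ho : ∀ i l, i < N → 1 ≤ l → l < N →
      inner ℝ (m.emb (u (i + 1)) - m.emb (u i))
        (m.emb (m.grad (p (l + 1))) - m.emb (m.grad (p l))) = 0 := by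
    intro i l hi hl hlN
    rw [inner_sub_left, inner_sub_right, inner_sub_right, hS.inner_grad hk (by omega) (by omega)
      (by omega), hS.inner_grad hk (by omega) (by omega) (by omega), hS.inner_grad hk (by omega)
      (by omega) (by omega), hS.inner_grad hk (by omega) (by omega) (by omega)]
    simp
  have hs : (2 * k)⁻¹ • ((3 : ℝ) • (m.emb (ut (j + 3)) - m.emb (ut (j + 2)))
      - (4 : ℝ) • (m.emb (u (j + 2)) - m.emb (u (j + 1))) + (m.emb (u (j + 1)) - m.emb (u j)))
      + (m.emb (m.grad (p (j + 2))) - m.emb (m.grad (p (j + 1)))) =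
      (m.emb (m.proj (f ((j + 3 : ℕ) * k))) + Re⁻¹ • m.emb (m.lap (ut (j + 3)))
        - m.emb (m.conv ((2 : ℝ) • u (j + 2) - u (j + 1)) (ut (j + 3)))) -
      (m.emb (m.proj (f ((j + 2 : ℕ) * k))) + Re⁻¹ • m.emb (m.lap (ut (j + 2)))
        - m.emb (m.conv ((2 : ℝ) • u (j + 1) - u j) (ut (j + 2)))) := by
    refine Eq.trans ?_ (congrArg₂ (· - ·) hp2 hp1)
    simp only [show j + 2 + 1 = j + 3 from rfl, show j + 1 + 1 = j + 2 from rfl,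
      show j + 2 - 1 = j + 1 from rfl, show j + 1 - 1 = j from rfl]
    module
  have hx : m.emb (u (j + 3)) - m.emb (u (j + 2)) = m.emb (ut (j + 3)) - m.emb (ut (j + 2)) -
      (2 * k / 3) • ((m.emb (m.grad (p (j + 3))) - m.emb (m.grad (p (j + 2)))) -
        (m.emb (m.grad (p (j + 2))) - m.emb (m.grad (p (j + 1))))) := by
    refine (congrArg₂ (· - ·) hc2 hc1).trans ?_
    simp only [show j + 2 + 1 = j + 3 from rfl, show j + 1 + 1 = j + 2 from rfl]
    module
  have hE := bdf_energy_step hk hs hx (ho (j + 2) (j + 1) (by omega) (by omega) (by omega))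
    (ho (j + 2) (j + 2) (by omega) (by omega) (by omega))
    (ho (j + 1) (j + 1) (by omega) (by omega) (by omega))
    (ho (j + 1) (j + 2) (by omega) (by omega) (by omega))
    (ho j (j + 1) (by omega) (by omega) (by omega))
    (ho j (j + 2) (by omega) (by omega) (by omega)) (norm_nonneg _) hr
  -- The change of the extrapolated transport field is precisely the vector in the second term of
  -- `incEnergy`, so the convection error is controlled by the energy itself.
  have hWd : m.emb ((2 : ℝ) • u (j + 2) - u (j + 1)) - m.emb ((2 : ℝ) • u (j + 1) - u j) =
      (2 : ℝ) • (m.emb (u (j + 2)) - m.emb (u (j + 1))) - (m.emb (u (j + 1)) - m.emb (u j)) := by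
    simp only [map_sub, map_smul]; module
  change _ ≤ _ + 4 * k * (triC c * (‖m.emb ((2 : ℝ) • u (j + 2) - u (j + 1)) -
    m.emb ((2 : ℝ) • u (j + 1) - u j)‖ * √(m.jumpSq (ut (j + 2))) *
      √(m.jumpSq (ut (j + 3) - ut (j + 2))))) at hE
  rw [hWd] at hE
  change ‖m.emb (u (j + 3)) - m.emb (u (j + 2))‖ ^ 2 +
    ‖(2 : ℝ) • (m.emb (u (j + 3)) - m.emb (u (j + 2))) -
      (m.emb (u (j + 2)) - m.emb (u (j + 1)))‖ ^ 2 +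
    4 * k ^ 2 / 3 * ‖m.emb (m.grad (p (j + 3))) - m.emb (m.grad (p (j + 2)))‖ ^ 2 ≤
    (1 + growthC c Re * (k * m.jumpSq (ut (j + 2)))) *
    (‖m.emb (u (j + 2)) - m.emb (u (j + 1))‖ ^ 2 +
    ‖(2 : ℝ) • (m.emb (u (j + 2)) - m.emb (u (j + 1))) - (m.emb (u (j + 1)) - m.emb (u j))‖ ^ 2 +
    4 * k ^ 2 / 3 * ‖m.emb (m.grad (p (j + 2))) - m.emb (m.grad (p (j + 1)))‖ ^ 2) +
    4 * k * ‖m.emb (m.proj (f ((j + 3 : ℕ) * k))) - m.emb (m.proj (f ((j + 2 : ℕ) * k)))‖ *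
      ‖m.emb (u (j + 3)) - m.emb (u (j + 2))‖ + 4 / 3 * k ^ 2 *
      ‖m.emb (m.proj (f ((j + 3 : ℕ) * k))) - m.emb (m.proj (f ((j + 2 : ℕ) * k)))‖ ^ 2
  have hJ1 := m.jumpSq_nonneg (ut (j + 2))
  have hJ2 := m.jumpSq_nonneg (ut (j + 3) - ut (j + 2))
  generalize m.jumpSq (ut (j + 2)) = J1 at *
  generalize m.jumpSq (ut (j + 3) - ut (j + 2)) = J2 at *
  generalize ‖(2 : ℝ) • (m.emb (u (j + 2)) - m.emb (u (j + 1))) -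
    (m.emb (u (j + 1)) - m.emb (u j))‖ = w at *
  have hy : 0 ≤ ‖m.emb (u (j + 2)) - m.emb (u (j + 1))‖ ^ 2 := sq_nonneg _
  have hg : 0 ≤ 4 * k ^ 2 / 3 * ‖m.emb (m.grad (p (j + 2))) - m.emb (m.grad (p (j + 1)))‖ ^ 2 := by
    positivity
  -- Young's inequality: the unknown jump J2 is absorbed by the diffusion, and the factor J1,
  -- already summable in time, becomes the growth rate `growthC`.
  have hamgm : 4 * k * (triC c * (w * √J1 * √J2)) ≤
      4 * k * (Re⁻¹ * (c / 4 * J2)) + growthC c Re * (k * J1) * w ^ 2 := by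
    have h2 : 0 ≤ k * c / Re * (√J2 - 2 * triC c * Re / c * (w * √J1)) ^ 2 := by positivity
    have h3 : k * c / Re * (√J2 - 2 * triC c * Re / c * (w * √J1)) ^ 2 =
        4 * k * (Re⁻¹ * (c / 4 * √J2 ^ 2)) + growthC c Re * (k * √J1 ^ 2) * w ^ 2 -
        4 * k * (triC c * (w * √J1 * √J2)) := by
      rw [growthC]; field_simp; ring
    rw [h3, Real.sq_sqrt hJ1, Real.sq_sqrt hJ2] at h2
    linarith
  have hgr : 0 ≤ growthC c Re * (k * J1) := by unfold growthC; positivity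
  have h5 := mul_nonneg hgr (add_nonneg hy hg)
  linarith

/-- Gronwall in which the variation of the source enters both as rate and as forcing. No smallness
of the time step is needed: a weight depending on the total variation V makes every implicit term
absorbable. -/
lemma le_of_increment_step {N : ℕ} {k V α M S : ℝ} {Z φ J : ℕ → ℝ} (hk : 0 < k)
    (hZ : ∀ n, 0 ≤ Z n) (hφ : ∀ n, 0 ≤ φ n) (hJ : ∀ n, 0 ≤ J n) (hα : 0 ≤ α)
    (hV : ∑ n ∈ Finset.Ico 2 N, φ n ≤ V) (hJS : ∑ n ∈ Finset.Ico 2 N, k * J n ≤ S)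
    (hZ2 : 2 ≤ N → Z 2 ≤ M * k ^ 2)
    (hstep : ∀ n, 2 ≤ n → n < N → Z (n + 1) ≤ (1 + α * (k * J n)) * Z n
      + 4 * k * φ n * √(Z (n + 1)) + 4 / 3 * k ^ 2 * φ n ^ 2) :
    ∀ n, 2 ≤ n → n ≤ N → Z n ≤ Real.exp (2 * V + α * S) * (M + (24 * V + 8) * V) * k ^ 2 := by
  have hφV : ∀ n, 2 ≤ n → n < N → φ n ≤ V := fun n h1 hn =>
    (Finset.single_le_sum (f := φ) (fun i _ => hφ i) (Finset.mem_Ico.2 ⟨h1, hn⟩)).trans hV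
  have hV0 : 0 ≤ V := (Finset.sum_nonneg fun i _ => hφ i).trans hV
  have hgr := discrete_gronwall (N := N) (s := 2) (Y := Z) (g := fun n => 2 * φ n + α * (k * J n))
    (b := fun n => (24 * V + 8) * φ n * k ^ 2)
    (fun n => mul_nonneg (mul_nonneg (by positivity) (hφ n)) (by positivity))
    (fun n => add_nonneg (mul_nonneg zero_le_two (hφ n))
      (mul_nonneg hα (mul_nonneg hk.le (hJ n)))) (by
      intro n h1 hn
      have h := hstep n h1 hn
      have h0 := hφ n
      have hv := hφV n h1 hn
      -- Chosen so that θ φ_n ≤ 1/2, since φ_n ≤ V, while the constant paid in Young's inequality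
      -- depends only on V.
      set θ : ℝ := 1 / (2 * V + 1) with hθ
      have hθ0 : 0 < θ := by positivity
      have hθ1 : θ ≤ 1 := by rw [hθ, div_le_one (by positivity)]; linarith
      have hθφ : θ * φ n ≤ 1 / 2 := by
        rw [hθ, div_mul_eq_mul_div, one_mul, div_le_iff₀ (by positivity)]; linarith
      have h2 : 4 * k * φ n * √(Z (n + 1)) ≤ θ * φ n * Z (n + 1) +
          4 * (2 * V + 1) * φ n * k ^ 2 := by
        have h3 : 0 ≤ θ * φ n * (√(Z (n + 1)) - 2 * (2 * V + 1) * k) ^ 2 := by positivity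
        have h4 : θ * φ n * (√(Z (n + 1)) - 2 * (2 * V + 1) * k) ^ 2 =
            θ * φ n * √(Z (n + 1)) ^ 2 - 4 * k * φ n * √(Z (n + 1)) +
              4 * (2 * V + 1) * φ n * k ^ 2 := by
          rw [hθ]; field_simp; ring
        rw [h4, Real.sq_sqrt (hZ _)] at h3
        linarith
      have h5 : 4 / 3 * k ^ 2 * φ n ^ 2 ≤ 4 / 3 * V * φ n * k ^ 2 := by
        have : φ n ^ 2 ≤ V * φ n := by nlinarith
        have := mul_le_mul_of_nonneg_left this (by positivity : 0 ≤ 4 / 3 * k ^ 2)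
        linarith
      have h6 : 0 ≤ α * (k * J n) := mul_nonneg hα (mul_nonneg hk.le (hJ n))
      set B := (12 * V + 4) * φ n * k ^ 2 with hB
      have hB0 : 0 ≤ B := by positivity
      have h7 : 4 * (2 * V + 1) * φ n * k ^ 2 + 4 / 3 * V * φ n * k ^ 2 ≤ B := by
        have : 0 ≤ V * φ n * k ^ 2 := by positivity
        rw [hB]; linarith
      have hA0 : 0 ≤ (1 + α * (k * J n)) * Z n := mul_nonneg (by linarith) (hZ n)
      have h8 := le_of_one_sub_mul_le (Y := Z (n + 1)) (mul_nonneg hθ0.le h0) hθφ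
        (add_nonneg hA0 hB0) (by linarith)
      have h9 : 1 + 2 * (θ * φ n) ≤ Real.exp (2 * φ n) := by
        have := Real.add_one_le_exp (2 * φ n)
        nlinarith
      have h10 : 1 + α * (k * J n) ≤ Real.exp (α * (k * J n)) := by
        have := Real.add_one_le_exp (α * (k * J n))
        linarith
      have h11 : (1 + 2 * (θ * φ n)) * ((1 + α * (k * J n)) * Z n) ≤
          Real.exp (2 * φ n + α * (k * J n)) * Z n := by
        rw [Real.exp_add, ← mul_assoc]
        refine mul_le_mul_of_nonneg_right ?_ (hZ n)
        exact mul_le_mul h9 h10 (by linarith) (Real.exp_pos _).le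
      have h12 : (1 + 2 * (θ * φ n)) * B ≤ 2 * B := mul_le_mul_of_nonneg_right (by linarith) hB0
      rw [hB] at h12
      linarith)
  intro n h1 hn
  refine (hgr n h1 hn).trans ?_
  have hsub : Finset.Ico 2 n ⊆ Finset.Ico 2 N := Finset.Ico_subset_Ico_right hn
  have e1 : ∑ j ∈ Finset.Ico 2 n, φ j ≤ V :=
    (Finset.sum_le_sum_of_subset_of_nonneg hsub fun i _ _ => hφ i).trans hV
  have e2 : ∑ j ∈ Finset.Ico 2 n, k * J j ≤ S :=
    (Finset.sum_le_sum_of_subset_of_nonneg hsub fun i _ _ => mul_nonneg hk.le (hJ i)).trans hJS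
  have e3 : ∑ j ∈ Finset.Ico 2 n, (2 * φ j + α * (k * J j)) ≤ 2 * V + α * S := by
    rw [Finset.sum_add_distrib, ← Finset.mul_sum, ← Finset.mul_sum]
    have := mul_le_mul_of_nonneg_left e2 hα
    linarith
  have e4 : ∑ j ∈ Finset.Ico 2 n, (24 * V + 8) * φ j * k ^ 2 ≤ (24 * V + 8) * V * k ^ 2 := by
    rw [← Finset.sum_mul, ← Finset.mul_sum]
    gcongr
  have e5 := hZ2 (by omega)
  rw [mul_assoc, add_mul]
  refine mul_le_mul (Real.exp_le_exp.2 e3) (add_le_add e5 e4) ?_ (Real.exp_pos _).le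
  exact add_nonneg (hZ 2) (Finset.sum_nonneg fun j _ =>
    mul_nonneg (mul_nonneg (by positivity) (hφ j)) (by positivity))

end DifferenceEnergy

end TriMesh

/-! ### Uniform Lipschitz bound in time -/

namespace TriMesh

variable {Ω : Set Plane} {m : TriMesh Ω} {c : ℝ}

section Increments

variable {Re k T F M A V : ℝ} {N : ℕ} {f : ℝ → L2 Ω Plane} {u ut : ℕ → m.P0} {p : ℕ → m.P1d}

/-- The bound of the first increment, divided by the time step. -/
def firstC (Re F M A : ℝ) : ℝ := (A + 2 * (F + M + Re⁻¹ * M + M)) / 3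

/-- The first prediction step is written for e = ũ² - u¹ and tested with e. Diffusion and convection
of e have favourable signs, and what remains is k times quantities bounded by the initial data. -/
lemma IsRegular.norm_first_increment_le (hm : m.IsRegular c) (hc : 0 < c) (hRe : 0 < Re)
    (hk : 0 < k) (hS : m.IsSchemeSolution Re k N f u ut p) (hN : 1 < N)
    (hF : ‖m.emb (m.proj (f ((1 + 1 : ℕ) * k)))‖ ≤ F) (hp1 : ‖m.emb (m.grad (p 1))‖ ≤ M)
    (hl1 : ‖m.emb (m.lap (u 1))‖ ≤ M)
    (hc1 : ‖m.emb (m.conv ((2 : ℝ) • u 1 - u 0) (u 1))‖ ≤ M)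
    (hd1 : ‖m.emb (u 1) - m.emb (u 0)‖ ≤ A * k) :
    ‖m.emb (ut 2) - m.emb (u 1)‖ ≤ firstC Re F M A * k := by
  have hp := hS.emb_prediction (n := 1) le_rfl hN
  have hW := hS.isRT0_extrap hk (n := 1) hN.le
  simp only [show 1 + 1 = 2 from rfl, show 1 - 1 = 0 from rfl] at hp hW
  have e1 : m.emb (m.conv ((2 : ℝ) • u 1 - u 0) (ut 2)) =
      m.emb (m.conv ((2 : ℝ) • u 1 - u 0) (ut 2 - u 1)) +
        m.emb (m.conv ((2 : ℝ) • u 1 - u 0) (u 1)) := by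
    rw [conv_sub hW, map_sub]; abel
  have e2 : m.emb (m.lap (ut 2)) = m.emb (m.lap (ut 2 - u 1)) + m.emb (m.lap (u 1)) := by
    rw [lap_sub, map_sub]; abel
  -- Writing 3ũ² - 4u¹ + u⁰ = 3(ũ² - u¹) - (u¹ - u⁰) isolates e.
  have e3 : (3 : ℝ) • (m.emb (ut 2) - m.emb (u 1)) = (m.emb (u 1) - m.emb (u 0)) +
      (2 * k) • (m.emb (m.proj (f ((2 : ℕ) * k))) +
        Re⁻¹ • (m.emb (m.lap (ut 2 - u 1)) + m.emb (m.lap (u 1))) -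
        (m.emb (m.conv ((2 : ℝ) • u 1 - u 0) (ut 2 - u 1)) +
        m.emb (m.conv ((2 : ℝ) • u 1 - u 0) (u 1))) - m.emb (m.grad (p 1))) := by
    rw [← e1, ← e2, ← hp, add_sub_cancel_right, smul_inv_smul₀ (by positivity)]
    module
  have h1 := hm.jumpSq_le_neg_inner_lap hc (ut 2 - u 1)
  have h2 := inner_conv_self_nonneg hW (ut 2 - u 1)
  have h0 := m.jumpSq_nonneg (ut 2 - u 1)
  rw [map_sub] at h1 h2
  set e := m.emb (ut 2) - m.emb (u 1) with he
  have h3 : 3 * ‖e‖ ^ 2 = inner ℝ ((3 : ℝ) • e) e := by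
    rw [real_inner_smul_left, real_inner_self_eq_norm_sq]
  rw [e3] at h3
  simp only [inner_add_left, inner_sub_left, real_inner_smul_left] at h3
  have h4 : ∀ {a : PiLp 2 (fun _ : Fin m.num => Plane)} {b : ℝ}, ‖a‖ ≤ b →
      |inner ℝ a e| ≤ b * ‖e‖ := fun h =>
    (abs_real_inner_le_norm _ _).trans (mul_le_mul_of_nonneg_right h (norm_nonneg _))
  have g1 := le_of_abs_le (h4 hd1)
  have g2 := le_of_abs_le (h4 hF)
  have g3 := mul_le_mul_of_nonneg_left (le_of_abs_le (h4 hl1)) (inv_nonneg.2 hRe.le)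
  have g4 := neg_le_of_abs_le (h4 hc1)
  have g5 := neg_le_of_abs_le (h4 hp1)
  have g6 : Re⁻¹ * inner ℝ (m.emb (m.lap (ut 2 - u 1))) e ≤ 0 :=
    mul_nonpos_of_nonneg_of_nonpos (inv_nonneg.2 hRe.le) (by
      have : 0 ≤ c / 4 * m.jumpSq (ut 2 - u 1) := by positivity
      linarith)
  rw [← inner_sub_left] at h3
  have g7 := mul_le_mul_of_nonneg_left (add_le_add (add_le_add (add_le_add (add_le_add
    (add_le_add g2 g3) (neg_le_of_neg_le g4)) (neg_le_of_neg_le g5)) g6) (neg_nonpos.2 h2))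
    (by positivity : 0 ≤ 2 * k)
  simp only [show 1 + 1 = 2 from rfl] at g7
  have g8 : 3 * ‖e‖ ^ 2 ≤ 3 * (firstC Re F M A * k) * ‖e‖ := by
    have : 3 * (firstC Re F M A * k) * ‖e‖ = A * k * ‖e‖ + 2 * k *
        (F * ‖e‖ + Re⁻¹ * (M * ‖e‖) + M * ‖e‖ + M * ‖e‖ + 0 + 0) := by
      rw [firstC]; ring
    rw [this]
    linarith
  rcases (norm_nonneg e).eq_or_lt with h | h
  · rw [← h]
    have hA : 0 ≤ A * k := (norm_nonneg _).trans hd1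
    have hF0 : 0 ≤ F := (norm_nonneg _).trans hF
    have hM0 : 0 ≤ M := (norm_nonneg _).trans hp1
    have hA0 : 0 ≤ A := nonneg_of_mul_nonneg_left hA hk
    unfold firstC; positivity
  · nlinarith

/-- By orthogonality, ũ² - u¹ splits in the sense of Pythagoras into the velocity increment and 2k/3
times the increment of the pressure gradient, so its O(k) bound controls both. -/
lemma incEnergy_two_le (hk : 0 < k) (hS : m.IsSchemeSolution Re k N f u ut p) (hN : 1 < N)
    {E : ℝ} (he : ‖m.emb (ut 2) - m.emb (u 1)‖ ≤ E * k)
    (hd1 : ‖m.emb (u 1) - m.emb (u 0)‖ ≤ A * k) :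
    incEnergy k u p 2 ≤ (9 * E ^ 2 + 2 * A ^ 2) * k ^ 2 := by
  have hco := hS.emb_correction (n := 1) le_rfl hN
  simp only [show 1 + 1 = 2 from rfl] at hco
  set δ := m.emb (m.grad (p 2)) - m.emb (m.grad (p 1)) with hδ
  have h1 : m.emb (ut 2) - m.emb (u 1) = (m.emb (u 2) - m.emb (u 1)) + (2 * k / 3) • δ := by
    rw [hco]; abel
  have h2 : inner ℝ (m.emb (u 2) - m.emb (u 1)) δ = 0 := by
    rw [hδ, inner_sub_left, inner_sub_right, inner_sub_right, hS.inner_grad hk (by omega)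
      (by omega) (by omega), hS.inner_grad hk (by omega) (by omega) (by omega),
      hS.inner_grad hk (by omega) (by omega) (by omega), hS.inner_grad hk (by omega) (by omega)
      (by omega)]
    simp
  have h3 : ‖m.emb (ut 2) - m.emb (u 1)‖ ^ 2 =
      ‖m.emb (u 2) - m.emb (u 1)‖ ^ 2 + 4 * k ^ 2 / 9 * ‖δ‖ ^ 2 := by
    rw [h1, norm_add_sq_real, real_inner_smul_right, h2, norm_smul, Real.norm_eq_abs,
      abs_of_pos (by positivity)]
    ring
  have h4 : ‖(2 : ℝ) • (m.emb (u 2) - m.emb (u 1)) - (m.emb (u 1) - m.emb (u 0))‖ ≤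
      2 * ‖m.emb (u 2) - m.emb (u 1)‖ + ‖m.emb (u 1) - m.emb (u 0)‖ := by
    refine (norm_sub_le _ _).trans ?_
    rw [norm_smul, Real.norm_two]
  have h5 := pow_le_pow_left₀ (norm_nonneg _) he 2
  have h6 := pow_le_pow_left₀ (norm_nonneg _) hd1 2
  have h7 := pow_le_pow_left₀ (norm_nonneg _) h4 2
  change ‖m.emb (u 2) - m.emb (u 1)‖ ^ 2 +
    ‖(2 : ℝ) • (m.emb (u 2) - m.emb (u 1)) - (m.emb (u 1) - m.emb (u 0))‖ ^ 2 +
    4 * k ^ 2 / 3 * ‖δ‖ ^ 2 ≤ _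
  have h8 : 0 ≤ k ^ 2 * ‖δ‖ ^ 2 := by positivity
  nlinarith [sq_nonneg (2 * ‖m.emb (u 2) - m.emb (u 1)‖ - ‖m.emb (u 1) - m.emb (u 0)‖)]

/-- The bound of the increments, divided by the time step. -/
def incC (c Re T F M A V : ℝ) : ℝ :=
  3 * √(Real.exp (2 * V + growthC c Re * (2 * Re / c * energyC T F M)) *
    ((9 * firstC Re F M A ^ 2 + 2 * A ^ 2) + (24 * V + 8) * V)) + firstC Re F M A

/-- The predicted velocity is Lipschitz continuous in time, uniformly in the discretization. -/
theorem IsRegular.norm_increment_le (hm : m.IsRegular c) (hc : 0 < c) (hRe : 0 < Re) (hk : 0 < k)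
    (hN : 1 ≤ N) (hNk : N * k = T) (hS : m.IsSchemeSolution Re k N f u ut p)
    (hF : ∀ n : ℕ, n ≤ N → ‖m.emb (m.proj (f (n * k)))‖ ≤ F)
    (hV : ∑ n ∈ Finset.Ico 2 N,
      ‖m.emb (m.proj (f ((n + 1 : ℕ) * k))) - m.emb (m.proj (f (n * k)))‖ ≤ V)
    (hu0 : ‖m.emb (u 0)‖ ≤ M) (hu1 : ‖m.emb (u 1)‖ ≤ M) (hp1 : ‖m.emb (m.grad (p 1))‖ ≤ M)
    (hl1 : ‖m.emb (m.lap (u 1))‖ ≤ M)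
    (hc1 : ‖m.emb (m.conv ((2 : ℝ) • u 1 - u 0) (u 1))‖ ≤ M)
    (hd1 : ‖m.emb (u 1) - m.emb (u 0)‖ ≤ A * k) {n : ℕ} (h1 : 1 ≤ n) (hn : n < N) :
    ‖m.emb (ut (n + 1)) - m.emb (ut n)‖ ≤ incC c Re T F M A V * k := by
  have he := hm.norm_first_increment_le hc hRe hk hS (by omega) (hF 2 (by omega)) hp1 hl1 hc1 hd1
  have hE0 : 0 ≤ firstC Re F M A := by
    have hA : 0 ≤ A * k := (norm_nonneg _).trans hd1
    have hF0 : 0 ≤ F := (norm_nonneg _).trans (hF 0 (by omega))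
    have hM0 : 0 ≤ M := (norm_nonneg _).trans hp1
    have hA0 : 0 ≤ A := nonneg_of_mul_nonneg_left hA hk
    unfold firstC; positivity
  have hV0 : 0 ≤ V := (Finset.sum_nonneg fun i _ => norm_nonneg _).trans hV
  rcases Nat.lt_or_ge 1 n with h2 | h2
  · have hJS := hm.sum_jumpSq_le hc hRe hk hN hNk hS hF hu0 hu1 hp1
    -- Index shift: the growth rate at step n involves ũ^n, whereas the energy estimate is indexed
    -- by ũ^{n+1}.
    have hJS' : ∑ n ∈ Finset.Ico 2 N, k * m.jumpSq (ut n) ≤ 2 * Re / c * energyC T F M := by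
      refine le_trans ?_ hJS
      rw [Finset.sum_Ico_add' (fun n => k * m.jumpSq (ut n)) 1 N 1]
      exact Finset.sum_le_sum_of_subset_of_nonneg (Finset.Ico_subset_Ico_right (by omega))
        fun i _ _ => mul_nonneg hk.le (m.jumpSq_nonneg _)
    have hZ := le_of_increment_step (Z := incEnergy k u p) (J := fun n => m.jumpSq (ut n))
      (α := growthC c Re) (M := 9 * firstC Re F M A ^ 2 + 2 * A ^ 2) hk
      (incEnergy_nonneg k u p) (fun n => norm_nonneg _) (fun n => m.jumpSq_nonneg _)
      (by unfold growthC; positivity) hV hJS'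
      (fun _ => incEnergy_two_le hk hS (by omega) he hd1) (by
        intro n h3 h4
        refine (hm.energy_step_increment hc hRe hk hS h3 h4).trans ?_
        gcongr
        apply Real.le_sqrt_of_sq_le
        have : 0 ≤ ‖(2 : ℝ) • (m.emb (u (n + 1)) - m.emb (u n)) -
          (m.emb (u n) - m.emb (u (n - 1)))‖ ^ 2 + 4 * k ^ 2 / 3 *
          ‖m.emb (m.grad (p (n + 1))) - m.emb (m.grad (p n))‖ ^ 2 := by positivity
        change _ ≤ ‖m.emb (u (n + 1)) - m.emb (u n)‖ ^ 2 +
          ‖(2 : ℝ) • (m.emb (u (n + 1)) - m.emb (u n)) -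
          (m.emb (u n) - m.emb (u (n - 1)))‖ ^ 2 + 4 * k ^ 2 / 3 *
          ‖m.emb (m.grad (p (n + 1))) - m.emb (m.grad (p n))‖ ^ 2
        linarith)
    set B := Real.exp (2 * V + growthC c Re * (2 * Re / c * energyC T F M)) *
      ((9 * firstC Re F M A ^ 2 + 2 * A ^ 2) + (24 * V + 8) * V) with hB
    have hB0 : 0 ≤ B := by positivity
    have hd : ∀ n, 2 ≤ n → n ≤ N → ‖m.emb (u n) - m.emb (u (n - 1))‖ ≤ √B * k := by
      intro n h3 h4
      have h5 := hZ n h3 h4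
      unfold incEnergy at h5
      apply le_of_sq_le_sq _ (by positivity)
      rw [mul_pow, Real.sq_sqrt hB0]
      refine le_trans ?_ h5
      have : 0 ≤ ‖(2 : ℝ) • (m.emb (u n) - m.emb (u (n - 1))) -
          (m.emb (u (n - 1)) - m.emb (u (n - 2)))‖ ^ 2 + 4 * k ^ 2 / 3 *
          ‖m.emb (m.grad (p n)) - m.emb (m.grad (p (n - 1)))‖ ^ 2 := by positivity
      linarith
    have hg : ∀ n, 2 ≤ n → n ≤ N →
        2 * k / 3 * ‖m.emb (m.grad (p n)) - m.emb (m.grad (p (n - 1)))‖ ≤ √B * k := by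
      intro n h3 h4
      have h5 := hZ n h3 h4
      unfold incEnergy at h5
      apply le_of_sq_le_sq _ (by positivity)
      rw [mul_pow, mul_pow, Real.sq_sqrt hB0]
      refine le_trans ?_ h5
      have : 0 ≤ ‖m.emb (u n) - m.emb (u (n - 1))‖ ^ 2 +
        ‖(2 : ℝ) • (m.emb (u n) - m.emb (u (n - 1))) -
          (m.emb (u (n - 1)) - m.emb (u (n - 2)))‖ ^ 2 := by positivity
      have : 0 ≤ k ^ 2 * ‖m.emb (m.grad (p n)) - m.emb (m.grad (p (n - 1)))‖ ^ 2 := by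
        positivity
      linarith
    obtain ⟨j, rfl⟩ : ∃ j, n = j + 2 := ⟨n - 2, by omega⟩
    have hc2 := hS.emb_correction (n := j + 2) (by omega) hn
    have hc3 := hS.emb_correction (n := j + 1) (by omega) (by omega)
    have a1 := hd (j + 3) (by omega) (by omega)
    have a2 := hg (j + 3) (by omega) (by omega)
    have a3 := hg (j + 2) (by omega) (by omega)
    simp only [show j + 2 + 1 = j + 3 from rfl, show j + 1 + 1 = j + 2 from rfl,
      show j + 3 - 1 = j + 2 from rfl, show j + 2 - 1 = j + 1 from rfl] at *
    -- The correction step expresses predicted increments through projected increments and two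
    -- successive increments of the pressure gradient, all controlled by the increment energy.
    have e : m.emb (ut (j + 3)) - m.emb (ut (j + 2)) = (m.emb (u (j + 3)) - m.emb (u (j + 2))) +
        (2 * k / 3) • (m.emb (m.grad (p (j + 3))) - m.emb (m.grad (p (j + 2)))) -
        (2 * k / 3) • (m.emb (m.grad (p (j + 2))) - m.emb (m.grad (p (j + 1)))) := by
      rw [hc2, hc3]; abel
    rw [e]
    refine (norm_sub_le _ _).trans ?_
    have h6 := norm_add_le (m.emb (u (j + 3)) - m.emb (u (j + 2)))
      ((2 * k / 3) • (m.emb (m.grad (p (j + 3))) - m.emb (m.grad (p (j + 2)))))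
    rw [norm_smul, Real.norm_eq_abs, abs_of_pos (by positivity)] at h6 ⊢
    have h7 : 0 ≤ firstC Re F M A * k := by positivity
    rw [incC, ← hB]
    linarith
  · obtain rfl : n = 1 := by omega
    rw [hS.ut_one]
    refine he.trans (mul_le_mul_of_nonneg_right ?_ hk.le)
    rw [incC]
    linarith [Real.sqrt_nonneg (Real.exp (2 * V + growthC c Re * (2 * Re / c * energyC T F M)) *
      ((9 * firstC Re F M A ^ 2 + 2 * A ^ 2) + (24 * V + 8) * V))]

end Increments

end TriMesh

/-! ### Discrete norms against norms on the domain -/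

lemma sq_lintegral_le {α : Type*} [MeasurableSpace α] {μ : Measure α} {g : α → ℝ≥0∞}
    (hg : AEMeasurable g μ) : (∫⁻ x, g x ∂μ) ^ 2 ≤ μ univ * ∫⁻ x, g x ^ 2 ∂μ := by
  have h := ENNReal.lintegral_mul_le_Lp_mul_Lq μ (Real.HolderConjugate.two_two) hg
    (aemeasurable_const (b := (1 : ℝ≥0∞)))
  simp only [Pi.mul_apply, mul_one, ENNReal.rpow_two] at h
  refine (pow_le_pow_left₀ zero_le h 2).trans (le_of_eq ?_)
  rw [mul_pow, ← ENNReal.rpow_natCast, ← ENNReal.rpow_natCast, ← ENNReal.rpow_mul,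
    ← ENNReal.rpow_mul, mul_comm]
  norm_num

lemma eLpNorm_two_sq {α F : Type*} [MeasurableSpace α] {μ : Measure α} [NormedAddCommGroup F]
    (g : α → F) : eLpNorm g 2 μ ^ 2 = ∫⁻ x, ‖g x‖ₑ ^ 2 ∂μ := by
  rw [eLpNorm_eq_lintegral_rpow_enorm_toReal two_ne_zero ENNReal.ofNat_ne_top,
    ← ENNReal.rpow_natCast, ← ENNReal.rpow_mul]
  simp

namespace TriMesh

variable {Ω : Set Plane} {m : TriMesh Ω}

lemma cell_subset_closure (K : Fin m.num) : m.cell K ⊆ closure Ω := by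
  rw [← m.cover]
  exact subset_iUnion (fun K => convexHull ℝ (range (m.tri K).points)) K

lemma interior_cell_subset (hΩ : interior (closure Ω) = Ω) (K : Fin m.num) :
    interior (m.cell K) ⊆ Ω :=
  (interior_mono (cell_subset_closure K)).trans hΩ.subset

/-- Triangles are only known to lie in the closure of Ω. Their interiors lie in the interior of that
closure, which is Ω, and the frontier of a convex set is null. -/
lemma cell_ae_le (hΩ : interior (closure Ω) = Ω) (K : Fin m.num) :
    m.cell K ≤ᵐ[volume] Ω := by
  have h := (m.convex_cell K).addHaar_frontier volume
  have h2 := measure_eq_zero_iff_ae_notMem.1 h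
  filter_upwards [h2] with x hx hxK
  rw [(m.isCompact_cell K).isClosed.frontier_eq] at hx
  exact interior_cell_subset hΩ K (by
    by_contra h3
    exact hx ⟨hxK, h3⟩)

lemma iUnion_cell_ae_le (hΩ : interior (closure Ω) = Ω) : (⋃ K, m.cell K) ≤ᵐ[volume] Ω := by
  have h : ∀ᵐ x, ∀ K, x ∈ m.cell K → x ∈ Ω := ae_all_iff.2 fun K => cell_ae_le hΩ K
  filter_upwards [h] with x hx hxU
  obtain ⟨K, hK⟩ := mem_iUnion.1 hxU
  exact hx K hK

lemma sum_setLIntegral_le (hΩ : interior (closure Ω) = Ω) (F : Plane → ℝ≥0∞) :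
    ∑ K, ∫⁻ x in m.cell K, F x ≤ ∫⁻ x in Ω, F x := by
  rw [← tsum_fintype (L := .unconditional _), ← lintegral_iUnion₀
    (fun K => (m.measurableSet_cell K).nullMeasurableSet) m.aedisjoint_cell]
  exact lintegral_mono_set' (iUnion_cell_ae_le hΩ)

lemma restrict_cell_le (hΩ : interior (closure Ω) = Ω) (K : Fin m.num) :
    volume.restrict (m.cell K) ≤ vol Ω :=
  Measure.restrict_mono' (cell_ae_le hΩ K) le_rfl

lemma ae_glue_eq {F : Type} [AddCommMonoid F] (g : Fin m.num → Plane → F) :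
    ∀ᵐ x : Plane, ∀ K, x ∈ m.cell K → m.glue g x = g K x := by
  filter_upwards [m.ae_cell_unique] with x hx K hK
  have h1 : ∀ L, L ≠ K → x ∉ m.cell L := fun L hL hxL => hL (hx L K hxL hK)
  rw [glue, Finset.sum_eq_single K, indicator_of_mem hK]
  all_goals simp +contextual [h1]

lemma eLpNorm_glue_sq (hΩ : interior (closure Ω) = Ω) {F : Type} [NormedAddCommGroup F]
    (g : Fin m.num → Plane → F) (hg : ∀ K, Measurable fun x => ‖g K x‖ₑ) :
    eLpNorm (m.glue g) 2 (vol Ω) ^ 2 = ∑ K, ∫⁻ x in m.cell K, ‖g K x‖ₑ ^ 2 := by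
  rw [eLpNorm_two_sq]
  apply le_antisymm
  · rw [← lintegral_glue_enorm_sq g hg]
    exact lintegral_mono' Measure.restrict_le_self le_rfl
  · refine le_trans (le_of_eq ?_) (sum_setLIntegral_le (m := m) hΩ fun x => ‖m.glue g x‖ₑ ^ 2)
    refine Finset.sum_congr rfl fun K _ => setLIntegral_congr_fun_ae (m.measurableSet_cell K) ?_
    filter_upwards [ae_glue_eq g] with x hx hK
    rw [hx K hK]

lemma eLpNorm_glue_const_sq (hΩ : interior (closure Ω) = Ω) {F : Type} [NormedAddCommGroup F]
    (a : Fin m.num → F) :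
    eLpNorm (m.glue fun K _ => a K) 2 (vol Ω) ^ 2 =
      ENNReal.ofReal (∑ K, m.area K * ‖a K‖ ^ 2) := by
  rw [eLpNorm_glue_sq hΩ (fun K _ => a K) fun K => measurable_const,
    ENNReal.ofReal_sum_of_nonneg fun K _ => mul_nonneg (m.area_pos K).le (sq_nonneg _)]
  refine Finset.sum_congr rfl fun K _ => ?_
  rw [setLIntegral_const, ENNReal.ofReal_mul (m.area_pos K).le, ofReal_area, mul_comm,
    ← ofReal_norm, ENNReal.ofReal_pow (norm_nonneg _)]

lemma eLpNorm_glue_const (hΩ : interior (closure Ω) = Ω) (v : m.P0) :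
    eLpNorm (m.glue fun K _ => v K) 2 (vol Ω) = ENNReal.ofReal ‖m.emb v‖ := by
  have h := eLpNorm_glue_const_sq hΩ v
  rw [← norm_emb_sq, ENNReal.ofReal_pow (norm_nonneg _)] at h
  exact (ENNReal.pow_right_strictMono two_ne_zero).injective h

lemma memLp_glue_const (hΩ : interior (closure Ω) = Ω) (v : m.P0) :
    MemLp (m.glue fun K _ => v K) 2 (vol Ω) := by
  refine ⟨?_, by rw [eLpNorm_glue_const hΩ]; exact ENNReal.ofReal_lt_top⟩
  have : m.glue (fun K _ => v K) = fun x => ∑ K, (m.cell K).indicator (fun _ => v K) x := rfl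
  rw [this]
  exact Finset.aestronglyMeasurable_fun_sum _ fun K _ =>
    (aestronglyMeasurable_const).indicator (m.measurableSet_cell K)

lemma integrableOn_cell (hΩ : interior (closure Ω) = Ω) (w : L2 Ω Plane) (K : Fin m.num) :
    IntegrableOn w (m.cell K) := by
  have h := (Lp.memLp w).mono_measure (restrict_cell_le hΩ K)
  have : IsFiniteMeasure (volume.restrict (m.cell K)) :=
    ⟨by rw [Measure.restrict_apply_univ]; exact (volume_cell_ne_top K).lt_top⟩
  exact h.integrable one_le_two

lemma proj_sub (hΩ : interior (closure Ω) = Ω) (w w' : L2 Ω Plane) :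
    m.proj (w - w') = m.proj w - m.proj w' := by
  funext K
  have h : (fun x => (w - w') x) =ᵐ[volume.restrict (m.cell K)] fun x => w x - w' x :=
    (Lp.coeFn_sub w w').filter_mono (ae_mono (restrict_cell_le hΩ K))
  simp only [proj, Pi.sub_apply]
  rw [integral_congr_ae h, integral_sub (integrableOn_cell hΩ w K) (integrableOn_cell hΩ w' K),
    smul_sub]

/-- Cauchy–Schwarz for each cell mean, then additivity over almost disjoint triangles. -/
lemma norm_emb_proj_le (hΩ : interior (closure Ω) = Ω) (w : L2 Ω Plane) :
    ‖m.emb (m.proj w)‖ ≤ ‖w‖ := by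
  have h1 : ENNReal.ofReal (‖m.emb (m.proj w)‖ ^ 2) ≤ eLpNorm w 2 (vol Ω) ^ 2 := by
    rw [norm_emb_sq, ENNReal.ofReal_sum_of_nonneg
      fun K _ => mul_nonneg (m.area_pos K).le (sq_nonneg _), eLpNorm_two_sq]
    refine le_trans (Finset.sum_le_sum fun K _ => ?_) (sum_setLIntegral_le (m := m) hΩ _)
    have ha := m.area_pos K
    have hm : AEMeasurable (fun x => ‖w x‖ₑ) (volume.restrict (m.cell K)) :=
      (integrableOn_cell hΩ w K).1.enorm
    have h2 := sq_lintegral_le hm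
    rw [Measure.restrict_apply_univ] at h2
    have h3 := enorm_integral_le_lintegral_enorm (μ := volume.restrict (m.cell K)) (w : Plane → Plane)
    have h4 := (pow_le_pow_left₀ zero_le h3 2).trans h2
    rw [proj, norm_smul, norm_inv, Real.norm_eq_abs, abs_of_pos ha, mul_pow, ← mul_assoc,
      ENNReal.ofReal_mul (by positivity), ENNReal.ofReal_pow (norm_nonneg _), ofReal_norm]
    refine (mul_le_mul_right h4 _).trans (le_of_eq ?_)
    rw [← ofReal_area, ← mul_assoc, ← ENNReal.ofReal_mul (by positivity)]
    have : m.area K * (m.area K)⁻¹ ^ 2 * m.area K = 1 := by field_simp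
    rw [this, ENNReal.ofReal_one, one_mul]
  have h2 : eLpNorm w 2 (vol Ω) = ENNReal.ofReal ‖w‖ := by
    rw [Lp.norm_def, ENNReal.ofReal_toReal (Lp.eLpNorm_ne_top w)]
  rw [h2, ← ENNReal.ofReal_pow (norm_nonneg _), ENNReal.ofReal_le_ofReal_iff (by positivity)] at h1
  exact le_of_sq_le_sq h1 (norm_nonneg _)

lemma sum_area_le (hΩ : interior (closure Ω) = Ω) (hb : volume Ω ≠ ⊤) :
    ∑ K, m.area K ≤ volume.real Ω := by
  have h := sum_setLIntegral_le (m := m) hΩ fun _ => 1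
  simp only [setLIntegral_one, ← ofReal_area] at h
  rw [← ENNReal.ofReal_sum_of_nonneg fun K _ => (m.area_pos K).le] at h
  exact (ENNReal.ofReal_le_iff_le_toReal hb).1 h

lemma norm_emb_le_of_forall (hΩ : interior (closure Ω) = Ω) (hb : volume Ω ≠ ⊤) {v : m.P0} {B : ℝ}
    (hB : 0 ≤ B) (h : ∀ K, ‖v K‖ ≤ B) : ‖m.emb v‖ ≤ √(volume.real Ω) * B := by
  apply le_of_sq_le_sq _ (by positivity)
  rw [norm_emb_sq, mul_pow, Real.sq_sqrt measureReal_nonneg]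
  calc ∑ K, m.area K * ‖v K‖ ^ 2 ≤ ∑ K, m.area K * B ^ 2 :=
        Finset.sum_le_sum fun K _ => mul_le_mul_of_nonneg_left
          (pow_le_pow_left₀ (norm_nonneg _) (h K) 2) (m.area_pos K).le
    _ = (∑ K, m.area K) * B ^ 2 := by rw [Finset.sum_mul]
    _ ≤ _ := mul_le_mul_of_nonneg_right (sum_area_le hΩ hb) (sq_nonneg _)

lemma IsRegular.h_le {c : ℝ} (hm : m.IsRegular c) (hc : 0 < c) (hb : Bornology.IsBounded Ω)
    (K : Fin m.num) : m.h ≤ Metric.diam Ω / c := by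
  rw [le_div_iff₀ hc, mul_comm]
  refine (hm K 0).2.trans ?_
  rw [← Metric.diam_closure Ω]
  exact Metric.diam_mono ((m.edge_subset_cell K 0).trans (cell_subset_closure K)) hb.closure

end TriMesh

/-! ### Localization by scaled bump functions -/

section Bump

/-- A fixed bump function on the plane. -/
def stdBump : ContDiffBump (0 : Plane) := ⟨1, 2, one_pos, one_lt_two⟩

lemma exists_norm_fderiv_stdBump_le : ∃ L : ℝ, 0 ≤ L ∧ ∀ x, ‖fderiv ℝ stdBump x‖ ≤ L := by
  have h : ContDiff ℝ 1 stdBump := stdBump.contDiff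
  obtain ⟨L, hL⟩ := (h.continuous_fderiv one_ne_zero).bounded_above_of_compact_support
    (stdBump.hasCompactSupport.fderiv ℝ)
  exact ⟨L, (norm_nonneg _).trans (hL 0), hL⟩

/-- A bound of the gradient of the fixed bump function. -/
def bumpL : ℝ := exists_norm_fderiv_stdBump_le.choose

lemma bumpL_nonneg : 0 ≤ bumpL := exists_norm_fderiv_stdBump_le.choose_spec.1

lemma norm_fderiv_stdBump_le (x : Plane) : ‖fderiv ℝ stdBump x‖ ≤ bumpL :=
  exists_norm_fderiv_stdBump_le.choose_spec.2 x

/-- The fixed bump function, scaled by `ε` and centered at `z`. -/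
def bumpAt (z : Plane) (ε : ℝ) (x : Plane) : ℝ := stdBump (ε⁻¹ • (x - z))

variable {z : Plane} {ε : ℝ}

lemma contDiff_bumpAt : ContDiff ℝ ∞ (bumpAt z ε) :=
  stdBump.contDiff.comp ((contDiff_id.sub contDiff_const).const_smul ε⁻¹)

lemma bumpAt_nonneg (x : Plane) : 0 ≤ bumpAt z ε x := stdBump.nonneg

lemma bumpAt_eq_one (hε : 0 < ε) {x : Plane} (hx : x ∈ Metric.closedBall z ε) :
    bumpAt z ε x = 1 := by
  refine stdBump.one_of_mem_closedBall ?_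
  rw [mem_closedBall_zero_iff, norm_smul, norm_inv, Real.norm_eq_abs, abs_of_pos hε,
    inv_mul_le_iff₀ hε, ← dist_eq_norm]
  simpa [stdBump] using hx

lemma bumpAt_eq_zero (hε : 0 < ε) {x : Plane} (hx : x ∉ Metric.ball z (2 * ε)) :
    bumpAt z ε x = 0 := by
  refine stdBump.zero_of_le_dist ?_
  rw [dist_zero_right, norm_smul, norm_inv, Real.norm_eq_abs, abs_of_pos hε,
    le_inv_mul_iff₀ hε, ← dist_eq_norm]
  simpa [stdBump, mul_comm] using hx

lemma tsupport_bumpAt_subset (hε : 0 < ε) :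
    tsupport (bumpAt z ε) ⊆ Metric.closedBall z (2 * ε) := by
  refine closure_minimal (fun x hx => ?_) Metric.isClosed_closedBall
  by_contra h
  exact hx (bumpAt_eq_zero hε fun h2 => h (Metric.ball_subset_closedBall h2))

lemma hasCompactSupport_bumpAt (hε : 0 < ε) : HasCompactSupport (bumpAt z ε) :=
  (isCompact_closedBall z (2 * ε)).of_isClosed_subset (isClosed_tsupport _)
    (tsupport_bumpAt_subset hε)

lemma abs_bumpAt_le (hε : 0 < ε) (x : Plane) :
    |bumpAt z ε x| ≤ (Metric.closedBall z (2 * ε)).indicator (fun _ => 1) x := by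
  by_cases hx : x ∈ Metric.closedBall z (2 * ε)
  · rw [indicator_of_mem hx, abs_of_nonneg (bumpAt_nonneg x)]
    exact stdBump.le_one
  · rw [indicator_of_notMem hx, bumpAt_eq_zero hε fun h => hx (Metric.ball_subset_closedBall h),
      abs_zero]

lemma abs_fderiv_bumpAt_le (hε : 0 < ε) (x e : Plane) :
    |fderiv ℝ (bumpAt z ε) x e| ≤
      (Metric.closedBall z (2 * ε)).indicator (fun _ => bumpL / ε * ‖e‖) x := by
  by_cases hx : x ∈ Metric.closedBall z (2 * ε)
  · rw [indicator_of_mem hx]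
    have h1 : HasFDerivAt (bumpAt z ε) ((fderiv ℝ stdBump (ε⁻¹ • (x - z))).comp
        (ε⁻¹ • ContinuousLinearMap.id ℝ Plane)) x := by
      refine HasFDerivAt.comp x (f := fun x => ε⁻¹ • (x - z)) ?_
        (((hasFDerivAt_id x).sub_const z).const_smul ε⁻¹)
      exact ((stdBump.contDiff (n := 1)).differentiable one_ne_zero _).hasFDerivAt
    rw [h1.fderiv]
    simp only [ContinuousLinearMap.comp_apply, smul_apply, ContinuousLinearMap.id_apply,
      map_smul, smul_eq_mul]
    rw [abs_mul, abs_inv, abs_of_pos hε, div_mul_eq_mul_div, div_eq_inv_mul]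
    have h2 := ((fderiv ℝ stdBump (ε⁻¹ • (x - z))).le_opNorm e).trans
      (mul_le_mul_of_nonneg_right (norm_fderiv_stdBump_le _) (norm_nonneg e))
    rw [Real.norm_eq_abs] at h2
    exact mul_le_mul_of_nonneg_left h2 (by positivity)
  · rw [indicator_of_notMem hx, fderiv_of_notMem_tsupport ℝ fun h => hx (tsupport_bumpAt_subset hε h)]
    simp

end Bump

section Integrals

lemma sq_enorm_integral_smul_le {F : Type} [NormedAddCommGroup F] [NormedSpace ℝ F]
    {μ : Measure Plane} (hμ : μ ≤ volume) {ψ : Plane → ℝ} {g : Plane → F}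
    (hg : AEStronglyMeasurable g μ) {B r : ℝ} {z : Plane} (hB : 0 ≤ B) (hr : 0 ≤ r)
    (hψ : ∀ x, |ψ x| ≤ (Metric.closedBall z r).indicator (fun _ => B) x) :
    ‖∫ x, ψ x • g x ∂μ‖ₑ ^ 2 ≤
      ENNReal.ofReal (B ^ 2 * (Real.pi * r ^ 2)) * ∫⁻ x in Metric.closedBall z r, ‖g x‖ₑ ^ 2 ∂μ := by
  have hpi := Real.pi_pos
  have hmeas : MeasurableSet (Metric.closedBall z r) := Metric.isClosed_closedBall.measurableSet
  have h1 : ‖∫ x, ψ x • g x ∂μ‖ₑ ≤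
      ENNReal.ofReal B * ∫⁻ x in Metric.closedBall z r, ‖g x‖ₑ ∂μ := by
    refine (enorm_integral_le_lintegral_enorm _).trans ?_
    rw [← lintegral_const_mul' _ _ ENNReal.ofReal_ne_top, ← lintegral_indicator hmeas]
    refine lintegral_mono fun x => ?_
    have h2 := hψ x
    by_cases hx : x ∈ Metric.closedBall z r
    · rw [indicator_of_mem hx] at h2 ⊢
      rw [enorm_smul, Real.enorm_eq_ofReal_abs]
      gcongr
    · rw [indicator_of_notMem hx] at h2 ⊢
      rw [abs_nonpos_iff.1 h2]; simp
  have h3 := sq_lintegral_le (hg.restrict (s := Metric.closedBall z r)).enorm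
  have h4 : (μ.restrict (Metric.closedBall z r)) univ ≤ ENNReal.ofReal (Real.pi * r ^ 2) := by
    rw [Measure.restrict_apply_univ]
    refine (hμ _).trans (le_of_eq ?_)
    rw [← TriMesh.volume_real_closedBall z hr, ofReal_measureReal measure_closedBall_lt_top.ne]
  calc ‖∫ x, ψ x • g x ∂μ‖ₑ ^ 2
      ≤ (ENNReal.ofReal B * ∫⁻ x in Metric.closedBall z r, ‖g x‖ₑ ∂μ) ^ 2 :=
        pow_le_pow_left₀ zero_le h1 2
    _ = ENNReal.ofReal B ^ 2 * (∫⁻ x in Metric.closedBall z r, ‖g x‖ₑ ∂μ) ^ 2 := mul_pow _ _ _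
    _ ≤ ENNReal.ofReal B ^ 2 * (ENNReal.ofReal (Real.pi * r ^ 2) *
        ∫⁻ x in Metric.closedBall z r, ‖g x‖ₑ ^ 2 ∂μ) :=
        mul_le_mul_right (h3.trans (mul_le_mul_left h4 _)) _
    _ = _ := by
        rw [← mul_assoc, ← ENNReal.ofReal_pow hB, ← ENNReal.ofReal_mul (by positivity)]

variable {Ω : Set Plane}

lemma tendsto_setIntegral_smul {F : Type} [NormedAddCommGroup F] [NormedSpace ℝ F]
    {ψ : Plane → ℝ} (hψ : Continuous ψ) (hψc : HasCompactSupport ψ) {G : ℕ → Plane → F}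
    {g : Plane → F} (hG : ∀ n, MemLp (G n) 2 (vol Ω)) (hg : MemLp g 2 (vol Ω))
    (h : Tendsto (fun n => eLpNorm (fun x => G n x - g x) 2 (vol Ω)) atTop (𝓝 0)) :
    Tendsto (fun n => ∫ x in Ω, ψ x • G n x) atTop (𝓝 (∫ x in Ω, ψ x • g x)) := by
  have hψ2 : MemLp ψ 2 (vol Ω) := (hψ.memLp_of_hasCompactSupport hψc).restrict Ω
  have hint : ∀ {u : Plane → F}, MemLp u 2 (vol Ω) → Integrable (fun x => ψ x • u x) (vol Ω) :=
    fun hu => memLp_one_iff_integrable.1 (hu.smul hψ2)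
  refine tendsto_integral_of_L1' _ (hint hg).1 (Eventually.of_forall fun n => hint (hG n)) ?_
  have h2 : ∀ n, eLpNorm ((fun x => ψ x • G n x) - fun x => ψ x • g x) 1 (vol Ω) ≤
      eLpNorm ψ 2 (vol Ω) * eLpNorm (fun x => G n x - g x) 2 (vol Ω) := by
    intro n
    have e : ((fun x => ψ x • G n x) - fun x => ψ x • g x) = ψ • fun x => G n x - g x := by
      funext x; simp [smul_sub]
    rw [e]
    exact eLpNorm_smul_le_mul_eLpNorm ((hG n).1.sub hg.1) hψ2.1
  refine tendsto_of_tendsto_of_tendsto_of_le_of_le tendsto_const_nhds ?_ (fun _ => zero_le) h2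
  simpa using ENNReal.Tendsto.const_mul h (Or.inr hψ2.2.ne)

lemma IsTest.pd {F : Type} [NormedAddCommGroup F] [NormedSpace ℝ F] {φ : Plane → F}
    (h : IsTest Ω φ) (i : Fin 2) : Continuous (pd i φ) ∧ HasCompactSupport (pd i φ) ∧
      ∀ x, x ∉ Ω → pd i φ x = 0 := by
  have h0 : ∀ x, x ∉ tsupport φ → FVScheme.pd i φ x = 0 := by
    intro x hx
    rw [FVScheme.pd, fderiv_of_notMem_tsupport ℝ hx]; rfl
  exact ⟨(h.1.continuous_fderiv (by simp)).clm_apply continuous_const,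
    HasCompactSupport.intro' h.2.1 (isClosed_tsupport _) h0, fun x hx => h0 x fun h1 =>
      hx (h.2.2 h1)⟩

lemma integral_pd_smul_eq {F : Type} [NormedAddCommGroup F] [NormedSpace ℝ F]
    {ψ : Plane → ℝ} (hψ : ContDiff ℝ ∞ ψ) (hψc : HasCompactSupport ψ) {φ : Plane → F}
    (hφ : ContDiff ℝ 1 φ) (i : Fin 2) :
    ∫ x, pd i ψ x • φ x = -∫ x, ψ x • pd i φ x := by
  have c1 : Continuous (pd i ψ) := (hψ.continuous_fderiv (by simp)).clm_apply continuous_const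
  have c2 : Continuous (pd i φ) := (hφ.continuous_fderiv one_ne_zero).clm_apply continuous_const
  have hs : HasCompactSupport (pd i ψ) :=
    HasCompactSupport.intro' hψc (isClosed_tsupport _) fun x hx => by
      rw [pd, fderiv_of_notMem_tsupport ℝ hx]; rfl
  have h := integral_smul_fderiv_eq_neg_fderiv_smul_of_integrable (μ := volume) (f := ψ) (g := φ)
    (v := EuclideanSpace.single i 1)
    ((c1.smul hφ.continuous).integrable_of_hasCompactSupport hs.smul_right)
    ((hψ.continuous.smul c2).integrable_of_hasCompactSupport hψc.smul_right)
    ((hψ.continuous.smul hφ.continuous).integrable_of_hasCompactSupport hψc.smul_right)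
    (fun x _ => hψ.differentiable (by simp) x) (fun x _ => hφ.differentiable one_ne_zero x)
  simp only [pd]
  rw [h, neg_neg]

/-- Here the zero boundary value acts: ψ need not be supported in Ω. The identity holds on the whole
plane for the approximating compactly supported fields and passes to the limit. -/
lemma IsH10.integral_pd_smul {w : L2 Ω Plane} {Dw : Fin 2 → L2 Ω Plane}
    (h : IsH10 Ω w Dw) {ψ : Plane → ℝ} (hψ : ContDiff ℝ ∞ ψ) (hψc : HasCompactSupport ψ)
    (i : Fin 2) : ∫ x in Ω, pd i ψ x • w x = -∫ x in Ω, ψ x • Dw i x := by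
  obtain ⟨φ, hφ, h1, h2⟩ := h
  have c1 : Continuous (pd i ψ) := (hψ.continuous_fderiv (by simp)).clm_apply continuous_const
  have hs : HasCompactSupport (pd i ψ) :=
    HasCompactSupport.intro' hψc (isClosed_tsupport _) fun x hx => by
      rw [pd, fderiv_of_notMem_tsupport ℝ hx]; rfl
  have m1 : ∀ n, MemLp (φ n) 2 (vol Ω) := fun n =>
    ((hφ n).1.continuous.memLp_of_hasCompactSupport (hφ n).2.1).restrict Ω
  have m2 : ∀ n, MemLp (pd i (φ n)) 2 (vol Ω) := fun n =>
    (((hφ n).pd i).1.memLp_of_hasCompactSupport ((hφ n).pd i).2.1).restrict Ω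
  have t1 := tendsto_setIntegral_smul c1 hs m1 (Lp.memLp w) h1
  have t2 := (tendsto_setIntegral_smul hψ.continuous hψc m2 (Lp.memLp (Dw i)) (h2 i)).neg
  refine tendsto_nhds_unique t1 (t2.congr fun n => ?_)
  have hz : ∀ x, x ∉ Ω → φ n x = 0 := fun x hx => image_eq_zero_of_notMem_tsupport
    fun h1 => hx ((hφ n).2.2 h1)
  rw [setIntegral_eq_integral_of_forall_compl_eq_zero (fun x hx => by
      rw [((hφ n).pd i).2.2 x hx, smul_zero]),
    setIntegral_eq_integral_of_forall_compl_eq_zero (fun x hx => by rw [hz x hx, smul_zero]),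
    integral_pd_smul_eq hψ hψc ((hφ n).1.of_le (by simp))]

end Integrals

lemma norm_integral_smul_le {F : Type} [NormedAddCommGroup F] [NormedSpace ℝ F]
    {μ : Measure Plane} (hμ : μ ≤ volume) {ψ : Plane → ℝ} {g : Plane → F}
    (hg : AEStronglyMeasurable g μ) {B r y : ℝ} {z : Plane} (hB : 0 ≤ B) (hr : 0 ≤ r) (hy : 0 ≤ y)
    (hψ : ∀ x, |ψ x| ≤ (Metric.closedBall z r).indicator (fun _ => B) x)
    (hgy : ∫⁻ x in Metric.closedBall z r, ‖g x‖ₑ ^ 2 ∂μ ≤ ENNReal.ofReal (y ^ 2)) :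
    ‖∫ x, ψ x • g x ∂μ‖ ≤ B * (√Real.pi * r) * y := by
  have hpi := Real.pi_pos
  have h := (sq_enorm_integral_smul_le hμ hg hB hr hψ).trans (mul_le_mul_right hgy _)
  rw [← ENNReal.ofReal_mul (by positivity), ← ofReal_norm, ← ENNReal.ofReal_pow (norm_nonneg _),
    ENNReal.ofReal_le_ofReal_iff (by positivity)] at h
  apply le_of_sq_le_sq _ (by positivity)
  refine h.trans (le_of_eq ?_)
  rw [mul_pow, mul_pow, mul_pow, Real.sq_sqrt hpi.le]

/-! ### Jumps of a field that is close to H¹₀ -/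

namespace TriMesh

variable {Ω : Set Plane} {m : TriMesh Ω}

lemma setIntegral_smul_glue (hΩ : interior (closure Ω) = Ω) {ψ : Plane → ℝ}
    (hψ : Continuous ψ) (v : m.P0) :
    ∫ x in Ω, ψ x • m.glue (fun K _ => v K) x = ∑ K, (∫ x in m.cell K, ψ x) • v K := by
  have h0 : ∀ x, ψ x • m.glue (fun K _ => v K) x =
      ∑ K, (m.cell K).indicator (fun x => ψ x • v K) x := by
    intro x
    rw [glue, Finset.smul_sum]
    refine Finset.sum_congr rfl fun K _ => ?_
    by_cases h : x ∈ m.cell K <;> simp [h]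
  simp only [h0]
  have hi : ∀ K, IntegrableOn (fun x => ψ x • v K) (m.cell K) := fun K =>
    (hψ.smul continuous_const).continuousOn.integrableOn_compact (m.isCompact_cell K)
  rw [integral_finsetSum _ fun K _ =>
    ((integrable_indicator_iff (m.measurableSet_cell K)).2 (hi K)).restrict]
  refine Finset.sum_congr rfl fun K _ => ?_
  rw [setIntegral_indicator (m.measurableSet_cell K), ← integral_smul_const]
  refine setIntegral_congr_set ?_
  filter_upwards [cell_ae_le hΩ K] with x hx
  exact propext ⟨fun h => h.2, fun h => ⟨hx h, h⟩⟩

/-- The bump equals 1 on the part of the edge within ε of the midpoint, of length 2ε; hence the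
parameter interval 1/2 ± ε/|σ|. -/
lemma two_mul_le_len_mul_edgeMean (K : Fin m.num) (i : Fin 3) {ε : ℝ} (hε : 0 < ε)
    (hl : 2 * ε ≤ m.len K i) :
    2 * ε ≤ m.len K i * edgeMean (bumpAt (m.mid K i) ε) (m.pt K) i := by
  have hlen := m.len_pos K i
  set s := ε / m.len K i with hs
  have hs0 : 0 < s := by positivity
  have hs2 : s ≤ 1 / 2 := by rw [hs, div_le_iff₀ hlen]; linarith
  have hc : Continuous fun t : ℝ => bumpAt (m.mid K i) ε
      ((1 - t) • m.pt K (i + 1) + t • m.pt K (i + 2)) :=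
    contDiff_bumpAt.continuous.comp (by fun_prop)
  have h1 := intervalIntegral.integral_mono_interval (μ := volume) (a := 1 / 2 - s) (b := 1 / 2 + s)
    (c := 0) (d := 1) (by linarith) (by linarith) (by linarith)
    (Eventually.of_forall fun t => bumpAt_nonneg _) (hc.intervalIntegrable 0 1)
  have h2 : ∫ t in (1 / 2 - s)..(1 / 2 + s), bumpAt (m.mid K i) ε
      ((1 - t) • m.pt K (i + 1) + t • m.pt K (i + 2)) = 2 * s := by
    rw [intervalIntegral.integral_congr (g := fun _ => (1 : ℝ)), intervalIntegral.integral_const]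
    · simp; ring
    · intro t ht
      rw [uIcc_of_le (by linarith)] at ht
      refine bumpAt_eq_one hε ?_
      rw [Metric.mem_closedBall, dist_eq_norm, mid_eq]
      have e : (1 - t) • m.pt K (i + 1) + t • m.pt K (i + 2) -
          ((2 : ℝ)⁻¹ • m.pt K (i + 1) + (2 : ℝ)⁻¹ • m.pt K (i + 2)) =
          (1 / 2 - t) • (m.pt K (i + 1) - m.pt K (i + 2)) := by module
      rw [e, norm_smul, ← dist_eq_norm (m.pt K (i + 1)), ← len_eq_dist, Real.norm_eq_abs]
      have h3 : |1 / 2 - t| ≤ s := abs_le.2 ⟨by linarith [ht.2], by linarith [ht.1]⟩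
      calc _ ≤ s * m.len K i := by gcongr
        _ = ε := by rw [hs]; field_simp
  rw [h2] at h1
  calc 2 * ε = m.len K i * (2 * s) := by rw [hs]; field_simp
    _ ≤ _ := mul_le_mul_of_nonneg_left h1 hlen.le

/-- All edges other than the two copies of the given one form a closed set, which conformity keeps
away from the midpoint. -/
lemma exists_ball_mid_subset (e : Fin m.num × Fin 3) : ∃ r > 0, ∀ e', e' ≠ e → e' ≠ m.opp e →
    ∀ x ∈ m.edge e'.1 e'.2, x ∉ Metric.ball (m.mid e.1 e.2) r := by
  classical
  set S : Set Plane := ⋃ e' ∈ {e' : Fin m.num × Fin 3 | e' ≠ e ∧ e' ≠ m.opp e}, m.edge e'.1 e'.2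
    with hS
  have hcl : IsClosed S := (toFinite _).isClosed_biUnion fun e' _ =>
    (m.isCompact_edge e'.1 e'.2).isClosed
  have hz : m.mid e.1 e.2 ∈ Sᶜ := by
    intro h
    simp only [hS, mem_iUnion] at h
    obtain ⟨e', ⟨h1, h2⟩, h3⟩ := h
    rcases m.eq_or_isOpp_of_mid_mem h3 with h4 | h4
    · exact h1 h4
    · exact h2 (opp_eq_of_isOpp h4).symm
  obtain ⟨r, hr, hsub⟩ := Metric.isOpen_iff.1 hcl.isOpen_compl _ hz
  refine ⟨r, hr, fun e' h1 h2 x hx hxb => hsub hxb ?_⟩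
  simp only [hS, mem_iUnion]
  exact ⟨e', ⟨h1, h2⟩, hx⟩

lemma edgeMean_bumpAt_eq_zero {e e' : Fin m.num × Fin 3} {ε : ℝ} (hε : 0 < ε)
    (h : ∀ x ∈ m.edge e'.1 e'.2, x ∉ Metric.ball (m.mid e.1 e.2) (2 * ε)) :
    edgeMean (bumpAt (m.mid e.1 e.2) ε) (m.pt e'.1) e'.2 = 0 := by
  have h1 := edgeMean_mem_of_forall (m := m) (K := e'.1) (i := e'.2) (z := 0) (b := 0)
    (contDiff_bumpAt (z := m.mid e.1 e.2) (ε := ε)).continuous fun x hx => by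
      rw [bumpAt_eq_zero hε (h x hx)]; simp
  rw [sub_zero] at h1
  exact abs_nonpos_iff.1 h1

/-- The divergence theorem on each triangle; only the two sides of the edge meet the bump, and their
opposite normals turn the two values into the jump. -/
lemma setIntegral_fderiv_bumpAt_smul_glue (hΩ : interior (closure Ω) = Ω) (v : m.P0)
    (e : Fin m.num × Fin 3) {ε : ℝ} (hε : 0 < ε)
    (h : ∀ e', e' ≠ e → e' ≠ m.opp e →
      ∀ x ∈ m.edge e'.1 e'.2, x ∉ Metric.ball (m.mid e.1 e.2) (2 * ε)) :
    ∫ x in Ω, fderiv ℝ (bumpAt (m.mid e.1 e.2) ε) x (m.nv e) • m.glue (fun K _ => v K) x =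
      -((m.ln e * edgeMean (bumpAt (m.mid e.1 e.2) ε) (m.pt e.1) e.2) • m.jump v e) := by
  set φ := bumpAt (m.mid e.1 e.2) ε with hφ
  have hφ1 : ContDiff ℝ 1 φ := contDiff_bumpAt.of_le (by simp)
  have hn : inner ℝ (m.nv e) (m.nv e) = 1 := by
    rw [real_inner_self_eq_norm_sq, norm_nv, one_pow]
  rw [setIntegral_smul_glue hΩ
    ((hφ1.continuous_fderiv one_ne_zero).clm_apply continuous_const)]
  simp only [m.setIntegral_cell_fderiv _ hφ1, Finset.sum_smul]
  set G : Fin m.num × Fin 3 → Plane := fun a =>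
    (m.ln a * inner ℝ (m.nv a) (m.nv e) * edgeMean φ (m.pt a.1) a.2) • v a.1 with hG
  change ∑ K, ∑ i, G (K, i) = _
  rw [← sum_prod_edges]
  have h0 : ∀ a, a ≠ e → a ≠ m.opp e → G a = 0 := by
    intro a h1 h2
    simp only [hG]
    rw [edgeMean_bumpAt_eq_zero hε (h a h1 h2)]; simp
  by_cases ho : m.opp e = e
  · rw [Fintype.sum_eq_single e fun a ha => h0 a ha (by rwa [ho]), jump, nb_of_eq ho]
    simp only [hG]
    rw [hn]; simp
  · rw [Fintype.sum_eq_add e (m.opp e) (fun h => ho h.symm) fun a ha => h0 a ha.1 ha.2, jump,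
      nb_of_ne ho]
    simp only [hG]
    rw [(isOpp_opp ho).edgeMean, ln_opp, nv_opp ho, inner_neg_left, hn]
    module

/-- A piecewise constant field that is uniformly close to an `H¹₀` field has small jumps. -/
lemma norm_jump_le_of_isH10 (hΩ : interior (closure Ω) = Ω) {w : L2 Ω Plane}
    {Dw : Fin 2 → L2 Ω Plane} (hw : IsH10 Ω w Dw) {v : m.P0} {b : ℝ} (hb : 0 ≤ b)
    (hvw : ∀ᵐ x ∂vol Ω, ‖m.glue (fun K _ => v K) x - w x‖ ≤ b) (e : Fin m.num × Fin 3) :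
    ‖m.jump v e‖ ≤ 2 * Real.pi * bumpL * b := by
  have hpi := Real.pi_pos
  have hL := bumpL_nonneg
  have hvol : vol Ω ≤ volume := Measure.restrict_le_self
  -- The bump radius ε will tend to 0 on a fixed mesh. The jump contributes at order ε; the sup-norm
  -- error contributes b at the same order, and the H¹₀ field o(ε), at most the arbitrary margin κ'
  -- after division by ε.
  refine le_of_forall_pos_le_add fun κ' hκ' => ?_
  set κ := κ' / (2 * √Real.pi) with hκ
  have hκ0 : 0 < κ := by positivity
  obtain ⟨r, hr, hsep⟩ := m.exists_ball_mid_subset e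
  -- Absolute continuity of the integral makes the L² norm of the weak gradient on the small disc at
  -- most κ; with the O(ε) norm of the bump, its contribution is κ times O(ε).
  have hδ : ∀ i, ∃ δ > (0 : ℝ), ∀ s, MeasurableSet s → (vol Ω) s ≤ ENNReal.ofReal δ →
      eLpNorm (s.indicator (Dw i)) 2 (vol Ω) ≤ ENNReal.ofReal κ := fun i => by
    obtain ⟨δ, h1, h2⟩ := (Lp.memLp (Dw i)).eLpNorm_indicator_le one_le_two ENNReal.ofNat_ne_top hκ0
    exact ⟨δ, h1, h2⟩
  choose δ hδ0 hδs using hδ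
  have hlen : 0 < m.ln e := ln_pos e
  obtain ⟨ε, hε, hεr, hεl, hε0, hε1⟩ : ∃ ε > 0, 2 * ε < r ∧ 2 * ε < m.ln e ∧
      Real.pi * (2 * ε) ^ 2 < δ 0 ∧ Real.pi * (2 * ε) ^ 2 < δ 1 := by
    have t1 : Tendsto (fun ε : ℝ => 2 * ε) (𝓝[>] 0) (𝓝 0) := by
      have : Tendsto (fun ε : ℝ => 2 * ε) (𝓝 0) (𝓝 (2 * 0)) := (continuous_const_mul 2).tendsto 0
      rw [mul_zero] at this
      exact this.mono_left nhdsWithin_le_nhds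
    have t2 : Tendsto (fun ε : ℝ => Real.pi * (2 * ε) ^ 2) (𝓝[>] 0) (𝓝 0) := by
      simpa using (t1.pow 2).const_mul Real.pi
    have := (eventually_mem_nhdsWithin (a := (0 : ℝ)) (s := Ioi 0)).and
      ((t1.eventually_lt_const hr).and ((t1.eventually_lt_const hlen).and
      ((t2.eventually_lt_const (hδ0 0)).and (t2.eventually_lt_const (hδ0 1)))))
    obtain ⟨ε, h1, h2, h3, h4, h5⟩ := this.exists
    exact ⟨ε, h1, h2, h3, h4, h5⟩
  set z := m.mid e.1 e.2 with hz
  set φ := bumpAt z ε with hφ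
  set n := m.nv e with hn
  have hnorm : ‖n‖ = 1 := norm_nv e
  have hI := setIntegral_fderiv_bumpAt_smul_glue hΩ v e hε fun e' h1 h2 x hx hxb =>
    hsep e' h1 h2 x hx (Metric.ball_subset_ball hεr.le hxb)
  rw [← hz, ← hφ, ← hn] at hI
  have hmeas : MeasurableSet (Metric.closedBall z (2 * ε)) := Metric.isClosed_closedBall.measurableSet
  have hcb : (vol Ω) (Metric.closedBall z (2 * ε)) ≤ ENNReal.ofReal (Real.pi * (2 * ε) ^ 2) := by
    rw [← volume_real_closedBall z (by positivity), ofReal_measureReal measure_closedBall_lt_top.ne]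
    exact hvol _
  have hD : ∀ i, ‖∫ x in Ω, φ x • Dw i x‖ ≤ √Real.pi * (2 * ε) * κ := by
    intro i
    have hi : Real.pi * (2 * ε) ^ 2 ≤ δ i := by fin_cases i; exacts [hε0.le, hε1.le]
    have h1 := hδs i _ hmeas (hcb.trans (ENNReal.ofReal_le_ofReal hi))
    rw [eLpNorm_indicator_eq_eLpNorm_restrict hmeas] at h1
    have h2 := pow_le_pow_left₀ zero_le h1 2
    rw [eLpNorm_two_sq, ← ENNReal.ofReal_pow hκ0.le] at h2
    have h3 := norm_integral_smul_le hvol (Lp.memLp (Dw i)).1 zero_le_one (by positivity)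
      hκ0.le (abs_bumpAt_le hε) h2
    rwa [one_mul] at h3
  have hgm := memLp_glue_const hΩ v
  have hderiv : ∀ x, |fderiv ℝ φ x n| ≤
      (Metric.closedBall z (2 * ε)).indicator (fun _ => bumpL / ε) x := by
    intro x
    have := abs_fderiv_bumpAt_le (z := z) hε x n
    rwa [hnorm, mul_one] at this
  have hB : ‖∫ x in Ω, fderiv ℝ φ x n • (m.glue (fun K _ => v K) x - w x)‖ ≤
      bumpL / ε * (√Real.pi * (2 * ε)) * (b * (√Real.pi * (2 * ε))) := by
    refine norm_integral_smul_le hvol (hgm.1.sub (Lp.memLp w).1) (by positivity) (by positivity)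
      (by positivity) hderiv ?_
    calc ∫⁻ x in Metric.closedBall z (2 * ε), ‖m.glue (fun K _ => v K) x - w x‖ₑ ^ 2 ∂vol Ω
        ≤ ∫⁻ _ in Metric.closedBall z (2 * ε), ENNReal.ofReal (b ^ 2) ∂vol Ω := by
          refine lintegral_mono_ae ((ae_restrict_of_ae hvw).mono fun x hx => ?_)
          rw [← ofReal_norm, ← ENNReal.ofReal_pow (norm_nonneg _)]
          exact ENNReal.ofReal_le_ofReal (pow_le_pow_left₀ (norm_nonneg _) hx 2)
      _ = ENNReal.ofReal (b ^ 2) * (vol Ω) (Metric.closedBall z (2 * ε)) := setLIntegral_const _ _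
      _ ≤ ENNReal.ofReal (b ^ 2) * ENNReal.ofReal (Real.pi * (2 * ε) ^ 2) := mul_le_mul_right hcb _
      _ = _ := by
          rw [← ENNReal.ofReal_mul (by positivity)]
          congr 1
          rw [mul_pow b, mul_pow √Real.pi, Real.sq_sqrt hpi.le]
  have hφc : Continuous fun x => fderiv ℝ φ x n :=
    ((contDiff_bumpAt (z := z) (ε := ε)).continuous_fderiv (by simp)).clm_apply continuous_const
  have hφs : HasCompactSupport fun x => fderiv ℝ φ x n :=
    HasCompactSupport.intro' (hasCompactSupport_bumpAt (z := z) hε) (isClosed_tsupport _)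
      fun x hx => by rw [fderiv_of_notMem_tsupport ℝ hx]; rfl
  have hint : ∀ {ψ : Plane → ℝ} {g : Plane → Plane}, Continuous ψ → HasCompactSupport ψ →
      MemLp g 2 (vol Ω) → Integrable (fun x => ψ x • g x) (vol Ω) := fun h1 h2 h3 =>
    memLp_one_iff_integrable.1 (h3.smul
      (((h1.memLp_of_hasCompactSupport h2).restrict Ω : MemLp _ 2 (vol Ω))))
  have hsplit : ∫ x in Ω, fderiv ℝ φ x n • (m.glue (fun K _ => v K) x - w x) =
      (∫ x in Ω, fderiv ℝ φ x n • m.glue (fun K _ => v K) x) -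
        ∫ x in Ω, fderiv ℝ φ x n • w x := by
    simp only [smul_sub]
    exact integral_sub (hint hφc hφs hgm) (hint hφc hφs (Lp.memLp w))
  have hw2 : ∫ x in Ω, fderiv ℝ φ x n • w x =
      -(n 0 • (∫ x in Ω, φ x • Dw 0 x) + n 1 • ∫ x in Ω, φ x • Dw 1 x) := by
    have hpc : ∀ i, Continuous (pd i φ) := fun i =>
      ((contDiff_bumpAt (z := z) (ε := ε)).continuous_fderiv (by simp)).clm_apply continuous_const
    have hps : ∀ i, HasCompactSupport (pd i φ) := fun i =>
      HasCompactSupport.intro' (hasCompactSupport_bumpAt (z := z) hε) (isClosed_tsupport _)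
        fun x hx => by rw [pd, fderiv_of_notMem_tsupport ℝ hx]; rfl
    have e1 : ∀ x, fderiv ℝ φ x n • w x = n 0 • (pd 0 φ x • w x) + n 1 • (pd 1 φ x • w x) := by
      intro x
      rw [show fderiv ℝ φ x n = fderiv ℝ φ x
        (n 0 • EuclideanSpace.single 0 1 + n 1 • EuclideanSpace.single 1 1) by
          congr 1; ext j; fin_cases j <;> simp]
      rw [map_add, map_smul, map_smul, add_smul, smul_assoc, smul_assoc, pd, pd]
    simp only [e1]
    have hj : ∀ i, Integrable (fun x => n i • (pd i φ x • w x)) (vol Ω) := fun i =>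
      (hint (hpc i) (hps i) (Lp.memLp w)).smul (n i)
    rw [integral_add (hj 0) (hj 1), integral_smul, integral_smul,
      hw.integral_pd_smul contDiff_bumpAt (hasCompactSupport_bumpAt hε),
      hw.integral_pd_smul contDiff_bumpAt (hasCompactSupport_bumpAt hε)]
    module
  rw [hsplit, hI, hw2] at hB
  have hE := two_mul_le_len_mul_edgeMean e.1 e.2 hε hεl.le
  rw [← hz, ← hφ] at hE
  set E := m.ln e * edgeMean φ (m.pt e.1) e.2 with hEdef
  change 2 * ε ≤ E at hE
  have hn1 : ∀ i, |n i| ≤ 1 := fun i => by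
    rw [← hnorm]; exact PiLp.norm_apply_le n i
  have hj : E * ‖m.jump v e‖ ≤ bumpL / ε * (√Real.pi * (2 * ε)) * (b * (√Real.pi * (2 * ε))) +
      2 * (√Real.pi * (2 * ε) * κ) := by
    have e1 : E • m.jump v e = -((-(E • m.jump v e) -
        -(n 0 • (∫ x in Ω, φ x • Dw 0 x) + n 1 • ∫ x in Ω, φ x • Dw 1 x)) -
        (n 0 • (∫ x in Ω, φ x • Dw 0 x) + n 1 • ∫ x in Ω, φ x • Dw 1 x)) := by abel
    have e2 : ‖E • m.jump v e‖ = E * ‖m.jump v e‖ := by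
      rw [norm_smul, Real.norm_eq_abs, abs_of_nonneg (by linarith)]
    rw [← e2, e1, norm_neg]
    refine (norm_sub_le _ _).trans (add_le_add hB ((norm_add_le _ _).trans ?_))
    rw [norm_smul, norm_smul, two_mul]
    refine add_le_add ?_ ?_
    · exact (mul_le_mul (hn1 0) (hD 0) (norm_nonneg _) zero_le_one).trans (by rw [one_mul])
    · exact (mul_le_mul (hn1 1) (hD 1) (norm_nonneg _) zero_le_one).trans (by rw [one_mul])
  have h5 := (mul_le_mul_of_nonneg_right hE (norm_nonneg (m.jump v e))).trans hj
  have h6 : bumpL / ε * (√Real.pi * (2 * ε)) * (b * (√Real.pi * (2 * ε))) +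
      2 * (√Real.pi * (2 * ε) * κ) = 2 * ε * (2 * Real.pi * bumpL * b + κ') := by
    have hs : √Real.pi ^ 2 = Real.pi := Real.sq_sqrt hpi.le
    have hs0 : 0 < √Real.pi := by positivity
    rw [hκ]
    field_simp
    rw [hs]
    ring
  rw [h6] at h5
  exact le_of_mul_le_mul_left h5 (by positivity)

end TriMesh

/-! ### Discrete operators applied to the initial data -/

namespace TriMesh

variable {Ω : Set Plane} {m : TriMesh Ω} {c : ℝ}

section InitialOperators

lemma IsRegular.tr_le (hm : m.IsRegular c) (hc : 0 < c) (e : Fin m.num × Fin 3) :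
    m.tr e ≤ 2 / c ^ 2 := by
  have hh := m.h_pos e.1
  have hl : m.ln e ≤ 2 * m.h := m.len_le _ _
  by_cases h : m.opp e = e
  · rw [tr_of_eq h, div_le_div_iff₀ (dist_ctr_mid_pos e) (by positivity)]
    have h1 := (hm.sq_mul_h_le hc e.1 e.2).trans
      (Metric.infDist_le_dist_of_mem (m.mid_mem_edge e.1 e.2))
    nlinarith [sq_nonneg c]
  · rw [tr_of_ne h, div_le_div_iff₀ (dist_ctr_opp_pos h) (by positivity)]
    -- The neighbouring circumcentre is interior to another triangle, hence outside the disc of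
    -- radius c² h about this one.
    have h1 : c ^ 2 * m.h ≤ dist (m.ctr e.1) (m.ctr (m.opp e).1) := by
      by_contra hcon
      have h2 := hm.ball_subset hc e.1 (Metric.mem_ball'.2 (not_le.1 hcon))
      exact (isOpp_opp h).1 (m.interior_cell_disjoint h2 (m.ctr_mem_interior _)).symm
    nlinarith [sq_nonneg c]

lemma norm_le_of_area_smul {a x : Plane} {K : Fin m.num} {B : ℝ} (h : m.area K • a = x)
    (hx : ‖x‖ ≤ m.area K * B) : ‖a‖ ≤ B := by
  rw [← h, norm_smul, Real.norm_eq_abs, abs_of_pos (m.area_pos K)] at hx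
  exact le_of_mul_le_mul_left hx (m.area_pos K)

/-- Transmissivities are bounded and areas are at least π c⁴ h², so jumps of order h² are exactly
what a bounded discrete Laplacian needs. -/
lemma IsRegular.norm_lap_le (hm : m.IsRegular c) (hc : 0 < c) {v : m.P0} {B : ℝ} (hB : 0 ≤ B)
    (hv : ∀ e, ‖m.jump v e‖ ≤ B * m.h ^ 2) (K : Fin m.num) :
    ‖m.lap v K‖ ≤ 6 / (Real.pi * c ^ 6) * B := by
  have hpi := Real.pi_pos
  have hh := m.h_pos K
  refine norm_le_of_area_smul (area_smul_lap v K) ?_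
  have h1 : ∀ i, ‖m.tr (K, i) • m.jump v (K, i)‖ ≤ 2 / c ^ 2 * (B * m.h ^ 2) := by
    intro i
    rw [norm_smul, Real.norm_eq_abs, abs_of_nonneg (tr_nonneg _)]
    exact mul_le_mul (hm.tr_le hc _) (hv _) (norm_nonneg _) (by positivity)
  refine (norm_sum_le _ _).trans ((Finset.sum_le_sum fun i _ => h1 i).trans ?_)
  simp only [Finset.sum_const, Finset.card_univ, Fintype.card_fin, nsmul_eq_mul]
  calc ((3 : ℕ) : ℝ) * (2 / c ^ 2 * (B * m.h ^ 2)) =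
        Real.pi * (c ^ 2 * m.h) ^ 2 * (6 / (Real.pi * c ^ 6) * B) := by
          push_cast; field_simp; ring
    _ ≤ _ := mul_le_mul_of_nonneg_right (hm.le_area hc K) (by positivity)

lemma IsRegular.norm_conv_le (hm : m.IsRegular c) (hc : 0 < c) {W v : m.P0} (hW : m.IsRT0 W)
    {B : ℝ} (hB : 0 ≤ B) (hv : ∀ e, ‖m.jump v e‖ ≤ B * m.h ^ 2) (K : Fin m.num) :
    ‖m.conv W v K‖ ≤ 6 / (Real.pi * c ^ 4) * B * m.h * ‖W K‖ := by
  have hpi := Real.pi_pos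
  have hh := m.h_pos K
  refine norm_le_of_area_smul (area_smul_conv hW v K) ?_
  have h1 : ∀ i, ‖(m.ln (K, i) / 2 * (m.nc W (K, i) - |m.nc W (K, i)|)) • m.jump v (K, i)‖ ≤
      2 * m.h * ‖W K‖ * (B * m.h ^ 2) := by
    intro i
    rw [norm_smul]
    refine mul_le_mul ?_ (hv _) (norm_nonneg _) (by positivity)
    have hl : m.ln (K, i) ≤ 2 * m.h := m.len_le K i
    have hl0 : 0 < m.ln (K, i) := ln_pos _
    have hn : |m.nc W (K, i)| ≤ ‖W K‖ := abs_nc_le W (K, i)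
    rw [Real.norm_eq_abs, abs_mul, abs_of_pos (half_pos hl0)]
    have h2 : abs (m.nc W (K, i) - |m.nc W (K, i)|) ≤ 2 * ‖W K‖ := by
      rw [abs_le]; have := abs_le.1 hn; have := abs_nonneg (m.nc W (K, i)); constructor <;> linarith
    calc m.ln (K, i) / 2 * abs (m.nc W (K, i) - |m.nc W (K, i)|) ≤ 2 * m.h / 2 * (2 * ‖W K‖) := by
          gcongr
      _ = _ := by ring
  refine (norm_sum_le _ _).trans ((Finset.sum_le_sum fun i _ => h1 i).trans ?_)
  simp only [Finset.sum_const, Finset.card_univ, Fintype.card_fin, nsmul_eq_mul]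
  calc ((3 : ℕ) : ℝ) * (2 * m.h * ‖W K‖ * (B * m.h ^ 2)) =
        Real.pi * (c ^ 2 * m.h) ^ 2 * (6 / (Real.pi * c ^ 4) * B * m.h * ‖W K‖) := by
          push_cast; field_simp; ring
    _ ≤ _ := mul_le_mul_of_nonneg_right (hm.le_area hc K) (by positivity)

lemma norm_emb_le_mul {v w : m.P0} {B : ℝ} (hB : 0 ≤ B) (h : ∀ K, ‖v K‖ ≤ B * ‖w K‖) :
    ‖m.emb v‖ ≤ B * ‖m.emb w‖ := by
  apply le_of_sq_le_sq _ (by positivity)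
  rw [mul_pow, norm_emb_sq, norm_emb_sq, Finset.mul_sum]
  refine Finset.sum_le_sum fun K _ => ?_
  have h1 := mul_le_mul_of_nonneg_left (pow_le_pow_left₀ (norm_nonneg _) (h K) 2) (m.area_pos K).le
  refine h1.trans (le_of_eq (by ring))

lemma area_le (K : Fin m.num) : m.area K ≤ Real.pi * m.h ^ 2 := by
  rw [← volume_real_closedBall (m.ctr K) (m.h_pos K).le]
  exact measureReal_mono (m.cell_subset_closedBall K) measure_closedBall_lt_top.ne

lemma aestronglyMeasurable_glue_affine (p : m.P1d) (μ : Measure Plane) :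
    AEStronglyMeasurable (m.glue fun K y => p K y) μ := by
  have : m.glue (fun K y => p K y) = fun x => ∑ K, (m.cell K).indicator (fun y => p K y) x := rfl
  rw [this]
  exact Finset.aestronglyMeasurable_fun_sum _ fun K _ =>
    ((contDiff_affine (p K)).continuous.aestronglyMeasurable).indicator (m.measurableSet_cell K)

lemma pi_mul_sq_le_integral_bumpAt (z : Plane) {ε : ℝ} (hε : 0 < ε) :
    Real.pi * ε ^ 2 ≤ ∫ x, bumpAt z ε x := by
  have hi : Integrable (bumpAt z ε) :=
    contDiff_bumpAt.continuous.integrable_of_hasCompactSupport (hasCompactSupport_bumpAt hε)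
  rw [← volume_real_closedBall z hε.le]
  calc volume.real (Metric.closedBall z ε) = ∫ x in Metric.closedBall z ε, (1 : ℝ) := by simp
    _ = ∫ x in Metric.closedBall z ε, bumpAt z ε x :=
        setIntegral_congr_fun Metric.isClosed_closedBall.measurableSet
          fun x hx => (bumpAt_eq_one hε hx).symm
    _ ≤ _ := setIntegral_le_integral hi (Eventually.of_forall bumpAt_nonneg)

/-- Inside one triangle p is affine with constant gradient. Integration by parts against a bump
supported there compares that gradient with the weak gradient of q, the error p - q being
differentiated only through the bump. -/
lemma grad_mul_integral_bumpAt (hΩ : interior (closure Ω) = Ω) {p : m.P1d} {q : L2 Ω ℝ}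
    {gq : L2 Ω Plane} {i : Fin 2} (hq : IsWeakPD Ω i q fun x => gq x i)
    (hp : MemLp (m.glue fun K y => p K y) 2 (vol Ω)) (K : Fin m.num) {ρ : ℝ} (hρ : 0 < ρ)
    (hsub : Metric.closedBall (m.ctr K) (2 * ρ) ⊆ interior (m.cell K)) :
    m.grad p K i * ∫ x, bumpAt (m.ctr K) ρ x =
      (∫ x in Ω, bumpAt (m.ctr K) ρ x • gq x i) -
        ∫ x in Ω, pd i (bumpAt (m.ctr K) ρ) x • (m.glue (fun K y => p K y) x - q x) := by
  set φ := bumpAt (m.ctr K) ρ with hφ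
  have hsubΩ := hsub.trans (interior_cell_subset hΩ K)
  have htest : IsTest Ω φ := ⟨contDiff_bumpAt, hasCompactSupport_bumpAt hρ,
    (tsupport_bumpAt_subset hρ).trans hsubΩ⟩
  have h1 := hq φ htest
  obtain ⟨c1, c2, c3⟩ := htest.pd i
  have hz : ∀ x, x ∉ Metric.closedBall (m.ctr K) (2 * ρ) → pd i φ x = 0 := by
    intro x hx
    rw [pd, fderiv_of_notMem_tsupport ℝ fun h => hx (tsupport_bumpAt_subset hρ h)]; rfl
  have hpd2 : MemLp (pd i φ) 2 (vol Ω) := (c1.memLp_of_hasCompactSupport c2).restrict Ω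
  have h2 : ∫ x in Ω, pd i φ x • m.glue (fun K y => p K y) x = ∫ x, pd i φ x • p K x := by
    rw [← setIntegral_eq_integral_of_forall_compl_eq_zero (s := Ω)
      (f := fun x => pd i φ x • p K x) fun x hx => by rw [c3 x hx, zero_smul]]
    refine integral_congr_ae (ae_restrict_of_ae ?_)
    filter_upwards [ae_glue_eq (m := m) fun K y => p K y] with x hx
    by_cases hxb : x ∈ Metric.closedBall (m.ctr K) (2 * ρ)
    · rw [hx K (interior_subset (hsub hxb))]
    · rw [hz x hxb, zero_smul, zero_smul]
  have h3 : ∫ x, pd i φ x • p K x = -(m.grad p K i * ∫ x, φ x) := by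
    rw [integral_pd_smul_eq contDiff_bumpAt (hasCompactSupport_bumpAt hρ) (contDiff_affine (p K))]
    simp only [pd, fderiv_affine, smul_eq_mul]
    rw [integral_mul_const, mul_comm]; rfl
  have h4 : ∫ x in Ω, pd i φ x • (m.glue (fun K y => p K y) x - q x) =
      (∫ x in Ω, pd i φ x • m.glue (fun K y => p K y) x) - ∫ x in Ω, pd i φ x • q x := by
    simp only [smul_sub]
    exact integral_sub (memLp_one_iff_integrable.1 (hp.smul hpd2))
      (memLp_one_iff_integrable.1 ((Lp.memLp q).smul hpd2))
  rw [h4, h2, h3, h1]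
  ring

/-- The constant in the bound of the discrete pressure gradient. -/
def gradPC (c : ℝ) : ℝ := 144 / c ^ 4 * (9 * bumpL ^ 2 / c ^ 4 + 1)

/-- An inverse estimate on the error: differentiating a bump of width proportional to h costs 1/h,
which the O(h) accuracy of the pressure in L² compensates; the remainder is the mean of the exact
gradient. -/
lemma IsRegular.sq_norm_emb_grad_le (hm : m.IsRegular c) (hc : 0 < c)
    (hΩ : interior (closure Ω) = Ω) {p : m.P1d} {q : L2 Ω ℝ} {gq : L2 Ω Plane}
    (hq : ∀ i, IsWeakPD Ω i q fun x => gq x i) {A : ℝ} (hA : 0 ≤ A)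
    (hp : eLpNorm (fun x => m.glue (fun K y => p K y) x - q x) 2 (vol Ω) ≤
      ENNReal.ofReal (A * m.h)) :
    ‖m.emb (m.grad p)‖ ^ 2 ≤ gradPC c * (A ^ 2 + ‖gq‖ ^ 2) := by
  have hpi := Real.pi_pos
  have hL := bumpL_nonneg
  rcases Nat.eq_zero_or_pos m.num with h0 | h0
  · have : IsEmpty (Fin m.num) := by rw [h0]; infer_instance
    rw [norm_emb_sq]
    simp only [Finset.univ_eq_empty, Finset.sum_empty]
    unfold gradPC; positivity
  have hh := m.h_pos ⟨0, h0⟩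
  have hc1 := hm.sq_le_one hc ⟨0, h0⟩
  set d : Plane → ℝ := fun x => m.glue (fun K y => p K y) x - q x with hd
  have hdm : AEStronglyMeasurable d (vol Ω) :=
    (aestronglyMeasurable_glue_affine p _).sub (Lp.memLp q).1
  have hd2 : MemLp d 2 (vol Ω) := ⟨hdm, hp.trans_lt ENNReal.ofReal_lt_top⟩
  have hgl : MemLp (m.glue fun K y => p K y) 2 (vol Ω) := by
    have := hd2.add (Lp.memLp q)
    refine this.congr_norm (aestronglyMeasurable_glue_affine p _) (Eventually.of_forall fun x => ?_)
    simp [hd]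
  have htotd : ∫⁻ x in Ω, ‖d x‖ₑ ^ 2 ≤ ENNReal.ofReal ((A * m.h) ^ 2) := by
    rw [← eLpNorm_two_sq, ENNReal.ofReal_pow (by positivity)]
    exact pow_le_pow_left₀ zero_le hp 2
  have htotg : ∫⁻ x in Ω, ‖gq x‖ₑ ^ 2 = ENNReal.ofReal (‖gq‖ ^ 2) := by
    rw [← eLpNorm_two_sq, ENNReal.ofReal_pow (norm_nonneg _), Lp.norm_def,
      ENNReal.ofReal_toReal (Lp.eLpNorm_ne_top gq)]
  have hle : ∀ (F : Plane → ℝ≥0∞) K, ∫⁻ x in m.cell K, F x ≤ ∫⁻ x in Ω, F x := fun F K =>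
    lintegral_mono' (restrict_cell_le hΩ K) le_rfl
  set a : Fin m.num → ℝ := fun K => (∫⁻ x in m.cell K, ‖d x‖ₑ ^ 2).toReal with ha
  set b : Fin m.num → ℝ := fun K => (∫⁻ x in m.cell K, ‖gq x‖ₑ ^ 2).toReal with hb
  have ha0 : ∀ K, 0 ≤ a K := fun K => ENNReal.toReal_nonneg
  have hb0 : ∀ K, 0 ≤ b K := fun K => ENNReal.toReal_nonneg
  have ha1 : ∀ K, ENNReal.ofReal (a K) = ∫⁻ x in m.cell K, ‖d x‖ₑ ^ 2 := fun K =>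
    ENNReal.ofReal_toReal ((hle _ K).trans_lt (htotd.trans_lt ENNReal.ofReal_lt_top)).ne
  have hb1 : ∀ K, ENNReal.ofReal (b K) = ∫⁻ x in m.cell K, ‖gq x‖ₑ ^ 2 := fun K =>
    ENNReal.ofReal_toReal ((hle _ K).trans_lt (htotg.le.trans_lt ENNReal.ofReal_lt_top)).ne
  have hsa : ∑ K, a K ≤ (A * m.h) ^ 2 := by
    rw [← ENNReal.ofReal_le_ofReal_iff (by positivity), ENNReal.ofReal_sum_of_nonneg
      fun K _ => ha0 K, Finset.sum_congr rfl fun K _ => ha1 K]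
    exact (sum_setLIntegral_le hΩ _).trans htotd
  have hsb : ∑ K, b K ≤ ‖gq‖ ^ 2 := by
    rw [← ENNReal.ofReal_le_ofReal_iff (by positivity), ENNReal.ofReal_sum_of_nonneg
      fun K _ => hb0 K, Finset.sum_congr rfl fun K _ => hb1 K]
    exact (sum_setLIntegral_le hΩ _).trans htotg.le
  -- The bump lives on the disc of radius 2ρ, which is less than the radius c² h known to fit inside
  -- the triangle.
  set ρ : ℝ := c ^ 2 * m.h / 3 with hρ
  have hρ0 : 0 < ρ := by positivity
  have hvol : vol Ω ≤ volume := Measure.restrict_le_self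
  have hcomp : ∀ K i, Real.pi * ρ ^ 2 * |m.grad p K i| ≤
      2 * √Real.pi * (bumpL * √(a K) + ρ * √(b K)) := by
    intro K i
    have hsub : Metric.closedBall (m.ctr K) (2 * ρ) ⊆ interior (m.cell K) :=
      (Metric.closedBall_subset_ball (by rw [hρ]; nlinarith [sq_pos_of_pos hc])).trans
        (hm.ball_subset hc K)
    have hid := grad_mul_integral_bumpAt hΩ (hq i) hgl K hρ0 hsub
    have hres : (vol Ω).restrict (Metric.closedBall (m.ctr K) (2 * ρ)) ≤
        volume.restrict (m.cell K) :=
      Measure.restrict_mono (hsub.trans interior_subset) hvol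
    have h1 := norm_integral_smul_le hvol (ψ := pd i (bumpAt (m.ctr K) ρ)) hdm
      (B := bumpL / ρ) (r := 2 * ρ) (y := √(a K)) (z := m.ctr K) (by positivity) (by positivity)
      (by positivity) (fun x => by
        have := abs_fderiv_bumpAt_le (z := m.ctr K) hρ0 x (EuclideanSpace.single i 1)
        rwa [PiLp.norm_single, norm_one, mul_one] at this) (by
        rw [Real.sq_sqrt (ha0 K), ha1]
        exact lintegral_mono' hres le_rfl)
    have hgi : AEStronglyMeasurable (fun x => gq x i) (vol Ω) :=
      (EuclideanSpace.proj (𝕜 := ℝ) i).continuous.comp_aestronglyMeasurable (Lp.memLp gq).1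
    have h2 := norm_integral_smul_le hvol (ψ := bumpAt (m.ctr K) ρ) hgi
      (B := 1) (r := 2 * ρ) (y := √(b K)) (z := m.ctr K) zero_le_one (by positivity)
      (by positivity) (abs_bumpAt_le hρ0) (by
        rw [Real.sq_sqrt (hb0 K), hb1]
        refine lintegral_mono' hres fun x => ?_
        gcongr
        rw [← ofReal_norm, ← ofReal_norm]
        exact ENNReal.ofReal_le_ofReal (PiLp.norm_apply_le _ _))
    have h3 := pi_mul_sq_le_integral_bumpAt (m.ctr K) hρ0
    have h4 := mul_le_mul_of_nonneg_left h3 (abs_nonneg (m.grad p K i))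
    have h5 : |m.grad p K i| * ∫ x, bumpAt (m.ctr K) ρ x =
        |m.grad p K i * ∫ x, bumpAt (m.ctr K) ρ x| := by
      rw [abs_mul, abs_of_nonneg (integral_nonneg bumpAt_nonneg)]
    rw [h5, hid] at h4
    have h6 := h4.trans ((abs_sub _ _).trans (add_le_add h2 h1))
    calc Real.pi * ρ ^ 2 * |m.grad p K i| = |m.grad p K i| * (Real.pi * ρ ^ 2) := by ring
      _ ≤ _ := h6
      _ = _ := by field_simp; ring
  have hcell : ∀ K, m.area K * ‖m.grad p K‖ ^ 2 ≤
      144 / c ^ 4 * (bumpL ^ 2 / ρ ^ 2 * a K + b K) := by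
    intro K
    have hsq : ∀ i, (Real.pi * ρ ^ 2) ^ 2 * m.grad p K i ^ 2 ≤
        8 * Real.pi * (bumpL ^ 2 * a K + ρ ^ 2 * b K) := by
      intro i
      have h1 := pow_le_pow_left₀ (by positivity) (hcomp K i) 2
      rw [mul_pow, sq_abs] at h1
      refine h1.trans ?_
      rw [mul_pow, mul_pow, Real.sq_sqrt hpi.le]
      have h2 : (bumpL * √(a K) + ρ * √(b K)) ^ 2 ≤ 2 * (bumpL ^ 2 * a K + ρ ^ 2 * b K) := by
        have e1 := Real.sq_sqrt (ha0 K)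
        have e2 := Real.sq_sqrt (hb0 K)
        nlinarith [sq_nonneg (bumpL * √(a K) - ρ * √(b K))]
      nlinarith
    rw [EuclideanSpace.real_norm_sq_eq, Fin.sum_univ_two]
    have h1 := hsq 0
    have h2 := hsq 1
    have h3 : (Real.pi * ρ ^ 2) ^ 2 * (m.grad p K 0 ^ 2 + m.grad p K 1 ^ 2) ≤
        16 * Real.pi * (bumpL ^ 2 * a K + ρ ^ 2 * b K) := by linarith
    have h4 : m.grad p K 0 ^ 2 + m.grad p K 1 ^ 2 ≤
        16 * Real.pi * (bumpL ^ 2 * a K + ρ ^ 2 * b K) / (Real.pi * ρ ^ 2) ^ 2 := by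
      rw [le_div_iff₀ (by positivity)]; linarith
    calc m.area K * (m.grad p K 0 ^ 2 + m.grad p K 1 ^ 2)
        ≤ Real.pi * m.h ^ 2 *
          (16 * Real.pi * (bumpL ^ 2 * a K + ρ ^ 2 * b K) / (Real.pi * ρ ^ 2) ^ 2) :=
          mul_le_mul (area_le K) h4 (by positivity) (by positivity)
      _ = _ := by rw [hρ]; field_simp; ring
  rw [norm_emb_sq]
  refine (Finset.sum_le_sum fun K _ => hcell K).trans ?_
  rw [← Finset.mul_sum, Finset.sum_add_distrib, ← Finset.mul_sum, gradPC, mul_assoc]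
  refine mul_le_mul_of_nonneg_left ?_ (by positivity)
  have h1 : bumpL ^ 2 / ρ ^ 2 * ∑ K, a K ≤ 9 * bumpL ^ 2 / c ^ 4 * A ^ 2 := by
    calc bumpL ^ 2 / ρ ^ 2 * ∑ K, a K ≤ bumpL ^ 2 / ρ ^ 2 * (A * m.h) ^ 2 :=
          mul_le_mul_of_nonneg_left hsa (by positivity)
      _ = _ := by rw [hρ]; field_simp; ring
  have h2 : 0 ≤ 9 * bumpL ^ 2 / c ^ 4 * ‖gq‖ ^ 2 := by positivity
  nlinarith [sq_nonneg A]

end InitialOperators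

end TriMesh

/-! ### Initial accuracy and the uniform constants -/

namespace TriMesh

variable {Ω : Set Plane} {m : TriMesh Ω} {c : ℝ}

section InitialData

variable {A k : ℝ} {v : ℝ → L2 Ω Plane} {q : ℝ → L2 Ω ℝ} {u0 u1 : m.P0} {p1 : m.P1d}

lemma InitialAccuracy.norm_emb_zero_le (hI : m.InitialAccuracy A k v q u0 u1 p1)
    (hΩ : interior (closure Ω) = Ω) (hAh : 0 ≤ A * m.h) : ‖m.emb u0‖ ≤ ‖v 0‖ + A * m.h := by
  have h1 := (le_self_add.trans le_self_add).trans hI.1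
  have h2 := eLpNorm_add_le (μ := vol Ω) (p := 2)
    ((memLp_glue_const hΩ u0).1.sub (Lp.memLp (v 0)).1) (Lp.memLp (v 0)).1 one_le_two
  rw [sub_add_cancel, eLpNorm_glue_const hΩ] at h2
  have h3 : eLpNorm (v 0) 2 (vol Ω) = ENNReal.ofReal ‖v 0‖ := by
    rw [Lp.norm_def, ENNReal.ofReal_toReal (Lp.memLp (v 0)).2.ne]
  rw [h3] at h2
  have h4 := h2.trans (add_le_add_left h1 _)
  rw [← ENNReal.ofReal_add hAh (norm_nonneg _),
    ENNReal.ofReal_le_ofReal_iff (by positivity)] at h4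
  linarith

lemma InitialAccuracy.ae_norm_sub_le (hI : m.InitialAccuracy A k v q u0 u1 p1) (hh : 0 < m.h)
    (hA : 0 ≤ A) :
    ∀ᵐ x ∂vol Ω, ‖m.glue (fun K _ => u1 K) x - v k x‖ ≤ A * m.h ^ 2 := by
  have h1 := (le_add_self.trans le_self_add).trans hI.1
  have h2 : eLpNorm (fun x => m.glue (fun K _ => u1 K) x - v k x) ∞ (vol Ω) ≤
      ENNReal.ofReal (A * m.h ^ 2) := by
    have h3 := mul_le_mul_right h1 (ENNReal.ofReal m.h)
    rw [← mul_assoc, ENNReal.mul_inv_cancel (by simpa using hh) ENNReal.ofReal_ne_top, one_mul,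
      ← ENNReal.ofReal_mul hh.le] at h3
    exact h3.trans (le_of_eq (congrArg _ (by ring)))
  rw [eLpNorm_exponent_top] at h2
  filter_upwards [enorm_ae_le_eLpNormEssSup
    (fun x => m.glue (fun K _ => u1 K) x - v k x) (vol Ω)] with x hx
  have h4 := hx.trans h2
  rwa [← ofReal_norm, ENNReal.ofReal_le_ofReal_iff (by positivity)] at h4

lemma InitialAccuracy.norm_emb_sub_le (hI : m.InitialAccuracy A k v q u0 u1 p1)
    (hΩ : interior (closure Ω) = Ω) (hAk : 0 ≤ A * k) : ‖m.emb u1 - m.emb u0‖ ≤ A * k := by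
  have h := hI.2
  rw [← map_sub]
  have h2 := eLpNorm_glue_const hΩ (u1 - u0)
  simp only [Pi.sub_apply] at h2
  have : (m.glue (fun K _ => u1 K - u0 K)) = m.glue fun (K : Fin m.num) (_ : Plane) => (u1 - u0) K := rfl
  rwa [h2, ENNReal.ofReal_le_ofReal_iff hAk] at h

lemma InitialAccuracy.eLpNorm_pressure_le (hI : m.InitialAccuracy A k v q u0 u1 p1) :
    eLpNorm (fun x => m.glue (fun K y => p1 K y) x - q k x) 2 (vol Ω) ≤
      ENNReal.ofReal (A * m.h) :=
  le_add_self.trans hI.1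

end InitialData

/-- Averaging over cells is a contraction, so the increments of the discrete force are controlled by
the variation of f on the time grid. -/
lemma sum_norm_proj_sub_le (hΩ : interior (closure Ω) = Ω) {f : ℝ → L2 Ω Plane} {T k : ℝ} {N : ℕ}
    (hf : BoundedVariationOn f (Icc 0 T)) (hk : 0 ≤ k) (hNk : N * k = T) :
    ∑ n ∈ Finset.Ico 2 N,
      ‖m.emb (m.proj (f ((n + 1 : ℕ) * k))) - m.emb (m.proj (f (n * k)))‖ ≤
      (eVariationOn f (Icc 0 T)).toReal := by
  have h1 := eVariationOn.sum_le_of_monotoneOn_Icc (f := f) (s := Icc 0 T) (m := 2) (n := N)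
    (u := fun n : ℕ => (n : ℝ) * k)
    (fun a _ b _ hab => mul_le_mul_of_nonneg_right (Nat.cast_le.2 hab) hk)
    (fun i hi => ⟨by positivity, hNk ▸ mul_le_mul_of_nonneg_right (Nat.cast_le.2 hi.2) hk⟩)
  have h2 : ∑ n ∈ Finset.Ico 2 N, dist (f ((n + 1 : ℕ) * k)) (f (n * k)) ≤
      (eVariationOn f (Icc 0 T)).toReal := by
    rw [← ENNReal.ofReal_le_iff_le_toReal hf, ENNReal.ofReal_sum_of_nonneg fun _ _ => dist_nonneg]
    simpa only [edist_dist] using h1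
  refine le_trans (Finset.sum_le_sum fun n _ => ?_) h2
  rw [← map_sub, ← proj_sub hΩ, dist_eq_norm]
  exact norm_emb_proj_le hΩ _

theorem exists_increment_bound (hb : Bornology.IsBounded Ω)
    (hΩ : interior (closure Ω) = Ω) {T Re : ℝ} (hT : 0 < T) (hRe : 0 < Re) {f : ℝ → L2 Ω Plane}
    (hfc : ContinuousOn f (Icc 0 T)) (hf : BoundedVariationOn f (Icc 0 T)) {u₀ : L2 Ω Plane}
    {v : ℝ → L2 Ω Plane} {q : ℝ → L2 Ω ℝ} (hvq : IsRegularNSSolution Ω T Re f u₀ v q)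
    {A : ℝ} (hc : 0 < c) (hA : 0 < A) :
    ∃ D : ℝ, 0 ≤ D ∧ ∀ m : TriMesh Ω, m.IsRegular c →
      ∀ (k : ℝ) (N : ℕ), 1 ≤ N → (N : ℝ) * k = T →
      ∀ (u ut : ℕ → m.P0) (p : ℕ → m.P1d), m.IsSchemeSolution Re k N f u ut p →
        m.InitialAccuracy A k v q (u 0) (u 1) (p 1) →
        ‖m.emb (ut 1)‖ ≤ D ∧
          ∀ n, 1 ≤ n → n < N → ‖m.emb (ut (n + 1)) - m.emb (ut n)‖ ≤ D * k := by
  obtain ⟨Dv, D2v, gq, -, -, -, hgq, hv0, hsol⟩ := hvq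
  obtain ⟨F, hF⟩ := isCompact_Icc.exists_bound_of_continuousOn hfc
  obtain ⟨G, hG⟩ := isCompact_Icc.exists_bound_of_continuousOn hgq
  have hpi := Real.pi_pos
  have hL := bumpL_nonneg
  have hvol : volume Ω ≠ ⊤ := hb.measure_lt_top.ne
  set V := (eVariationOn f (Icc 0 T)).toReal with hV
  set H := Metric.diam Ω / c with hH
  have hH0 : 0 ≤ H := div_nonneg Metric.diam_nonneg hc.le
  -- A H bounds the error of u⁰, since h ≤ H, and A T bounds the step A k from u⁰ to u¹.
  set M0 := ‖v 0‖ + A * H + A * T with hM0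
  set B := 2 * Real.pi * bumpL * A with hB
  have hB0 : 0 ≤ B := by positivity
  have hM00 : 0 ≤ M0 := by positivity
  set Ml := √(volume.real Ω) * (6 / (Real.pi * c ^ 6) * B) with hMl
  set Mc := 6 / (Real.pi * c ^ 4) * B * H * (3 * M0) with hMc
  set Mp := √(gradPC c * (A ^ 2 + G ^ 2)) with hMp
  have hMl0 : 0 ≤ Ml := by positivity
  have hMc0 : 0 ≤ Mc := by positivity
  have hMp0 : 0 ≤ Mp := by positivity
  set M := M0 + Ml + Mc + Mp with hM
  refine ⟨max M (incC c Re T F M A V), le_max_of_le_left (by positivity), ?_⟩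
  intro m hm k N hN hNk u ut p hS hI
  have hN0 : (1 : ℝ) ≤ N := by exact_mod_cast hN
  have hk : 0 < k := by
    by_contra hcon
    nlinarith [not_lt.1 hcon]
  have hkT : k ≤ T := by nlinarith
  have hkI : k ∈ Icc 0 T := ⟨hk.le, hkT⟩
  -- Without triangles every discrete field is zero; positivity of h, needed to divide by it,
  -- requires a triangle.
  rcases Nat.eq_zero_or_pos m.num with hnum | hnum
  · have : IsEmpty (Fin m.num) := by rw [hnum]; infer_instance
    have h0 : ∀ w : m.P0, ‖m.emb w‖ = 0 := fun w => by
      rw [Subsingleton.elim w 0, map_zero, norm_zero]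
    refine ⟨by rw [h0]; exact le_max_of_le_left (by positivity), fun n _ _ => ?_⟩
    rw [← map_sub, h0]
    exact mul_nonneg (le_max_of_le_left (by positivity)) hk.le
  let K : Fin m.num := ⟨0, hnum⟩
  have hh := m.h_pos K
  have hhH : m.h ≤ H := hm.h_le hc hb K
  have hu0 : ‖m.emb (u 0)‖ ≤ M0 - A * T := by
    have h1 := hI.norm_emb_zero_le hΩ (by positivity)
    have h2 := mul_le_mul_of_nonneg_left hhH hA.le
    rw [hM0]; linarith
  have hd1 := hI.norm_emb_sub_le hΩ (by positivity)
  have hAT : A * k ≤ A * T := mul_le_mul_of_nonneg_left hkT hA.le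
  have hu1 : ‖m.emb (u 1)‖ ≤ M0 := by
    have h1 := norm_le_norm_add_norm_sub' (m.emb (u 1)) (m.emb (u 0))
    linarith
  have hAT0 : 0 < A * T := by positivity
  have hjump : ∀ e, ‖m.jump (u 1) e‖ ≤ B * m.h ^ 2 := by
    intro e
    refine (norm_jump_le_of_isH10 hΩ (hsol k hkI).2.2.2.1 (b := A * m.h ^ 2) (by positivity)
      (hI.ae_norm_sub_le hh hA.le) e).trans (le_of_eq ?_)
    rw [hB]; ring
  have hl1 : ‖m.emb (m.lap (u 1))‖ ≤ Ml :=
    norm_emb_le_of_forall hΩ hvol (by positivity) (hm.norm_lap_le hc hB0 hjump)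
  have hW : m.IsRT0 ((2 : ℝ) • u 1 - u 0) := hS.isRT0_extrap hk hN
  have hc1 : ‖m.emb (m.conv ((2 : ℝ) • u 1 - u 0) (u 1))‖ ≤ Mc := by
    refine (norm_emb_le_mul (by positivity) (hm.norm_conv_le hc hW hB0 hjump)).trans ?_
    have h1 : ‖m.emb ((2 : ℝ) • u 1 - u 0)‖ ≤ 3 * M0 := by
      rw [map_sub, map_smul]
      refine (norm_sub_le _ _).trans ?_
      rw [norm_smul, Real.norm_two]
      linarith
    refine mul_le_mul (mul_le_mul_of_nonneg_left hhH (by positivity)) h1 (norm_nonneg _)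
      (by positivity)
  have hp1 : ‖m.emb (m.grad (p 1))‖ ≤ Mp := by
    have h1 := hm.sq_norm_emb_grad_le hc hΩ (hsol k hkI).2.2.1 hA.le hI.eLpNorm_pressure_le
    refine Real.le_sqrt_of_sq_le (h1.trans ?_)
    have h2 := pow_le_pow_left₀ (norm_nonneg _) (hG k hkI) 2
    refine mul_le_mul_of_nonneg_left (by linarith) ?_
    unfold gradPC; positivity
  refine ⟨?_, fun n h1 hn => ?_⟩
  · rw [hS.ut_one]
    refine le_max_of_le_left (hu1.trans ?_)
    rw [hM]; linarith
  · refine (hm.norm_increment_le hc hRe hk hN hNk hS (F := F) (M := M) (A := A) (V := V) ?_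
      (sum_norm_proj_sub_le hΩ hf hk.le hNk) ?_ ?_ ?_ ?_ ?_ hd1 h1 hn).trans
      (mul_le_mul_of_nonneg_right (le_max_right _ _) hk.le)
    · intro j hj
      refine (norm_emb_proj_le hΩ _).trans (hF _ ⟨by positivity, ?_⟩)
      rw [← hNk]
      exact mul_le_mul_of_nonneg_right (Nat.cast_le.2 hj) hk.le
    all_goals rw [hM]; linarith

end TriMesh

/-! ### Fourier transform in time of a step function -/

/-- The Fourier transform of the indicator function of `[a, b)`. -/
def indHat (a b τ : ℝ) : ℂ :=
  ∫ t in Ico a b, Complex.exp (((-2 * Real.pi * t * τ : ℝ) : ℂ) * Complex.I)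

lemma norm_indHat_le {a b : ℝ} (hab : a ≤ b) (τ : ℝ) : ‖indHat a b τ‖ ≤ b - a := by
  have h := norm_setIntegral_le_of_norm_le_const (μ := volume) (s := Ico a b) (C := 1)
    (f := fun t : ℝ => Complex.exp (((-2 * Real.pi * t * τ : ℝ) : ℂ) * Complex.I))
    measure_Ico_lt_top fun t _ => (Complex.norm_exp_ofReal_mul_I _).le
  rwa [one_mul, Real.volume_real_Ico_of_le hab] at h

/-- An antiderivative of `t ↦ exp (-2πiτt)`. -/
def expPrim (τ t : ℝ) : ℂ :=
  Complex.exp (((-2 * Real.pi * t * τ : ℝ) : ℂ) * Complex.I) / (-2 * Real.pi * τ * Complex.I)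

lemma norm_expPrim (τ t : ℝ) : ‖expPrim τ t‖ = (2 * Real.pi * |τ|)⁻¹ := by
  rw [expPrim, norm_div, Complex.norm_exp_ofReal_mul_I]
  simp [abs_of_pos Real.pi_pos]

lemma indHat_eq_sub {a b τ : ℝ} (hab : a ≤ b) (hτ : τ ≠ 0) :
    indHat a b τ = expPrim τ b - expPrim τ a := by
  have hc : (-2 * Real.pi * τ * Complex.I : ℂ) ≠ 0 := by
    simp [hτ, Real.pi_ne_zero]
  have h := integral_exp_mul_complex (a := a) (b := b) hc
  rw [indHat, integral_Ico_eq_integral_Ioc, ← intervalIntegral.integral_of_le hab, expPrim,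
    expPrim, ← sub_div]
  convert h using 3
  · congr 1; push_cast; ring
  · congr 1; push_cast; ring
  · congr 1; push_cast; ring

section StepFunction

variable {E : Type*} [NormedAddCommGroup E] [NormedSpace ℂ E]

/-- Abel summation: apart from the two boundary terms, differences of e against X become values of e
against differences of X. -/
lemma norm_sum_sub_smul_le {e : ℕ → ℂ} {r : ℝ} (he : ∀ n, ‖e n‖ ≤ r) (X : ℕ → E) (N : ℕ) :
    ‖∑ n ∈ Finset.range (N + 1), (e (n + 1) - e n) • X n - (e (N + 1) • X N - e 0 • X 0)‖ ≤
      r * ∑ n ∈ Finset.range N, ‖X (n + 1) - X n‖ := by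
  induction N with
  | zero => simp [sub_smul]
  | succ N ih =>
    rw [Finset.sum_range_succ, Finset.sum_range_succ (fun n => ‖X (n + 1) - X n‖), mul_add]
    have h1 : ‖e (N + 1) • (X (N + 1) - X N)‖ ≤ r * ‖X (N + 1) - X N‖ := by
      rw [norm_smul]
      exact mul_le_mul_of_nonneg_right (he _) (norm_nonneg _)
    refine le_trans (le_of_eq ?_) ((norm_sub_le _ _).trans (add_le_add ih h1))
    congr 1
    simp only [sub_smul, smul_sub]
    abel

/-- Two bounds are added. The L¹ norm in time bounds the transform itself; Abel summation against
the antiderivative of the exponential, of size at most 1/|τ|, bounds |τ| times it by the endpoint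
values plus the total variation. -/
lemma one_add_abs_mul_norm_sum_indHat_le {k D D' T : ℝ} {N : ℕ} (hk : 0 ≤ k)
    (hNk : (N + 1 : ℕ) * k = T) {X : ℕ → E} (hX : ∀ n ≤ N, ‖X n‖ ≤ D')
    (hd : ∀ n < N, ‖X (n + 1) - X n‖ ≤ D * k) (hD : 0 ≤ D) (τ : ℝ) :
    (1 + |τ|) * ‖∑ n ∈ Finset.range (N + 1), indHat (n * k) ((n + 1) * k) τ • X n‖ ≤
      T * D' + 2 * D' + T * D := by
  have hD' : 0 ≤ D' := (norm_nonneg _).trans (hX 0 (Nat.zero_le _))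
  have hT : 0 ≤ T := by rw [← hNk]; positivity
  have hmono : ∀ n : ℕ, (n : ℝ) * k ≤ (n + 1) * k := fun n => by nlinarith
  have h1 : ‖∑ n ∈ Finset.range (N + 1), indHat (n * k) ((n + 1) * k) τ • X n‖ ≤ T * D' := by
    refine (norm_sum_le _ _).trans ?_
    calc ∑ n ∈ Finset.range (N + 1), ‖indHat (n * k) ((n + 1) * k) τ • X n‖
        ≤ ∑ n ∈ Finset.range (N + 1), k * D' := by
          refine Finset.sum_le_sum fun n hn => ?_
          rw [norm_smul]
          refine mul_le_mul ((norm_indHat_le (hmono n) τ).trans (by linarith))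
            (hX n (by simpa [Nat.lt_succ_iff] using hn)) (norm_nonneg _) hk
      _ = T * D' := by
          rw [Finset.sum_const, Finset.card_range, nsmul_eq_mul, ← mul_assoc, hNk]
  rw [add_mul, one_mul, add_assoc]
  refine add_le_add h1 ?_
  rcases eq_or_ne τ 0 with rfl | hτ
  · simp only [abs_zero, zero_mul]; positivity
  have hτ0 := abs_pos.2 hτ
  have hpi := Real.pi_gt_three
  have he : ∀ n : ℕ, ‖expPrim τ (n * k)‖ ≤ |τ|⁻¹ := fun n => by
    rw [norm_expPrim]
    exact inv_anti₀ hτ0 (by nlinarith)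
  have h2 := norm_sum_sub_smul_le (e := fun n : ℕ => expPrim τ (n * k)) he X N
  have h3 : ∑ n ∈ Finset.range N, ‖X (n + 1) - X n‖ ≤ T * D := by
    refine (Finset.sum_le_sum fun n hn => hd n (Finset.mem_range.1 hn)).trans ?_
    rw [Finset.sum_const, Finset.card_range, nsmul_eq_mul, ← hNk]
    push_cast
    nlinarith [mul_nonneg hD hk]
  have h4 : ∑ n ∈ Finset.range (N + 1), indHat (n * k) ((n + 1) * k) τ • X n =
      ∑ n ∈ Finset.range (N + 1),
        (expPrim τ ((n + 1 : ℕ) * k) - expPrim τ (n * k)) • X n :=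
    Finset.sum_congr rfl fun n _ => by rw [indHat_eq_sub (hmono n) hτ, Nat.cast_succ]
  have h5 : ‖expPrim τ ((N + 1 : ℕ) * k) • X N - expPrim τ ((0 : ℕ) * k) • X 0‖ ≤
      |τ|⁻¹ * (2 * D') := by
    refine (norm_sub_le _ _).trans ?_
    rw [norm_smul, norm_smul, two_mul, mul_add]
    exact add_le_add
      (mul_le_mul (he _) (hX _ le_rfl) (norm_nonneg _) (by positivity))
      (mul_le_mul (he _) (hX _ (Nat.zero_le _)) (norm_nonneg _) (by positivity))
  rw [← h4] at h2
  have h6 := norm_le_norm_sub_add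
    (∑ n ∈ Finset.range (N + 1), indHat (n * k) ((n + 1) * k) τ • X n)
    (expPrim τ ((N + 1 : ℕ) * k) • X N - expPrim τ ((0 : ℕ) * k) • X 0)
  have h7 := h6.trans (add_le_add
    (h2.trans (mul_le_mul_of_nonneg_left h3 (inv_nonneg.2 hτ0.le))) h5)
  calc |τ| * _ ≤ |τ| * (|τ|⁻¹ * (T * D) + |τ|⁻¹ * (2 * D')) :=
        mul_le_mul_of_nonneg_left h7 hτ0.le
    _ = 2 * D' + T * D := by field_simp; ring

end StepFunction

/-- Complexification of vectors of the plane. -/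
def complexify : Plane →ₗ[ℝ] EuclideanSpace ℂ (Fin 2) where
  toFun x := WithLp.toLp 2 fun j => (x j : ℂ)
  map_add' x y := by ext j; simp
  map_smul' a x := by ext j; simp

lemma norm_complexify (x : Plane) : ‖complexify x‖ = ‖x‖ := by
  simp [complexify, EuclideanSpace.norm_eq]

namespace TriMesh

variable {Ω : Set Plane} {m : TriMesh Ω} {c : ℝ}

lemma utHat_eq_sum (k : ℝ) (N : ℕ) (ut : ℕ → m.P0) (τ : ℝ) (K : Fin m.num) :
    m.utHat k N ut τ K =
      ∑ n ∈ Finset.range N, indHat (n * k) ((n + 1) * k) τ • complexify (ut (n + 1) K) := by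
  have h1 : ∀ t, (WithLp.toLp 2 fun j => ((m.utEps k N ut t K j : ℝ) : ℂ) :
      EuclideanSpace ℂ (Fin 2)) = ∑ n ∈ Finset.range N,
        (Ico (n * k) ((n + 1) * k)).indicator (fun _ => complexify (ut (n + 1) K)) t := by
    intro t
    change complexify (m.utEps k N ut t K) = _
    rw [utEps, Finset.sum_apply, map_sum]
    refine Finset.sum_congr rfl fun n _ => ?_
    by_cases h : t ∈ Ico (n * k) ((n + 1) * k) <;> simp [h]
  rw [utHat]
  simp only [h1]
  rw [Real.fourier_real_eq_integral_exp_smul]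
  have h2 : ∀ t : ℝ, Complex.exp (((-2 * Real.pi * t * τ : ℝ) : ℂ) * Complex.I) •
      ∑ n ∈ Finset.range N,
        (Ico (n * k) ((n + 1) * k)).indicator (fun _ => complexify (ut (n + 1) K)) t =
      ∑ n ∈ Finset.range N, (Ico (n * k) ((n + 1) * k)).indicator
        (fun t : ℝ => Complex.exp (((-2 * Real.pi * t * τ : ℝ) : ℂ) * Complex.I) •
          complexify (ut (n + 1) K)) t := by
    intro t
    rw [Finset.smul_sum]
    refine Finset.sum_congr rfl fun n _ => ?_
    by_cases h : t ∈ Ico (n * k) ((n + 1) * k) <;> simp [h]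
  simp only [h2]
  rw [integral_finsetSum]
  · refine Finset.sum_congr rfl fun n _ => ?_
    rw [integral_indicator measurableSet_Ico, integral_smul_const, indHat]
  · intro n _
    rw [integrable_indicator_iff measurableSet_Ico]
    refine (Continuous.integrableOn_Icc ?_).mono_set Ico_subset_Icc_self
    fun_prop

variable (m) in
/-- Complex piecewise constant fields as a Hilbert space with the `L²` norm. -/
def embC : (Fin m.num → EuclideanSpace ℂ (Fin 2)) →ₗ[ℂ]
    PiLp 2 (fun _ : Fin m.num => EuclideanSpace ℂ (Fin 2)) where
  toFun a := WithLp.toLp 2 fun K => (√(m.area K) : ℂ) • a K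
  map_add' v w := by ext K j; simp
  map_smul' a v := by ext K j; simp; ring

lemma norm_embC_sq (a : Fin m.num → EuclideanSpace ℂ (Fin 2)) :
    ‖m.embC a‖ ^ 2 = ∑ K, m.area K * ‖a K‖ ^ 2 := by
  rw [PiLp.norm_sq_eq_of_L2]
  refine Finset.sum_congr rfl fun K _ => ?_
  simp only [embC, LinearMap.coe_mk, AddHom.coe_mk]
  rw [norm_smul, mul_pow, Complex.norm_real, Real.norm_eq_abs, sq_abs,
    Real.sq_sqrt (m.area_pos K).le]

lemma norm_embC_complexify (v : m.P0) : ‖m.embC fun K => complexify (v K)‖ = ‖m.emb v‖ := by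
  rw [← sq_eq_sq₀ (norm_nonneg _) (norm_nonneg _), norm_embC_sq, norm_emb_sq]
  simp only [norm_complexify]

lemma embC_utHat (k : ℝ) (N : ℕ) (ut : ℕ → m.P0) (τ : ℝ) :
    m.embC (m.utHat k N ut τ) = ∑ n ∈ Finset.range N,
      indHat (n * k) ((n + 1) * k) τ • m.embC fun K => complexify (ut (n + 1) K) := by
  simp only [← map_smul, ← map_sum]
  congr 1
  funext K
  rw [utHat_eq_sum, Finset.sum_apply]
  rfl

lemma norm_emb_le_of_increments {ut : ℕ → m.P0} {D k T : ℝ} {N : ℕ} (hk : 0 ≤ k) (hD : 0 ≤ D)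
    (hNk : N * k = T) (h1 : ‖m.emb (ut 1)‖ ≤ D)
    (hd : ∀ n, 1 ≤ n → n < N → ‖m.emb (ut (n + 1)) - m.emb (ut n)‖ ≤ D * k) {n : ℕ} (hn : n < N) :
    ‖m.emb (ut (n + 1))‖ ≤ D + T * D := by
  have h2 : ∀ n < N, ‖m.emb (ut (n + 1))‖ ≤ D + n * (D * k) := by
    intro n
    induction n with
    | zero => intro _; simpa using h1
    | succ n ih =>
      intro hn
      have h3 := norm_le_norm_add_norm_sub' (m.emb (ut (n + 1 + 1))) (m.emb (ut (n + 1)))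
      have h4 := hd (n + 1) (by omega) hn
      have h5 := ih (by omega)
      push_cast
      linarith
  refine (h2 n hn).trans ?_
  have h6 : (n : ℝ) * (D * k) ≤ N * (D * k) :=
    mul_le_mul_of_nonneg_right (Nat.cast_le.2 hn.le) (mul_nonneg hD hk)
  rw [← hNk]
  linarith

lemma one_add_abs_mul_norm_embC_utHat_le {ut : ℕ → m.P0} {D k T : ℝ} {N : ℕ} (hk : 0 ≤ k)
    (hD : 0 ≤ D) (hN : 1 ≤ N) (hNk : N * k = T) (h1 : ‖m.emb (ut 1)‖ ≤ D)
    (hd : ∀ n, 1 ≤ n → n < N → ‖m.emb (ut (n + 1)) - m.emb (ut n)‖ ≤ D * k) (τ : ℝ) :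
    (1 + |τ|) * ‖m.embC (m.utHat k N ut τ)‖ ≤
      T * (D + T * D) + 2 * (D + T * D) + T * D := by
  obtain ⟨N, rfl⟩ : ∃ N', N = N' + 1 := ⟨N - 1, by omega⟩
  rw [embC_utHat]
  refine one_add_abs_mul_norm_sum_indHat_le hk hNk (fun n hn => ?_) (fun n hn => ?_) hD τ
  · rw [norm_embC_complexify]
    exact norm_emb_le_of_increments hk hD hNk h1 hd (by omega)
  · rw [← map_sub]
    have h2 := hd (n + 1) (by omega) (by omega)
    rw [← map_sub, ← norm_embC_complexify] at h2
    refine (le_of_eq (congrArg (fun a => ‖m.embC a‖) ?_)).trans h2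
    funext K
    simp

/-- The decay 1/(1+|τ|) leaves the weight (1+|τ|)^{-(2-2γ)}, integrable on the line exactly because
2 - 2γ > 1. -/
lemma lintegral_rpow_mul_utHat_le (hΩ : interior (closure Ω) = Ω) {ut : ℕ → m.P0} {k P γ : ℝ}
    {N : ℕ} (hγ0 : 0 ≤ γ) (hγ : γ < 1 / 2)
    (hP : ∀ τ, (1 + |τ|) * ‖m.embC (m.utHat k N ut τ)‖ ≤ P) :
    ∫⁻ τ : ℝ, ENNReal.ofReal (|τ| ^ (2 * γ)) *
      (eLpNorm (m.glue (fun K _ => m.utHat k N ut τ K)) 2 (vol Ω)) ^ 2 ≤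
      ENNReal.ofReal (P ^ 2 * ∫ τ : ℝ, (1 + ‖τ‖) ^ (-(2 - 2 * γ))) := by
  have hint : Integrable fun τ : ℝ => P ^ 2 * (1 + ‖τ‖) ^ (-(2 - 2 * γ)) :=
    (integrable_one_add_norm (by simp; linarith)).const_mul _
  rw [← integral_const_mul, ofReal_integral_eq_lintegral_ofReal hint
    (Eventually.of_forall fun τ => by positivity)]
  refine lintegral_mono fun τ => ?_
  rw [eLpNorm_glue_const_sq hΩ, ← norm_embC_sq, ← ENNReal.ofReal_mul (by positivity)]
  refine ENNReal.ofReal_le_ofReal ?_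
  have h1 : (0 : ℝ) < 1 + |τ| := by positivity
  have h2 := pow_le_pow_left₀ (by positivity) (hP τ) 2
  have h3 : |τ| ^ (2 * γ) ≤ (1 + |τ|) ^ (2 * γ) :=
    Real.rpow_le_rpow (abs_nonneg _) (by linarith) (by linarith)
  have h4 : (1 + |τ|) ^ (-(2 - 2 * γ)) * (1 + |τ|) ^ 2 = (1 + |τ|) ^ (2 * γ) := by
    rw [← Real.rpow_two, ← Real.rpow_add h1]
    congr 1; ring
  rw [Real.norm_eq_abs]
  calc |τ| ^ (2 * γ) * ‖m.embC (m.utHat k N ut τ)‖ ^ 2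
      ≤ (1 + |τ|) ^ (2 * γ) * ‖m.embC (m.utHat k N ut τ)‖ ^ 2 :=
        mul_le_mul_of_nonneg_right h3 (sq_nonneg _)
    _ = ((1 + |τ|) * ‖m.embC (m.utHat k N ut τ)‖) ^ 2 * (1 + |τ|) ^ (-(2 - 2 * γ)) := by
        rw [← h4]; ring
    _ ≤ _ := mul_le_mul_of_nonneg_right h2 (by positivity)

end TriMesh

end FVScheme

end

/-! ### Conclusion -/

theorem mainTheorem2
    (Ω : Set FVScheme.Plane) (hΩ_open : IsOpen Ω) (hΩ_bdd : Bornology.IsBounded Ω)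
    (hΩ_reg : interior (closure Ω) = Ω)
    (T Re : ℝ) (hT : 0 < T) (hRe : 0 < Re)
    (f : ℝ → FVScheme.L2 Ω FVScheme.Plane)
    (hf_cont : ContinuousOn f (Set.Icc 0 T)) (hf_bv : BoundedVariationOn f (Set.Icc 0 T))
    (u₀ : FVScheme.L2 Ω FVScheme.Plane)
    (v : ℝ → FVScheme.L2 Ω FVScheme.Plane) (q : ℝ → FVScheme.L2 Ω ℝ)
    (hvq : FVScheme.IsRegularNSSolution Ω T Re f u₀ v q)
    (c A : ℝ) (hc : 0 < c) (hA : 0 < A)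
    (γ : ℝ) (hγ_pos : 0 < γ) (hγ_lt : γ < 1 / 4) :
    ∃ C : ℝ, 0 < C ∧
      ∀ (m : FVScheme.TriMesh Ω), m.IsRegular c →
      ∀ (k : ℝ) (N : ℕ), 1 ≤ N → (N : ℝ) * k = T →
      ∀ (u ut : ℕ → m.P0) (p : ℕ → m.P1d),
        m.IsSchemeSolution Re k N f u ut p →
        m.InitialAccuracy A k v q (u 0) (u 1) (p 1) →
        ∫⁻ τ : ℝ, ENNReal.ofReal (|τ| ^ (2 * γ)) *
          (MeasureTheory.eLpNorm (m.glue (fun K _ => m.utHat k N ut τ K)) 2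
            (FVScheme.vol Ω)) ^ 2 ≤ ENNReal.ofReal C := by
  obtain ⟨D, hD, hbound⟩ := FVScheme.TriMesh.exists_increment_bound hΩ_bdd hΩ_reg hT hRe
    hf_cont hf_bv hvq hc hA
  set P := T * (D + T * D) + 2 * (D + T * D) + T * D with hP
  set I := ∫ τ : ℝ, (1 + ‖τ‖) ^ (-(2 - 2 * γ)) with hI
  have hI0 : 0 ≤ I := MeasureTheory.integral_nonneg fun τ => by positivity
  -- The added 1 only makes the constant strictly positive when D, and hence P, is zero.
  refine ⟨P ^ 2 * I + 1, by positivity, ?_⟩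
  intro m hm k N hN hNk u ut p hS hA
  have hN0 : (0 : ℝ) < N := by exact_mod_cast hN
  have hk : 0 ≤ k := by
    by_contra hcon
    nlinarith [not_le.1 hcon]
  obtain ⟨h1, hd⟩ := hbound m hm k N hN hNk u ut p hS hA
  refine (FVScheme.TriMesh.lintegral_rpow_mul_utHat_le hΩ_reg hγ_pos.le (by linarith)
    (FVScheme.TriMesh.one_add_abs_mul_norm_embC_utHat_le hk hD hN hNk h1 hd)).trans ?_
  exact ENNReal.ofReal_le_ofReal (by linarith)
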